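/- For integers $m,n$ and $c\geq 1$ let $S(m,n;c)=\sum_{a \bmod c,\ (a,c)=1} e\big(\tfrac{ma+n\bar a}{c}\big)$ be the Kloosterman sum, where $e(z)=e^{2\pi i z}$ and $a\bar a\equiv 1 \pmod c$. Fix an integer $k\geq 1$, a real number $\gamma$ with $0<\gamma\leq \tfrac14$, and a non-negative smooth function $g:\mathbb{R}\to\mathbb{R}$ supported in $[1,2]$, with Mellin transform $\tilde g(s)=\int_0^\infty g(x)x^{s-1}\,dx$. For $X\ge 2$ put $\sqrt D=X^{\gamma}\exp(-\sqrt{\log X})$, and let $$\lambda_d=\mu(d)\Big(\frac{\log(\sqrt D/d)}{\log \sqrt D}\Big)^{k}\quad (1\leq d\leq \sqrt D),\qquad \lambda_d=0\quad (d>\sqrt D),$$ $$H_2(X)=\sum_{n\ge 1} g\Big(\frac nX\Big)\frac{|S(1,1;n)|}{\sqrt n}\,\mu^2(n)\Big(\frac k2\Big)^{\omega(n)}\Big(\sum_{d\mid n}\lambda_d\Big)^2,$$ where $\mu$ is the Möbius function and $\omega(n)$ is the number of distinct prime divisors of $n$. Then, as $X\to\infty$ (with $k$, $\gamma$, $g$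 fixed), for all sufficiently large $X$, $$H_2(X)\leq (k!)^2\, R_k(\gamma)\,\tilde g(1)\,\frac{X}{\log X}\,(1+o(1)),$$ where $$R_k(y)=\sum_{j=1}^{k}\sum_{i=0}^{j-1}\binom{k}{j}\binom{j-1}{i}\binom{2(k-j)}{k-j}\frac{\Gamma(j+i)}{\Gamma(j)^2}\,\frac{(-1)^i}{(2k-j+i)!}\,\frac{1}{y^{\,j-i}}.$$ -/

import Mathlib

open Filter Topology

open scoped ContDiff

noncomputable section

namespace KloostermanSieve

/-- The Kloosterman sum `S(m, n; c) = ∑* e((m a + n ā) / c)`, the sum being over the residues `a`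
modulo `c` that are coprime to `c`, with `a ā ≡ 1` modulo `c` and `e(z) = exp(2 π i z)`. The inverse
of a residue coprime to `c` is taken in `ZMod c` and lifted to `{0, …, c - 1}`. -/
def kloostermanSum (m n : ℤ) (c : ℕ) : ℂ :=
  ∑ a ∈ (Finset.range c).filter (fun a => Nat.Coprime a c),
    Complex.exp (2 * Real.pi * Complex.I *
      (((m : ℂ) * (a : ℂ) + (n : ℂ) * (((a : ZMod c)⁻¹).val : ℂ)) / (c : ℂ)))

/-- `√D = X ^ γ * exp (-√(log X))`. -/
def sqrtD (γ X : ℝ) : ℝ :=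
  X ^ γ * Real.exp (-Real.sqrt (Real.log X))

/-- The sieve weight `λ_d = μ(d) (log (√D / d) / log √D) ^ k` for `1 ≤ d ≤ √D`, and `λ_d = 0` for
`d > √D` (the Möbius function of Mathlib vanishes at `d = 0`). -/
def sieveWeight (k : ℕ) (γ X : ℝ) (d : ℕ) : ℝ :=
  if (d : ℝ) ≤ sqrtD γ X then
    (ArithmeticFunction.moebius d : ℝ) *
      (Real.log (sqrtD γ X / (d : ℝ)) / Real.log (sqrtD γ X)) ^ k
  else 0

/-- The sum
`H₂(X) = ∑ₙ g(n / X) |S(1, 1; n)| / √n · μ²(n) (k / 2) ^ ω(n) (∑_{d ∣ n} λ_d)²`.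
For `X > 0` and `g` supported in `[1, 2]` only finitely many terms are nonzero. -/
def H2 (g : ℝ → ℝ) (k : ℕ) (γ X : ℝ) : ℝ :=
  ∑' n : ℕ, g ((n : ℝ) / X) * (‖kloostermanSum 1 1 n‖ / Real.sqrt (n : ℝ)) *
    (ArithmeticFunction.moebius n : ℝ) ^ 2 *
    ((k : ℝ) / 2) ^ (ArithmeticFunction.cardDistinctFactors n) *
    (∑ d ∈ n.divisors, sieveWeight k γ X d) ^ 2

/-- The polynomial in `1 / y`
`R_k(y) = ∑_{1 ≤ j ≤ k} ∑_{0 ≤ i ≤ j - 1} C(k, j) C(j - 1, i) C(2 (k - j), k - j)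
  Γ(j + i) / Γ(j)² · (-1) ^ i / (2 k - j + i)! · 1 / y ^ (j - i)`.
No subtraction of natural numbers is truncated, since `0 ≤ i < j ≤ k`. -/
def R (k : ℕ) (y : ℝ) : ℝ :=
  ∑ j ∈ Finset.Icc 1 k, ∑ i ∈ Finset.range j,
    (k.choose j : ℝ) * ((j - 1).choose i : ℝ) * ((2 * (k - j)).choose (k - j) : ℝ) *
      (Real.Gamma ((j : ℝ) + (i : ℝ)) / Real.Gamma (j : ℝ) ^ 2) *
      ((-1 : ℝ) ^ i / ((2 * k - j + i).factorial : ℝ)) * (1 / y ^ (j - i))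

end KloostermanSieve

end

/-!
Weil's bound `|S(1,1;n)| ≤ 2 ^ ω(n) √n` for squarefree `n` turns `(k / 2) ^ ω(n)` into `k ^ ω(n)`,
which is the value at `n` of the `k`-fold divisor function `d_k`. All terms are non-negative, so
the condition that `n` be squarefree can then be dropped: `H₂(X)` is at most the sieved divisor sum
`∑ g(n / X) d_k(n) (∑_{d ∣ n} λ_d)²` (`sievedSum`, `H2_le_sievedSum`). For this sum there is an
asymptotic formula whose constant is exactly `(k!)² g̃(1) R_k(γ)` (`tendsto_sievedSum`), so the
error `o(1)` of the theorem is the relative error in that formula. The constant is positive unless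
`g = 0`, a trivial case.

*Weil's bound* (`norm_kloostermanSum_one_one_le`). By the Chinese remainder theorem a prime modulus
`p` suffices. The Kloosterman sum is attached to a multiplicative function on monic polynomials
over `𝔽_p` whose `L`-function is a polynomial of degree at most two (`lCoeff_polyChar_eq_zero`), so
the sums over extension fields are `-(α ^ r + β ^ r)` (`exists_logDerivCoeff_eq`,
`sum_quadraticChar_mul_trace`). Summed over all additive characters they count points on
`w² = (y ^ p - y)² - 4`. Stepanov's method (`card_eval_pow_eq_le`) bounds this number from below,
and a one-sided bound for power sums already bounds each `α` and `β`, since high powers of points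
on the unit circle return to `1` simultaneously (`norm_le_of_re_sum_pow_le`).

*Divisor sums over multiples* (`exists_norm_sum_multiples_sub_circleIntegral_le`). After opening
the square, the sum over the `n` divisible by `[d₁, d₂]` is, by Mellin inversion and a shift of the
contour to `Re s = 1/4`, the integral over a small circle about `s = 1` up to `O(X ^ (1/4))`,
uniformly in `d₁` and `d₂`. As `γ ≤ 1/4` there are `O(X ^ (1/2))` pairs of weights, so the errors
add up to `O(X ^ (3/4))`.

*The sieve form* (`tendsto_sieveForm`). The sum over `d₁, d₂` inside the circle integral is a
quadratic form `sieveForm` in the weights. Perron's formula for each weight makes it a double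
integral over an Euler product, which is `ζ(s + s₁ + s₂) ^ k / (ζ(s + s₁) ^ k ζ(s + s₂) ^ k)` times
a product that converges absolutely for `Re s ≥ 3/4` (`sieveForm_eq_integral_sieveIntegrand`). On
the scale `1 / L`, with `L = log √D`, every zeta value may be replaced by its pole: the bounds for
`ζ` and `1 / ζ` just to the right of `Re s = 1` (`exists_norm_riemannZeta_one_add_bounds`) supply a
dominating function. As `log X / L → 1 / γ`, the factor `X ^ s` of the circle integral, at
`s = 1 + w / L`, becomes `X exp (w / γ)`; the factor `exp (-√(log X))` in `√D` is not felt in this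
limit.

*The constant.* The limiting integral is evaluated by the identity
`(σ₁ + w) (σ₂ + w) = w (w + σ₁ + σ₂) + σ₁ σ₂`, Laplace inversion, and the residue at `w = 0`
(`circleIntegral_modelIntegrand`). The resulting integral over `[0, 1]` is expanded by the binomial
theorem into beta integrals, which gives `R_k(γ)` (`R_eq_inv_mul_modelConstant`).
-/

namespace KloostermanSieve

/-! ### Stepanov's method for the quadratic character -/

section Stepanov

open Polynomial

variable {F : Type*} [Field F]

lemma X_pow_dvd_expChar_pow_sub_C {p : ℕ} [Fact p.Prime] [CharP F p] (n : ℕ) (f : F[X]) :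
    (X : F[X]) ^ p ^ n ∣ f ^ p ^ n - C (f.coeff 0 ^ p ^ n) := by
  have h : (X : F[X]) ∣ f - C (f.coeff 0) := by
    rw [X_dvd_iff]; simp
  have := pow_dvd_pow_of_dvd h (p ^ n)
  rwa [sub_pow_char_pow, ← C_pow] at this

/-- The key non-vanishing input of the auxiliary polynomial: modulo `X ^ ℓ` the power `f ^ ℓ` is a
constant, so a relation `ρ + σ f ^ ((ℓ + 1) / 2) ≡ 0` squares to an honest identity
`ρ² = c σ² f` once the degrees are below `ℓ`. -/
lemma eq_zero_of_X_pow_dvd_add_mul_pow {p n e r : ℕ} [Fact p.Prime] [CharP F p]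
    (hℓ : p ^ n = 2 * e + 1) (f : F[X]) (hf : f.natDegree = 2 * r) (h0 : f.coeff 0 ≠ 0)
    (hns : ∀ (c : F) (ρ σ : F[X]), c ≠ 0 → ρ ^ 2 = C c * σ ^ 2 * f → σ = 0)
    (her : r ≤ e) {ρ σ : F[X]} (hρ : ρ.natDegree ≤ e - r) (hσ : σ.natDegree ≤ e - r)
    (hdvd : X ^ p ^ n ∣ ρ + σ * f ^ (e + 1)) : ρ = 0 ∧ σ = 0 := by
  have hd : X ^ p ^ n ∣ ρ ^ 2 - C (f.coeff 0 ^ p ^ n) * σ ^ 2 * f := by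
    have h1 : X ^ p ^ n ∣ (ρ + σ * f ^ (e + 1)) * (ρ - σ * f ^ (e + 1)) := hdvd.mul_right _
    have h2 : X ^ p ^ n ∣ (f ^ p ^ n - C (f.coeff 0 ^ p ^ n)) * (σ ^ 2 * f) :=
      (X_pow_dvd_expChar_pow_sub_C n f).mul_right _
    have h3 := dvd_add h1 h2
    have h4 : (ρ + σ * f ^ (e + 1)) * (ρ - σ * f ^ (e + 1)) +
        (f ^ p ^ n - C (f.coeff 0 ^ p ^ n)) * (σ ^ 2 * f) =
        ρ ^ 2 - C (f.coeff 0 ^ p ^ n) * σ ^ 2 * f := by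
      rw [hℓ]; ring
    rwa [h4] at h3
  have hz : ρ ^ 2 - C (f.coeff 0 ^ p ^ n) * σ ^ 2 * f = 0 := by
    by_contra hne
    have := natDegree_le_of_dvd hd hne
    rw [natDegree_X_pow] at this
    have h5 : (ρ ^ 2 - C (f.coeff 0 ^ p ^ n) * σ ^ 2 * f).natDegree ≤ 2 * e := by
      refine (natDegree_sub_le _ _).trans (max_le ?_ ?_)
      · refine natDegree_pow_le.trans ?_
        omega
      · refine natDegree_mul_le.trans ?_
        have := natDegree_C_mul_le (f.coeff 0 ^ p ^ n) (σ ^ 2)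
        have := natDegree_pow_le (p := σ) (n := 2)
        omega
    omega
  have hσ0 : σ = 0 := hns _ ρ σ (pow_ne_zero _ h0) (sub_eq_zero.1 hz)
  refine ⟨?_, hσ0⟩
  rw [hσ0] at hz
  simpa using hz

/-- All but the lowest block of the sum are divisible by `X ^ ℓ` with `ℓ = p ^ n`, so the lowest block
is as well and hence vanishes; the remaining blocks follow by induction. -/
lemma eq_zero_of_sum_X_pow_mul {p n e r : ℕ} [Fact p.Prime] [CharP F p]
    (hℓ : p ^ n = 2 * e + 1) (f : F[X]) (hf : f.natDegree = 2 * r) (h0 : f.coeff 0 ≠ 0)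
    (hns : ∀ (c : F) (ρ σ : F[X]), c ≠ 0 → ρ ^ 2 = C c * σ ^ 2 * f → σ = 0)
    (her : r ≤ e) (J : ℕ) (ρ σ : ℕ → F[X]) (hρ : ∀ j, (ρ j).natDegree ≤ e - r)
    (hσ : ∀ j, (σ j).natDegree ≤ e - r)
    (hsum : ∑ j ∈ Finset.range J, (ρ j + σ j * f ^ (e + 1)) * X ^ (j * p ^ n) = 0) :
    ∀ j < J, ρ j = 0 ∧ σ j = 0 := by
  induction J generalizing ρ σ with
  | zero => intro j hj; omega
  | succ J ih =>
    rw [Finset.sum_range_succ'] at hsum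
    have hfac : ∑ j ∈ Finset.range J, (ρ (j + 1) + σ (j + 1) * f ^ (e + 1)) * X ^ ((j + 1) * p ^ n)
        = X ^ p ^ n *
          ∑ j ∈ Finset.range J, (ρ (j + 1) + σ (j + 1) * f ^ (e + 1)) * X ^ (j * p ^ n) := by
      rw [Finset.mul_sum]
      refine Finset.sum_congr rfl fun j _ => ?_
      rw [add_mul j 1, pow_add, one_mul]; ring
    rw [hfac] at hsum
    simp only [zero_mul, pow_zero, mul_one] at hsum
    have hd : X ^ p ^ n ∣ ρ 0 + σ 0 * f ^ (e + 1) := by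
      rw [← dvd_add_right (Dvd.intro _ rfl), hsum]
      exact dvd_zero _
    have hz := eq_zero_of_X_pow_dvd_add_mul_pow hℓ f hf h0 hns her (hρ 0) (hσ 0) hd
    rw [hz.1, hz.2] at hsum
    simp only [zero_mul, add_zero, mul_eq_zero] at hsum
    have h2 := ih (fun j => ρ (j + 1)) (fun j => σ (j + 1)) (fun j => hρ _) (fun j => hσ _)
      (hsum.resolve_left (pow_ne_zero _ X_ne_zero))
    intro j hj
    cases j with
    | zero => exact hz
    | succ j => exact h2 j (by omega)

/-- Stepanov's bound: over a field with `q = ℓ²` elements, at most `q / 2 + O(√q)` points `x` give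
`f(x)` a prescribed quadratic character. The auxiliary polynomial
`Ψ = ∑ⱼ (ρⱼ + σⱼ f ^ ((ℓ + 1) / 2)) X ^ (j ℓ)` satisfies `Ψ(x) ^ ℓ = Θ(x)` at those points, where
`Θ` has so low a degree that it can be made to vanish by a dimension count. -/
theorem card_eval_pow_eq_le [Fintype F] [DecidableEq F] {p n e r : ℕ} [Fact p.Prime] [CharP F p]
    (hℓ : p ^ n = 2 * e + 1) (hcard : Fintype.card F = (p ^ n) ^ 2) (f : F[X])
    (hf : f.natDegree = 2 * r) (h0 : f.coeff 0 ≠ 0)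
    (hns : ∀ (c : F) (ρ σ : F[X]), c ≠ 0 → ρ ^ 2 = C c * σ ^ 2 * f → σ = 0)
    (her : r * r + r ≤ e) (a : F) :
    2 * (Finset.univ.filter fun x : F => f.eval x ^ (((p ^ n) ^ 2 - 1) / 2) = a).card ≤
      (p ^ n) ^ 2 + 4 * r * p ^ n := by
  have her' : r ≤ e := by nlinarith
  -- `D` is the number of coefficients of `ρⱼ` and `σⱼ`, `J` the number of blocks, and all degrees of
  -- `Θ` are below `M`; a non-trivial choice with `Θ = 0` exists since
  -- `2 * D * J - M = 2 * (e - r ^ 2 - r) + 1 > 0`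
  set D := e - r + 1 with hD
  set J := e + r + 1 with hJ
  set M := (e - r) * p ^ n + 2 * r * (e + 1) + J with hM
  let Θ : (Fin J → degreeLT F D) × (Fin J → degreeLT F D) → F[X] := fun v =>
    ∑ j : Fin J, ((v.1 j : F[X]) ^ p ^ n + C a * (v.2 j : F[X]) ^ p ^ n * f ^ (e + 1)) * X ^ (j : ℕ)
  have hdeg (g : degreeLT F D) : (g : F[X]).natDegree ≤ e - r := by
    have := mem_degreeLT.1 g.2
    by_cases hg : (g : F[X]) = 0
    · simp [hg]
    · rw [degree_eq_natDegree hg] at this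
      have : (g : F[X]).natDegree < D := by exact_mod_cast this
      omega
  have hΘdeg (v : (Fin J → degreeLT F D) × (Fin J → degreeLT F D)) : Θ v ∈ degreeLT F M := by
    refine Submodule.sum_mem _ fun j _ => ?_
    rw [mem_degreeLT]
    have h1 : (((v.1 j : F[X]) ^ p ^ n + C a * (v.2 j : F[X]) ^ p ^ n * f ^ (e + 1)) *
        X ^ (j : ℕ)).natDegree < M := by
      have hj := j.2
      refine lt_of_le_of_lt natDegree_mul_le ?_
      rw [natDegree_X_pow]
      have : ((v.1 j : F[X]) ^ p ^ n + C a * (v.2 j : F[X]) ^ p ^ n * f ^ (e + 1)).natDegree ≤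
          (e - r) * p ^ n + 2 * r * (e + 1) := by
        refine (natDegree_add_le _ _).trans (max_le ?_ ?_)
        · refine natDegree_pow_le.trans ?_
          have := Nat.mul_le_mul_left (p ^ n) (hdeg (v.1 j))
          nlinarith
        · refine natDegree_mul_le.trans (add_le_add ?_ ?_)
          · refine (natDegree_C_mul_le _ _).trans (natDegree_pow_le.trans ?_)
            have := Nat.mul_le_mul_left (p ^ n) (hdeg (v.2 j))
            nlinarith
          · refine natDegree_pow_le.trans ?_
            rw [hf]; nlinarith
      omega
    exact lt_of_le_of_lt degree_le_natDegree (by exact_mod_cast h1)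
  have hΘsub (v w : (Fin J → degreeLT F D) × (Fin J → degreeLT F D)) :
      Θ (v - w) = Θ v - Θ w := by
    simp only [Θ, ← Finset.sum_sub_distrib]
    refine Finset.sum_congr rfl fun j _ => ?_
    have h1 : (((v - w).1 j : degreeLT F D) : F[X]) = v.1 j - w.1 j := rfl
    have h2 : (((v - w).2 j : degreeLT F D) : F[X]) = v.2 j - w.2 j := rfl
    rw [h1, h2, sub_pow_char_pow, sub_pow_char_pow]
    ring
  -- dimension count: the space of pairs is strictly larger than the space containing the values
  let eD := (degreeLTEquiv F D).toEquiv
  let eM := (degreeLTEquiv F M).toEquiv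
  have : Fintype (degreeLT F D) := Fintype.ofEquiv _ eD.symm
  have : Fintype (degreeLT F M) := Fintype.ofEquiv _ eM.symm
  have hcardlt : Fintype.card (degreeLT F M) < Fintype.card ((Fin J → degreeLT F D) × (Fin J → degreeLT F D)) := by
    rw [Fintype.card_congr eM, Fintype.card_prod, Fintype.card_fun, Fintype.card_fun,
      Fintype.card_congr eD, Fintype.card_fun, Fintype.card_fin, Fintype.card_fin, Fintype.card_fin,
      ← pow_mul, ← pow_add]
    refine Nat.pow_lt_pow_right Fintype.one_lt_card ?_
    obtain ⟨s, rfl⟩ := Nat.exists_eq_add_of_le her'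
    simp only [hM, hJ, hD, hℓ, Nat.add_sub_cancel_left]
    nlinarith
  obtain ⟨v, w, hvw, heq⟩ := Fintype.exists_ne_map_eq_of_card_lt
    (fun v : (Fin J → degreeLT F D) × (Fin J → degreeLT F D) => (⟨Θ v, hΘdeg v⟩ : degreeLT F M)) hcardlt
  have hΘ0 : Θ (v - w) = 0 := by
    rw [hΘsub, sub_eq_zero]; exact congrArg Subtype.val heq
  have hne : v - w ≠ 0 := sub_ne_zero.2 hvw
  set u := v - w with hu
  let ρ : ℕ → F[X] := fun j => if h : j < J then (u.1 ⟨j, h⟩ : F[X]) else 0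
  let σ : ℕ → F[X] := fun j => if h : j < J then (u.2 ⟨j, h⟩ : F[X]) else 0
  have hρ (j) : (ρ j).natDegree ≤ e - r := by
    by_cases h : j < J
    · simp only [ρ, h, dite_true]; exact hdeg _
    · simp [ρ, h]
  have hσ (j) : (σ j).natDegree ≤ e - r := by
    by_cases h : j < J
    · simp only [σ, h, dite_true]; exact hdeg _
    · simp [σ, h]
  set Ψ := ∑ j ∈ Finset.range J, (ρ j + σ j * f ^ (e + 1)) * X ^ (j * p ^ n) with hΨ
  have hΨ0 : Ψ ≠ 0 := by
    intro hz
    apply hne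
    have := eq_zero_of_sum_X_pow_mul hℓ f hf h0 hns her' J ρ σ hρ hσ hz
    refine Prod.ext (funext fun j => ?_) (funext fun j => ?_)
    · have := (this j j.2).1
      simp only [ρ, j.2, dite_true] at this
      exact Subtype.ext this
    · have := (this j j.2).2
      simp only [σ, j.2, dite_true] at this
      exact Subtype.ext this
  have hΘ' : Θ u = ∑ j ∈ Finset.range J,
      (ρ j ^ p ^ n + C a * σ j ^ p ^ n * f ^ (e + 1)) * X ^ j := by
    rw [Finset.sum_range]
    refine Finset.sum_congr rfl fun j _ => ?_
    simp [ρ, σ]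
  -- `Ψ(x) ^ ℓ = Θ(x)`, because `x ^ (ℓ ^ 2) = x` in a field with `ℓ ^ 2` elements
  have hroot (x : F) (hx : f.eval x ^ (((p ^ n) ^ 2 - 1) / 2) = a) : Ψ.eval x = 0 := by
    have h1 : (Ψ.eval x) ^ p ^ n = (Θ u).eval x := by
      rw [hΘ', hΨ, eval_finsetSum, eval_finsetSum, sum_pow_char_pow]
      refine Finset.sum_congr rfl fun j _ => ?_
      have hxq : x ^ (p ^ n * p ^ n) = x := by
        rw [← sq, ← hcard]; exact FiniteField.pow_card x
      have hexp : ((p ^ n) ^ 2 - 1) / 2 + (e + 1) = (e + 1) * p ^ n := by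
        have : (p ^ n) ^ 2 - 1 = 2 * (2 * e * e + 2 * e) := by
          rw [hℓ]
          have : (2 * e + 1) ^ 2 = 2 * (2 * e * e + 2 * e) + 1 := by ring
          omega
        rw [this, Nat.mul_div_cancel_left _ (by norm_num), hℓ]; ring
      have hfx : (f.eval x ^ (e + 1)) ^ p ^ n = a * f.eval x ^ (e + 1) := by
        rw [← pow_mul, ← hexp, pow_add, hx]
      simp only [eval_mul, eval_add, eval_pow, eval_X, eval_C, mul_pow, add_pow_char_pow]
      rw [hfx, ← pow_mul, mul_assoc, mul_comm j, pow_mul, hxq]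
      ring
    rw [hΘ0, eval_zero] at h1
    exact pow_eq_zero_iff (by rw [hℓ]; omega) |>.1 h1
  have hcount : (Finset.univ.filter fun x : F =>
      f.eval x ^ (((p ^ n) ^ 2 - 1) / 2) = a).card ≤ Ψ.natDegree := by
    have hsub : (Finset.univ.filter fun x : F => f.eval x ^ (((p ^ n) ^ 2 - 1) / 2) = a) ⊆
        Ψ.roots.toFinset := by
      intro x hx
      rw [Multiset.mem_toFinset, mem_roots hΨ0]
      exact hroot x (Finset.mem_filter.1 hx).2
    exact (Finset.card_le_card hsub).trans ((Multiset.toFinset_card_le _).trans (card_roots' _))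
  have hΨdeg : Ψ.natDegree ≤ (e - r) + 2 * r * (e + 1) + (e + r) * p ^ n := by
    refine natDegree_sum_le_of_forall_le _ _ fun j hj => ?_
    have hj' : j ≤ e + r := by have := Finset.mem_range.1 hj; omega
    refine natDegree_mul_le.trans (add_le_add ?_ ?_)
    · refine (natDegree_add_le _ _).trans (max_le ((hρ j).trans (by omega)) ?_)
      refine natDegree_mul_le.trans (add_le_add (hσ j) ?_)
      refine natDegree_pow_le.trans ?_
      rw [hf]; nlinarith
    · rw [natDegree_X_pow]; exact Nat.mul_le_mul_right _ hj'
  have := hcount.trans hΨdeg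
  obtain ⟨s, rfl⟩ := Nat.exists_eq_add_of_le her'
  rw [hℓ] at this ⊢
  simp only [Nat.add_sub_cancel_left] at this
  nlinarith

end Stepanov

/-! ### `L`-functions over monic polynomials -/

section EulerProductPolynomials

open Polynomial

variable (K : Type*) [Field K] [Finite K]

lemma finite_natDegree_le (n : ℕ) : {f : K[X] | f.natDegree ≤ n}.Finite := by
  have : Finite (degreeLT K (n + 1)) := Finite.of_equiv _ (degreeLTEquiv K (n + 1)).toEquiv.symm
  refine (Set.toFinite (degreeLT K (n + 1) : Set K[X])).subset fun f hf => ?_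
  have hf' : f.natDegree ≤ n := hf
  simp only [SetLike.mem_coe, mem_degreeLT]
  refine degree_le_natDegree.trans_lt ?_
  exact_mod_cast Nat.lt_succ_of_le hf'

/-- The monic polynomials of degree `n` over a finite field. -/
noncomputable def monicsOfDegree (n : ℕ) : Finset K[X] :=
  ((finite_natDegree_le K n).subset (t := {f : K[X] | f.Monic ∧ f.natDegree = n})
    fun _ hf => hf.2.le).toFinset

/-- The monic irreducible polynomials of degree at most `n` over a finite field. -/
noncomputable def monicIrreducibles (n : ℕ) : Finset K[X] :=
  ((finite_natDegree_le K n).subset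
    (t := {f : K[X] | f.Monic ∧ Irreducible f ∧ f.natDegree ≤ n}) fun _ hf => hf.2.2).toFinset

variable {K}

lemma mem_monicsOfDegree {n : ℕ} {f : K[X]} :
    f ∈ monicsOfDegree K n ↔ f.Monic ∧ f.natDegree = n := by
  simp [monicsOfDegree]

lemma mem_monicIrreducibles {n : ℕ} {f : K[X]} :
    f ∈ monicIrreducibles K n ↔ f.Monic ∧ Irreducible f ∧ f.natDegree ≤ n := by
  simp [monicIrreducibles]

open Classical in
/-- The degree of `h`, counted through the prime powers that divide it. -/
lemma sum_natDegree_mul_card_pow_dvd {n : ℕ} {h : K[X]} (hm : h.Monic) (hn : h.natDegree = n) :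
    ∑ P ∈ monicIrreducibles K n,
      P.natDegree * {k ∈ Finset.Icc 1 n | P ^ k ∣ h}.card = n := by
  have h0 : h ≠ 0 := hm.ne_zero
  have hcount (P : K[X]) (hP : P ∈ monicIrreducibles K n) :
      {k ∈ Finset.Icc 1 n | P ^ k ∣ h}.card =
        (UniqueFactorizationMonoid.normalizedFactors h).count P := by
    obtain ⟨hPm, hPi, -⟩ := mem_monicIrreducibles.1 hP
    have hiff (k : ℕ) : P ^ k ∣ h ↔ k ≤ (UniqueFactorizationMonoid.normalizedFactors h).count P := by
      rw [pow_dvd_iff_le_emultiplicity,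
        UniqueFactorizationMonoid.emultiplicity_eq_count_normalizedFactors hPi h0,
        hPm.normalize_eq_self, Nat.cast_le]
    have hle : (UniqueFactorizationMonoid.normalizedFactors h).count P ≤ n := by
      have h1 := natDegree_le_of_dvd ((hiff _).2 le_rfl) h0
      rw [hPm.natDegree_pow, hn] at h1
      have := hPi.natDegree_pos
      nlinarith
    have : {k ∈ Finset.Icc 1 n | P ^ k ∣ h} =
        Finset.Icc 1 ((UniqueFactorizationMonoid.normalizedFactors h).count P) := by
      ext k
      simp only [Finset.mem_filter, Finset.mem_Icc, hiff]
      omega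
    rw [this]; simp
  rw [Finset.sum_congr rfl fun P hP => by rw [hcount P hP]]
  have hprod : (UniqueFactorizationMonoid.normalizedFactors h).prod = h := by
    rw [UniqueFactorizationMonoid.prod_normalizedFactors_eq h0, hm.normalize_eq_self]
  have hdeg : ((UniqueFactorizationMonoid.normalizedFactors h).map natDegree).sum = n := by
    rw [← natDegree_multiset_prod _ (UniqueFactorizationMonoid.zero_notMem_normalizedFactors h),
      hprod, hn]
  rw [Finset.sum_multiset_map_count] at hdeg
  refine Eq.trans (Eq.symm ?_) hdeg
  refine Finset.sum_subset_zero_on_sdiff ?_ ?_ ?_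
  · intro P hP
    rw [Multiset.mem_toFinset] at hP
    have hi := UniqueFactorizationMonoid.irreducible_of_normalized_factor P hP
    have hd := UniqueFactorizationMonoid.dvd_of_mem_normalizedFactors hP
    refine mem_monicIrreducibles.2 ⟨?_, hi, hn ▸ natDegree_le_of_dvd hd h0⟩
    rw [← UniqueFactorizationMonoid.normalize_normalized_factor P hP]
    exact monic_normalize hi.ne_zero
  · intro P hP
    rw [Finset.mem_sdiff, Multiset.mem_toFinset] at hP
    rw [Multiset.count_eq_zero.2 hP.2, mul_zero]
  · intro P _
    rw [smul_eq_mul, mul_comm]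

/-- The `n`-th coefficient of the `L`-function of `Λ`. -/
noncomputable def lCoeff (Λ : K[X] → ℂ) (n : ℕ) : ℂ := ∑ h ∈ monicsOfDegree K n, Λ h

/-- The `r`-th coefficient of the logarithmic derivative of the `L`-function of `Λ`. -/
noncomputable def logDerivCoeff (Λ : K[X] → ℂ) (r : ℕ) : ℂ :=
  ∑ P ∈ monicIrreducibles K r with P.natDegree ∣ r, P.natDegree * Λ P ^ (r / P.natDegree)

lemma lCoeff_zero {Λ : K[X] → ℂ} (h1 : Λ 1 = 1) : lCoeff Λ 0 = 1 := by
  have : monicsOfDegree K 0 = {1} := by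
    ext f
    rw [mem_monicsOfDegree, Finset.mem_singleton]
    constructor
    · rintro ⟨hm, hd⟩; exact hm.natDegree_eq_zero.1 hd
    · rintro rfl; simp
  rw [lCoeff, this, Finset.sum_singleton, h1]

open Classical in
/-- The multiples of `P ^ k` of degree `n` are `P ^ k * g` with `g` of degree `n - k deg P`. -/
lemma sum_filter_pow_dvd {Λ : K[X] → ℂ} (h1 : Λ 1 = 1)
    (hmul : ∀ f g : K[X], f.Monic → g.Monic → Λ (f * g) = Λ f * Λ g) {n k : ℕ} {P : K[X]}
    (hP : P.Monic) :
    ∑ h ∈ monicsOfDegree K n with P ^ k ∣ h, Λ h =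
      if k * P.natDegree ≤ n then Λ P ^ k * lCoeff Λ (n - k * P.natDegree) else 0 := by
  have hpow (k : ℕ) : Λ (P ^ k) = Λ P ^ k := by
    induction k with
    | zero => simp [h1]
    | succ k ih => rw [pow_succ, hmul _ _ (hP.pow k) hP, ih, pow_succ]
  split_ifs with hle
  · rw [lCoeff, Finset.mul_sum]
    symm
    refine Finset.sum_bij (fun g _ => P ^ k * g) ?_ ?_ ?_ ?_
    · intro g hg
      obtain ⟨hm, hd⟩ := mem_monicsOfDegree.1 hg
      refine Finset.mem_filter.2 ⟨mem_monicsOfDegree.2 ⟨(hP.pow k).mul hm, ?_⟩, Dvd.intro _ rfl⟩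
      rw [(hP.pow k).natDegree_mul hm, hP.natDegree_pow, hd]; omega
    · intro g _ g' _ h
      exact mul_left_cancel₀ (hP.pow k).ne_zero h
    · intro h hh
      obtain ⟨hh, g, rfl⟩ := Finset.mem_filter.1 hh
      obtain ⟨hm, hd⟩ := mem_monicsOfDegree.1 hh
      have hgm : g.Monic := (hP.pow k).of_mul_monic_left hm
      refine ⟨g, mem_monicsOfDegree.2 ⟨hgm, ?_⟩, rfl⟩
      rw [(hP.pow k).natDegree_mul hgm, hP.natDegree_pow] at hd
      omega
    · intro g hg
      rw [hmul _ _ (hP.pow k) (mem_monicsOfDegree.1 hg).1, hpow]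
  · refine Finset.sum_eq_zero fun h hh => ?_
    obtain ⟨hh, hd⟩ := Finset.mem_filter.1 hh
    obtain ⟨hm, hn⟩ := mem_monicsOfDegree.1 hh
    have := natDegree_le_of_dvd hd hm.ne_zero
    rw [hP.natDegree_pow, hn] at this
    exact absurd this hle

/-- Newton's identities for the `L`-function of a completely multiplicative function on monic
polynomials, the coefficient form of `T L' = L · (T L' / L)`. -/
theorem natCast_mul_lCoeff {Λ : K[X] → ℂ} (h1 : Λ 1 = 1)
    (hmul : ∀ f g : K[X], f.Monic → g.Monic → Λ (f * g) = Λ f * Λ g) (n : ℕ) :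
    n * lCoeff Λ n = ∑ r ∈ Finset.Icc 1 n, logDerivCoeff Λ r * lCoeff Λ (n - r) := by
  classical
  have hL : n * lCoeff Λ n = ∑ P ∈ monicIrreducibles K n, ∑ k ∈ Finset.Icc 1 n,
      (P.natDegree : ℂ) * ∑ h ∈ monicsOfDegree K n with P ^ k ∣ h, Λ h := by
    rw [lCoeff, Finset.mul_sum]
    have : ∀ h ∈ monicsOfDegree K n, (n : ℂ) * Λ h = ∑ P ∈ monicIrreducibles K n,
        ∑ k ∈ Finset.Icc 1 n, if P ^ k ∣ h then (P.natDegree : ℂ) * Λ h else 0 := by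
      intro h hh
      obtain ⟨hm, hd⟩ := mem_monicsOfDegree.1 hh
      conv_lhs => rw [← sum_natDegree_mul_card_pow_dvd hm hd]
      push_cast
      rw [Finset.sum_mul]
      refine Finset.sum_congr rfl fun P _ => ?_
      rw [← Finset.sum_filter, Finset.sum_const, nsmul_eq_mul]
      ring
    rw [Finset.sum_congr rfl this, Finset.sum_comm]
    refine Finset.sum_congr rfl fun P _ => ?_
    rw [Finset.sum_comm]
    refine Finset.sum_congr rfl fun k _ => ?_
    rw [← Finset.sum_filter, Finset.mul_sum]
  have hR : ∑ r ∈ Finset.Icc 1 n, logDerivCoeff Λ r * lCoeff Λ (n - r) =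
      ∑ P ∈ monicIrreducibles K n, ∑ r ∈ Finset.Icc 1 n with P.natDegree ∣ r,
        P.natDegree * Λ P ^ (r / P.natDegree) * lCoeff Λ (n - r) := by
    have : ∀ r ∈ Finset.Icc 1 n, logDerivCoeff Λ r * lCoeff Λ (n - r) =
        ∑ P ∈ monicIrreducibles K n, if P.natDegree ∣ r then
          P.natDegree * Λ P ^ (r / P.natDegree) * lCoeff Λ (n - r) else 0 := by
      intro r hr
      rw [Finset.mem_Icc] at hr
      rw [logDerivCoeff, Finset.sum_mul, ← Finset.sum_filter]
      refine Finset.sum_congr ?_ fun _ _ => rfl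
      ext P
      simp only [Finset.mem_filter, mem_monicIrreducibles]
      constructor
      · rintro ⟨⟨h1, h2, h3⟩, h4⟩; exact ⟨⟨h1, h2, h3.trans hr.2⟩, h4⟩
      · rintro ⟨⟨h1, h2, h3⟩, h4⟩; exact ⟨⟨h1, h2, Nat.le_of_dvd hr.1 h4⟩, h4⟩
    rw [Finset.sum_congr rfl this, Finset.sum_comm]
    refine Finset.sum_congr rfl fun P _ => ?_
    rw [← Finset.sum_filter]
  rw [hL, hR]
  refine Finset.sum_congr rfl fun P hP => ?_
  obtain ⟨hPm, hPi, -⟩ := mem_monicIrreducibles.1 hP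
  have hpos := hPi.natDegree_pos
  have h3 : ∀ k ∈ Finset.Icc 1 n,
      (P.natDegree : ℂ) * ∑ h ∈ monicsOfDegree K n with P ^ k ∣ h, Λ h =
      if k * P.natDegree ≤ n then
        (P.natDegree : ℂ) * Λ P ^ k * lCoeff Λ (n - k * P.natDegree) else 0 := by
    intro k _
    rw [sum_filter_pow_dvd h1 hmul hPm]
    split_ifs <;> ring
  rw [Finset.sum_congr rfl h3, ← Finset.sum_filter]
  refine Finset.sum_bij' (fun k _ => k * P.natDegree) (fun r _ => r / P.natDegree) ?_ ?_ ?_ ?_ ?_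
  · intro k hk
    simp only [Finset.mem_filter, Finset.mem_Icc] at hk ⊢
    exact ⟨⟨Nat.mul_pos hk.1.1 hpos, hk.2⟩, Dvd.intro_left _ rfl⟩
  · intro r hr
    simp only [Finset.mem_filter, Finset.mem_Icc] at hr ⊢
    refine ⟨⟨Nat.div_pos (Nat.le_of_dvd hr.1.1 hr.2) hpos, (Nat.div_le_self _ _).trans hr.1.2⟩, ?_⟩
    rw [Nat.div_mul_cancel hr.2]; exact hr.1.2
  · intro k _; exact Nat.mul_div_cancel _ hpos
  · intro r hr; exact Nat.div_mul_cancel (Finset.mem_filter.1 hr).2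
  · intro k _
    rw [Nat.mul_div_cancel _ hpos]

/-- If the `L`-function is a polynomial of degree at most two, the coefficients of its logarithmic
derivative are (minus) power sums of its inverse roots. -/
theorem exists_logDerivCoeff_eq {Λ : K[X] → ℂ} (h1 : Λ 1 = 1)
    (hmul : ∀ f g : K[X], f.Monic → g.Monic → Λ (f * g) = Λ f * Λ g)
    (hvan : ∀ n, 3 ≤ n → lCoeff Λ n = 0) :
    ∃ α β : ℂ, ∀ r, 1 ≤ r → logDerivCoeff Λ r = -(α ^ r + β ^ r) := by
  obtain ⟨α, β, hα, hβ⟩ : ∃ α β : ℂ, α + β = -lCoeff Λ 1 ∧ α * β = lCoeff Λ 2 := by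
    obtain ⟨s, hs⟩ := IsAlgClosed.exists_pow_nat_eq (lCoeff Λ 1 ^ 2 - 4 * lCoeff Λ 2)
      (n := 2) (by norm_num)
    refine ⟨(-lCoeff Λ 1 + s) / 2, (-lCoeff Λ 1 - s) / 2, by ring, ?_⟩
    linear_combination -hs / 4
  refine ⟨α, β, ?_⟩
  have h0 := lCoeff_zero h1
  have hL1 : lCoeff Λ 1 = -(α + β) := by rw [hα]; ring
  have key := natCast_mul_lCoeff h1 hmul
  have e1 : logDerivCoeff Λ 1 = -(α ^ 1 + β ^ 1) := by
    have := key 1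
    simp only [Finset.Icc_self, Finset.sum_singleton, Nat.sub_self, h0] at this
    rw [← mul_one (logDerivCoeff Λ 1), ← this, hL1]; push_cast; ring
  have e2 : logDerivCoeff Λ 2 = -(α ^ 2 + β ^ 2) := by
    have := key 2
    rw [show Finset.Icc 1 2 = {1, 2} from rfl, Finset.sum_pair (by norm_num)] at this
    simp only [Nat.sub_self, h0, show 2 - 1 = 1 from rfl, e1, hL1, ← hβ] at this
    push_cast at this
    linear_combination -this
  intro r hr
  induction r using Nat.strong_induction_on with
  | _ r ih =>
    rcases Nat.lt_or_ge r 3 with h | h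
    · interval_cases r
      · exact e1
      · exact e2
    · obtain ⟨m, rfl⟩ := Nat.exists_eq_add_of_le h
      have hk := key (3 + m)
      rw [hvan _ h, mul_zero] at hk
      have hsub : ∑ r ∈ Finset.Icc 1 (3 + m), logDerivCoeff Λ r * lCoeff Λ (3 + m - r) =
          ∑ r ∈ ({m + 1, m + 2, m + 3} : Finset ℕ),
            logDerivCoeff Λ r * lCoeff Λ (3 + m - r) := by
        symm
        refine Finset.sum_subset ?_ ?_
        · intro r hr
          simp only [Finset.mem_insert, Finset.mem_singleton] at hr
          rw [Finset.mem_Icc]; omega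
        · intro r hr hr'
          simp only [Finset.mem_insert, Finset.mem_singleton, Finset.mem_Icc] at hr hr'
          rw [hvan _ (by omega), mul_zero]
      rw [hsub, Finset.sum_insert (by simp), Finset.sum_insert (by simp), Finset.sum_singleton,
        show 3 + m - (m + 1) = 2 by omega, show 3 + m - (m + 2) = 1 by omega,
        show 3 + m - (m + 3) = 0 by omega, h0, hL1, ← hβ, ih (m + 1) (by omega) (by omega),
        ih (m + 2) (by omega) (by omega)] at hk
      rw [add_comm 3 m]
      linear_combination -hk

end EulerProductPolynomials

/-! ### The multiplicative function attached to a Kloosterman sum -/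

section CharacterOnPolynomials

set_option linter.unusedSectionVars false

open Polynomial

variable {K : Type*} [Field K] [Fintype K] [DecidableEq K]

/-- The completely multiplicative function on monic polynomials attached to the character sum
`∑ₜ χ(t² - 4) ψ(t)`: on `X - t` it takes the value `χ(t² - 4) ψ(t)`. -/
noncomputable def polyChar (ψ : AddChar K ℂ) (h : K[X]) : ℂ :=
  ((quadraticChar K (h.eval 2 * h.eval (-2)) : ℤ) : ℂ) * ψ (-h.nextCoeff)

lemma polyChar_one (ψ : AddChar K ℂ) : polyChar ψ 1 = 1 := by
  have : (1 : K[X]).nextCoeff = 0 := by rw [← C_1, nextCoeff_C_eq_zero]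
  simp [polyChar, this]

lemma polyChar_mul (ψ : AddChar K ℂ) (f g : K[X]) (hf : f.Monic) (hg : g.Monic) :
    polyChar ψ (f * g) = polyChar ψ f * polyChar ψ g := by
  simp only [polyChar, hf.nextCoeff_mul hg, eval_mul]
  rw [show f.eval 2 * g.eval 2 * (f.eval (-2) * g.eval (-2)) =
    (f.eval 2 * f.eval (-2)) * (g.eval 2 * g.eval (-2)) by ring, map_mul, neg_add,
    AddChar.map_add_eq_mul]
  push_cast; ring

/-- Adding `c (X² - 4) X ^ (n - 3)` does not change the values at `±2`, but translates the second
coefficient, so for nontrivial `ψ` the sum over all monic polynomials of degree `n` vanishes. -/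
lemma lCoeff_polyChar_eq_zero {ψ : AddChar K ℂ} (hψ : ψ ≠ 1) {n : ℕ} (hn : 3 ≤ n) :
    lCoeff (polyChar ψ) n = 0 := by
  obtain ⟨c, hc⟩ := AddChar.ne_one_iff.1 hψ
  obtain ⟨m, rfl⟩ := Nat.exists_eq_add_of_le hn
  set g : K[X] := C (-c) * ((X ^ 2 - 4) * X ^ m) with hg
  have hgX : g = C (-c) * X ^ (m + 2) + C (4 * c) * X ^ m := by
    rw [hg, C_mul, C_neg, show (C 4 : K[X]) = 4 from rfl]; ring
  have hgdeg : g.natDegree ≤ m + 2 := by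
    rw [hgX]
    refine (natDegree_add_le _ _).trans (max_le (natDegree_C_mul_X_pow_le _ _)
      ((natDegree_C_mul_X_pow_le _ _).trans (by omega)))
  have hgcoeff : g.coeff (m + 2) = -c := by
    rw [hgX, coeff_add, coeff_C_mul_X_pow, coeff_C_mul_X_pow, if_pos rfl, if_neg (by omega),
      add_zero]
  have hg2 : g.eval 2 = 0 := by rw [hg]; simp; right; left; norm_num
  have hg2' : g.eval (-2) = 0 := by rw [hg]; simp; right; left; norm_num
  have key (u : K[X]) (hu : u.natDegree ≤ m + 2) (h : K[X]) (hh : h ∈ monicsOfDegree K (3 + m)) :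
      h + u ∈ monicsOfDegree K (3 + m) := by
    obtain ⟨hm, hd⟩ := mem_monicsOfDegree.1 hh
    have hlt : u.natDegree < h.natDegree := by omega
    refine mem_monicsOfDegree.2 ⟨?_, ?_⟩
    · exact hm.add_of_left (degree_lt_degree hlt)
    · rw [natDegree_add_eq_left_of_natDegree_lt hlt, hd]
  have hshift : lCoeff (polyChar ψ) (3 + m) =
      ∑ h ∈ monicsOfDegree K (3 + m), polyChar ψ (h + g) := by
    symm
    refine Finset.sum_bij' (fun h _ => h + g) (fun h _ => h + -g) (fun h hh => key g hgdeg h hh)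
      (fun h hh => key (-g) (by rwa [natDegree_neg]) h hh) ?_ ?_ ?_
    · intro h _; ring
    · intro h _; ring
    · intro h _; rfl
  have hterm (h : K[X]) (hh : h ∈ monicsOfDegree K (3 + m)) :
      polyChar ψ (h + g) = ψ c * polyChar ψ h := by
    obtain ⟨hm, hd⟩ := mem_monicsOfDegree.1 hh
    have hd' : (h + g).natDegree = 3 + m := (mem_monicsOfDegree.1 (key g hgdeg h hh)).2
    have e1 : (h + g).nextCoeff = h.nextCoeff - c := by
      rw [nextCoeff_of_natDegree_pos (by omega), nextCoeff_of_natDegree_pos (by omega), hd, hd',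
        show 3 + m - 1 = m + 2 by omega, coeff_add, hgcoeff]; ring
    rw [polyChar, polyChar, e1, eval_add, eval_add, hg2, hg2', add_zero, add_zero, neg_sub,
      sub_eq_add_neg, AddChar.map_add_eq_mul]
    ring
  rw [Finset.sum_congr rfl hterm, ← Finset.mul_sum, ← lCoeff] at hshift
  have : (1 - ψ c) * lCoeff (polyChar ψ) (3 + m) = 0 := by linear_combination hshift
  exact (mul_eq_zero.1 this).resolve_left (sub_ne_zero.2 (Ne.symm hc))

variable {L : Type*} [Field L] [Fintype L] [DecidableEq L] [Algebra K L]

open IntermediateField in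
/-- The norm of `a - t` is a power of the value at `a` of the minimal polynomial of `t`; the exponent is
the degree of `L` over `K(t)`. -/
lemma norm_algebraMap_sub (a : K) (t : L) :
    Algebra.norm K (algebraMap K L a - t) =
      (minpoly K t).eval a ^ (Module.finrank K L / (minpoly K t).natDegree) := by
  have ht : IsIntegral K t := .of_finite K t
  have hsub : algebraMap K L a - t =
      algebraMap K⟮t⟯ L (algebraMap K K⟮t⟯ a - AdjoinSimple.gen K t) := by
    rw [map_sub, AdjoinSimple.algebraMap_gen, ← IsScalarTower.algebraMap_apply]
  have hfin : Module.finrank K K⟮t⟯ = (minpoly K t).natDegree := adjoin.finrank ht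
  have hfin2 : Module.finrank K⟮t⟯ L = Module.finrank K L / (minpoly K t).natDegree := by
    rw [← Module.finrank_mul_finrank K K⟮t⟯ L, hfin,
      Nat.mul_div_cancel_left _ (minpoly.natDegree_pos ht)]
  rw [hsub, ← Algebra.norm_norm (S := K⟮t⟯), Algebra.norm_algebraMap, map_pow, hfin2]
  congr 1
  set pb := adjoin.powerBasis ht with hpb
  have hgen : AdjoinSimple.gen K t = pb.gen := (adjoin.powerBasis_gen ht).symm
  rw [Algebra.norm_eq_matrix_det pb.basis, hgen, map_sub, AlgHom.commutes, ← minpoly_gen K t, hgen,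
    ← charpoly_leftMulMatrix pb, Matrix.eval_charpoly]
  rfl

/-- The quadratic character of an extension is the lift of that of the base field through the norm,
because both are given by powers, with exponents `(#L - 1) / 2` and `(#K - 1) / 2`. -/
lemma quadraticChar_eq_norm (hK : ringChar K ≠ 2) (u : L) :
    quadraticChar L u = quadraticChar K (Algebra.norm K u) := by
  have hchar : ringChar L = ringChar K := (Algebra.ringChar_eq K L).symm
  have hL : ringChar L ≠ 2 := hchar ▸ hK
  have h1 := quadraticChar_eq_pow_of_char_ne_two' hL u
  have h2 := quadraticChar_eq_pow_of_char_ne_two' hK (Algebra.norm K u)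
  have h3 : ((quadraticChar K (Algebra.norm K u) : ℤ) : L) = u ^ (Fintype.card L / 2) := by
    have := congrArg (algebraMap K L) h2
    rw [map_intCast, map_pow, FiniteField.algebraMap_norm_eq_pow, ← pow_mul,
      Nat.card_eq_fintype_card, Nat.card_eq_fintype_card] at this
    rw [this]
    congr 1
    have hodd : Fintype.card K % 2 = 1 := FiniteField.odd_card_of_char_ne_two hK
    have hodd' : Fintype.card L % 2 = 1 := FiniteField.odd_card_of_char_ne_two hL
    have hdvd : Fintype.card K - 1 ∣ Fintype.card L - 1 := by
      rw [Module.card_eq_pow_finrank (K := K) (V := L)]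
      simpa using Nat.sub_dvd_pow_sub_pow (Fintype.card K) 1 (Module.finrank K L)
    obtain ⟨c, hc⟩ := hdvd
    have hK1 : 1 < Fintype.card K := Fintype.one_lt_card
    obtain ⟨b, hb⟩ : ∃ b, Fintype.card K = 2 * b + 1 := ⟨Fintype.card K / 2, by omega⟩
    have hb0 : 0 < b := by omega
    rw [hc, hb, Nat.add_sub_cancel, Nat.mul_div_cancel_left _ (by omega)]
    rw [hb, Nat.add_sub_cancel] at hc
    have : Fintype.card L = 2 * (b * c) + 1 := by
      have := Fintype.card_pos (α := L)
      rw [mul_assoc] at hc; omega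
    rw [this, show (2 * b + 1) / 2 = b by omega, show (2 * (b * c) + 1) / 2 = b * c by omega,
      mul_comm]
  have hinj (x y : ℤ) (hx : x = 0 ∨ x = 1 ∨ x = -1) (hy : y = 0 ∨ y = 1 ∨ y = -1)
      (h : (x : L) = y) : x = y := by
    have h2 : (1 : L) ≠ -1 := fun h => (Ring.neg_one_ne_one_of_char_ne_two hL) h.symm
    rcases hx with rfl | rfl | rfl <;> rcases hy with rfl | rfl | rfl <;> simp_all
  refine hinj _ _ ?_ ?_ (h1.trans h3.symm)
  · by_cases h : u = 0
    · left; simp [h]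
    · right; exact quadraticChar_dichotomy h
  · by_cases h : Algebra.norm K u = 0
    · left; simp [h]
    · right; exact quadraticChar_dichotomy h

/-- A monic irreducible polynomial has as many roots in a finite extension as its degree, as soon as
that degree divides the degree of the extension. -/
lemma card_filter_minpoly_eq {P : K[X]} (hPm : P.Monic) (hPi : Irreducible P)
    (hdvd : P.natDegree ∣ Module.finrank K L) :
    (Finset.univ.filter fun t : L => minpoly K t = P).card = P.natDegree := by
  have : Fact (Irreducible P) := ⟨hPi⟩
  have hfin : Module.finrank K (AdjoinRoot P) = P.natDegree :=
    (AdjoinRoot.powerBasis hPi.ne_zero).finrank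
  have h1 := FiniteField.natCard_algHom_of_finrank_dvd (F := K) (K := AdjoinRoot P) (L := L)
    (by rwa [hfin])
  rw [Nat.card_congr (AdjoinRoot.equiv L K P hPi.ne_zero), hfin] at h1
  rw [← h1, ← Fintype.card_subtype, ← Nat.card_eq_fintype_card]
  refine Nat.card_congr (Equiv.subtypeEquivRight fun t => ?_)
  rw [mem_aroots]
  constructor
  · intro h
    exact ⟨hPi.ne_zero, h ▸ minpoly.aeval K t⟩
  · rintro ⟨-, h⟩
    exact (minpoly.eq_of_irreducible_of_monic hPi h hPm).symm

/-- The logarithmic derivative coefficients are the character sums over the extension fields: the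
elements of `L` are grouped by their minimal polynomials. -/
theorem sum_quadraticChar_mul_trace (hK : ringChar K ≠ 2) (ψ : AddChar K ℂ) :
    ∑ t : L, ((quadraticChar L (t ^ 2 - 4) : ℤ) : ℂ) * ψ (Algebra.trace K L t) =
      logDerivCoeff (polyChar ψ) (Module.finrank K L) := by
  have hdeg (t : L) : (minpoly K t).natDegree ∣ Module.finrank K L := minpoly.degree_dvd (.of_finite K t)
  have hterm (t : L) : ((quadraticChar L (t ^ 2 - 4) : ℤ) : ℂ) * ψ (Algebra.trace K L t) =
      polyChar ψ (minpoly K t) ^ (Module.finrank K L / (minpoly K t).natDegree) := by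
    have ht : IsIntegral K t := .of_finite K t
    have e1 : t ^ 2 - 4 = (algebraMap K L 2 - t) * (algebraMap K L (-2) - t) := by
      rw [map_neg, map_ofNat]; ring
    have hfin2 : Module.finrank (IntermediateField.adjoin K {t}) L =
        Module.finrank K L / (minpoly K t).natDegree := by
      rw [← Module.finrank_mul_finrank K (IntermediateField.adjoin K {t}) L,
        IntermediateField.adjoin.finrank ht,
        Nat.mul_div_cancel_left _ (minpoly.natDegree_pos ht)]
    rw [e1, quadraticChar_eq_norm hK, map_mul, norm_algebraMap_sub, norm_algebraMap_sub,
      trace_eq_finrank_mul_minpoly_nextCoeff, hfin2, polyChar, mul_pow, ← Int.cast_pow, ← map_pow, mul_pow,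
      ← nsmul_eq_mul, AddChar.map_nsmul_eq_pow]
  rw [Finset.sum_congr rfl fun t _ => hterm t, logDerivCoeff]
  rw [← Finset.sum_fiberwise_of_maps_to
    (t := {P ∈ monicIrreducibles K (Module.finrank K L) | P.natDegree ∣ Module.finrank K L})
    (g := fun t : L => minpoly K t)]
  · refine Finset.sum_congr rfl fun P hP => ?_
    obtain ⟨hP, hd⟩ := Finset.mem_filter.1 hP
    obtain ⟨hPm, hPi, -⟩ := mem_monicIrreducibles.1 hP
    rw [Finset.sum_congr rfl (g := fun _ => polyChar ψ P ^ (Module.finrank K L / P.natDegree))]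
    · rw [Finset.sum_const, card_filter_minpoly_eq hPm hPi hd, nsmul_eq_mul]
    · intro t ht
      rw [(Finset.mem_filter.1 ht).2]
  · intro t _
    have ht : IsIntegral K t := .of_finite K t
    refine Finset.mem_filter.2 ⟨mem_monicIrreducibles.2 ⟨minpoly.monic ht, minpoly.irreducible ht,
      minpoly.natDegree_le t⟩, hdeg t⟩

end CharacterOnPolynomials

/-! ### Power sums of complex numbers -/

section PowerSums

/-- Simultaneous recurrence: arbitrarily high powers of finitely many points of the unit circle are
simultaneously close to `1`. -/
lemma exists_forall_norm_pow_sub_one_le {ι : Type*} [Fintype ι] (u : ι → ℂ) (hu : ∀ i, ‖u i‖ = 1)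
    (N : ℕ) : ∃ n ≥ N, ∀ i, ‖u i ^ n - 1‖ ≤ 1 / 2 := by
  have hK : IsCompact (Metric.closedBall (0 : ι → ℂ) 1) := isCompact_closedBall _ _
  obtain ⟨a, -, φ, hφ, ha⟩ := hK.tendsto_subseq (x := fun n => u ^ n) fun n => by
    rw [mem_closedBall_zero_iff, pi_norm_le_iff_of_nonneg zero_le_one]
    intro i; simp [hu]
  obtain ⟨m, hm⟩ := Metric.cauchySeq_iff.1 ha.cauchySeq (1 / 2) (by norm_num)
  have hge : φ m + N ≤ φ (φ m + N + m) :=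
    (Nat.le_add_right _ _).trans (hφ.id_le _)
  refine ⟨φ (φ m + N + m) - φ m, by omega, fun i => ?_⟩
  have h1 := hm (φ m + N + m) (by omega) m le_rfl
  rw [dist_eq_norm] at h1
  have h2 := (norm_le_pi_norm _ i).trans h1.le
  have h3 : u i ^ φ (φ m + N + m) - u i ^ φ m =
      u i ^ φ m * (u i ^ (φ (φ m + N + m) - φ m) - 1) := by
    rw [mul_sub, ← pow_add, mul_one]; congr 2; omega
  have h4 : ‖u i ^ φ (φ m + N + m) - u i ^ φ m‖ ≤ 1 / 2 := h2
  rwa [h3, norm_mul, norm_pow, hu, one_pow, one_mul] at h4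

/-- A one-sided bound for power sums bounds every term. -/
theorem norm_le_of_re_sum_pow_le {ι : Type*} [Fintype ι] (γ : ι → ℂ) {C R : ℝ} (hR : 0 < R) (N : ℕ)
    (h : ∀ n ≥ N, (∑ i, γ i ^ n).re ≤ C * R ^ n) (i : ι) : ‖γ i‖ ≤ R := by
  by_contra! hi
  have htend : Tendsto (fun n : ℕ => (‖γ i‖ / R) ^ n) atTop atTop :=
    tendsto_pow_atTop_atTop_of_one_lt ((one_lt_div hR).2 hi)
  obtain ⟨N', hN'⟩ := eventually_atTop.1 (htend.eventually_gt_atTop (2 * C))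
  let u : ι → ℂ := fun j => if γ j = 0 then 1 else γ j / ‖γ j‖
  have hu (j) : ‖u j‖ = 1 := by
    by_cases hj : γ j = 0
    · simp [u, hj]
    · simp [u, hj]
  have hγ (j) (n : ℕ) (hn : n ≠ 0) : γ j ^ n = (‖γ j‖ ^ n : ℝ) * u j ^ n := by
    by_cases hj : γ j = 0
    · simp [hj, hn]
    · have : (‖γ j‖ : ℂ) ≠ 0 := by simpa using hj
      simp only [u, hj, if_false, div_pow]
      push_cast
      field_simp
  obtain ⟨n, hn, hclose⟩ := exists_forall_norm_pow_sub_one_le u hu (max (max N N') 1)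
  have hn0 : n ≠ 0 := by have := (le_max_right _ _).trans hn; omega
  have hre (j) : ‖γ j‖ ^ n / 2 ≤ (γ j ^ n).re := by
    rw [hγ j n hn0, Complex.re_ofReal_mul]
    have : 1 / 2 ≤ (u j ^ n).re := by
      have h1 := (Complex.abs_re_le_norm (u j ^ n - 1)).trans (hclose j)
      rw [Complex.sub_re, Complex.one_re, abs_le] at h1
      linarith [h1.1]
    have h0 : 0 ≤ ‖γ j‖ ^ n := by positivity
    nlinarith
  have h1 := h n ((le_max_left _ _).trans ((le_max_left _ _).trans hn))
  rw [Complex.re_sum] at h1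
  have h2 : (γ i ^ n).re ≤ ∑ j, (γ j ^ n).re :=
    Finset.single_le_sum (f := fun j => (γ j ^ n).re)
      (fun j _ => (by positivity : (0 : ℝ) ≤ ‖γ j‖ ^ n / 2).trans (hre j)) (Finset.mem_univ i)
  have h3 := hN' n ((le_max_right _ _).trans ((le_max_left _ _).trans hn))
  rw [div_pow, lt_div_iff₀ (by positivity)] at h3
  linarith [hre i]

end PowerSums

/-! ### Character sums and Artin–Schreier coverings -/

section WeilBound

set_option linter.unusedSectionVars false

open Polynomial

/-- The equation `x + x⁻¹ = t` is quadratic with discriminant `t ^ 2 - 4`, so it has `1 + χ(t ^ 2 - 4)`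
solutions. -/
lemma sum_add_inv_eq {L : Type*} [Field L] [Fintype L] [DecidableEq L] (hL : ringChar L ≠ 2)
    (φ : L → ℂ) : ∑ x : L with x ≠ 0, φ (x + x⁻¹) =
      ∑ t : L, (1 + ((quadraticChar L (t ^ 2 - 4) : ℤ) : ℂ)) * φ t := by
  have h2 : (2 : L) ≠ 0 := Ring.two_ne_zero hL
  rw [← Finset.sum_fiberwise (s := Finset.univ.filter fun x : L => x ≠ 0)
    (g := fun x : L => x + x⁻¹)]
  refine Finset.sum_congr rfl fun t _ => ?_
  rw [Finset.sum_congr rfl (g := fun _ => φ t)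
    (fun x hx => by rw [(Finset.mem_filter.1 hx).2]), Finset.sum_const, nsmul_eq_mul]
  congr 1
  have hs := quadraticChar_card_sqrts hL (t ^ 2 - 4)
  have hcard : ((Finset.univ.filter fun x : L => x ≠ 0).filter fun x => x + x⁻¹ = t).card =
      {x : L | x ^ 2 = t ^ 2 - 4}.toFinset.card := by
    refine Finset.card_bij' (fun x _ => 2 * x - t) (fun y _ => (y + t) / 2) ?_ ?_ ?_ ?_
    · intro x hx
      simp only [Finset.mem_filter, Finset.mem_univ, true_and] at hx
      simp only [Set.mem_toFinset, Set.mem_ofPred_eq]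
      rw [← hx.2]
      have := hx.1
      field_simp; ring
    · intro y hy
      simp only [Set.mem_toFinset, Set.mem_ofPred_eq] at hy
      have h4 : (y + t) * (t - y) = 4 := by linear_combination -hy
      have h40 : (4 : L) ≠ 0 := by
        rw [show (4 : L) = 2 * 2 by norm_num]; exact mul_ne_zero h2 h2
      have hne : y + t ≠ 0 := fun h => h40 (by rw [← h4, h, zero_mul])
      simp only [Finset.mem_filter, Finset.mem_univ, true_and]
      refine ⟨div_ne_zero hne h2, ?_⟩
      field_simp
      linear_combination hy
    · intro x _; field_simp; ring
    · intro y _; field_simp; ring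
  have : (((Finset.univ.filter fun x : L => x ≠ 0).filter fun x => x + x⁻¹ = t).card : ℤ) =
      1 + quadraticChar L (t ^ 2 - 4) := by
    rw [hcard, hs, add_comm]
  exact_mod_cast congrArg (fun z : ℤ => (z : ℂ)) this

lemma sum_quadraticChar_sq_sub_four {L : Type*} [Field L] [Fintype L] [DecidableEq L]
    (hL : ringChar L ≠ 2) : ∑ t : L, ((quadraticChar L (t ^ 2 - 4) : ℤ) : ℂ) = -1 := by
  have h := sum_add_inv_eq hL (fun _ => 1)
  simp only [mul_one, Finset.sum_add_distrib, Finset.sum_const, nsmul_eq_mul,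
    Finset.card_univ] at h
  have hc : (Finset.univ.filter fun x : L => x ≠ 0).card + 1 = Fintype.card L := by
    rw [Finset.filter_ne', Finset.card_erase_of_mem (Finset.mem_univ _), Finset.card_univ]
    have := Fintype.card_pos (α := L); omega
  rw [← hc] at h
  push_cast at h
  linear_combination -h

variable {p : ℕ} [Fact p.Prime] {L : Type*} [Field L] [Fintype L] [DecidableEq L]
  [Algebra (ZMod p) L]

lemma trace_frobenius (y : L) :
    Algebra.trace (ZMod p) L (y ^ p) = Algebra.trace (ZMod p) L y := by
  have h := Algebra.trace_eq_of_algEquiv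
    (FiniteField.frobeniusAlgEquivOfAlgebraic (ZMod p) L) y
  rw [FiniteField.coe_frobeniusAlgEquivOfAlgebraic] at h
  simpa [ZMod.card] using h

/-- Additive Hilbert 90 in counting form: the number of solutions of `y ^ p - y = t` is detected by
the additive characters composed with the trace. -/
lemma card_pow_sub_self_eq (t : L) :
    ((Finset.univ.filter fun y : L => y ^ p - y = t).card : ℂ) =
      ∑ ψ : AddChar (ZMod p) ℂ, ψ (Algebra.trace (ZMod p) L t) := by
  have hp : p.Prime := Fact.out
  have hval (t : L) : ∑ ψ : AddChar (ZMod p) ℂ, ψ (Algebra.trace (ZMod p) L t) =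
      ((if Algebra.trace (ZMod p) L t = 0 then p else 0 : ℕ) : ℂ) := by
    rw [AddChar.sum_apply_eq_ite]
    split_ifs <;> simp [ZMod.card]
  have hle (t : L) : (Finset.univ.filter fun y : L => y ^ p - y = t).card ≤
      if Algebra.trace (ZMod p) L t = 0 then p else 0 := by
    split_ifs with h
    · have hne : (X ^ p - X - C t : L[X]) ≠ 0 := by
        intro h0
        have := congrArg (fun f : L[X] => f.coeff p) h0
        simp [coeff_X, coeff_C, hp.ne_one.symm, hp.ne_zero] at this
      have hdeg : (X ^ p - X - C t : L[X]).natDegree ≤ p := by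
        refine (natDegree_sub_le _ _).trans (max_le ((natDegree_sub_le _ _).trans ?_) (by simp))
        rw [natDegree_X_pow, natDegree_X]
        exact max_le le_rfl hp.one_lt.le
      refine le_trans (Finset.card_le_card (t := (X ^ p - X - C t : L[X]).roots.toFinset) ?_)
        ((Multiset.toFinset_card_le _).trans ((card_roots' _).trans hdeg))
      intro y hy
      rw [Multiset.mem_toFinset, mem_roots hne]
      simp only [Finset.mem_filter, Finset.mem_univ, true_and] at hy
      simp [IsRoot, hy]
    · rw [Nat.le_zero, Finset.card_eq_zero, Finset.filter_eq_empty_iff]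
      intro y _ hy
      apply h
      rw [← hy, map_sub, trace_frobenius, sub_self]
  have hsum : ∑ t : L, (if Algebra.trace (ZMod p) L t = 0 then p else 0) =
      ∑ t : L, (Finset.univ.filter fun y : L => y ^ p - y = t).card := by
    have h1 : ∑ t : L, (Finset.univ.filter fun y : L => y ^ p - y = t).card = Fintype.card L := by
      rw [← Finset.card_univ]
      exact (Finset.card_eq_sum_card_fiberwise fun _ _ => Finset.mem_coe.2 (Finset.mem_univ _)).symm
    rw [h1]
    have h2 : ((∑ t : L, (if Algebra.trace (ZMod p) L t = 0 then p else 0) : ℕ) : ℂ) =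
        Fintype.card L := by
      push_cast
      have : ∀ t : L, (if Algebra.trace (ZMod p) L t = 0 then (p : ℂ) else 0) =
          ∑ ψ : AddChar (ZMod p) ℂ, ψ (Algebra.trace (ZMod p) L t) := by
        intro t; rw [hval]; split_ifs <;> simp
      rw [Finset.sum_congr rfl fun t _ => this t, Finset.sum_comm,
        Finset.sum_eq_single (1 : AddChar (ZMod p) ℂ)]
      · simp
      · intro ψ _ hψ
        let ψ' : AddChar L ℂ := ψ.compAddMonoidHom (Algebra.trace (ZMod p) L).toAddMonoidHom
        have hψ' : ψ' ≠ 0 := by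
          obtain ⟨a, ha⟩ := AddChar.ne_one_iff.1 hψ
          obtain ⟨x, hx⟩ := Algebra.trace_surjective (ZMod p) L a
          refine AddChar.ne_one_iff.2 ⟨x, ?_⟩
          change ψ (Algebra.trace (ZMod p) L x) ≠ 1
          rwa [hx]
        exact AddChar.sum_eq_zero_iff_ne_zero.2 hψ'
      · intro h; exact absurd (Finset.mem_univ _) h
    exact_mod_cast h2
  rw [hval]
  have := (Finset.sum_eq_sum_iff_of_le fun t _ => hle t).1 hsum.symm t (Finset.mem_univ t)
  rw [this]

end WeilBound

/-! ### The Weil bound for prime moduli -/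

section WeilBoundPrime

lemma zmod_two_ne_zero_iff : ∀ x : ZMod 2, x ≠ 0 ↔ x = 1 := by decide

open Polynomial

variable {p : ℕ} [Fact p.Prime]

/-- The derivative of `(X ^ p - X) ^ 2 - 4` in characteristic `p` is `-2 (X ^ p - X)`, which has no
root in common with it. -/
lemma squarefree_artinSchreier_sq_sub_four {L : Type*} [Field L] [CharP L p] (hp2 : p ≠ 2) :
    Squarefree ((X ^ p - X) ^ 2 - 4 : L[X]) := by
  have h2 : (2 : L) ≠ 0 := by
    have hp : p.Prime := Fact.out
    intro h
    have : p ∣ 2 := (CharP.cast_eq_zero_iff L p 2).1 (by exact_mod_cast h)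
    exact hp2 ((Nat.prime_dvd_prime_iff_eq hp Nat.prime_two).1 this)
  apply Separable.squarefree
  have hder : derivative ((X ^ p - X) ^ 2 - 4 : L[X]) = -(C 2 * (X ^ p - X)) := by
    rw [show (4 : L[X]) = C 4 from rfl]
    simp only [derivative_sub, derivative_pow, derivative_X, derivative_C,
      CharP.cast_eq_zero, C_0]
    simp
  rw [separable_def, hder]
  refine ⟨C (-1 / 4), C (-1 / 8) * (X ^ p - X), ?_⟩
  have h4 : (4 : L[X]) = C 4 := rfl
  have e1 : (C (-1 / 4) * C 4 : L[X]) = -1 := by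
    have : (4 : L) ≠ 0 := by rw [show (4 : L) = 2 * 2 by norm_num]; exact mul_ne_zero h2 h2
    rw [← C_mul, div_mul_cancel₀ _ this]; simp
  have e2 : (C (-1 / 8) * C 2 : L[X]) = C (-1 / 4) := by
    rw [← C_mul]; congr 1
    rw [show (8 : L) = 4 * 2 by norm_num]; field_simp
  rw [h4]
  linear_combination -e1 - e2 * (X ^ p - X) ^ 2

lemma natDegree_artinSchreier_sq_sub_four {L : Type*} [Field L] :
    ((X ^ p - X) ^ 2 - 4 : L[X]).natDegree = 2 * p := by
  have hp : p.Prime := Fact.out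
  have h1 : (X ^ p - X : L[X]).natDegree = p := by
    rw [natDegree_sub_eq_left_of_natDegree_lt, natDegree_X_pow]
    rw [natDegree_X_pow, natDegree_X]; exact hp.one_lt
  rw [show (4 : L[X]) = C 4 from rfl, natDegree_sub_C, natDegree_pow, h1]

/-- The lower bound for the number of points of the curve `w² = (y ^ p - y)² - 4`. -/
lemma neg_sum_quadraticChar_artinSchreier_le {L : Type*} [Field L] [Fintype L] [DecidableEq L]
    [CharP L p] (hp2 : p ≠ 2) {n : ℕ} (hn : 4 ≤ n) (hcard : Fintype.card L = (p ^ n) ^ 2) :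
    -∑ y : L, quadraticChar L ((y ^ p - y) ^ 2 - 4) ≤ 6 * p * p ^ n := by
  have hp : p.Prime := Fact.out
  have hL : ringChar L ≠ 2 := by rwa [ringChar.eq L p]
  set f : L[X] := (X ^ p - X) ^ 2 - 4 with hf
  have hsq : Squarefree f := squarefree_artinSchreier_sq_sub_four hp2
  have hdeg : f.natDegree = 2 * p := natDegree_artinSchreier_sq_sub_four
  have hf0 : f ≠ 0 := hsq.ne_zero
  have h2 : (2 : L) ≠ 0 := Ring.two_ne_zero hL
  have h40 : (4 : L) ≠ 0 := by
    rw [show (4 : L) = 2 * 2 by norm_num]; exact mul_ne_zero h2 h2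
  have h0 : f.coeff 0 ≠ 0 := by
    rw [coeff_zero_eq_eval_zero, hf]
    simpa [hp.ne_zero] using h40
  have hns : ∀ (c : L) (ρ σ : L[X]), c ≠ 0 → ρ ^ 2 = C c * σ ^ 2 * f → σ = 0 := by
    intro c ρ σ hc h
    by_contra hσ
    have hdvd : σ ∣ ρ := by
      rw [← IsIntegrallyClosed.pow_dvd_pow_iff (n := 2) two_ne_zero, h]
      exact ⟨C c * f, by ring⟩
    obtain ⟨τ, rfl⟩ := hdvd
    have h3 : τ ^ 2 = C c * f := by
      have : σ ^ 2 * τ ^ 2 = σ ^ 2 * (C c * f) := by linear_combination h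
      exact mul_left_cancel₀ (pow_ne_zero 2 hσ) this
    have hτ : τ * τ ∣ f := by
      rw [← sq, h3]
      have hu : IsUnit (C c : L[X]) := isUnit_C.2 hc.isUnit
      exact (hu.mul_left_dvd).2 dvd_rfl
    have hu := hsq τ hτ
    have h4 : (τ ^ 2).natDegree = 0 := natDegree_eq_zero_of_isUnit (hu.pow 2)
    rw [h3, natDegree_C_mul hc, hdeg] at h4
    have := hp.pos
    omega
  have hodd : (p ^ n) % 2 = 1 := by
    have : Odd p := hp.odd_of_ne_two hp2
    exact Nat.odd_iff.1 this.pow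
  obtain ⟨e, he⟩ : ∃ e, p ^ n = 2 * e + 1 := ⟨p ^ n / 2, by omega⟩
  have hp3 : 3 ≤ p := by
    have := hp.two_le
    omega
  have hpe : p * p + p ≤ e := by
    have h1 : p ^ 4 ≤ p ^ n := Nat.pow_le_pow_right hp.pos hn
    have h2 : 9 * (p * p) ≤ p ^ 4 := by
      have : 9 ≤ p * p := Nat.mul_le_mul hp3 hp3
      calc 9 * (p * p) ≤ (p * p) * (p * p) := Nat.mul_le_mul_right _ this
        _ = p ^ 4 := by ring
    have h3 : 3 * p ≤ p * p := Nat.mul_le_mul_right _ hp3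
    omega
  have hst := card_eval_pow_eq_le he hcard f hdeg h0 hns hpe (-1)
  have heval (y : L) : f.eval y = (y ^ p - y) ^ 2 - 4 := by
    rw [hf, show (4 : L[X]) = C 4 from rfl]; simp
  set A := Finset.univ.filter fun x : L => f.eval x ^ (((p ^ n) ^ 2 - 1) / 2) = -1 with hA
  set B := Finset.univ.filter fun x : L => f.eval x = 0 with hB
  have hBcard : B.card ≤ 2 * p := by
    refine le_trans (Finset.card_le_card (t := f.roots.toFinset) ?_)
      ((Multiset.toFinset_card_le _).trans ((card_roots' _).trans hdeg.le))
    intro y hy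
    rw [Multiset.mem_toFinset, mem_roots hf0]
    exact (Finset.mem_filter.1 hy).2
  -- `A` holds the points where the character is `-1`, `B` the zeros of `f`
  have hpt (y : L) : -quadraticChar L ((y ^ p - y) ^ 2 - 4) ≤
      2 * (if y ∈ A then 1 else 0) - 1 + (if y ∈ B then 1 else 0) := by
    rw [← heval]
    by_cases hy : f.eval y = 0
    · have hyB : y ∈ B := by simp [hB, hy]
      rw [hy, if_pos hyB]
      split_ifs <;> simp
    · have hyB : y ∉ B := by simp [hB, hy]
      rw [if_neg hyB]
      rcases quadraticChar_dichotomy hy with h | h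
      · rw [h]; split_ifs <;> simp
      · have hyA : y ∈ A := by
          have h1 := quadraticChar_eq_pow_of_char_ne_two' hL (f.eval y)
          rw [h, hcard] at h1
          have h2 : ((p ^ n) ^ 2 - 1) / 2 = (p ^ n) ^ 2 / 2 := by
            have : ((p ^ n) ^ 2) % 2 = 1 := by rw [Nat.pow_mod, hodd]
            omega
          simp only [hA, Finset.mem_filter, Finset.mem_univ, true_and, h2]
          rw [← h1]; simp
        rw [h, if_pos hyA]; norm_num
  have hsum := Finset.sum_le_sum fun y (_ : y ∈ (Finset.univ : Finset L)) => hpt y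
  rw [Finset.sum_neg_distrib, Finset.sum_add_distrib, Finset.sum_sub_distrib, ← Finset.mul_sum,
    Finset.sum_ite_mem, Finset.sum_ite_mem, Finset.univ_inter, Finset.univ_inter,
    Finset.sum_const, Finset.sum_const, Finset.sum_const, Finset.card_univ, hcard] at hsum
  simp only [nsmul_eq_mul, mul_one] at hsum
  have hst' : 2 * (A.card : ℤ) ≤ (p ^ n) ^ 2 + 4 * p * p ^ n := by exact_mod_cast hst
  have hB' : (B.card : ℤ) ≤ 2 * p := by exact_mod_cast hBcard
  have h1 : (1 : ℤ) ≤ p ^ n := by exact_mod_cast Nat.one_le_pow _ _ hp.pos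
  have h5 : (p : ℤ) ≤ p * p ^ n := by nlinarith [hp.pos]
  push_cast at hsum
  nlinarith

/-- Weil's bound for Kloosterman sums over a prime field. -/
theorem norm_sum_addChar_add_inv_le {ψ : AddChar (ZMod p) ℂ} (hψ : ψ ≠ 1) :
    ‖∑ x : ZMod p with x ≠ 0, ψ (x + x⁻¹)‖ ≤ 2 * Real.sqrt p := by
  have hp : p.Prime := Fact.out
  by_cases hp2 : p = 2
  · subst hp2
    have h1 : (Finset.univ.filter fun x : ZMod 2 => x ≠ 0) = {1} := by
      ext x
      simpa using zmod_two_ne_zero_iff x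
    rw [h1, Finset.sum_singleton, AddChar.norm_apply]
    have := Real.one_le_sqrt.2 (by norm_num : (1 : ℝ) ≤ (2 : ℕ))
    linarith
  have hK : ringChar (ZMod p) ≠ 2 := by rwa [ringChar.eq (ZMod p) p]
  choose α β hαβ using fun ψ : {ψ : AddChar (ZMod p) ℂ // ψ ≠ 1} =>
    exists_logDerivCoeff_eq (polyChar_one ψ.1) (polyChar_mul ψ.1)
      fun n hn => lCoeff_polyChar_eq_zero ψ.2 hn
  -- squares, because the point counts are available only over extensions of even degree
  let γ : {ψ : AddChar (ZMod p) ℂ // ψ ≠ 1} ⊕ {ψ : AddChar (ZMod p) ℂ // ψ ≠ 1} → ℂ :=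
    Sum.elim (fun ψ => α ψ ^ 2) (fun ψ => β ψ ^ 2)
  have hpow : ∀ n ≥ 4, (∑ i, γ i ^ n).re ≤ (6 * p : ℝ) * (p : ℝ) ^ n := by
    intro n hn
    have : Fintype (GaloisField p (2 * n)) := Fintype.ofFinite _
    classical
    have hfin : Module.finrank (ZMod p) (GaloisField p (2 * n)) = 2 * n :=
      GaloisField.finrank p (by omega)
    have hcard : Fintype.card (GaloisField p (2 * n)) = (p ^ n) ^ 2 := by
      rw [Fintype.card_eq_nat_card, GaloisField.card p _ (by omega), ← pow_mul, mul_comm]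
    have hL : ringChar (GaloisField p (2 * n)) ≠ 2 := by
      rwa [ringChar.eq (GaloisField p (2 * n)) p]
    have hlog (ψ : AddChar (ZMod p) ℂ) :=
      sum_quadraticChar_mul_trace (L := GaloisField p (2 * n)) hK ψ
    have hγ : ∑ i, γ i ^ n =
        -∑ ψ : {ψ : AddChar (ZMod p) ℂ // ψ ≠ 1}, logDerivCoeff (polyChar ψ.1) (2 * n) := by
      rw [Fintype.sum_sum_type, ← Finset.sum_add_distrib, ← Finset.sum_neg_distrib]
      refine Finset.sum_congr rfl fun ψ _ => ?_
      rw [hαβ ψ _ (by omega)]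
      simp only [γ, Sum.elim_inl, Sum.elim_inr, ← pow_mul]
      ring
    have htot : ∑ ψ : AddChar (ZMod p) ℂ, logDerivCoeff (polyChar ψ) (2 * n) =
        ∑ y : GaloisField p (2 * n), ((quadraticChar _ ((y ^ p - y) ^ 2 - 4) : ℤ) : ℂ) := by
      rw [← Finset.sum_fiberwise (s := Finset.univ)
        (g := fun y : GaloisField p (2 * n) => y ^ p - y)]
      rw [Finset.sum_congr rfl fun ψ _ => by rw [← hfin, ← hlog ψ], Finset.sum_comm]
      refine Finset.sum_congr rfl fun t _ => ?_
      rw [← Finset.mul_sum, ← card_pow_sub_self_eq,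
        Finset.sum_congr rfl (g := fun _ => ((quadraticChar _ (t ^ 2 - 4) : ℤ) : ℂ))
          (fun y hy => by rw [(Finset.mem_filter.1 hy).2]), Finset.sum_const, nsmul_eq_mul,
        mul_comm]
    -- the trivial character contributes `-1`, which does not affect the bound
    have htriv : logDerivCoeff (polyChar (1 : AddChar (ZMod p) ℂ)) (2 * n) = -1 := by
      have h1 := hlog 1
      rw [hfin] at h1
      rw [← h1, ← sum_quadraticChar_sq_sub_four hL]
      simp
    have hsplit : ∑ ψ : AddChar (ZMod p) ℂ, logDerivCoeff (polyChar ψ) (2 * n) =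
        -1 + ∑ ψ : {ψ : AddChar (ZMod p) ℂ // ψ ≠ 1}, logDerivCoeff (polyChar ψ.1) (2 * n) := by
      rw [← Finset.add_sum_erase _ _ (Finset.mem_univ 1), htriv]
      congr 1
      refine Finset.sum_subtype _ (fun ψ => ?_) _
      simp
    have hst := neg_sum_quadraticChar_artinSchreier_le hp2 hn hcard
    have hst' : -∑ y : GaloisField p (2 * n), ((quadraticChar _ ((y ^ p - y) ^ 2 - 4) : ℤ) : ℝ) ≤
        6 * p * p ^ n := by exact_mod_cast hst
    have heq : ∑ i, γ i ^ n = ((-1 - ∑ y : GaloisField p (2 * n),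
        ((quadraticChar _ ((y ^ p - y) ^ 2 - 4) : ℤ) : ℝ) : ℝ) : ℂ) := by
      rw [hγ]
      push_cast
      rw [← htot, hsplit]; ring
    rw [heq, Complex.ofReal_re]
    linarith
  have hbound := norm_le_of_re_sum_pow_le γ (by exact_mod_cast hp.pos : (0 : ℝ) < p) 4 hpow
  have hsqrt {z : ℂ} (h : ‖z ^ 2‖ ≤ p) : ‖z‖ ≤ Real.sqrt p := by
    rw [norm_pow] at h
    exact Real.le_sqrt_of_sq_le h
  have hα := hsqrt (hbound (Sum.inl ⟨ψ, hψ⟩))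
  have hβ := hsqrt (hbound (Sum.inr ⟨ψ, hψ⟩))
  have h1 : ∑ x : ZMod p with x ≠ 0, ψ (x + x⁻¹) = -(α ⟨ψ, hψ⟩ + β ⟨ψ, hψ⟩) := by
    have h2 := sum_quadraticChar_mul_trace (L := ZMod p) hK ψ
    rw [Module.finrank_self, hαβ ⟨ψ, hψ⟩ 1 le_rfl, pow_one, pow_one] at h2
    rw [sum_add_inv_eq hK, ← h2]
    simp only [add_mul, one_mul, Finset.sum_add_distrib, Algebra.trace_self_apply]
    rw [AddChar.sum_eq_zero_iff_ne_zero.2 hψ, zero_add]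
  rw [h1, norm_neg]
  exact (norm_add_le _ _).trans (by linarith)

end WeilBoundPrime

/-! ### Kloosterman sums to squarefree moduli -/

section KloostermanSquarefree

/-- The bound `‖∑ ψ(x + x⁻¹)‖ ≤ 2 ^ ω(n) √n` over the units of `ZMod n`, for all primitive additive
characters `ψ`: this class of characters is stable under the Chinese remainder theorem. -/
lemma norm_sum_units_addChar_le (n : ℕ) (hn : Squarefree n) :
    ∀ ψ : AddChar (ZMod n) ℂ, ψ.IsPrimitive → ∀ [Fintype (ZMod n)ˣ],
      ‖∑ u : (ZMod n)ˣ, ψ (u + (u⁻¹ : (ZMod n)ˣ))‖ ≤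
        2 ^ ArithmeticFunction.cardDistinctFactors n * Real.sqrt n := by
  induction n using Nat.recOnPosPrimePosCoprime with
  | zero => exact absurd rfl hn.ne_zero
  | one =>
    intro ψ _ _
    refine (norm_sum_le _ _).trans ?_
    simp [AddChar.norm_apply]
  | prime_pow p m hp hm =>
    have : Fact p.Prime := ⟨hp⟩
    have hm1 : m = 1 := by
      rcases (Nat.squarefree_pow_iff hp.ne_one hm.ne').1 hn with ⟨-, h⟩
      exact h
    subst hm1
    rw [pow_one]
    intro ψ hψ _
    have hψ1 : ψ ≠ 1 := by
      have := hψ one_ne_zero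
      rwa [AddChar.mulShift_one] at this
    have heq : ∑ u : (ZMod p)ˣ, ψ (u + (u⁻¹ : (ZMod p)ˣ)) =
        ∑ x : ZMod p with x ≠ 0, ψ (x + x⁻¹) := by
      refine Finset.sum_bij' (fun u _ => (u : ZMod p))
        (fun x hx => Units.mk0 x (Finset.mem_filter.1 hx).2) ?_ ?_ ?_ ?_ ?_
      · intro u _; simp
      · intro x _; simp
      · intro u _; simp
      · intro x _; simp
      · intro u _; rw [Units.val_inv_eq_inv_val]
    rw [heq, ArithmeticFunction.cardDistinctFactors_apply_prime hp, pow_one]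
    exact norm_sum_addChar_add_inv_le hψ1
  | coprime a b ha hb hab iha ihb =>
    intro ψ hψ _
    have hsa := hn.of_mul_left
    have hsb := hn.of_mul_right
    have : NeZero a := ⟨by omega⟩
    have : NeZero b := ⟨by omega⟩
    let e := ZMod.chineseRemainder hab
    let ψ₁ : AddChar (ZMod a) ℂ :=
      { toFun := fun x => ψ (e.symm (x, 0))
        map_zero_eq_one' := by
          rw [show ((0 : ZMod a), (0 : ZMod b)) = 0 from rfl, map_zero, AddChar.map_zero_eq_one]
        map_add_eq_mul' := fun x y => by
          rw [← AddChar.map_add_eq_mul, ← map_add, Prod.mk_add_mk, add_zero] }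
    let ψ₂ : AddChar (ZMod b) ℂ :=
      { toFun := fun y => ψ (e.symm (0, y))
        map_zero_eq_one' := by
          rw [show ((0 : ZMod a), (0 : ZMod b)) = 0 from rfl, map_zero, AddChar.map_zero_eq_one]
        map_add_eq_mul' := fun x y => by
          rw [← AddChar.map_add_eq_mul, ← map_add, Prod.mk_add_mk, add_zero] }
    have hsplit (x : ZMod a) (y : ZMod b) : ψ (e.symm (x, y)) = ψ₁ x * ψ₂ y := by
      change _ = ψ (e.symm (x, 0)) * ψ (e.symm (0, y))
      rw [← AddChar.map_add_eq_mul, ← map_add, Prod.mk_add_mk, add_zero, zero_add]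
    have hψ₁ : ψ₁.IsPrimitive := by
      intro x hx h
      have hne : e.symm (x, 0) ≠ 0 := by
        rw [Ne, EmbeddingLike.map_eq_zero_iff]
        intro h0; exact hx (congrArg Prod.fst h0)
      refine hψ hne ?_
      ext y
      have := DFunLike.congr_fun h (e y).1
      rw [AddChar.mulShift_apply, AddChar.one_apply] at this ⊢
      rw [← this]
      change _ = ψ (e.symm (x * (e y).1, 0))
      congr 1
      apply e.injective
      rw [map_mul, e.apply_symm_apply, e.apply_symm_apply]
      ext <;> simp
    have hψ₂ : ψ₂.IsPrimitive := by
      intro x hx h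
      have hne : e.symm (0, x) ≠ 0 := by
        rw [Ne, EmbeddingLike.map_eq_zero_iff]
        intro h0; exact hx (congrArg Prod.snd h0)
      refine hψ hne ?_
      ext y
      have := DFunLike.congr_fun h (e y).2
      rw [AddChar.mulShift_apply, AddChar.one_apply] at this ⊢
      rw [← this]
      change _ = ψ (e.symm (0, x * (e y).2))
      congr 1
      apply e.injective
      rw [map_mul, e.apply_symm_apply, e.apply_symm_apply]
      ext <;> simp
    have hprod : ∑ u : (ZMod (a * b))ˣ, ψ (u + (u⁻¹ : (ZMod (a * b))ˣ)) =
        (∑ v : (ZMod a)ˣ, ψ₁ (v + (v⁻¹ : (ZMod a)ˣ))) *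
          ∑ w : (ZMod b)ˣ, ψ₂ (w + (w⁻¹ : (ZMod b)ˣ)) := by
      rw [Finset.sum_mul_sum, ← Finset.sum_product', Finset.univ_product_univ]
      refine Fintype.sum_equiv
        ((Units.mapEquiv e.toMulEquiv).trans MulEquiv.prodUnits).toEquiv _ _ fun u => ?_
      rw [← hsplit]
      congr 1
      apply e.injective
      rw [e.apply_symm_apply, map_add]
      rfl
    rw [hprod, norm_mul,
      ArithmeticFunction.cardDistinctFactors_mul hab, pow_add, Nat.cast_mul,
      Real.sqrt_mul (Nat.cast_nonneg a)]
    calc _ ≤ (2 ^ ArithmeticFunction.cardDistinctFactors a * Real.sqrt a) *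
          (2 ^ ArithmeticFunction.cardDistinctFactors b * Real.sqrt b) :=
          mul_le_mul (iha hsa ψ₁ hψ₁) (ihb hsb ψ₂ hψ₂) (norm_nonneg _) (by positivity)
      _ = _ := by ring

lemma kloostermanSum_one_one_eq (n : ℕ) [NeZero n] :
    kloostermanSum 1 1 n = ∑ u : (ZMod n)ˣ,
      ZMod.stdAddChar ((u : ZMod n) + ((u⁻¹ : (ZMod n)ˣ) : ZMod n)) := by
  rw [kloostermanSum]
  refine Finset.sum_bij' (fun a ha => ZMod.unitOfCoprime a (Finset.mem_filter.1 ha).2)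
    (fun u _ => (u : ZMod n).val) ?_ ?_ ?_ ?_ ?_
  · intro a _; exact Finset.mem_univ _
  · intro u _
    rw [Finset.mem_filter, Finset.mem_range]
    exact ⟨ZMod.val_lt _, ZMod.val_coe_unit_coprime u⟩
  · intro a ha
    rw [Finset.mem_filter, Finset.mem_range] at ha
    rw [ZMod.coe_unitOfCoprime]
    exact ZMod.val_cast_of_lt ha.1
  · intro u _
    ext
    simp
  · intro a ha
    rw [← ZMod.inv_coe_unit, ZMod.coe_unitOfCoprime]
    have : (a : ZMod n) + (a : ZMod n)⁻¹ = (((a : ℤ) + (((a : ZMod n)⁻¹).val : ℤ) : ℤ) : ZMod n) := by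
      push_cast
      rw [ZMod.natCast_zmod_val]
    rw [this, ZMod.stdAddChar_coe]
    congr 1
    push_cast
    ring

/-- The Weil bound for Kloosterman sums to squarefree moduli. -/
theorem norm_kloostermanSum_one_one_le {n : ℕ} (hn : Squarefree n) :
    ‖kloostermanSum 1 1 n‖ ≤ 2 ^ ArithmeticFunction.cardDistinctFactors n * Real.sqrt n := by
  have : NeZero n := ⟨hn.ne_zero⟩
  rw [kloostermanSum_one_one_eq]
  exact norm_sum_units_addChar_le n hn _ (ZMod.isPrimitive_stdAddChar n)

end KloostermanSquarefree

/-! ### The zeta function to the left of its abscissa of convergence -/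

section ZetaBounds

/-- The entire function `(s - 1) ζ(s)`, with the value `1` at `s = 1`. -/
noncomputable def poleFreeZeta : ℂ → ℂ :=
  Function.update (fun s => (s - 1) * riemannZeta s) 1 1

lemma poleFreeZeta_of_ne {s : ℂ} (hs : s ≠ 1) : poleFreeZeta s = (s - 1) * riemannZeta s := by
  simp [poleFreeZeta, hs]

lemma poleFreeZeta_one : poleFreeZeta 1 = 1 := by simp [poleFreeZeta]

lemma riemannZeta_eq_poleFreeZeta_div {s : ℂ} (hs : s ≠ 1) :
    riemannZeta s = poleFreeZeta s / (s - 1) := by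
  rw [poleFreeZeta_of_ne hs, mul_div_cancel_left₀ _ (sub_ne_zero.2 hs)]

lemma differentiable_poleFreeZeta : Differentiable ℂ poleFreeZeta := by
  have hne {s : ℂ} (hs : s ≠ 1) : DifferentiableAt ℂ poleFreeZeta s := by
    have h : DifferentiableAt ℂ (fun s => (s - 1) * riemannZeta s) s :=
      (differentiableAt_id.sub_const 1).mul (differentiableAt_riemannZeta hs)
    refine h.congr_of_eventuallyEq ?_
    filter_upwards [isOpen_ne.mem_nhds hs] with z hz using poleFreeZeta_of_ne hz
  intro s
  by_cases hs : s = 1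
  · subst hs
    refine (Complex.analyticAt_of_differentiable_on_punctured_nhds_of_continuousAt ?_ ?_).differentiableAt
    · filter_upwards [self_mem_nhdsWithin] with z hz using hne hz
    · rw [poleFreeZeta, continuousAt_update_same]
      exact riemannZeta_residue_one
  · exact hne hs

lemma poleFreeZeta_ne_zero {s : ℂ} (hs : 1 ≤ s.re) : poleFreeZeta s ≠ 0 := by
  by_cases h : s = 1
  · rw [h, poleFreeZeta_one]; exact one_ne_zero
  · rw [poleFreeZeta_of_ne h]
    exact mul_ne_zero (sub_ne_zero.2 h) (riemannZeta_ne_zero_of_one_le_re hs)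

/-- The `m`-th error term in the Euler–Maclaurin comparison of `(s - 1) ∑ n ^ (-s)` with
`∫ (s - 1) x ^ (-s)`. -/
noncomputable def zetaErrorTerm (m : ℕ) (s : ℂ) : ℂ :=
  (s - 1) * ((m : ℂ) + 1) ^ (-s) + ((m : ℂ) + 1) ^ (1 - s) - (m : ℂ) ^ (1 - s)

/-- Two applications of the mean value inequality, one for each factor `‖s - 1‖` and `‖s‖`. -/
lemma norm_zetaErrorTerm_le {m : ℕ} (hm : 1 ≤ m) {s : ℂ} (hs : 0 < s.re) :
    ‖zetaErrorTerm m s‖ ≤ ‖s - 1‖ * ‖s‖ * (m : ℝ) ^ (-s.re - 1) := by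
  have hm0 : (0 : ℝ) < m := by exact_mod_cast hm
  set B : ℝ := (m : ℝ) ^ (-s.re - 1) with hB
  have hpos {x : ℝ} (hx : x ∈ Set.Icc (m : ℝ) (m + 1)) : 0 < x := hm0.trans_le hx.1
  have hcpow (x : ℝ) (hx : x ∈ Set.Icc (m : ℝ) (m + 1)) (r : ℂ) :
      HasDerivWithinAt (fun y : ℝ => (y : ℂ) ^ r) (r * (x : ℂ) ^ (r - 1))
        (Set.Icc (m : ℝ) (m + 1)) x := by
    have h0 : (x : ℂ) ∈ Complex.slitPlane := Complex.ofReal_mem_slitPlane.2 (hpos hx)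
    have := (hasDerivAt_id (x : ℂ)).cpow_const (c := r) h0
    simpa using (this.comp_ofReal).hasDerivWithinAt
  have h1 {x : ℝ} (hx : x ∈ Set.Icc (m : ℝ) (m + 1)) :
      ‖((m + 1 : ℝ) : ℂ) ^ (-s) - (x : ℂ) ^ (-s)‖ ≤ ‖s‖ * B := by
    have := (convex_Icc (m : ℝ) (m + 1)).norm_image_sub_le_of_norm_hasDerivWithin_le
      (f := fun y : ℝ => (y : ℂ) ^ (-s)) (C := ‖s‖ * B) (fun y hy => hcpow y hy (-s)) (fun y hy => by
        rw [norm_mul, norm_neg, Complex.norm_cpow_eq_rpow_re_of_pos (hpos hy)]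
        refine mul_le_mul_of_nonneg_left ?_ (norm_nonneg _)
        simp only [Complex.sub_re, Complex.neg_re, Complex.one_re]
        exact Real.rpow_le_rpow_of_nonpos hm0 hy.1 (by linarith)) hx
      (Set.right_mem_Icc.2 (by linarith))
    refine this.trans ?_
    rw [Real.norm_eq_abs, abs_of_nonneg (by linarith [hx.2])]
    have : (m : ℝ) + 1 - x ≤ 1 := by linarith [hx.1]
    exact mul_le_of_le_one_right (by positivity) this
  have h2 := (convex_Icc (m : ℝ) (m + 1)).norm_image_sub_le_of_norm_hasDerivWithin_le
      (f := fun y : ℝ => (s - 1) * ((m + 1 : ℝ) : ℂ) ^ (-s) * y + (y : ℂ) ^ (1 - s))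
      (f' := fun y : ℝ => (s - 1) * (((m + 1 : ℝ) : ℂ) ^ (-s) - (y : ℂ) ^ (-s)))
      (C := ‖s - 1‖ * (‖s‖ * B)) (fun y hy => by
        have e1 : HasDerivWithinAt (fun y : ℝ => (s - 1) * ((m + 1 : ℝ) : ℂ) ^ (-s) * (y : ℂ))
            ((s - 1) * ((m + 1 : ℝ) : ℂ) ^ (-s)) (Set.Icc (m : ℝ) (m + 1)) y := by
          have := ((hasDerivAt_id (y : ℂ)).comp_ofReal.const_mul
            ((s - 1) * ((m + 1 : ℝ) : ℂ) ^ (-s))).hasDerivWithinAt (s := Set.Icc (m : ℝ) (m + 1))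
          simpa using this
        refine (e1.add (hcpow y hy (1 - s))).congr_deriv ?_
        rw [show (1 - s - 1 : ℂ) = -s by ring]; ring) (fun y hy => by
        rw [norm_mul]
        exact mul_le_mul_of_nonneg_left (h1 hy) (norm_nonneg _))
      (Set.left_mem_Icc.2 (by linarith)) (Set.right_mem_Icc.2 (by linarith))
  have h3 : ((s - 1) * ((m + 1 : ℝ) : ℂ) ^ (-s) * ((m + 1 : ℝ) : ℂ) + ((m + 1 : ℝ) : ℂ) ^ (1 - s)) -
      ((s - 1) * ((m + 1 : ℝ) : ℂ) ^ (-s) * ((m : ℝ) : ℂ) + ((m : ℝ) : ℂ) ^ (1 - s)) =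
      zetaErrorTerm m s := by
    rw [zetaErrorTerm]; push_cast; ring
  rw [h3] at h2
  simpa [mul_assoc] using h2

lemma summable_rpow_shift {σ : ℝ} (hσ : 0 < σ) (N : ℕ) :
    Summable fun j : ℕ => ((N + j : ℕ) : ℝ) ^ (-σ - 1) := by
  have h : Summable fun j : ℕ => (j : ℝ) ^ (-σ - 1) :=
    Real.summable_nat_rpow.2 (by linarith)
  have := (summable_nat_add_iff N).2 h
  simpa [add_comm] using this

/-- Comparison of the tail of the series with the integral of `x ^ (-σ - 1)`. -/
lemma tsum_rpow_shift_le {σ : ℝ} (hσ : 0 < σ) {N : ℕ} (hN : 1 ≤ N) :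
    ∑' j : ℕ, ((N + j : ℕ) : ℝ) ^ (-σ - 1) ≤ (1 + 1 / σ) * (N : ℝ) ^ (-σ) := by
  have hN0 : (0 : ℝ) < N := by exact_mod_cast hN
  -- `n ^ (-σ - 1) ≤ ((n - 1) ^ (-σ) - n ^ (-σ)) / σ`, which telescopes
  have hstep (j : ℕ) : ((N + j + 1 : ℕ) : ℝ) ^ (-σ - 1) ≤
      (((N + j : ℕ) : ℝ) ^ (-σ) - ((N + j + 1 : ℕ) : ℝ) ^ (-σ)) / σ := by
    have hx : (0 : ℝ) < ((N + j : ℕ) : ℝ) := by exact_mod_cast Nat.lt_of_lt_of_le hN (Nat.le_add_right _ _)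
    have hlt : ((N + j : ℕ) : ℝ) < ((N + j + 1 : ℕ) : ℝ) := by push_cast; linarith
    obtain ⟨c, hc, hc'⟩ := exists_hasDerivAt_eq_slope (fun x : ℝ => x ^ (-σ))
      (fun x : ℝ => -σ * x ^ (-σ - 1)) hlt
      (fun x hx' => (Real.continuousAt_rpow_const _ _ (Or.inl (hx.trans_le hx'.1).ne')).continuousWithinAt)
      (fun x hx' => Real.hasDerivAt_rpow_const (Or.inl (hx.trans hx'.1).ne'))
    have h1 : ((N + j + 1 : ℕ) : ℝ) - ((N + j : ℕ) : ℝ) = 1 := by push_cast; ring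
    rw [h1, div_one] at hc'
    have h2 : ((N + j + 1 : ℕ) : ℝ) ^ (-σ - 1) ≤ c ^ (-σ - 1) :=
      Real.rpow_le_rpow_of_nonpos (hx.trans hc.1) hc.2.le (by linarith)
    rw [le_div_iff₀ hσ]
    nlinarith
  have hsum : ∀ J : ℕ, ∑ j ∈ Finset.range J, ((N + j : ℕ) : ℝ) ^ (-σ - 1) ≤
      (1 + 1 / σ) * (N : ℝ) ^ (-σ) := by
    intro J
    cases J with
    | zero => simp; positivity
    | succ J =>
      rw [Finset.sum_range_succ']
      have h1 : ∑ j ∈ Finset.range J, ((N + (j + 1) : ℕ) : ℝ) ^ (-σ - 1) ≤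
          ((N : ℝ) ^ (-σ)) / σ := by
        calc _ ≤ ∑ j ∈ Finset.range J,
              (((N + j : ℕ) : ℝ) ^ (-σ) / σ - ((N + (j + 1) : ℕ) : ℝ) ^ (-σ) / σ) :=
              Finset.sum_le_sum fun j _ => by
                have := hstep j
                rwa [sub_div] at this
          _ = (N : ℝ) ^ (-σ) / σ - ((N + J : ℕ) : ℝ) ^ (-σ) / σ := by
              rw [Finset.sum_range_sub' (fun j => ((N + j : ℕ) : ℝ) ^ (-σ) / σ)]; simp
          _ ≤ _ := by
              have : (0 : ℝ) ≤ ((N + J : ℕ) : ℝ) ^ (-σ) / σ := by positivity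
              linarith
      have h2 : ((N + 0 : ℕ) : ℝ) ^ (-σ - 1) ≤ (N : ℝ) ^ (-σ) := by
        rw [add_zero]
        exact Real.rpow_le_rpow_of_exponent_le (by exact_mod_cast hN) (by linarith)
      calc _ ≤ (N : ℝ) ^ (-σ) / σ + (N : ℝ) ^ (-σ) := add_le_add h1 h2
        _ = _ := by ring
  exact (summable_rpow_shift hσ N).tsum_le_of_sum_range_le hsum

lemma summable_zetaErrorTerm {N : ℕ} (hN : 1 ≤ N) {s : ℂ} (hs : 0 < s.re) :
    Summable fun j : ℕ => zetaErrorTerm (N + j) s := by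
  refine Summable.of_norm_bounded ((summable_rpow_shift hs N).mul_left (‖s - 1‖ * ‖s‖)) fun j => ?_
  exact norm_zetaErrorTerm_le (by omega) hs

lemma differentiableOn_tsum_zetaErrorTerm {N : ℕ} (hN : 1 ≤ N) :
    DifferentiableOn ℂ (fun s => ∑' j : ℕ, zetaErrorTerm (N + j) s) {s | 0 < s.re} := by
  intro s hs
  have hs : 0 < s.re := hs
  set U : Set ℂ := {z | s.re / 2 < z.re} ∩ Metric.ball 0 (‖s‖ + 1) with hU
  have hUo : IsOpen U := (isOpen_lt continuous_const Complex.continuous_re).inter Metric.isOpen_ball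
  have hsU : s ∈ U := ⟨by simp only [Set.mem_ofPred_eq]; linarith, by simp⟩
  refine DifferentiableAt.differentiableWithinAt ?_
  refine (Complex.differentiableOn_tsum_of_summable_norm
    (u := fun j => (‖s‖ + 2) * (‖s‖ + 1) * ((N + j : ℕ) : ℝ) ^ (-(s.re / 2) - 1))
    ((summable_rpow_shift (by linarith) N).mul_left _) (fun j => ?_) hUo
    (fun j z hz => ?_)).differentiableAt (hUo.mem_nhds hsU)
  · have h1 : ((N + j : ℕ) : ℂ) ≠ 0 := by
      have : N + j ≠ 0 := by omega
      exact_mod_cast this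
    have h2 : ((N + j : ℕ) : ℂ) + 1 ≠ 0 := by exact_mod_cast Nat.succ_ne_zero (N + j)
    unfold zetaErrorTerm
    refine DifferentiableOn.sub (DifferentiableOn.add (DifferentiableOn.mul ?_ ?_) ?_) ?_
    · exact (differentiable_id.sub_const 1).differentiableOn
    · exact (differentiable_id.neg.const_cpow (Or.inl h2)).differentiableOn
    · exact ((differentiable_id.const_sub 1).const_cpow (Or.inl h2)).differentiableOn
    · exact ((differentiable_id.const_sub 1).const_cpow (Or.inl h1)).differentiableOn
  · have hz1 : s.re / 2 < z.re := hz.1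
    have hz2 : ‖z‖ < ‖s‖ + 1 := by simpa using hz.2
    refine (norm_zetaErrorTerm_le (by omega) (by linarith)).trans ?_
    have hx : (1 : ℝ) ≤ ((N + j : ℕ) : ℝ) := by exact_mod_cast (by omega : 1 ≤ N + j)
    have h3 : ‖z - 1‖ ≤ ‖s‖ + 2 := (norm_sub_le _ _).trans (by rw [norm_one]; linarith)
    have h4 : ((N + j : ℕ) : ℝ) ^ (-z.re - 1) ≤ ((N + j : ℕ) : ℝ) ^ (-(s.re / 2) - 1) :=
      Real.rpow_le_rpow_of_exponent_le hx (by linarith)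
    gcongr

/-- The truncated Dirichlet series of `ζ` with explicit remainder, valid for `Re s > 0`. -/
theorem poleFreeZeta_eq {N : ℕ} (hN : 1 ≤ N) {s : ℂ} (hs : 0 < s.re) :
    poleFreeZeta s = (s - 1) * ∑ n ∈ Finset.range N, ((n : ℂ) + 1) ^ (-s) + (N : ℂ) ^ (1 - s) +
      ∑' j : ℕ, zetaErrorTerm (N + j) s := by
  set G : ℂ → ℂ := fun s => (s - 1) * ∑ n ∈ Finset.range N, ((n : ℂ) + 1) ^ (-s) +
    (N : ℂ) ^ (1 - s) + ∑' j : ℕ, zetaErrorTerm (N + j) s with hG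
  have hUo : IsOpen {s : ℂ | 0 < s.re} := isOpen_lt continuous_const Complex.continuous_re
  have hGd : DifferentiableOn ℂ G {s | 0 < s.re} := by
    refine DifferentiableOn.add (DifferentiableOn.add (DifferentiableOn.mul ?_ ?_) ?_)
      (differentiableOn_tsum_zetaErrorTerm hN)
    · exact (differentiable_id.sub_const 1).differentiableOn
    · refine DifferentiableOn.fun_sum fun n _ => ?_
      exact (differentiable_id.neg.const_cpow
        (Or.inl (by exact_mod_cast Nat.succ_ne_zero n))).differentiableOn
    · exact ((differentiable_id.const_sub 1).const_cpow
        (Or.inl (by exact_mod_cast (by omega : N ≠ 0)))).differentiableOn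
  have heq1 : ∀ s : ℂ, 1 < s.re → poleFreeZeta s = G s := by
    intro s hs
    have hs1 : s ≠ 1 := by rintro rfl; simp at hs
    have hsum : Summable fun n : ℕ => ((n : ℂ) + 1) ^ (-s) := by
      have := (summable_nat_add_iff 1).2 (Complex.summable_one_div_nat_cpow.2 hs)
      refine this.congr fun n => ?_
      push_cast
      rw [Complex.cpow_neg, one_div]
    have hzeta : riemannZeta s = ∑' n : ℕ, ((n : ℂ) + 1) ^ (-s) := by
      rw [zeta_eq_tsum_one_div_nat_add_one_cpow hs]
      exact tsum_congr fun n => by rw [Complex.cpow_neg, one_div]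
    have hsumN : Summable fun j : ℕ => (((N + j : ℕ) : ℂ) + 1) ^ (-s) := by
      have := (summable_nat_add_iff N).2 hsum
      simpa [add_comm, add_left_comm] using this
    have htel : ∑' j : ℕ, zetaErrorTerm (N + j) s =
        (s - 1) * ∑' j : ℕ, (((N + j : ℕ) : ℂ) + 1) ^ (-s) - (N : ℂ) ^ (1 - s) := by
      have h1 := (summable_zetaErrorTerm hN (by linarith : 0 < s.re)).hasSum.tendsto_sum_nat
      have h2 := (hsumN.hasSum.mul_left (s - 1)).tendsto_sum_nat
      have h3 : Tendsto (fun J : ℕ => (((N + J : ℕ) : ℝ) : ℂ) ^ (1 - s)) atTop (𝓝 0) := by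
        rw [tendsto_zero_iff_norm_tendsto_zero]
        have h4 : Tendsto (fun J : ℕ => ((N + J : ℕ) : ℝ) ^ (1 - s.re)) atTop (𝓝 0) := by
          have h5 := (tendsto_rpow_neg_atTop (by linarith : 0 < s.re - 1)).comp
            (tendsto_natCast_atTop_atTop.comp (tendsto_add_atTop_nat N))
          refine h5.congr fun J => ?_
          simp [add_comm]
        refine h4.congr fun J => ?_
        rw [Complex.norm_cpow_eq_rpow_re_of_pos (by exact_mod_cast (by omega : 0 < N + J))]
        simp
      have h5 : ∀ J : ℕ, ∑ j ∈ Finset.range J, zetaErrorTerm (N + j) s =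
          ∑ j ∈ Finset.range J, (s - 1) * (((N + j : ℕ) : ℂ) + 1) ^ (-s) +
            ((((N + J : ℕ) : ℝ) : ℂ) ^ (1 - s) - (N : ℂ) ^ (1 - s)) := by
        intro J
        have := Finset.sum_range_sub (fun j => (((N + j : ℕ) : ℝ) : ℂ) ^ (1 - s)) J
        simp only [add_zero, Complex.ofReal_natCast] at this ⊢
        rw [← this, ← Finset.sum_add_distrib]
        refine Finset.sum_congr rfl fun j _ => ?_
        rw [zetaErrorTerm]
        push_cast
        rw [← add_assoc (N : ℂ)]; ring
      have h6 := h2.add (h3.sub_const ((N : ℂ) ^ (1 - s)))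
      rw [zero_sub] at h6
      have := tendsto_nhds_unique h1 (h6.congr fun J => (h5 J).symm)
      rw [this]; ring
    simp only [hG]
    rw [poleFreeZeta_of_ne hs1, htel, hzeta, ← hsum.sum_add_tsum_nat_add N]
    have : ∑' i : ℕ, (((i + N : ℕ) : ℂ) + 1) ^ (-s) = ∑' j : ℕ, (((N + j : ℕ) : ℂ) + 1) ^ (-s) :=
      tsum_congr fun j => by rw [add_comm j N]
    rw [this]; ring
  have hpre : IsPreconnected {s : ℂ | 0 < s.re} := (convex_halfSpace_re_gt 0).isPreconnected
  have h2 : (2 : ℂ) ∈ {s : ℂ | 0 < s.re} := by simp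
  have hev : poleFreeZeta =ᶠ[𝓝 2] G := by
    have : {s : ℂ | 1 < s.re} ∈ 𝓝 (2 : ℂ) :=
      (isOpen_lt continuous_const Complex.continuous_re).mem_nhds (by simp)
    filter_upwards [this] with z hz using heq1 z hz
  exact (differentiable_poleFreeZeta.differentiableOn.analyticOnNhd hUo).eqOn_of_preconnected_of_eventuallyEq
    (hGd.analyticOnNhd hUo) hpre h2 hev hs

lemma norm_tsum_zetaErrorTerm_le {N : ℕ} (hN : 1 ≤ N) {s : ℂ} (hs : 0 < s.re) :
    ‖∑' j : ℕ, zetaErrorTerm (N + j) s‖ ≤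
      ‖s - 1‖ * ‖s‖ * ((1 + 1 / s.re) * (N : ℝ) ^ (-s.re)) := by
  refine (tsum_of_norm_bounded ((summable_rpow_shift hs N).mul_left (‖s - 1‖ * ‖s‖)).hasSum
    fun j => norm_zetaErrorTerm_le (by omega) hs).trans ?_
  rw [tsum_mul_left]
  exact mul_le_mul_of_nonneg_left (tsum_rpow_shift_le hs hN) (by positivity)

end ZetaBounds

/-! ### Growth of zeta far from the real axis -/

section ZetaGrowth

lemma ne_one_of_one_le_abs_im {s : ℂ} (hs : 1 ≤ |s.im|) : s ≠ 1 := by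
  rintro rfl; norm_num at hs

lemma riemannZeta_eq_sum_add {N : ℕ} (hN : 1 ≤ N) {s : ℂ} (hs : 0 < s.re) (hs1 : s ≠ 1) :
    riemannZeta s = ∑ n ∈ Finset.range N, ((n : ℂ) + 1) ^ (-s) + (N : ℂ) ^ (1 - s) / (s - 1) +
      (∑' j : ℕ, zetaErrorTerm (N + j) s) / (s - 1) := by
  have := sub_ne_zero.2 hs1
  rw [riemannZeta_eq_poleFreeZeta_div hs1, poleFreeZeta_eq hN hs]
  field_simp

lemma norm_riemannZeta_le_sum {N : ℕ} (hN : 1 ≤ N) {s : ℂ} (hs : 0 < s.re) (hs1 : s ≠ 1) :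
    ‖riemannZeta s‖ ≤ ∑ n ∈ Finset.range N, ((n : ℝ) + 1) ^ (-s.re) +
      (N : ℝ) ^ (1 - s.re) / ‖s - 1‖ + ‖s‖ * ((1 + 1 / s.re) * (N : ℝ) ^ (-s.re)) := by
  have h0 : 0 < ‖s - 1‖ := norm_pos_iff.2 (sub_ne_zero.2 hs1)
  rw [riemannZeta_eq_sum_add hN hs hs1]
  refine (norm_add₃_le).trans (add_le_add (add_le_add ?_ ?_) ?_)
  · refine (norm_sum_le _ _).trans (Finset.sum_le_sum fun n _ => le_of_eq ?_)
    have : ((n : ℂ) + 1) = ((n + 1 : ℝ) : ℂ) := by push_cast; ring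
    rw [this, Complex.norm_cpow_eq_rpow_re_of_pos (by positivity), Complex.neg_re]
  · rw [norm_div]
    have : (N : ℂ) = ((N : ℝ) : ℂ) := by simp
    rw [this, Complex.norm_cpow_eq_rpow_re_of_pos (by exact_mod_cast hN), Complex.sub_re,
      Complex.one_re]
  · rw [norm_div, div_le_iff₀ h0]
    refine (norm_tsum_zetaErrorTerm_le hN hs).trans (le_of_eq (by ring))

/-- The truncated Dirichlet series at `N = 1`. -/
lemma norm_riemannZeta_le_linear {s : ℂ} (hs : 1 / 4 ≤ s.re) (hs1 : s ≠ 1) :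
    ‖riemannZeta s‖ ≤ 1 + 1 / ‖s - 1‖ + 5 * ‖s‖ := by
  refine (norm_riemannZeta_le_sum le_rfl (by linarith) hs1).trans ?_
  have h1 : 1 / s.re ≤ 4 := by
    rw [div_le_iff₀ (by linarith)]; linarith
  have := norm_nonneg s
  simp only [Finset.range_one, Finset.sum_singleton, Nat.cast_zero, zero_add, Real.one_rpow,
    Nat.cast_one, mul_one]
  nlinarith

/-- Polynomial growth of arbitrarily small order near and to the right of the line `Re s = 1`. -/
lemma exists_norm_riemannZeta_le_rpow {η : ℝ} (hη : 0 < η) (hη2 : η ≤ 1 / 2) :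
    ∃ C : ℝ, 0 < C ∧ ∀ s : ℂ, 1 - η ≤ s.re → s.re ≤ 3 → 1 ≤ |s.im| →
      ‖riemannZeta s‖ ≤ C * |s.im| ^ (2 * η) := by
  refine ⟨2 * (1 + 1 / η) + 2 + 24, by positivity, fun s hs hs3 ht => ?_⟩
  set t := |s.im| with ht_def
  have ht0 : 0 < t := by linarith
  set N := ⌈t⌉₊ with hN
  have hNt : t ≤ N := Nat.le_ceil t
  have hN2 : (N : ℝ) ≤ 2 * t := by
    have := (Nat.ceil_lt_add_one ht0.le).le
    rw [← hN] at this; linarith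
  have hN1 : 1 ≤ N := by
    have : (1 : ℝ) ≤ N := ht.trans hNt
    exact_mod_cast this
  have hNr : (1 : ℝ) ≤ N := by exact_mod_cast hN1
  have hσ : 0 < s.re := by linarith
  have hs1 : s ≠ 1 := ne_one_of_one_le_abs_im ht
  have hpow : (N : ℝ) ^ (2 * η) ≤ 2 * t ^ (2 * η) := by
    calc (N : ℝ) ^ (2 * η) ≤ (2 * t) ^ (2 * η) :=
          Real.rpow_le_rpow (by positivity) hN2 (by positivity)
      _ = 2 ^ (2 * η) * t ^ (2 * η) := Real.mul_rpow (by norm_num) ht0.le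
      _ ≤ 2 ^ (1 : ℝ) * t ^ (2 * η) := by
          gcongr
          · norm_num
          · linarith
      _ = _ := by rw [Real.rpow_one]
  have hNη : (N : ℝ) ^ η ≤ (N : ℝ) ^ (2 * η) :=
    Real.rpow_le_rpow_of_exponent_le hNr (by linarith)
  have hsum : ∑ n ∈ Finset.range N, ((n : ℝ) + 1) ^ (-s.re) ≤ (1 + 1 / η) * (N : ℝ) ^ (2 * η) := by
    calc ∑ n ∈ Finset.range N, ((n : ℝ) + 1) ^ (-s.re)
        ≤ ∑ n ∈ Finset.range N, (N : ℝ) ^ η * ((n : ℝ) + 1)⁻¹ := by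
          refine Finset.sum_le_sum fun n hn => ?_
          have hnN : (n : ℝ) + 1 ≤ N := by exact_mod_cast Finset.mem_range.1 hn
          have hn1 : (1 : ℝ) ≤ n + 1 := by linarith [Nat.cast_nonneg (α := ℝ) n]
          calc ((n : ℝ) + 1) ^ (-s.re) ≤ ((n : ℝ) + 1) ^ (η + -1) :=
                Real.rpow_le_rpow_of_exponent_le hn1 (by linarith)
            _ = ((n : ℝ) + 1) ^ η * ((n : ℝ) + 1)⁻¹ := by
                rw [Real.rpow_add (by linarith), Real.rpow_neg_one]
            _ ≤ _ := by gcongr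
      _ = (N : ℝ) ^ η * (harmonic N : ℝ) := by
          rw [← Finset.mul_sum, harmonic]
          push_cast; rfl
      _ ≤ (N : ℝ) ^ η * (1 + Real.log N) := by
          gcongr
          exact harmonic_le_one_add_log N
      _ ≤ (N : ℝ) ^ η * (1 + (N : ℝ) ^ η / η) := by
          gcongr
          exact Real.log_le_rpow_div (by positivity) hη
      _ ≤ (N : ℝ) ^ η * ((N : ℝ) ^ η + (N : ℝ) ^ η / η) := by
          gcongr
          exact Real.one_le_rpow hNr hη.le
      _ = (1 + 1 / η) * (N : ℝ) ^ (2 * η) := by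
          rw [two_mul, Real.rpow_add (by linarith)]; ring
  have h2 : (N : ℝ) ^ (1 - s.re) / ‖s - 1‖ ≤ (N : ℝ) ^ (2 * η) := by
    have h1 : 1 ≤ ‖s - 1‖ := by
      have := Complex.abs_im_le_norm (s - 1)
      simp only [Complex.sub_im, Complex.one_im, sub_zero] at this
      linarith
    refine (div_le_self (by positivity) h1).trans ?_
    exact Real.rpow_le_rpow_of_exponent_le hNr (by linarith)
  have hsn : ‖s‖ ≤ 4 * N := by
    have := Complex.norm_le_abs_re_add_abs_im s
    rw [abs_of_pos hσ] at this
    linarith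
  have h3 : ‖s‖ * ((1 + 1 / s.re) * (N : ℝ) ^ (-s.re)) ≤ 12 * (N : ℝ) ^ (2 * η) := by
    have h1 : 1 / s.re ≤ 2 := by
      rw [div_le_iff₀ hσ]; linarith
    calc ‖s‖ * ((1 + 1 / s.re) * (N : ℝ) ^ (-s.re)) ≤ (4 * N) * (3 * (N : ℝ) ^ (-s.re)) := by
          gcongr; linarith
      _ = 12 * (N : ℝ) ^ (1 + -s.re) := by
          rw [Real.rpow_add (by linarith), Real.rpow_one]; ring
      _ ≤ _ := by
          gcongr
          linarith
  have hC : (0 : ℝ) ≤ 1 + 1 / η := by positivity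
  have htp : 0 ≤ t ^ (2 * η) := by positivity
  calc ‖riemannZeta s‖ ≤ (1 + 1 / η) * (N : ℝ) ^ (2 * η) + (N : ℝ) ^ (2 * η) +
        12 * (N : ℝ) ^ (2 * η) :=
        (norm_riemannZeta_le_sum hN1 hσ hs1).trans (add_le_add (add_le_add hsum h2) h3)
    _ = ((1 + 1 / η) + 13) * (N : ℝ) ^ (2 * η) := by ring
    _ ≤ ((1 + 1 / η) + 13) * (2 * t ^ (2 * η)) := by gcongr
    _ = _ := by ring

/-- Cauchy's estimate on a circle of radius `η`. -/
lemma exists_norm_deriv_riemannZeta_le {η : ℝ} (hη : 0 < η) (hη2 : η ≤ 1 / 2) :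
    ∃ C : ℝ, 0 < C ∧ ∀ s : ℂ, 1 ≤ s.re → s.re ≤ 2 → 2 ≤ |s.im| →
      ‖deriv riemannZeta s‖ ≤ C * |s.im| ^ (2 * η) := by
  obtain ⟨C, hC, hb⟩ := exists_norm_riemannZeta_le_rpow hη hη2
  refine ⟨C * 2 / η, by positivity, fun s hs hs2 ht => ?_⟩
  have hmem (z : ℂ) (hz : ‖z - s‖ ≤ η) :
      1 - η ≤ z.re ∧ z.re ≤ 3 ∧ 1 ≤ |z.im| ∧ |z.im| ≤ 2 * |s.im| := by
    have h1 := (Complex.abs_re_le_norm (z - s)).trans hz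
    have h2 := (Complex.abs_im_le_norm (z - s)).trans hz
    rw [Complex.sub_re, abs_le] at h1
    rw [Complex.sub_im] at h2
    have h3 := abs_sub_abs_le_abs_sub s.im z.im
    have h4 := abs_sub_abs_le_abs_sub z.im s.im
    rw [abs_sub_comm] at h3
    refine ⟨by linarith [h1.1], by linarith [h1.2], by linarith, by linarith⟩
  refine (Complex.norm_deriv_le_of_forall_mem_sphere_norm_le (R := η)
    (C := C * (2 * |s.im| ^ (2 * η))) hη ?_ ?_).trans (le_of_eq (by ring))
  · refine DifferentiableOn.diffContOnCl_ball (U := {z | z ≠ 1})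
      (fun z hz => (differentiableAt_riemannZeta hz).differentiableWithinAt) fun z hz => ?_
    exact ne_one_of_one_le_abs_im (hmem z (by simpa [dist_eq_norm] using hz)).2.2.1
  · intro z hz
    obtain ⟨h1, h2, h3, h4⟩ := hmem z (by rw [← dist_eq_norm]; exact (Metric.mem_sphere.1 hz).le)
    refine (hb z h1 h2 h3).trans ?_
    gcongr
    calc |z.im| ^ (2 * η) ≤ (2 * |s.im|) ^ (2 * η) :=
          Real.rpow_le_rpow (by positivity) h4 (by positivity)
      _ = 2 ^ (2 * η) * |s.im| ^ (2 * η) := Real.mul_rpow (by norm_num) (abs_nonneg _)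
      _ ≤ 2 ^ (1 : ℝ) * |s.im| ^ (2 * η) := by
          gcongr
          · norm_num
          · linarith
      _ = _ := by rw [Real.rpow_one]

/-- The inequality that rests on `3 + 4 cos θ + cos 2θ ≥ 0`. -/
lemma one_le_norm_riemannZeta_product {x : ℝ} (hx : 0 < x) (y : ℝ) :
    1 ≤ ‖riemannZeta (1 + x)‖ ^ 3 * ‖riemannZeta (1 + x + Complex.I * y)‖ ^ 4 *
      ‖riemannZeta (1 + x + 2 * Complex.I * y)‖ := by
  have h := DirichletCharacter.norm_LFunction_product_ge_one (1 : DirichletCharacter ℂ 1) hx y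
  simpa only [DirichletCharacter.LFunctionTrivChar, DirichletCharacter.LFunction_modOne_eq,
    norm_mul, norm_pow] using h

/-- Lower bound for `ζ` far from the real axis, from `ζ(σ)³ |ζ(σ + it)|⁴ |ζ(σ + 2it)| ≥ 1` and the
bound for `ζ'`. -/
lemma exists_rpow_le_norm_riemannZeta {η : ℝ} (hη : 0 < η) (hη2 : η ≤ 1 / 2) :
    ∃ c : ℝ, 0 < c ∧ ∀ s : ℂ, 1 < s.re → s.re ≤ 2 → 2 ≤ |s.im| →
      c * |s.im| ^ (-(8 * η)) ≤ ‖riemannZeta s‖ := by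
  obtain ⟨C, hC, hb⟩ := exists_norm_riemannZeta_le_rpow hη hη2
  obtain ⟨C₁, hC₁, hb₁⟩ := exists_norm_deriv_riemannZeta_le hη hη2
  -- the bound `‖ζ(1 + x + iy)‖ ≥ c₀ x^(3/4) |y|^(-η/2)`
  obtain ⟨c₀, hc₀, hlow⟩ : ∃ c₀ : ℝ, 0 < c₀ ∧ ∀ x y : ℝ, 0 < x → x ≤ 1 → 2 ≤ |y| →
      c₀ * x ^ (3 / 4 : ℝ) * |y| ^ (-(η / 2)) ≤ ‖riemannZeta (1 + x + Complex.I * y)‖ := by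
    refine ⟨(12 ^ 3 * (2 * C)) ^ (-(1 / 4) : ℝ), by positivity, fun x y hx hx1 hy => ?_⟩
    have hy0 : 0 < |y| := by linarith
    have h1 := one_le_norm_riemannZeta_product hx y
    have hz1 : ‖riemannZeta (1 + x)‖ ≤ 12 / x := by
      have hne : (1 + x : ℂ) ≠ 1 := by
        intro h; have := add_eq_left.1 h; exact hx.ne' (by exact_mod_cast this)
      refine (norm_riemannZeta_le_linear (by simp; linarith) hne).trans ?_
      have e1 : ‖(1 + x : ℂ) - 1‖ = x := by
        rw [add_sub_cancel_left, Complex.norm_real, Real.norm_eq_abs, abs_of_pos hx]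
      have e2 : ‖(1 + x : ℂ)‖ ≤ 2 := by
        refine (norm_add_le _ _).trans ?_
        rw [norm_one, Complex.norm_real, Real.norm_eq_abs, abs_of_pos hx]; linarith
      have e3 : 1 ≤ 1 / x := by rw [le_div_iff₀ hx]; linarith
      rw [e1]
      have : 12 / x = 12 * (1 / x) := by ring
      rw [this]; linarith
    have hz2 : ‖riemannZeta (1 + x + 2 * Complex.I * y)‖ ≤ 2 * C * |y| ^ (2 * η) := by
      have him : (1 + x + 2 * Complex.I * y : ℂ).im = 2 * y := by simp
      have hre : (1 + x + 2 * Complex.I * y : ℂ).re = 1 + x := by simp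
      have := hb (1 + x + 2 * Complex.I * y) (by rw [hre]; linarith) (by rw [hre]; linarith)
        (by rw [him, abs_mul]; norm_num; linarith)
      refine this.trans ?_
      rw [him, abs_mul, Real.mul_rpow (by norm_num) (abs_nonneg _), abs_of_pos (by norm_num : (0:ℝ) < 2)]
      have h2 : (2 : ℝ) ^ (2 * η) ≤ 2 := by
        calc (2 : ℝ) ^ (2 * η) ≤ 2 ^ (1 : ℝ) :=
              Real.rpow_le_rpow_of_exponent_le (by norm_num) (by linarith)
          _ = 2 := Real.rpow_one 2
      have : 0 ≤ |y| ^ (2 * η) := by positivity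
      nlinarith [mul_le_mul_of_nonneg_right h2 this]
    set Z := ‖riemannZeta (1 + x + Complex.I * y)‖ with hZ
    have hZ0 : 0 ≤ Z := norm_nonneg _
    have h4 : (12 ^ 3 * (2 * C))⁻¹ * x ^ 3 * (|y| ^ (2 * η))⁻¹ ≤ Z ^ 4 := by
      have h5 : 1 ≤ (12 / x) ^ 3 * Z ^ 4 * (2 * C * |y| ^ (2 * η)) :=
        h1.trans (by gcongr)
      have hyp : 0 < |y| ^ (2 * η) := by positivity
      rw [← mul_inv_le_iff₀ (by positivity)] at h5
      have e : (12 ^ 3 * (2 * C))⁻¹ * x ^ 3 * (|y| ^ (2 * η))⁻¹ =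
          (1 * (2 * C * |y| ^ (2 * η))⁻¹) * (x / 12) ^ 3 := by
        field_simp
      rw [e]
      calc _ ≤ ((12 / x) ^ 3 * Z ^ 4) * (x / 12) ^ 3 := by gcongr
        _ = Z ^ 4 := by field_simp
    have h6 := Real.rpow_le_rpow (by positivity) h4 (by norm_num : (0 : ℝ) ≤ 1 / 4)
    have e1 : (Z ^ 4) ^ (1 / 4 : ℝ) = Z := by
      rw [← Real.rpow_natCast, ← Real.rpow_mul hZ0]; norm_num
    have e2 : ((12 ^ 3 * (2 * C))⁻¹ * x ^ 3 * (|y| ^ (2 * η))⁻¹) ^ (1 / 4 : ℝ) =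
        (12 ^ 3 * (2 * C)) ^ (-(1 / 4) : ℝ) * x ^ (3 / 4 : ℝ) * |y| ^ (-(η / 2)) := by
      rw [Real.mul_rpow (by positivity) (by positivity), Real.mul_rpow (by positivity) (by positivity),
        Real.inv_rpow (by positivity), ← Real.rpow_neg (by positivity), ← Real.rpow_natCast x,
        ← Real.rpow_mul hx.le, ← Real.rpow_neg (by positivity), ← Real.rpow_mul (by positivity)]
      congr 2
      · norm_num
      · ring
    rwa [e1, e2] at h6
  set κ := min 1 (c₀ / (2 * C₁)) with hκ
  have hκ0 : 0 < κ := lt_min one_pos (by positivity)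
  have hκ1 : κ ≤ 1 := min_le_left _ _
  have hκ2 : C₁ * κ ≤ c₀ / 2 := by
    calc C₁ * κ ≤ C₁ * (c₀ / (2 * C₁)) := by gcongr; exact min_le_right _ _
      _ = c₀ / 2 := by field_simp
  refine ⟨c₀ / 2 * κ ^ 3, by positivity, fun s hs hs2 ht => ?_⟩
  set t := |s.im| with htdef
  have ht0 : 0 < t := by linarith
  -- the threshold `δ = (κ t^(-5η/2))⁴` balances the two bounds
  set r := κ * t ^ (-(5 * η / 2)) with hr
  have hr0 : 0 < r := by positivity
  have htle : t ^ (-(5 * η / 2)) ≤ 1 :=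
    Real.rpow_le_one_of_one_le_of_nonpos (by linarith) (by linarith)
  have hr1 : r ≤ 1 := mul_le_one₀ hκ1 (by positivity) htle
  have hδ34 : (r ^ 4) ^ (3 / 4 : ℝ) = r ^ 3 := by
    rw [← Real.rpow_natCast, ← Real.rpow_natCast, ← Real.rpow_mul hr0.le]; norm_num
  have hmain : c₀ * κ ^ 3 * t ^ (-(8 * η)) = c₀ * r ^ 3 * t ^ (-(η / 2)) := by
    rw [hr, mul_pow, ← Real.rpow_natCast (t ^ _), ← Real.rpow_mul ht0.le, mul_assoc, mul_assoc,
      mul_assoc, ← Real.rpow_add ht0]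
    congr 3; push_cast; ring
  have hsform (x : ℝ) (hx : s.re = 1 + x) : s = 1 + x + Complex.I * s.im := by
    apply Complex.ext <;> simp [hx]
  rcases le_or_gt (r ^ 4) (s.re - 1) with h | h
  · have h1 := hlow (s.re - 1) s.im (by linarith) (by linarith) ht
    rw [← hsform (s.re - 1) (by ring)] at h1
    have h2 : r ^ 3 ≤ (s.re - 1) ^ (3 / 4 : ℝ) := by
      rw [← hδ34]; exact Real.rpow_le_rpow (by positivity) h (by norm_num)
    calc c₀ / 2 * κ ^ 3 * t ^ (-(8 * η)) ≤ c₀ * κ ^ 3 * t ^ (-(8 * η)) := by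
          gcongr; linarith
      _ = c₀ * r ^ 3 * t ^ (-(η / 2)) := hmain
      _ ≤ c₀ * (s.re - 1) ^ (3 / 4 : ℝ) * t ^ (-(η / 2)) := by gcongr
      _ ≤ _ := h1
  · set s' : ℂ := 1 + (r ^ 4 : ℝ) + Complex.I * s.im with hs'
    have hr41 : r ^ 4 ≤ 1 := pow_le_one₀ hr0.le hr1
    have h1 := hlow (r ^ 4) s.im (by positivity) hr41 ht
    rw [hδ34] at h1
    have hseg : ∀ z ∈ segment ℝ s' s, 1 ≤ z.re ∧ z.re ≤ 2 ∧ z.im = s.im := by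
      intro z hz
      obtain ⟨a, b, ha, hb', hab, rfl⟩ := hz
      have hre : s'.re = 1 + r ^ 4 := by rw [hs']; simp [-Complex.ofReal_pow]
      have him : s'.im = s.im := by rw [hs']; simp [-Complex.ofReal_pow]
      simp only [Complex.add_re, Complex.add_im, Complex.smul_re, Complex.smul_im, smul_eq_mul, hre,
        him]
      refine ⟨?_, ?_, ?_⟩
      · nlinarith [pow_pos hr0 4]
      · nlinarith
      · rw [← add_mul, hab, one_mul]
    have h2 := (convex_segment s' s).norm_image_sub_le_of_norm_deriv_le (𝕜 := ℂ)
      (f := riemannZeta) (C := C₁ * t ^ (2 * η))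
      (fun z hz => differentiableAt_riemannZeta (ne_one_of_one_le_abs_im (by
        rw [(hseg z hz).2.2]; linarith)))
      (fun z hz => by
        obtain ⟨h1, h2, h3⟩ := hseg z hz
        have := hb₁ z h1 h2 (by rw [h3]; exact ht)
        rwa [h3] at this) (left_mem_segment ℝ s' s) (right_mem_segment ℝ s' s)
    have h3 : ‖s - s'‖ ≤ r ^ 4 := by
      have : s - s' = ((s.re - 1 - r ^ 4 : ℝ) : ℂ) := by
        apply Complex.ext <;> simp [hs']; ring
      rw [this, Complex.norm_real, Real.norm_eq_abs, abs_le]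
      constructor <;> linarith
    have h4 : ‖riemannZeta s'‖ - ‖riemannZeta s‖ ≤ ‖riemannZeta s - riemannZeta s'‖ := by
      rw [norm_sub_rev]; exact norm_sub_norm_le _ _
    have h5 : C₁ * t ^ (2 * η) * r ^ 4 ≤ c₀ / 2 * r ^ 3 * t ^ (-(η / 2)) := by
      have e : t ^ (2 * η) * t ^ (-(5 * η / 2)) = t ^ (-(η / 2)) := by
        rw [← Real.rpow_add ht0]; congr 1; ring
      calc C₁ * t ^ (2 * η) * r ^ 4 = (C₁ * κ) * r ^ 3 * (t ^ (2 * η) * t ^ (-(5 * η / 2))) := by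
            rw [show r ^ 4 = r ^ 3 * r by ring]; nth_rewrite 2 [hr]; ring
        _ ≤ c₀ / 2 * r ^ 3 * (t ^ (2 * η) * t ^ (-(5 * η / 2))) := by gcongr
        _ = _ := by rw [e]
    have h6 : ‖riemannZeta s - riemannZeta s'‖ ≤ C₁ * t ^ (2 * η) * r ^ 4 :=
      h2.trans (by gcongr)
    have h7 : c₀ / 2 * κ ^ 3 * t ^ (-(8 * η)) = c₀ / 2 * r ^ 3 * t ^ (-(η / 2)) := by
      linear_combination hmain / 2
    rw [h7]
    linarith

end ZetaGrowth

/-! ### Zeta and its inverse to the right of the line `Re s = 1` -/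

section ZetaNearOneLine

/-- Compactness, and the non-vanishing of `ζ` on the line `Re s = 1`. -/
lemma exists_norm_poleFreeZeta_bounds : ∃ c C : ℝ, 0 < c ∧ 0 < C ∧ ∀ s : ℂ, 0 ≤ s.re → s.re ≤ 1 →
    |s.im| ≤ 2 → c ≤ ‖poleFreeZeta (1 + s)‖ ∧ ‖poleFreeZeta (1 + s)‖ ≤ C := by
  have hK : IsCompact (Set.Icc (0 : ℝ) 1 ×ℂ Set.Icc (-2 : ℝ) 2) := isCompact_Icc.reProdIm isCompact_Icc
  have hcont : Continuous fun s : ℂ => ‖poleFreeZeta (1 + s)‖ :=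
    (differentiable_poleFreeZeta.continuous.comp (continuous_const.add continuous_id)).norm
  have hne : (Set.Icc (0 : ℝ) 1 ×ℂ Set.Icc (-2 : ℝ) 2).Nonempty := ⟨0, by simp [Complex.mem_reProdIm]⟩
  obtain ⟨a, ha, hmin⟩ := hK.exists_isMinOn hne hcont.continuousOn
  obtain ⟨b, hb, hmax⟩ := hK.exists_isMaxOn hne hcont.continuousOn
  have hpos (z : ℂ) (hz : z ∈ Set.Icc (0 : ℝ) 1 ×ℂ Set.Icc (-2 : ℝ) 2) :
      0 < ‖poleFreeZeta (1 + z)‖ := by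
    refine norm_pos_iff.2 (poleFreeZeta_ne_zero ?_)
    have := (Complex.mem_reProdIm.1 hz).1.1
    simp only [Complex.add_re, Complex.one_re]; linarith
  refine ⟨_, _, hpos a ha, hpos b hb, fun s h0 h1 h2 => ?_⟩
  have hs : s ∈ Set.Icc (0 : ℝ) 1 ×ℂ Set.Icc (-2 : ℝ) 2 :=
    Complex.mem_reProdIm.2 ⟨⟨h0, h1⟩, abs_le.1 h2⟩
  exact ⟨hmin hs, hmax hs⟩

/-- Uniform bounds for `ζ` and `1 / ζ` in the strip `1 < Re s ≤ 2`: up to arbitrarily small powers,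
`ζ(1 + s)` behaves like `1 / s` near the pole and like a bounded function far from it. -/
theorem exists_norm_riemannZeta_one_add_bounds {ε : ℝ} (hε : 0 < ε) (hε1 : ε ≤ 1) :
    ∃ C : ℝ, 0 < C ∧ ∀ s : ℂ, 0 < s.re → s.re ≤ 1 →
      ‖riemannZeta (1 + s)‖⁻¹ ≤ C * (‖s‖ * (1 + ‖s‖) ^ (ε - 1)) ∧
      ‖riemannZeta (1 + s)‖ ≤ C * (‖s‖⁻¹ * (1 + ‖s‖) ^ (1 + ε)) := by
  obtain ⟨c₁, C₁, hc₁, hC₁, h₁⟩ := exists_norm_poleFreeZeta_bounds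
  obtain ⟨C₂, hC₂, h₂⟩ := exists_norm_riemannZeta_le_rpow (η := ε / 8) (by linarith) (by linarith)
  obtain ⟨c₃, hc₃, h₃⟩ := exists_rpow_le_norm_riemannZeta (η := ε / 8) (by linarith) (by linarith)
  refine ⟨c₁⁻¹ * 4 + C₁ + C₂ + c₃⁻¹ * 2, by positivity, fun s hs hs1 => ?_⟩
  have hs0 : s ≠ 0 := by rintro rfl; simp at hs
  have hsn : 0 < ‖s‖ := norm_pos_iff.2 hs0
  have hre : (1 + s).re = 1 + s.re := by simp
  have him : (1 + s).im = s.im := by simp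
  set C := c₁⁻¹ * 4 + C₁ + C₂ + c₃⁻¹ * 2 with hC
  have hi₁ : 0 < c₁⁻¹ := by positivity
  have hi₃ : 0 < c₃⁻¹ := by positivity
  rcases le_or_gt |s.im| 2 with him2 | him2
  · obtain ⟨hlo, hhi⟩ := h₁ s hs.le hs1 him2
    have hz : ‖riemannZeta (1 + s)‖ = ‖poleFreeZeta (1 + s)‖ / ‖s‖ := by
      rw [riemannZeta_eq_poleFreeZeta_div (by simpa using hs0), norm_div, add_sub_cancel_left]
    have hs3 : 1 + ‖s‖ ≤ 4 := by
      have := Complex.norm_le_abs_re_add_abs_im s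
      rw [abs_of_pos hs] at this; linarith
    constructor
    · have h4 : 1 / 4 ≤ (1 + ‖s‖) ^ (ε - 1) := by
        calc (1 / 4 : ℝ) ≤ (1 + ‖s‖)⁻¹ := by
              rw [one_div]; exact inv_anti₀ (by positivity) hs3
          _ = (1 + ‖s‖) ^ (-1 : ℝ) := (Real.rpow_neg_one _).symm
          _ ≤ _ := Real.rpow_le_rpow_of_exponent_le (by linarith) (by linarith)
      rw [hz, inv_div]
      calc ‖s‖ / ‖poleFreeZeta (1 + s)‖ ≤ ‖s‖ / c₁ := by gcongr
        _ = (c₁⁻¹ * 4) * (‖s‖ * (1 / 4)) := by field_simp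
        _ ≤ C * (‖s‖ * (1 + ‖s‖) ^ (ε - 1)) := by
            gcongr
            rw [hC]; linarith
    · have h4 : 1 ≤ (1 + ‖s‖) ^ (1 + ε) := Real.one_le_rpow (by linarith) (by linarith)
      rw [hz]
      calc ‖poleFreeZeta (1 + s)‖ / ‖s‖ ≤ C₁ / ‖s‖ := by gcongr
        _ = C₁ * (‖s‖⁻¹ * 1) := by field_simp
        _ ≤ C * (‖s‖⁻¹ * (1 + ‖s‖) ^ (1 + ε)) := by
            gcongr
            rw [hC]; linarith
  · have ht : |s.im| ≤ ‖s‖ := Complex.abs_im_le_norm s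
    have hs2 : 1 ≤ ‖s‖ := by linarith
    have hu := h₂ (1 + s) (by rw [hre]; linarith) (by rw [hre]; linarith) (by rw [him]; linarith)
    have hl := h₃ (1 + s) (by rw [hre]; linarith) (by rw [hre]; linarith) (by rw [him]; linarith)
    rw [him] at hu hl
    have hpos : 0 < 1 + ‖s‖ := by linarith
    constructor
    · rw [show 8 * (ε / 8) = ε by ring] at hl
      have h5 : ‖riemannZeta (1 + s)‖⁻¹ ≤ (c₃ * |s.im| ^ (-ε))⁻¹ :=
        inv_anti₀ (by positivity) hl
      have h6 : (c₃ * |s.im| ^ (-ε))⁻¹ = c₃⁻¹ * |s.im| ^ ε := by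
        rw [mul_inv, Real.rpow_neg (abs_nonneg _), inv_inv]
      rw [h6] at h5
      calc _ ≤ c₃⁻¹ * |s.im| ^ ε := h5
        _ ≤ c₃⁻¹ * (1 + ‖s‖) ^ ε := by gcongr; linarith
        _ = c₃⁻¹ * ((1 + ‖s‖) * (1 + ‖s‖) ^ (ε - 1)) := by
            rw [Real.rpow_sub_one hpos.ne']; field_simp
        _ ≤ c₃⁻¹ * ((2 * ‖s‖) * (1 + ‖s‖) ^ (ε - 1)) := by gcongr; linarith
        _ = (c₃⁻¹ * 2) * (‖s‖ * (1 + ‖s‖) ^ (ε - 1)) := by ring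
        _ ≤ _ := by gcongr; rw [hC]; linarith
    · calc _ ≤ C₂ * |s.im| ^ (2 * (ε / 8)) := hu
        _ ≤ C₂ * (1 + ‖s‖) ^ (2 * (ε / 8)) := by gcongr; linarith
        _ ≤ C₂ * (1 + ‖s‖) ^ ε := by
            gcongr
            · linarith
            · linarith
        _ = C₂ * ((1 + ‖s‖)⁻¹ * (1 + ‖s‖) ^ (1 + ε)) := by
            rw [Real.rpow_add hpos, Real.rpow_one]; field_simp
        _ ≤ C₂ * (‖s‖⁻¹ * (1 + ‖s‖) ^ (1 + ε)) := by gcongr; linarith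
        _ ≤ _ := by gcongr; rw [hC]; linarith

end ZetaNearOneLine

/-! ### Laplace inversion -/

section LaplaceInversion

open MeasureTheory FourierTransform

/-- Laplace inversion on the line `Re σ = c`, deduced from Fourier inversion. -/
lemma integral_exp_mul_laplace_eq {f : ℝ → ℂ} {c : ℝ}
    (hf : Integrable (fun t : ℝ => Complex.exp (-(c * t)) * f t))
    (hF : Integrable (fun ξ : ℝ => ∫ t : ℝ, Complex.exp (-((c + ξ * Complex.I) * t)) * f t))
    {x : ℝ} (hx : ContinuousAt f x) :
    ∫ ξ : ℝ, Complex.exp ((c + ξ * Complex.I) * x) *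
      ∫ t : ℝ, Complex.exp (-((c + ξ * Complex.I) * t)) * f t = 2 * Real.pi * f x := by
  set F : ℝ → ℂ := fun ξ : ℝ => ∫ t : ℝ, Complex.exp (-((c + ξ * Complex.I) * t)) * f t with hFdef
  set g : ℝ → ℂ := fun t : ℝ => Complex.exp (-(c * t)) * f t with hg
  have hpi : (2 * Real.pi) ≠ 0 := by positivity
  have hfour : 𝓕 g = fun w : ℝ => F (2 * Real.pi * w) := by
    ext w
    rw [Real.fourier_real_eq_integral_exp_smul, hFdef]
    refine integral_congr_ae (Eventually.of_forall fun t => ?_)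
    simp only [hg, smul_eq_mul]
    rw [← mul_assoc, ← Complex.exp_add]
    congr 2
    push_cast
    ring
  have hcont : ContinuousAt g x := by
    apply ContinuousAt.mul _ hx
    fun_prop
  have hinv := hf.fourierInv_fourier_eq (by rw [hfour]; exact hF.comp_mul_left' hpi) hcont
  rw [hfour, Real.fourierInv_eq'] at hinv
  have h1 : ∫ ξ : ℝ, Complex.exp ((c + ξ * Complex.I) * x) * F ξ =
      Complex.exp (c * x) * ∫ ξ : ℝ, Complex.exp (ξ * x * Complex.I) * F ξ := by
    rw [← integral_const_mul]
    refine integral_congr_ae (Eventually.of_forall fun t => ?_)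
    simp only
    rw [← mul_assoc, ← Complex.exp_add]
    congr 2
    ring
  have h2 : ∫ w : ℝ, Complex.exp ((↑(2 * Real.pi * inner ℝ w x) * Complex.I)) •
      F (2 * Real.pi * w) =
      (2 * Real.pi : ℂ)⁻¹ * ∫ ξ : ℝ, Complex.exp (ξ * x * Complex.I) * F ξ := by
    have := Measure.integral_comp_mul_left
      (fun ξ : ℝ => Complex.exp (ξ * x * Complex.I) * F ξ) (2 * Real.pi)
    rw [abs_of_pos (by positivity)] at this
    rw [← smul_eq_mul (a := (2 * Real.pi : ℂ)⁻¹)]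
    have h3 : (2 * Real.pi : ℂ)⁻¹ = ((2 * Real.pi)⁻¹ : ℝ) := by push_cast; rfl
    rw [h3, Complex.coe_smul, ← this]
    refine integral_congr_ae (Eventually.of_forall fun t => ?_)
    simp only [smul_eq_mul]
    congr 2
    simp [mul_comm]
    ring
  rw [h2] at hinv
  rw [h1]
  have hpi' : (2 * Real.pi : ℂ) ≠ 0 := by exact_mod_cast hpi
  rw [inv_mul_eq_iff_eq_mul₀ hpi'] at hinv
  rw [hinv, hg]
  simp only
  rw [mul_left_comm, ← mul_assoc (Complex.exp _), ← Complex.exp_add]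
  simp

/-- The function `y ^ m / m!` on the positive half line, extended by zero: the Laplace inverse of
`1 / σ ^ (m + 1)`. -/
noncomputable def powKernel (m : ℕ) (y : ℝ) : ℂ := if 0 < y then (y : ℂ) ^ m / m.factorial else 0

lemma powKernel_of_pos (m : ℕ) {y : ℝ} (hy : 0 < y) : powKernel m y = (y : ℂ) ^ m / m.factorial :=
  if_pos hy

lemma powKernel_of_nonpos (m : ℕ) {y : ℝ} (hy : y ≤ 0) : powKernel m y = 0 :=
  if_neg hy.not_gt

lemma powKernel_eq_indicator (m : ℕ) :
    powKernel m = (Set.Ioi (0 : ℝ)).indicator (fun y => (y : ℂ) ^ m / m.factorial) := by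
  ext y
  simp only [powKernel, Set.indicator, Set.mem_Ioi]

lemma measurable_powKernel (m : ℕ) : Measurable (powKernel m) := by
  rw [powKernel_eq_indicator]
  exact Measurable.indicator (by fun_prop) measurableSet_Ioi

lemma continuousAt_powKernel (m : ℕ) {y : ℝ} (hy : y ≠ 0) : ContinuousAt (powKernel m) y := by
  rcases lt_or_gt_of_ne hy with h | h
  · refine (continuousAt_const (y := (0 : ℂ))).congr ?_
    filter_upwards [Iio_mem_nhds h] with u hu
    exact (powKernel_of_nonpos m (le_of_lt hu)).symm
  · refine ContinuousAt.congr (f := fun y : ℝ => (y : ℂ) ^ m / m.factorial) (by fun_prop) ?_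
    filter_upwards [Ioi_mem_nhds h] with u hu
    exact (powKernel_of_pos m hu).symm

lemma continuous_powKernel {m : ℕ} (hm : m ≠ 0) : Continuous (powKernel m) := by
  have : powKernel m = fun y : ℝ => ((max y 0 : ℝ) : ℂ) ^ m / m.factorial := by
    ext y
    rcases le_or_gt y 0 with h | h
    · rw [powKernel_of_nonpos m h, max_eq_right h]; simp [hm]
    · rw [powKernel_of_pos m h, max_eq_left h.le]
  rw [this]
  fun_prop

lemma norm_powKernel_le (m : ℕ) {y b : ℝ} (hb : 0 ≤ b) (hy : y ≤ b) :
    ‖powKernel m y‖ ≤ b ^ m := by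
  rcases le_or_gt y 0 with h | h
  · rw [powKernel_of_nonpos m h]; simp; positivity
  · rw [powKernel_of_pos m h, norm_div, norm_pow, Complex.norm_real, Real.norm_of_nonneg h.le,
      Complex.norm_natCast]
    calc y ^ m / m.factorial ≤ y ^ m / 1 := by
          gcongr; exact_mod_cast Nat.one_le_iff_ne_zero.mpr m.factorial_ne_zero
      _ ≤ b ^ m := by rw [div_one]; gcongr

lemma tendsto_exp_mul_pow_atTop {σ : ℂ} (hσ : 0 < σ.re) (m : ℕ) :
    Tendsto (fun t : ℝ => Complex.exp (-(σ * t)) * (t : ℂ) ^ m) atTop (𝓝 0) := by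
  rw [tendsto_zero_iff_norm_tendsto_zero]
  have := Real.tendsto_pow_mul_exp_neg_atTop_nhds_zero m
  have h2 := (this.comp (tendsto_id.const_mul_atTop hσ)).const_mul ((σ.re ^ m)⁻¹)
  rw [mul_zero] at h2
  refine h2.congr' ?_
  filter_upwards [eventually_gt_atTop 0] with t ht
  rw [norm_mul, norm_pow, Complex.norm_real, Real.norm_of_nonneg ht.le, Complex.norm_exp]
  simp only [Function.comp, id, Complex.neg_re, Complex.mul_re, Complex.ofReal_re,
    Complex.ofReal_im, mul_zero, sub_zero, mul_pow]
  field_simp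

lemma integrable_exp_mul_powKernel {σ : ℂ} (hσ : 0 < σ.re) (m : ℕ) :
    Integrable (fun t : ℝ => Complex.exp (-(σ * t)) * powKernel m t) := by
  have h := integrableOn_rpow_mul_exp_neg_mul_rpow (s := m) (p := 1) (b := σ.re)
    (by have := Nat.cast_nonneg (α := ℝ) m; linarith) (by norm_num) hσ
  have h2 : Integrable (fun t : ℝ => (Set.Ioi (0:ℝ)).indicator
      (fun x : ℝ => x ^ (m : ℝ) * Real.exp (-σ.re * x ^ (1 : ℝ))) t) :=
    (integrable_indicator_iff measurableSet_Ioi).mpr h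
  refine h2.mono' ((by fun_prop : Measurable fun t : ℝ => Complex.exp (-(σ * t))).mul
    (measurable_powKernel m)).aestronglyMeasurable (Eventually.of_forall fun t => ?_)
  rcases le_or_gt t 0 with ht | ht
  · rw [powKernel_of_nonpos m ht]
    simp [ht.not_gt]
  · rw [powKernel_of_pos m ht, Set.indicator_of_mem (Set.mem_Ioi.mpr ht), norm_mul, Complex.norm_exp, norm_div,
      norm_pow, Complex.norm_real, Real.norm_of_nonneg ht.le, Complex.norm_natCast,
      Real.rpow_natCast, Real.rpow_one, mul_comm]
    simp only [Complex.neg_re, Complex.mul_re, Complex.ofReal_re, Complex.ofReal_im, mul_zero,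
      sub_zero, neg_mul]
    gcongr
    exact div_le_self (by positivity)
      (by exact_mod_cast Nat.one_le_iff_ne_zero.mpr m.factorial_ne_zero)

lemma integral_exp_mul_powKernel {σ : ℂ} (hσ : 0 < σ.re) (m : ℕ) :
    ∫ t : ℝ, Complex.exp (-(σ * t)) * powKernel m t = 1 / σ ^ (m + 1) := by
  have hσ0 : σ ≠ 0 := by rintro rfl; simp at hσ
  have key : ∀ m : ℕ, ∫ t : ℝ, Complex.exp (-(σ * t)) * powKernel m t =
      ∫ t in Set.Ioi (0 : ℝ), Complex.exp (-(σ * t)) * ((t : ℂ) ^ m / m.factorial) := by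
    intro m
    rw [← integral_indicator measurableSet_Ioi]
    congr 1
    ext t
    rw [powKernel_eq_indicator]
    by_cases ht : t ∈ Set.Ioi (0 : ℝ) <;> simp [Set.indicator, ht]
  have hint : ∀ m : ℕ, IntegrableOn
      (fun t : ℝ => Complex.exp (-(σ * t)) * ((t : ℂ) ^ m / m.factorial)) (Set.Ioi 0) := by
    intro m
    refine ((integrable_exp_mul_powKernel hσ m).integrableOn (s := Set.Ioi 0)).congr_fun ?_
      measurableSet_Ioi
    intro t ht
    simp only [powKernel_of_pos m ht]
  have hexp : ∀ t : ℝ, HasDerivAt (fun t : ℝ => Complex.exp (-(σ * t)))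
      (Complex.exp (-(σ * t)) * (-σ)) t := by
    intro t
    have h1 : HasDerivAt (fun t : ℝ => -(σ * (t : ℂ))) (-(σ * 1)) t :=
      ((Complex.ofRealCLM.hasDerivAt (x := t)).const_mul σ).neg
    simpa using h1.cexp
  induction m with
  | zero =>
    rw [key]
    have := integral_Ioi_of_hasDerivAt_of_tendsto' (a := 0) (m := 0)
      (f := fun t : ℝ => Complex.exp (-(σ * t)) * (-σ)⁻¹)
      (f' := fun t : ℝ => Complex.exp (-(σ * t)) * ((t : ℂ) ^ 0 / (Nat.factorial 0 : ℕ)))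
      (fun t _ => ?_) (hint 0) ?_
    · rw [this]; simp
    · have := (hexp t).mul_const ((-σ)⁻¹)
      rw [mul_assoc, mul_inv_cancel₀ (neg_ne_zero.mpr hσ0)] at this
      simpa using this
    · simpa using (tendsto_exp_mul_pow_atTop hσ 0).mul_const ((-σ)⁻¹)
  | succ m ih =>
    have h0 := integral_Ioi_of_hasDerivAt_of_tendsto' (a := 0) (m := 0)
      (f := fun t : ℝ => Complex.exp (-(σ * t)) * ((t : ℂ) ^ (m + 1) / (m + 1).factorial))
      (f' := fun t : ℝ => Complex.exp (-(σ * t)) * ((t : ℂ) ^ m / m.factorial) -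
        σ * (Complex.exp (-(σ * t)) * ((t : ℂ) ^ (m + 1) / (m + 1).factorial)))
      (fun t _ => ?_) ((hint m).sub ((hint (m + 1)).const_mul σ)) ?_
    · rw [integral_sub (hint m) ((hint (m + 1)).const_mul σ), ← key, ih, integral_const_mul,
        ← key] at h0
      have h1 : 1 / σ ^ (m + 1) = σ * ∫ t : ℝ, Complex.exp (-(σ * t)) * powKernel (m + 1) t := by
        have h2 : (0 : ℂ) - Complex.exp (-(σ * (0 : ℝ))) *
            (((0 : ℝ) : ℂ) ^ (m + 1) / (m + 1).factorial) = 0 := by simp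
        rw [h2] at h0
        exact sub_eq_zero.mp h0
      rw [eq_comm, pow_succ, ← one_div_mul_one_div, h1, mul_one_div, mul_div_cancel_left₀ _ hσ0]
    · have hp : HasDerivAt (fun t : ℝ => (t : ℂ) ^ (m + 1) / (m + 1).factorial)
          ((t : ℂ) ^ m / m.factorial) t := by
        have := ((Complex.ofRealCLM.hasDerivAt (x := t)).pow (m + 1)).div_const
          ((m + 1).factorial : ℂ)
        refine this.congr_deriv ?_
        rw [Nat.factorial_succ]
        have h3 : ((m : ℂ) + 1) ≠ 0 := by exact_mod_cast Nat.succ_ne_zero m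
        have h4 : (m.factorial : ℂ) ≠ 0 := by exact_mod_cast m.factorial_ne_zero
        simp only [Complex.ofRealCLM_apply]
        push_cast
        simp
        field_simp
      refine ((hexp t).mul hp).congr_deriv ?_
      ring
    · have := (tendsto_exp_mul_pow_atTop hσ (m + 1)).div_const ((m + 1).factorial : ℂ)
      simpa [mul_div_assoc] using this

/-- Laplace inversion for the product of `1 / σ ^ (m + 1)` and the transform of `φ`. -/
lemma integral_exp_mul_laplace_div_pow {φ : ℝ → ℂ} {c : ℝ} (hc : 0 < c) (m : ℕ)
    (hφ : Integrable (fun t : ℝ => Complex.exp (-(c * t)) * φ t))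
    (hF : Integrable (fun ξ : ℝ => (∫ t : ℝ, Complex.exp (-((c + ξ * Complex.I) * t)) * φ t) /
      (c + ξ * Complex.I) ^ (m + 1))) (x : ℝ) :
    ∫ ξ : ℝ, Complex.exp ((c + ξ * Complex.I) * x) *
      ((∫ t : ℝ, Complex.exp (-((c + ξ * Complex.I) * t)) * φ t) / (c + ξ * Complex.I) ^ (m + 1))
      = 2 * Real.pi * ∫ t : ℝ, φ t * powKernel m (x - t) := by
  set a : ℝ → ℂ := fun t : ℝ => Complex.exp (-(c * t)) * φ t with ha
  set b : ℝ → ℂ := fun t : ℝ => Complex.exp (-(c * t)) * powKernel m t with hb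
  set f : ℝ → ℂ := fun x => ∫ t : ℝ, φ t * powKernel m (x - t) with hf
  have hcre : ∀ ξ : ℝ, 0 < ((c : ℂ) + ξ * Complex.I).re := by intro ξ; simpa using hc
  have hbint : Integrable b := by
    have := integrable_exp_mul_powKernel (σ := c) (by simpa using hc) m
    exact this
  have hconv : (fun t : ℝ => Complex.exp (-(c * t)) * f t) =
      MeasureTheory.convolution a b (ContinuousLinearMap.mul ℂ ℂ) volume := by
    ext t
    rw [convolution_def, hf]
    simp only
    rw [← integral_const_mul]
    refine integral_congr_ae (Eventually.of_forall fun u => ?_)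
    simp only [ha, hb, ContinuousLinearMap.mul_apply']
    rw [mul_mul_mul_comm, ← Complex.exp_add]
    congr 2
    push_cast
    ring
  have hlap : ∀ (h : ℝ → ℂ) (ξ : ℝ), 𝓕 (fun t : ℝ => Complex.exp (-(c * t)) * h t)
      (ξ / (2 * Real.pi)) = ∫ t : ℝ, Complex.exp (-((c + ξ * Complex.I) * t)) * h t := by
    intro h ξ
    rw [Real.fourier_real_eq_integral_exp_smul]
    refine integral_congr_ae (Eventually.of_forall fun t => ?_)
    simp only [smul_eq_mul]
    rw [← mul_assoc, ← Complex.exp_add]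
    congr 2
    have : (Real.pi : ℂ) ≠ 0 := by exact_mod_cast Real.pi_ne_zero
    push_cast
    field_simp
    ring
  have htrans : ∀ ξ : ℝ, ∫ t : ℝ, Complex.exp (-((c + ξ * Complex.I) * t)) * f t =
      (∫ t : ℝ, Complex.exp (-((c + ξ * Complex.I) * t)) * φ t) /
        (c + ξ * Complex.I) ^ (m + 1) := by
    intro ξ
    rw [← hlap f, hconv, Real.fourier_mul_convolution_eq hφ hbint, ha, hb, hlap, hlap,
      integral_exp_mul_powKernel (hcre ξ), mul_one_div]
  have hcont : ContinuousAt f x := by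
    have hmeas : ∀ y : ℝ, AEStronglyMeasurable (fun t => φ t * powKernel m (y - t)) volume := by
      intro y
      have h1 : AEStronglyMeasurable φ volume := by
        have : φ = fun t : ℝ => Complex.exp (c * t) * a t := by
          ext t
          simp only [ha]
          rw [← mul_assoc, ← Complex.exp_add]
          simp
        rw [this]
        exact (by fun_prop : Continuous fun t : ℝ => Complex.exp (c * t)).aestronglyMeasurable.mul
          hφ.aestronglyMeasurable
      exact h1.mul ((measurable_powKernel m).comp (by fun_prop)).aestronglyMeasurable
    obtain ⟨M, hM⟩ : ∃ M : ℝ, ∀ u : ℝ, ‖b u‖ ≤ M := by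
      have hlim := tendsto_exp_mul_pow_atTop (σ := c) (by simpa using hc) m
      obtain ⟨T, hT⟩ := (hlim.norm.eventually (gt_mem_nhds (by simp : ‖(0:ℂ)‖ < 1))).exists_forall_of_atTop
      obtain ⟨M, hM⟩ := (isCompact_Icc (a := (0:ℝ)) (b := T)).exists_bound_of_continuousOn
        (f := fun t : ℝ => Complex.exp (-(c * t)) * (t : ℂ) ^ m) (by fun_prop)
      refine ⟨max M 1, fun u => ?_⟩
      have hle : 0 < u → ‖b u‖ ≤ ‖Complex.exp (-(c * u)) * (u : ℂ) ^ m‖ := by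
        intro hu
        rw [hb]
        simp only
        rw [powKernel_of_pos m hu, ← mul_div_assoc, norm_div, Complex.norm_natCast]
        exact div_le_self (norm_nonneg _)
          (by exact_mod_cast Nat.one_le_iff_ne_zero.mpr m.factorial_ne_zero)
      rcases le_or_gt u 0 with h | h
      · rw [hb]
        simp [powKernel_of_nonpos m h]
      · rcases le_or_gt u T with h' | h'
        · exact ((hle h).trans (hM u ⟨h.le, h'⟩)).trans (le_max_left _ _)
        · exact ((hle h).trans (hT u h'.le).le).trans (le_max_right _ _)
    have hker : ∀ y t : ℝ, φ t * powKernel m (y - t) = Complex.exp (c * y) * (a t * b (y - t)) := by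
      intro y t
      simp only [ha, hb]
      rw [mul_mul_mul_comm, ← Complex.exp_add, ← mul_assoc, ← Complex.exp_add]
      have : (c : ℂ) * y + (-(c * t) + -(c * ((y - t : ℝ) : ℂ))) = 0 := by push_cast; ring
      rw [this, Complex.exp_zero, one_mul]
    refine continuousAt_of_dominated (bound := fun t => Real.exp (c * (x + 1)) * (‖a t‖ * M))
      (Eventually.of_forall hmeas) ?_ ((hφ.norm.mul_const M).const_mul _) ?_
    · filter_upwards [Iio_mem_nhds (lt_add_one x)] with y hy
      refine Eventually.of_forall fun t => ?_
      rw [hker, norm_mul, norm_mul, Complex.norm_exp]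
      have : ((c : ℂ) * y).re = c * y := by simp
      rw [this]
      have hM' := hM (y - t)
      have hy' : y ≤ x + 1 := le_of_lt hy
      gcongr
    · have : ∀ᵐ t : ℝ, t ≠ x := by
        rw [ae_iff]; simp
      filter_upwards [this] with t ht
      refine ContinuousAt.mul continuousAt_const ?_
      refine ContinuousAt.comp (g := powKernel m) ?_ (by fun_prop)
      exact continuousAt_powKernel m (sub_ne_zero.mpr ht.symm)
  have hmain := integral_exp_mul_laplace_eq (f := f) (c := c) (x := x) ?_ ?_ hcont
  · simp_rw [htrans] at hmain
    exact hmain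
  · rw [hconv]
    exact hφ.integrable_convolution _ hbint
  · simp_rw [htrans]
    exact hF

/-- For `c > 0` the function `|c + iξ|⁻ʳ` is integrable when `r ≥ 2`. -/
lemma integrable_one_div_add_mul_I_pow {c : ℝ} (hc : 0 < c) {m : ℕ} (hm : m ≠ 0) :
    Integrable (fun ξ : ℝ => 1 / ((c : ℂ) + ξ * Complex.I) ^ (m + 1)) := by
  have h0 : ∀ ξ : ℝ, (c : ℂ) + ξ * Complex.I ≠ 0 := by
    intro ξ h
    have := congrArg Complex.re h
    simp at this
    exact hc.ne' this
  have hcont : Continuous (fun ξ : ℝ => 1 / ((c : ℂ) + ξ * Complex.I) ^ (m + 1)) := by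
    refine continuous_const.div (by fun_prop) (fun ξ => pow_ne_zero _ (h0 ξ))
  have hint : Integrable (fun ξ : ℝ => (1 / c ^ (m + 1)) * (1 + (c⁻¹ * ξ) ^ 2)⁻¹) :=
    (integrable_inv_one_add_sq.comp_mul_left' (inv_ne_zero hc.ne')).const_mul _
  refine hint.mono' hcont.aestronglyMeasurable (Eventually.of_forall fun ξ => ?_)
  rw [norm_div, norm_one, norm_pow]
  have hsq : ‖(c : ℂ) + ξ * Complex.I‖ ^ 2 = c ^ 2 + ξ ^ 2 := by
    rw [Complex.sq_norm, Complex.normSq_add_mul_I]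
  have hge : c ≤ ‖(c : ℂ) + ξ * Complex.I‖ := by
    have := Complex.re_le_norm ((c : ℂ) + ξ * Complex.I)
    simpa using this
  have h2 : c ^ (m + 1) * (1 + (c⁻¹ * ξ) ^ 2) ≤ ‖(c : ℂ) + ξ * Complex.I‖ ^ (m + 1) := by
    obtain ⟨j, rfl⟩ := Nat.exists_eq_add_one_of_ne_zero hm
    calc c ^ (j + 1 + 1) * (1 + (c⁻¹ * ξ) ^ 2) = c ^ j * (c ^ 2 + ξ ^ 2) := by
          field_simp
          ring
      _ ≤ ‖(c : ℂ) + ξ * Complex.I‖ ^ j * ‖(c : ℂ) + ξ * Complex.I‖ ^ 2 := by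
          rw [hsq]; gcongr
      _ = _ := by ring
  rw [one_div, one_div, ← mul_inv]
  exact inv_anti₀ (by positivity) h2

/-- Perron's formula in its absolutely convergent form, for the kernel `x ^ m / m!`. -/
lemma integral_exp_div_pow_eq {c : ℝ} (hc : 0 < c) {m : ℕ} (hm : m ≠ 0) (x : ℝ) :
    ∫ ξ : ℝ, Complex.exp ((c + ξ * Complex.I) * x) * (1 / (c + ξ * Complex.I) ^ (m + 1)) =
      2 * Real.pi * powKernel m x := by
  have hcre : ∀ ξ : ℝ, 0 < ((c : ℂ) + ξ * Complex.I).re := by intro ξ; simpa using hc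
  have htrans := fun ξ : ℝ => integral_exp_mul_powKernel (hcre ξ) m
  have := integral_exp_mul_laplace_eq (f := powKernel m) (c := c) (x := x) ?_ ?_
    (continuous_powKernel hm).continuousAt
  · simp_rw [htrans] at this
    exact this
  · exact integrable_exp_mul_powKernel (σ := c) (by simpa using hc) m
  · simp_rw [htrans]
    exact integrable_one_div_add_mul_I_pow hc hm

end LaplaceInversion

/-! ### The model integral -/

section ModelIntegral

open MeasureTheory

/-- The integrable function on the plane that dominates the Laplace integrals below. -/
noncomputable def planeMajorant (p : ℝ × ℝ) : ℝ :=
  (1 + |p.1|) ^ (-(7 / 8) : ℝ) * (1 + |p.2|) ^ (-(7 / 8) : ℝ) * (1 + |p.1 + p.2|)⁻¹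

lemma planeMajorant_nonneg (p : ℝ × ℝ) : 0 ≤ planeMajorant p := by
  unfold planeMajorant; positivity

/-- The largest of the three factors is used to increase the decay in the other two. -/
lemma rpow_mul_rpow_mul_inv_le {a b c : ℝ} (ha : 1 ≤ a) (hb : 1 ≤ b) (hc : 1 ≤ c) :
    a ^ (-(7 / 8) : ℝ) * b ^ (-(7 / 8) : ℝ) * c⁻¹ ≤
      a ^ (-(11 / 8) : ℝ) * b ^ (-(11 / 8) : ℝ) + a ^ (-(11 / 8) : ℝ) * c ^ (-(11 / 8) : ℝ) +
        b ^ (-(11 / 8) : ℝ) * c ^ (-(11 / 8) : ℝ) := by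
  have ha0 : 0 < a := by linarith
  have hb0 : 0 < b := by linarith
  have hc0 : 0 < c := by linarith
  have split : ∀ {x : ℝ}, 0 < x → ∀ r s : ℝ, x ^ (r + s) = x ^ r * x ^ s :=
    fun hx r s => Real.rpow_add hx r s
  have anti : ∀ {x y : ℝ}, 0 < x → x ≤ y → ∀ {r : ℝ}, r ≤ 0 → y ^ r ≤ x ^ r :=
    fun hx hxy _ hr => Real.rpow_le_rpow_of_nonpos hx hxy hr
  have nn : ∀ {x : ℝ}, 0 < x → ∀ r : ℝ, 0 ≤ x ^ r := fun hx r => (Real.rpow_pos_of_pos hx r).le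
  have h1 := mul_nonneg (nn ha0 (-(11 / 8))) (nn hb0 (-(11 / 8)))
  have h2 := mul_nonneg (nn ha0 (-(11 / 8))) (nn hc0 (-(11 / 8)))
  have h3 := mul_nonneg (nn hb0 (-(11 / 8))) (nn hc0 (-(11 / 8)))
  have hcinv : c⁻¹ = c ^ (-(1 : ℝ)) := (Real.rpow_neg_one c).symm
  rcases le_total a c with hac | hac
  · rcases le_total b c with hbc | hbc
    · have : a ^ (-(7 / 8) : ℝ) * b ^ (-(7 / 8) : ℝ) * c⁻¹ ≤
          a ^ (-(11 / 8) : ℝ) * b ^ (-(11 / 8) : ℝ) := by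
        calc a ^ (-(7 / 8) : ℝ) * b ^ (-(7 / 8) : ℝ) * c⁻¹
            = a ^ (-(7 / 8) : ℝ) * b ^ (-(7 / 8) : ℝ) *
              (c ^ (-(1 / 2) : ℝ) * c ^ (-(1 / 2) : ℝ)) := by
              rw [← split hc0, hcinv]; norm_num
          _ ≤ a ^ (-(7 / 8) : ℝ) * b ^ (-(7 / 8) : ℝ) *
              (a ^ (-(1 / 2) : ℝ) * b ^ (-(1 / 2) : ℝ)) :=
              mul_le_mul_of_nonneg_left (mul_le_mul (anti ha0 hac (by norm_num))
                (anti hb0 hbc (by norm_num)) (nn hc0 _) (nn ha0 _))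
                (mul_nonneg (nn ha0 _) (nn hb0 _))
          _ = a ^ (-(7 / 8) + -(1 / 2) : ℝ) * b ^ (-(7 / 8) + -(1 / 2) : ℝ) := by
              rw [split ha0, split hb0]; ring
          _ = _ := by norm_num
      linarith
    · have : a ^ (-(7 / 8) : ℝ) * b ^ (-(7 / 8) : ℝ) * c⁻¹ ≤
          a ^ (-(11 / 8) : ℝ) * c ^ (-(11 / 8) : ℝ) := by
        calc a ^ (-(7 / 8) : ℝ) * b ^ (-(7 / 8) : ℝ) * c⁻¹
            = a ^ (-(7 / 8) : ℝ) * c ^ (-(1 : ℝ)) *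
              (b ^ (-(1 / 2) : ℝ) * b ^ (-(3 / 8) : ℝ)) := by
              rw [← split hb0, hcinv]; norm_num; ring
          _ ≤ a ^ (-(7 / 8) : ℝ) * c ^ (-(1 : ℝ)) *
              (a ^ (-(1 / 2) : ℝ) * c ^ (-(3 / 8) : ℝ)) :=
              mul_le_mul_of_nonneg_left (mul_le_mul (anti ha0 (hac.trans hbc) (by norm_num))
                (anti hc0 hbc (by norm_num)) (nn hb0 _) (nn ha0 _))
                (mul_nonneg (nn ha0 _) (nn hc0 _))
          _ = a ^ (-(7 / 8) + -(1 / 2) : ℝ) * c ^ (-1 + -(3 / 8) : ℝ) := by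
              rw [split ha0, split hc0]; ring
          _ = _ := by norm_num
      linarith
  · rcases le_total a b with hab | hab
    · have : a ^ (-(7 / 8) : ℝ) * b ^ (-(7 / 8) : ℝ) * c⁻¹ ≤
          a ^ (-(11 / 8) : ℝ) * c ^ (-(11 / 8) : ℝ) := by
        calc a ^ (-(7 / 8) : ℝ) * b ^ (-(7 / 8) : ℝ) * c⁻¹
            = a ^ (-(7 / 8) : ℝ) * c ^ (-(1 : ℝ)) *
              (b ^ (-(1 / 2) : ℝ) * b ^ (-(3 / 8) : ℝ)) := by
              rw [← split hb0, hcinv]; norm_num; ring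
          _ ≤ a ^ (-(7 / 8) : ℝ) * c ^ (-(1 : ℝ)) *
              (a ^ (-(1 / 2) : ℝ) * c ^ (-(3 / 8) : ℝ)) :=
              mul_le_mul_of_nonneg_left (mul_le_mul (anti ha0 hab (by norm_num))
                (anti hc0 (hac.trans hab) (by norm_num)) (nn hb0 _) (nn ha0 _))
                (mul_nonneg (nn ha0 _) (nn hc0 _))
          _ = a ^ (-(7 / 8) + -(1 / 2) : ℝ) * c ^ (-1 + -(3 / 8) : ℝ) := by
              rw [split ha0, split hc0]; ring
          _ = _ := by norm_num
      linarith
    · have : a ^ (-(7 / 8) : ℝ) * b ^ (-(7 / 8) : ℝ) * c⁻¹ ≤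
          b ^ (-(11 / 8) : ℝ) * c ^ (-(11 / 8) : ℝ) := by
        calc a ^ (-(7 / 8) : ℝ) * b ^ (-(7 / 8) : ℝ) * c⁻¹
            = b ^ (-(7 / 8) : ℝ) * c ^ (-(1 : ℝ)) *
              (a ^ (-(1 / 2) : ℝ) * a ^ (-(3 / 8) : ℝ)) := by
              rw [← split ha0, hcinv]; norm_num; ring
          _ ≤ b ^ (-(7 / 8) : ℝ) * c ^ (-(1 : ℝ)) *
              (b ^ (-(1 / 2) : ℝ) * c ^ (-(3 / 8) : ℝ)) :=
              mul_le_mul_of_nonneg_left (mul_le_mul (anti hb0 hab (by norm_num))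
                (anti hc0 hac (by norm_num)) (nn ha0 _) (nn hb0 _))
                (mul_nonneg (nn hb0 _) (nn hc0 _))
          _ = b ^ (-(7 / 8) + -(1 / 2) : ℝ) * c ^ (-1 + -(3 / 8) : ℝ) := by
              rw [split hb0, split hc0]; ring
          _ = _ := by norm_num
      linarith

lemma integrable_planeMajorant : Integrable planeMajorant := by
  have h1 : Integrable (fun x : ℝ => (1 + |x|) ^ (-(11 / 8) : ℝ)) := by
    have := integrable_one_add_norm (E := ℝ) (μ := volume) (r := 11 / 8)
      (by simp; norm_num)
    simpa [Real.norm_eq_abs] using this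
  have hpair : Integrable (fun p : ℝ × ℝ =>
      (1 + |p.1|) ^ (-(11 / 8) : ℝ) * (1 + |p.2|) ^ (-(11 / 8) : ℝ)) := h1.mul_prod h1
  have hshear : Integrable (fun p : ℝ × ℝ =>
      (1 + |p.1|) ^ (-(11 / 8) : ℝ) * (1 + |p.1 + p.2|) ^ (-(11 / 8) : ℝ)) :=
    (measurePreserving_prod_add (volume : Measure ℝ) volume).integrable_comp_of_integrable hpair
  have hshear' : Integrable (fun p : ℝ × ℝ =>
      (1 + |p.2|) ^ (-(11 / 8) : ℝ) * (1 + |p.1 + p.2|) ^ (-(11 / 8) : ℝ)) := by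
    have := hshear.swap
    refine this.congr (Eventually.of_forall fun p => ?_)
    simp [Function.comp, add_comm]
  refine ((hpair.add hshear).add hshear').mono' ?_ (Eventually.of_forall fun p => ?_)
  · exact (by unfold planeMajorant; fun_prop : Measurable planeMajorant).aestronglyMeasurable
  · rw [Real.norm_of_nonneg (planeMajorant_nonneg p)]
    have h : ∀ x : ℝ, 1 ≤ 1 + |x| := fun x => by linarith [abs_nonneg x]
    exact rpow_mul_rpow_mul_inv_le (h p.1) (h p.2) (h (p.1 + p.2))

/-- The point `2 + iξ` of the line `Re σ = 2`. -/
noncomputable def lineTwo (ξ : ℝ) : ℂ := ((2 : ℝ) : ℂ) + ξ * Complex.I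

@[simp] lemma lineTwo_re (ξ : ℝ) : (lineTwo ξ).re = 2 := by simp [lineTwo]

@[simp] lemma lineTwo_im (ξ : ℝ) : (lineTwo ξ).im = ξ := by simp [lineTwo]

@[fun_prop] lemma continuous_lineTwo : Continuous lineTwo := by unfold lineTwo; fun_prop

lemma lineTwo_ne_zero (ξ : ℝ) : lineTwo ξ ≠ 0 := by
  intro h; have := congrArg Complex.re h; simp at this

lemma le_norm_lineTwo (ξ : ℝ) : (1 + |ξ|) / 2 ≤ ‖lineTwo ξ‖ := by
  have h1 := Complex.abs_re_le_norm (lineTwo ξ)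
  have h2 := Complex.abs_im_le_norm (lineTwo ξ)
  simp at h1 h2
  linarith

lemma norm_lineTwo_le (ξ : ℝ) : ‖lineTwo ξ‖ ≤ 2 * (1 + |ξ|) := by
  have := Complex.norm_le_abs_re_add_abs_im (lineTwo ξ)
  simp at this
  linarith [abs_nonneg ξ]

lemma le_norm_lineTwo_add {w : ℂ} (hw : ‖w‖ ≤ 1) (ξ : ℝ) : (1 + |ξ|) / 4 ≤ ‖lineTwo ξ + w‖ := by
  have h1 := Complex.re_le_norm (lineTwo ξ + w)
  have h2 := Complex.abs_im_le_norm (lineTwo ξ + w)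
  have h3 := (abs_le.mp ((Complex.abs_re_le_norm w).trans hw)).1
  have h4 := (Complex.abs_im_le_norm w).trans hw
  have h5 := abs_sub_abs_le_abs_sub ξ (-w.im)
  simp at h1 h2 h5
  linarith

lemma norm_lineTwo_add_le {w : ℂ} (hw : ‖w‖ ≤ 1) (ξ : ℝ) : ‖lineTwo ξ + w‖ ≤ 3 * (1 + |ξ|) := by
  have := norm_add_le (lineTwo ξ) w
  linarith [norm_lineTwo_le ξ, abs_nonneg ξ]

lemma le_norm_add_lineTwo_add_lineTwo {w : ℂ} (hw : ‖w‖ ≤ 1) (ξ₁ ξ₂ : ℝ) :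
    (1 + |ξ₁ + ξ₂|) / 2 ≤ ‖w + lineTwo ξ₁ + lineTwo ξ₂‖ := by
  have h1 := Complex.re_le_norm (w + lineTwo ξ₁ + lineTwo ξ₂)
  have h2 := Complex.abs_im_le_norm (w + lineTwo ξ₁ + lineTwo ξ₂)
  have h3 := (abs_le.mp ((Complex.abs_re_le_norm w).trans hw)).1
  have h4 := (Complex.abs_im_le_norm w).trans hw
  have h5 := abs_sub_abs_le_abs_sub (ξ₁ + ξ₂) (-w.im)
  simp at h1 h2 h5
  rw [show w.im + ξ₁ + ξ₂ = ξ₁ + ξ₂ + w.im by ring] at h2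
  linarith

lemma add_lineTwo_add_lineTwo_ne_zero {w : ℂ} (hw : ‖w‖ ≤ 1) (ξ₁ ξ₂ : ℝ) :
    w + lineTwo ξ₁ + lineTwo ξ₂ ≠ 0 := by
  have := le_norm_add_lineTwo_add_lineTwo hw ξ₁ ξ₂
  exact norm_pos_iff.mp (by linarith [abs_nonneg (ξ₁ + ξ₂)])

lemma one_add_abs_rpow_ge (x : ℝ) : (1 + |x|)⁻¹ ≤ (1 + |x|) ^ (-(7 / 8) : ℝ) := by
  rw [← Real.rpow_neg_one]
  exact Real.rpow_le_rpow_of_exponent_le (by linarith [abs_nonneg x]) (by norm_num)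

/-- The `j`-th term in the binomial expansion of the model integrand; `m` stands for `k - j`. -/
noncomputable def modelTerm (w : ℂ) (j m : ℕ) (p : ℝ × ℝ) : ℂ :=
  Complex.exp (lineTwo p.1 + lineTwo p.2) *
    (1 / ((w + lineTwo p.1 + lineTwo p.2) ^ j * (lineTwo p.1 * lineTwo p.2) ^ (m + 1)))

lemma continuous_modelTerm {w : ℂ} (hw : ‖w‖ ≤ 1) (j m : ℕ) : Continuous (modelTerm w j m) := by
  unfold modelTerm
  refine Continuous.mul (by fun_prop) (continuous_const.div (by fun_prop) fun p => ?_)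
  exact mul_ne_zero (pow_ne_zero _ (add_lineTwo_add_lineTwo_ne_zero hw _ _))
    (pow_ne_zero _ (mul_ne_zero (lineTwo_ne_zero _) (lineTwo_ne_zero _)))

lemma integrable_modelTerm {w : ℂ} (hw : ‖w‖ ≤ 1) {j m : ℕ} (hjm : j + m ≠ 0) :
    Integrable (modelTerm w j m) := by
  refine (integrable_planeMajorant.const_mul (Real.exp 4 * (16 : ℝ) ^ (m + j + 1))).mono'
    (continuous_modelTerm hw j m).aestronglyMeasurable (Eventually.of_forall fun p => ?_)
  have h1 := le_norm_lineTwo p.1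
  have h2 := le_norm_lineTwo p.2
  have h3 := le_norm_add_lineTwo_add_lineTwo hw p.1 p.2
  set A := 1 + |p.1| with hA
  set B := 1 + |p.2| with hB
  set C := 1 + |p.1 + p.2| with hC
  have hA1 : 1 ≤ A := by simp [hA]
  have hB1 : 1 ≤ B := by simp [hB]
  have hC1 : 1 ≤ C := by simp [hC]
  have hCAB : C ≤ A * B := by
    have := abs_add_le p.1 p.2
    have h5 := mul_nonneg (abs_nonneg p.1) (abs_nonneg p.2)
    rw [hA, hB, hC]; nlinarith
  have hden : (A * B * C) / 16 ^ (m + j + 1) ≤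
      ‖(w + lineTwo p.1 + lineTwo p.2) ^ j * (lineTwo p.1 * lineTwo p.2) ^ (m + 1)‖ := by
    rw [norm_mul, norm_pow, norm_pow, norm_mul]
    have h4 : (A * B) / 4 ≤ ‖lineTwo p.1‖ * ‖lineTwo p.2‖ := by
      calc (A * B) / 4 = (A / 2) * (B / 2) := by ring
        _ ≤ _ := by gcongr
    calc (A * B * C) / 16 ^ (m + j + 1) ≤ (C / 2) ^ j * ((A * B) / 4) ^ (m + 1) := by
          rw [div_pow, div_pow, div_mul_div_comm]
          have hAB1 : 1 ≤ A * B := one_le_mul_of_one_le_of_one_le hA1 hB1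
          gcongr ?_ / ?_
          · rcases Nat.eq_zero_or_pos j with rfl | hj
            · have hm : 1 ≤ m := by omega
              calc A * B * C ≤ A * B * (A * B) := by gcongr
                _ = (A * B) ^ 2 := by ring
                _ ≤ (A * B) ^ (m + 1) := pow_le_pow_right₀ hAB1 (by omega)
                _ = C ^ 0 * (A * B) ^ (m + 1) := by simp
            · calc A * B * C = C ^ 1 * (A * B) ^ 1 := by ring
                _ ≤ C ^ j * (A * B) ^ (m + 1) := by
                  exact mul_le_mul (pow_le_pow_right₀ hC1 hj)
                    (pow_le_pow_right₀ hAB1 (by omega)) (by positivity) (by positivity)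
          · calc (2 : ℝ) ^ j * 4 ^ (m + 1) ≤ 16 ^ j * 16 ^ (m + 1) := by gcongr <;> norm_num
              _ = 16 ^ (m + j + 1) := by rw [← pow_add]; congr 1; omega
      _ ≤ _ := by gcongr
  have hpos : 0 < (A * B * C) / 16 ^ (m + j + 1) := by positivity
  rw [modelTerm, norm_mul, norm_div, norm_one, Complex.norm_exp, Complex.add_re, lineTwo_re,
    lineTwo_re, show (2 : ℝ) + 2 = 4 by norm_num, mul_assoc]
  gcongr
  calc 1 / _ ≤ 1 / ((A * B * C) / 16 ^ (m + j + 1)) := one_div_le_one_div_of_le hpos hden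
    _ = 16 ^ (m + j + 1) * (A⁻¹ * B⁻¹ * C⁻¹) := by field_simp
    _ ≤ 16 ^ (m + j + 1) * planeMajorant p := by
        unfold planeMajorant
        rw [← hA, ← hB, ← hC]
        gcongr
        · exact one_add_abs_rpow_ge p.1
        · exact one_add_abs_rpow_ge p.2

/-- Two successive Laplace inversions evaluate the terms with `j = n + 1 ≥ 1`. -/
lemma integral_modelTerm_succ {w : ℂ} (hw : ‖w‖ ≤ 1) (n m : ℕ) :
    ∫ p, modelTerm w (n + 1) m p = (2 * Real.pi) ^ 2 *
      ∫ t in (0 : ℝ)..1, (t : ℂ) ^ n / n.factorial * Complex.exp (-(w * t)) *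
        ((1 - t : ℂ) ^ m / m.factorial) ^ 2 := by
  have hint := integrable_modelTerm hw (j := n + 1) (m := m) (by omega)
  have hwre := (abs_le.mp ((Complex.abs_re_le_norm w).trans hw)).1
  set ψ : ℝ → ℂ := fun t => Complex.exp (-(w * t)) * powKernel n t * powKernel m (1 - t) with hψ
  -- the inner inversion
  have hinner : ∀ᵐ ξ₂ : ℝ, ∫ ξ₁ : ℝ, modelTerm w (n + 1) m (ξ₁, ξ₂) =
      2 * Real.pi * (Complex.exp (lineTwo ξ₂) *
        ((∫ t : ℝ, Complex.exp (-(lineTwo ξ₂ * t)) * ψ t) / lineTwo ξ₂ ^ (m + 1))) := by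
    filter_upwards [hint.prod_left_ae] with ξ₂ hξ₂
    set φ : ℝ → ℂ := fun t => Complex.exp (-((w + lineTwo ξ₂) * t)) * powKernel n t with hφ
    have htr : ∀ ξ₁ : ℝ, ∫ t : ℝ, Complex.exp (-((((2 : ℝ) : ℂ) + ξ₁ * Complex.I) * t)) * φ t =
        1 / (w + lineTwo ξ₁ + lineTwo ξ₂) ^ (n + 1) := by
      intro ξ₁
      rw [← integral_exp_mul_powKernel (σ := w + lineTwo ξ₁ + lineTwo ξ₂)
        (by simp; linarith) n]
      refine integral_congr_ae (Eventually.of_forall fun t => ?_)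
      simp only [hφ]
      rw [← mul_assoc, ← Complex.exp_add]
      congr 2
      unfold lineTwo
      ring
    have hval : ∀ ξ₁ : ℝ, modelTerm w (n + 1) m (ξ₁, ξ₂) =
        (Complex.exp (lineTwo ξ₂) / lineTwo ξ₂ ^ (m + 1)) *
          (Complex.exp ((((2 : ℝ) : ℂ) + ξ₁ * Complex.I) * (1 : ℝ)) *
          ((∫ t : ℝ, Complex.exp (-((((2 : ℝ) : ℂ) + ξ₁ * Complex.I) * t)) * φ t) /
            (((2 : ℝ) : ℂ) + ξ₁ * Complex.I) ^ (m + 1))) := by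
      intro ξ₁
      rw [htr, modelTerm]
      simp only
      rw [Complex.exp_add, show ((2 : ℝ) : ℂ) + ξ₁ * Complex.I = lineTwo ξ₁ from rfl,
        Complex.ofReal_one, mul_one, mul_pow]
      field_simp
    simp_rw [hval]
    rw [integral_const_mul, integral_exp_mul_laplace_div_pow (by norm_num) m]
    · have : ∫ t : ℝ, φ t * powKernel m (1 - t) =
          ∫ t : ℝ, Complex.exp (-(lineTwo ξ₂ * t)) * ψ t := by
        refine integral_congr_ae (Eventually.of_forall fun t => ?_)
        simp only [hφ, hψ]
        rw [← mul_assoc, ← mul_assoc, ← Complex.exp_add]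
        congr 3
        ring
      rw [this]
      ring
    · have := integrable_exp_mul_powKernel (σ := w + lineTwo 0 + lineTwo ξ₂)
        (by simp; linarith) n
      refine this.congr (Eventually.of_forall fun t => ?_)
      simp only [hφ]
      rw [← mul_assoc, ← Complex.exp_add]
      congr 2
      simp [lineTwo]
      ring
    · simp_rw [hval] at hξ₂
      have h2 : Integrable (fun ξ₁ : ℝ => Complex.exp (-(lineTwo ξ₁)) *
          ((lineTwo ξ₂ ^ (m + 1) / Complex.exp (lineTwo ξ₂)) *
          ((Complex.exp (lineTwo ξ₂) / lineTwo ξ₂ ^ (m + 1)) *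
          (Complex.exp ((((2 : ℝ) : ℂ) + ξ₁ * Complex.I) * (1 : ℝ)) *
          ((∫ t : ℝ, Complex.exp (-((((2 : ℝ) : ℂ) + ξ₁ * Complex.I) * t)) * φ t) /
            (((2 : ℝ) : ℂ) + ξ₁ * Complex.I) ^ (m + 1)))))) := by
        refine (hξ₂.const_mul _).bdd_mul (c := Real.exp (-2))
          (by fun_prop : Continuous fun ξ₁ : ℝ => Complex.exp (-(lineTwo ξ₁))).aestronglyMeasurable
          (Eventually.of_forall fun ξ => ?_)
        rw [Complex.norm_exp]; simp
      refine h2.congr (Eventually.of_forall fun ξ₁ => ?_)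
      simp only
      have h0 := pow_ne_zero (m + 1) (lineTwo_ne_zero ξ₂)
      have he := Complex.exp_ne_zero (lineTwo ξ₂)
      rw [← mul_assoc (lineTwo ξ₂ ^ (m + 1) / _), div_mul_div_cancel₀' h0, div_self he, one_mul,
        ← mul_assoc, ← Complex.exp_add]
      simp [lineTwo]
  have hψint : ∀ ξ : ℝ, Integrable (fun t : ℝ => Complex.exp (-(lineTwo ξ * t)) * ψ t) := by
    intro ξ
    have h1 := (integrable_exp_mul_powKernel (σ := w + lineTwo ξ) (by simp; linarith) n)
    have h2 : Integrable (fun t : ℝ => (Set.Ioi (0 : ℝ)).indicator (fun t : ℝ => powKernel m (1 - t)) t *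
        (Complex.exp (-((w + lineTwo ξ) * t)) * powKernel n t)) := by
      refine h1.bdd_mul (c := 1)
        (((measurable_powKernel m).comp (by fun_prop)).indicator
          measurableSet_Ioi).aestronglyMeasurable (Eventually.of_forall fun t => ?_)
      by_cases ht : t ∈ Set.Ioi (0 : ℝ)
      · rw [Set.indicator_of_mem ht]
        have := norm_powKernel_le m (y := 1 - t) (b := 1) (by norm_num)
          (by have := Set.mem_Ioi.mp ht; linarith)
        simpa using this
      · rw [Set.indicator_of_notMem ht]; simp
    refine h2.congr (Eventually.of_forall fun t => ?_)
    simp only [hψ]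
    by_cases ht : t ∈ Set.Ioi (0 : ℝ)
    · rw [Set.indicator_of_mem ht,
        show -((w + lineTwo ξ) * t) = -(lineTwo ξ * t) + -(w * t) by ring, Complex.exp_add]
      ring
    · rw [powKernel_of_nonpos n (not_lt.mp ht)]; simp
  have houter := integral_exp_mul_laplace_div_pow (φ := ψ) (c := 2) (by norm_num) m ?_ ?_ 1
  · rw [Measure.volume_eq_prod, integral_prod_symm _ hint, integral_congr_ae hinner, integral_const_mul]
    have h3 : ∫ ξ₂ : ℝ, Complex.exp (lineTwo ξ₂) *
        ((∫ t : ℝ, Complex.exp (-(lineTwo ξ₂ * t)) * ψ t) / lineTwo ξ₂ ^ (m + 1)) =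
        2 * Real.pi * ∫ t : ℝ, ψ t * powKernel m (1 - t) := by
      rw [← houter]
      simp only [Complex.ofReal_one, mul_one]
      rfl
    rw [h3, ← mul_assoc, ← sq, intervalIntegral.integral_of_le zero_le_one,
      ← integral_indicator measurableSet_Ioc]
    congr 1
    have hne : ∀ᵐ t : ℝ, t ≠ 1 := by rw [ae_iff]; simp
    refine integral_congr_ae ?_
    filter_upwards [hne] with t ht
    simp only [hψ]
    by_cases ht' : t ∈ Set.Ioc (0 : ℝ) 1
    · have hlt : 0 < 1 - t := sub_pos.mpr (lt_of_le_of_ne ht'.2 ht)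
      rw [Set.indicator_of_mem ht', powKernel_of_pos n ht'.1, powKernel_of_pos m hlt]
      push_cast
      ring
    · rw [Set.indicator_of_notMem ht']
      rcases le_or_gt t 0 with h | h
      · rw [powKernel_of_nonpos n h]; simp
      · have : 1 < t := by
          by_contra hcon
          exact ht' ⟨h, not_lt.mp hcon⟩
        rw [powKernel_of_nonpos m (by linarith : 1 - t ≤ 0)]; simp
  · have := hψint 0
    refine this.congr (Eventually.of_forall fun t => ?_)
    simp [lineTwo]
  · have h1 := hint.integral_prod_right
    have h2 := (h1.congr hinner).const_mul ((2 * Real.pi : ℂ)⁻¹)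
    have h3 := h2.bdd_mul (c := Real.exp (-2)) (f := fun ξ₁ : ℝ => Complex.exp (-(lineTwo ξ₁)))
          (by fun_prop : Continuous fun ξ₁ : ℝ => Complex.exp (-(lineTwo ξ₁))).aestronglyMeasurable
          (Eventually.of_forall fun ξ => by rw [Complex.norm_exp]; simp)
    refine h3.congr (Eventually.of_forall fun ξ => ?_)
    simp only
    have hpi : (2 * Real.pi : ℂ) ≠ 0 := by
      exact_mod_cast (by positivity : (2 * Real.pi) ≠ 0)
    rw [inv_mul_cancel_left₀ hpi, ← mul_assoc, ← Complex.exp_add]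
    simp [lineTwo]

/-- For `j = 0` the variables separate, and each integral is an inverse Laplace transform at `1`. -/
lemma integral_modelTerm_zero (w : ℂ) {m : ℕ} (hm : m ≠ 0) :
    ∫ p, modelTerm w 0 m p = (2 * Real.pi / m.factorial) ^ 2 := by
  have h : ∀ p : ℝ × ℝ, modelTerm w 0 m p =
      (Complex.exp (lineTwo p.1) * (1 / lineTwo p.1 ^ (m + 1))) *
      (Complex.exp (lineTwo p.2) * (1 / lineTwo p.2 ^ (m + 1))) := by
    intro p
    rw [modelTerm, Complex.exp_add, mul_pow]
    have h1 := lineTwo_ne_zero p.1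
    have h2 := lineTwo_ne_zero p.2
    field_simp
  simp_rw [h]
  rw [Measure.volume_eq_prod, integral_prod_mul (fun ξ : ℝ => Complex.exp (lineTwo ξ) * (1 / lineTwo ξ ^ (m + 1)))
    (fun ξ : ℝ => Complex.exp (lineTwo ξ) * (1 / lineTwo ξ ^ (m + 1)))]
  have h3 := integral_exp_div_pow_eq (c := 2) (by norm_num) hm 1
  rw [powKernel_of_pos m one_pos] at h3
  simp only [Complex.ofReal_one, mul_one] at h3
  have h4 : ∫ ξ : ℝ, Complex.exp (lineTwo ξ) * (1 / lineTwo ξ ^ (m + 1)) =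
    2 * Real.pi * (1 ^ m / m.factorial) := h3
  rw [h4]
  simp
  ring

/-- The integrand of the double Laplace integral that is the scaling limit of the sieve sum. -/
noncomputable def modelIntegrand (k : ℕ) (w : ℂ) (p : ℝ × ℝ) : ℂ :=
  Complex.exp (lineTwo p.1 + lineTwo p.2) *
    (((lineTwo p.1 + w) * (lineTwo p.2 + w)) ^ k /
      ((w + lineTwo p.1 + lineTwo p.2) ^ k * (lineTwo p.1 * lineTwo p.2) ^ (k + 1)))

/-- The identity `(σ₁ + w) (σ₂ + w) = w (w + σ₁ + σ₂) + σ₁ σ₂` splits the integrand. -/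
lemma modelIntegrand_eq_sum (k : ℕ) {w : ℂ} (hw : ‖w‖ ≤ 1) (p : ℝ × ℝ) :
    modelIntegrand k w p = ∑ j ∈ Finset.range (k + 1),
      (k.choose j : ℂ) * w ^ (k - j) * modelTerm w j (k - j) p := by
  have h1 := lineTwo_ne_zero p.1
  have h2 := lineTwo_ne_zero p.2
  have h3 := add_lineTwo_add_lineTwo_ne_zero hw p.1 p.2
  have h4 : (lineTwo p.1 + w) * (lineTwo p.2 + w) =
      lineTwo p.1 * lineTwo p.2 + w * (w + lineTwo p.1 + lineTwo p.2) := by ring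
  have h12 := mul_ne_zero h1 h2
  rw [modelIntegrand, h4, add_pow, Finset.sum_div, Finset.mul_sum]
  refine Finset.sum_congr rfl fun j hj => ?_
  have hj' : j ≤ k := Nat.lt_succ_iff.mp (Finset.mem_range.mp hj)
  rw [modelTerm]
  set S := w + lineTwo p.1 + lineTwo p.2 with hS
  set P := lineTwo p.1 * lineTwo p.2 with hP
  have e1 : S ^ k = S ^ j * S ^ (k - j) := by rw [← pow_add]; congr 1; omega
  have e2 : P ^ (k + 1) = P ^ j * P ^ (k - j + 1) := by rw [← pow_add]; congr 1; omega
  rw [e1, e2, mul_pow w]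
  field_simp

/-- Summation of the terms `j = 0` and `j = n + 1` of the binomial expansion. -/
lemma integral_modelIntegrand {k : ℕ} (hk : 1 ≤ k) {w : ℂ} (hw : ‖w‖ = 1) :
    ∫ p, modelIntegrand k w p = (2 * Real.pi) ^ 2 * (w ^ k / (k.factorial : ℂ) ^ 2 +
      ∑ n ∈ Finset.range k, (k.choose (n + 1) : ℂ) * w ^ (k - (n + 1)) *
        ∫ t in (0 : ℝ)..1, (t : ℂ) ^ n / n.factorial * Complex.exp (-(w * t)) *
          ((1 - t : ℂ) ^ (k - (n + 1)) / (k - (n + 1)).factorial) ^ 2) := by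
  simp_rw [modelIntegrand_eq_sum k hw.le]
  rw [integral_finsetSum]
  · simp_rw [integral_const_mul]
    rw [Finset.sum_range_succ']
    simp_rw [integral_modelTerm_succ hw.le]
    rw [Nat.sub_zero, integral_modelTerm_zero w (by omega : k ≠ 0), mul_add, Finset.mul_sum,
      add_comm]
    congr 1
    · simp; ring
    · refine Finset.sum_congr rfl fun n _ => ?_
      ring
  · intro j hj
    have : j < k + 1 := Finset.mem_range.mp hj
    exact (integrable_modelTerm hw.le (by omega)).const_mul _

end ModelIntegral

/-! ### Evaluation of the limiting constant -/

section ModelConstant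

open MeasureTheory

/-- The integral `I(u)` for which `γ⁻¹ I(γ⁻¹) = R_k(γ)`. The index `n` is `j - 1`. -/
noncomputable def modelConstant (k : ℕ) (u : ℝ) : ℝ :=
  ∑ n ∈ Finset.range k, (k.choose (n + 1) : ℝ) * ∫ t in (0 : ℝ)..1,
    t ^ n / n.factorial * ((u - t) ^ n / n.factorial) *
      ((1 - t) ^ (k - (n + 1)) / (k - (n + 1)).factorial) ^ 2

lemma circleIntegral_inv_pow_mul_exp {r : ℝ} (hr : 0 < r) (n : ℕ) (a : ℂ) :
    (∮ w in C(0, r), (w ^ (n + 1))⁻¹ * Complex.exp (a * w)) =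
      2 * Real.pi * Complex.I * (a ^ n / n.factorial) := by
  have := (Differentiable.diffContOnCl (f := fun w : ℂ => Complex.exp (a * w))
    (by fun_prop) (s := Metric.ball (0 : ℂ) r)).circleIntegral_one_div_sub_center_pow_smul
    hr n
  rw [iteratedDeriv_cexp_const_mul] at this
  simp only [sub_zero, one_div, smul_eq_mul, mul_zero, Complex.exp_zero, mul_one] at this
  rw [this]
  ring

lemma circleIntegral_exp_mul_eq_zero (u : ℝ) :
    (∮ w in C(0, 1), Complex.exp (w * u)) = 0 :=
  Complex.circleIntegral_eq_zero_of_differentiable_on_off_countable zero_le_one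
    Set.countable_empty (by fun_prop) fun _ _ => by fun_prop

/-- The integrals over the circle and over the unit interval may be exchanged. -/
lemma circleIntegral_intervalIntegral_swap {f : ℂ → ℝ → ℂ}
    (hf : Continuous fun p : ℝ × ℝ => f (circleMap 0 1 p.1) p.2) :
    (∮ w in C(0, 1), ∫ t in (0 : ℝ)..1, f w t) = ∫ t in (0 : ℝ)..1, ∮ w in C(0, 1), f w t := by
  simp only [circleIntegral]
  simp_rw [← intervalIntegral.integral_smul]
  refine intervalIntegral_intervalIntegral_swap ?_
  have hc : Continuous (Function.uncurry fun θ t : ℝ =>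
      deriv (circleMap 0 1) θ • f (circleMap 0 1 θ) t) := by
    have h1 : Continuous fun p : ℝ × ℝ => deriv (circleMap 0 1) p.1 := by
      simp only [deriv_circleMap]
      fun_prop
    exact h1.smul hf
  refine (hc.continuousOn.integrableOn_compact
    (isCompact_Icc.prod isCompact_Icc : IsCompact (Set.Icc 0 (2 * Real.pi) ×ˢ
      Set.Icc (0 : ℝ) 1))).mono_set ?_
  rw [Set.uIoc_of_le (by positivity), Set.uIoc_of_le zero_le_one]
  exact Set.prod_mono Set.Ioc_subset_Icc_self Set.Ioc_subset_Icc_self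

/-- The term with `j = 0` is entire and contributes nothing; each of the others has a pole of order
`n + 1` at the origin, whose residue is a power of `u - t`. -/
lemma circleIntegral_modelIntegrand {k : ℕ} (hk : 1 ≤ k) (u : ℝ) :
    (∮ w in C(0, 1), Complex.exp (w * u) * (w ^ k)⁻¹ * ∫ p, modelIntegrand k w p) =
      (2 * Real.pi) ^ 2 * (2 * Real.pi * Complex.I * modelConstant k u) := by
  set F : ℕ → ℂ → ℝ → ℂ := fun n w t => ((t : ℂ) ^ n / n.factorial *
    ((1 - t : ℂ) ^ (k - (n + 1)) / (k - (n + 1)).factorial) ^ 2) *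
      ((w ^ (n + 1))⁻¹ * Complex.exp ((u - t) * w)) with hF
  have hcirc : ∀ θ : ℝ, circleMap 0 1 θ ≠ 0 := fun θ => circleMap_ne_center one_ne_zero
  have hFcont : ∀ n, Continuous fun p : ℝ × ℝ => F n (circleMap 0 1 p.1) p.2 := by
    intro n
    have h0 : Continuous fun p : ℝ × ℝ => ((circleMap 0 1 p.1) ^ (n + 1))⁻¹ :=
      Continuous.inv₀ (by fun_prop) fun p => pow_ne_zero _ (hcirc p.1)
    simp only [hF]
    fun_prop
  have hFint : ∀ n, (∮ w in C(0, 1), ∫ t in (0 : ℝ)..1, F n w t) =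
      2 * Real.pi * Complex.I * ((∫ t in (0 : ℝ)..1, t ^ n / n.factorial *
      ((u - t) ^ n / n.factorial) *
      ((1 - t) ^ (k - (n + 1)) / (k - (n + 1)).factorial) ^ 2 : ℝ) : ℂ) := by
    intro n
    rw [circleIntegral_intervalIntegral_swap (hFcont n), ← intervalIntegral.integral_ofReal,
      ← intervalIntegral.integral_const_mul]
    refine intervalIntegral.integral_congr fun t _ => ?_
    simp only [hF]
    rw [circleIntegral.integral_const_mul, circleIntegral_inv_pow_mul_exp one_pos]
    push_cast
    ring
  have hFci : ∀ n, CircleIntegrable (fun w => ∫ t in (0 : ℝ)..1, F n w t) 0 1 := by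
    intro n
    refine Continuous.intervalIntegrable ?_ _ _
    exact intervalIntegral.continuous_parametric_intervalIntegral_of_continuous' (hFcont n) 0 1
  -- division by `w ^ k` turns the factor `w ^ (k - (n + 1))` into a pole of order `n + 1`
  have hpt : ∀ w ∈ Metric.sphere (0 : ℂ) 1,
      Complex.exp (w * u) * (w ^ k)⁻¹ * ∫ p, modelIntegrand k w p =
      (2 * Real.pi) ^ 2 * (((k.factorial : ℂ) ^ 2)⁻¹ * Complex.exp (w * u) +
        ∑ n ∈ Finset.range k, (k.choose (n + 1) : ℂ) * ∫ t in (0 : ℝ)..1, F n w t) := by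
    intro w hw
    have hw1 : ‖w‖ = 1 := by simpa using hw
    have hw0 : w ≠ 0 := by rintro rfl; simp at hw1
    rw [integral_modelIntegrand hk hw1, mul_left_comm, mul_add, Finset.mul_sum]
    congr 2
    · field_simp
    · refine Finset.sum_congr rfl fun n hn => ?_
      have hn' : n + 1 ≤ k := Finset.mem_range.mp hn
      have h1 : (w ^ k)⁻¹ * w ^ (k - (n + 1)) = (w ^ (n + 1))⁻¹ := by
        have : w ^ k = w ^ (n + 1) * w ^ (k - (n + 1)) := by rw [← pow_add]; congr 1; omega
        rw [this]
        field_simp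
      calc Complex.exp (w * u) * (w ^ k)⁻¹ * ((k.choose (n + 1) : ℂ) * w ^ (k - (n + 1)) *
          ∫ t in (0 : ℝ)..1, (t : ℂ) ^ n / n.factorial * Complex.exp (-(w * t)) *
          ((1 - t : ℂ) ^ (k - (n + 1)) / (k - (n + 1)).factorial) ^ 2)
          = (k.choose (n + 1) : ℂ) * ((Complex.exp (w * u) * ((w ^ k)⁻¹ * w ^ (k - (n + 1)))) *
          ∫ t in (0 : ℝ)..1, (t : ℂ) ^ n / n.factorial * Complex.exp (-(w * t)) *
          ((1 - t : ℂ) ^ (k - (n + 1)) / (k - (n + 1)).factorial) ^ 2) := by ring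
        _ = _ := by
          rw [h1, ← intervalIntegral.integral_const_mul]
          congr 1
          refine intervalIntegral.integral_congr fun t _ => ?_
          simp only [hF]
          rw [show ((u : ℂ) - t) * w = w * u + -(w * t) by ring, Complex.exp_add]
          ring
  have hexp : CircleIntegrable (fun w => ((k.factorial : ℂ) ^ 2)⁻¹ * Complex.exp (w * u)) 0 1 :=
    (by fun_prop : Continuous fun w : ℂ =>
      ((k.factorial : ℂ) ^ 2)⁻¹ * Complex.exp (w * u)).continuousOn.circleIntegrable zero_le_one
  have hterm : ∀ n ∈ Finset.range k, CircleIntegrable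
      (fun w => (k.choose (n + 1) : ℂ) * ∫ t in (0 : ℝ)..1, F n w t) 0 1 :=
    fun n _ => (hFci n).const_smul (a := (k.choose (n + 1) : ℂ))
  rw [circleIntegral.integral_congr zero_le_one hpt, circleIntegral.integral_const_mul,
    circleIntegral.integral_add hexp (CircleIntegrable.fun_sum _ hterm),
    circleIntegral.integral_const_mul, circleIntegral_exp_mul_eq_zero, mul_zero, zero_add,
    circleIntegral.integral_fun_sum hterm]
  congr 1
  rw [modelConstant, Complex.ofReal_sum, Finset.mul_sum]
  refine Finset.sum_congr rfl fun n _ => ?_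
  rw [circleIntegral.integral_const_mul, hFint]
  push_cast
  ring

lemma integral_pow_mul_one_sub_pow (a b : ℕ) :
    ∫ t in (0 : ℝ)..1, t ^ a * (1 - t) ^ b =
      (a.factorial * b.factorial : ℝ) / (a + b + 1).factorial := by
  have h := Complex.Gamma_mul_Gamma_eq_betaIntegral (s := a + 1) (t := b + 1)
    (by simp; positivity) (by simp; positivity)
  rw [Complex.Gamma_nat_eq_factorial, Complex.Gamma_nat_eq_factorial,
    show (a : ℂ) + 1 + (b + 1) = ((a + b + 1 : ℕ) : ℂ) + 1 by push_cast; ring,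
    Complex.Gamma_nat_eq_factorial, Complex.betaIntegral] at h
  simp only [add_sub_cancel_right, Complex.cpow_natCast] at h
  have h2 : ∫ t in (0 : ℝ)..1, (t : ℂ) ^ a * (1 - (t : ℂ)) ^ b =
      ((∫ t in (0 : ℝ)..1, t ^ a * (1 - t) ^ b : ℝ) : ℂ) := by
    rw [← intervalIntegral.integral_ofReal]
    refine intervalIntegral.integral_congr fun t _ => ?_
    push_cast
    rfl
  rw [h2] at h
  have h3 : ((a + b + 1).factorial : ℝ) ≠ 0 := by exact_mod_cast (a + b + 1).factorial_ne_zero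
  rw [eq_div_iff h3, mul_comm]
  exact_mod_cast h.symm

lemma modelConstant_pos {k : ℕ} (hk : 1 ≤ k) {u : ℝ} (hu : 1 < u) : 0 < modelConstant k u := by
  refine Finset.sum_pos (fun n hn => ?_) (Finset.nonempty_range_iff.mpr (by omega))
  have hn' : n + 1 ≤ k := Finset.mem_range.mp hn
  have hch : 0 < k.choose (n + 1) := Nat.choose_pos hn'
  refine mul_pos (by exact_mod_cast hch) ?_
  refine intervalIntegral.intervalIntegral_pos_of_pos_on
    (Continuous.intervalIntegrable (by fun_prop) _ _) (fun t ht => ?_) one_pos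
  have h1 : 0 < t := ht.1
  have h2 : 0 < 1 - t := by linarith [ht.2]
  have h3 : 0 < u - t := by linarith [ht.2]
  positivity

/-- The polynomial `R_k` is the integral `modelConstant`, evaluated by Euler's beta integral after
the expansion of `(u - t) ^ (j - 1)`. -/
lemma R_eq_inv_mul_modelConstant (k : ℕ) {γ : ℝ} (hγ : γ ≠ 0) :
    R k γ = γ⁻¹ * modelConstant k γ⁻¹ := by
  have hIcc : Finset.Icc 1 k = Finset.Ico 1 (k + 1) := by ext; simp
  rw [R, modelConstant, Finset.mul_sum, hIcc, Finset.sum_Ico_eq_sum_range, Nat.add_sub_cancel]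
  refine Finset.sum_congr rfl fun n hn => ?_
  have hn' : n + 1 ≤ k := Finset.mem_range.mp hn
  obtain ⟨m, rfl⟩ := Nat.exists_eq_add_of_le hn'
  have e1 : n + 1 + m - (n + 1) = m := by omega
  have hI : ∫ t in (0 : ℝ)..1, t ^ n / n.factorial * ((γ⁻¹ - t) ^ n / n.factorial) *
      ((1 - t) ^ m / m.factorial) ^ 2 =
      ∑ i ∈ Finset.range (n + 1), (n.choose i : ℝ) * (-1) ^ i * γ⁻¹ ^ (n - i) /
        ((n.factorial : ℝ) ^ 2 * (m.factorial : ℝ) ^ 2) *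
        (((n + i).factorial * (2 * m).factorial : ℝ) / (n + i + 2 * m + 1).factorial) := by
    simp_rw [← integral_pow_mul_one_sub_pow, ← intervalIntegral.integral_const_mul]
    rw [← intervalIntegral.integral_finsetSum
      (fun i _ => Continuous.intervalIntegrable (by fun_prop) _ _)]
    refine intervalIntegral.integral_congr fun t _ => ?_
    rw [show γ⁻¹ - t = -t + γ⁻¹ by ring, add_pow, Finset.sum_div, Finset.mul_sum, Finset.sum_mul]
    refine Finset.sum_congr rfl fun i _ => ?_
    rw [neg_pow t i, pow_add t n i, mul_comm 2 m, pow_mul]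
    field_simp
  rw [add_comm 1 n, e1, hI, Finset.mul_sum, Finset.mul_sum]
  refine Finset.sum_congr rfl fun i hi => ?_
  have hi' : i ≤ n := Nat.lt_succ_iff.mp (Finset.mem_range.mp hi)
  have e2 : n + 1 - i = n - i + 1 := by omega
  have e3 : 2 * (n + 1 + m) - (n + 1) + i = n + i + 2 * m + 1 := by omega
  have e4 : Real.Gamma (((n + 1 : ℕ) : ℝ) + i) = (n + i).factorial := by
    rw [← Real.Gamma_nat_eq_factorial]; congr 1; push_cast; ring
  have e5 : Real.Gamma ((n + 1 : ℕ) : ℝ) = n.factorial := by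
    rw [← Real.Gamma_nat_eq_factorial]; congr 1; push_cast; ring
  have e6 : ((2 * m).choose m : ℝ) = (2 * m).factorial / ((m.factorial : ℝ) ^ 2) := by
    have h := Nat.add_choose_mul_factorial_mul_factorial m m
    have h' : ((2 * m).choose m : ℝ) * m.factorial * m.factorial = (2 * m).factorial := by
      rw [two_mul]; exact_mod_cast h
    have hm : (m.factorial : ℝ) ≠ 0 := by exact_mod_cast m.factorial_ne_zero
    rw [eq_div_iff (pow_ne_zero _ hm), ← h']
    ring
  rw [e2, e3, e4, e5, e6, Nat.add_sub_cancel, pow_succ γ, inv_pow]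
  have hm : (m.factorial : ℝ) ≠ 0 := by exact_mod_cast m.factorial_ne_zero
  have hnf : (n.factorial : ℝ) ≠ 0 := by exact_mod_cast n.factorial_ne_zero
  field_simp

end ModelConstant

/-! ### Factorisation of the Euler product of the sieve -/

section EulerProduct

lemma exists_one_sub_pow_eq (k : ℕ) :
    ∃ ρ : ℂ → ℂ, Continuous ρ ∧ ∀ x, (1 - x) ^ k = 1 - k * x + x ^ 2 * ρ x := by
  induction k with
  | zero => exact ⟨fun _ => 0, continuous_const, fun x => by simp⟩
  | succ k ih =>
    obtain ⟨ρ, hρ, h⟩ := ih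
    refine ⟨fun x => k + (1 - x) * ρ x, by fun_prop, fun x => ?_⟩
    rw [pow_succ, h]
    push_cast
    ring

/-- The local factor of the sieve sum divided by the local factor of
`ζ(s + s₁ + s₂) ^ k / (ζ(s + s₁) ^ k ζ(s + s₂) ^ k)`, in terms of `q = p ^ (-s)`,
`a = p ^ (-s₁)`, `b = p ^ (-s₂)`. -/
noncomputable def eulerRatio (k : ℕ) (q a b : ℂ) : ℂ :=
  (1 + (1 - (1 - q) ^ k) * (a * b - a - b)) * (1 - q * a * b) ^ k /
    ((1 - q * a) ^ k * (1 - q * b) ^ k)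

lemma one_sub_mul_ne_zero {q a : ℂ} (hq : ‖q‖ < 1) (ha : ‖a‖ ≤ 1) : 1 - q * a ≠ 0 := by
  intro h
  have h1 : ‖q * a‖ < 1 := by
    rw [norm_mul]
    calc ‖q‖ * ‖a‖ ≤ ‖q‖ * 1 := by gcongr
      _ < 1 := by linarith
  rw [← sub_eq_zero.mp h] at h1
  simp at h1

/-- The linear terms in `q` cancel. -/
lemma exists_norm_eulerRatio_sub_one_le (k : ℕ) :
    ∃ C : ℝ, 0 ≤ C ∧ ∀ q a b : ℂ, ‖q‖ ≤ 2 / 3 → ‖a‖ ≤ 1 → ‖b‖ ≤ 1 →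
      ‖eulerRatio k q a b - 1‖ ≤ C * ‖q‖ ^ 2 := by
  obtain ⟨ρ, hρ, h⟩ := exists_one_sub_pow_eq k
  set G : ℂ × ℂ × ℂ → ℂ := fun x =>
    (-((x.2.1 * x.2.2 - x.2.1 - x.2.2) * ρ x.1) + (x.2.1 * x.2.2) ^ 2 * ρ (x.1 * x.2.1 * x.2.2) +
    (x.2.1 * x.2.2 - x.2.1 - x.2.2) * (k - x.1 * ρ x.1) *
      (-(k * x.2.1 * x.2.2) + x.1 * (x.2.1 * x.2.2) ^ 2 * ρ (x.1 * x.2.1 * x.2.2)) -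
    x.2.1 ^ 2 * ρ (x.1 * x.2.1) - x.2.2 ^ 2 * ρ (x.1 * x.2.2) -
    (-(k * x.2.1) + x.1 * x.2.1 ^ 2 * ρ (x.1 * x.2.1)) *
      (-(k * x.2.2) + x.1 * x.2.2 ^ 2 * ρ (x.1 * x.2.2))) with hG
  set K : Set (ℂ × ℂ × ℂ) := Metric.closedBall 0 (2 / 3) ×ˢ
    (Metric.closedBall 0 1 ×ˢ Metric.closedBall 0 1) with hK
  have hKc : IsCompact K := (isCompact_closedBall _ _).prod
    ((isCompact_closedBall _ _).prod (isCompact_closedBall _ _))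
  have hcont : ContinuousOn (fun x : ℂ × ℂ × ℂ =>
      G x / ((1 - x.1 * x.2.1) ^ k * (1 - x.1 * x.2.2) ^ k)) K := by
    refine ContinuousOn.div (by fun_prop) (by fun_prop) fun x hx => ?_
    simp only [hK, Set.mem_prod, mem_closedBall_zero_iff] at hx
    exact mul_ne_zero (pow_ne_zero _ (one_sub_mul_ne_zero (by linarith [hx.1]) hx.2.1))
      (pow_ne_zero _ (one_sub_mul_ne_zero (by linarith [hx.1]) hx.2.2))
  obtain ⟨C, hC⟩ := hKc.exists_bound_of_continuousOn hcont
  refine ⟨C, ?_, fun q a b hq ha hb => ?_⟩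
  · exact (norm_nonneg _).trans (hC (0, 0, 0) (by simp [hK]; norm_num))
  · have hx : (q, a, b) ∈ K := by
      simp only [hK, Set.mem_prod, mem_closedBall_zero_iff]
      exact ⟨hq, ha, hb⟩
    have h1 : (1 - q * a) ^ k ≠ 0 := pow_ne_zero _ (one_sub_mul_ne_zero (by linarith) ha)
    have h2 : (1 - q * b) ^ k ≠ 0 := pow_ne_zero _ (one_sub_mul_ne_zero (by linarith) hb)
    have hkey : eulerRatio k q a b - 1 =
        q ^ 2 * (G (q, a, b) / ((1 - q * a) ^ k * (1 - q * b) ^ k)) := by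
      rw [eulerRatio, div_sub_one (mul_ne_zero h1 h2), ← mul_div_assoc]
      congr 1
      simp only [hG]
      rw [h q, h (q * a * b), h (q * a), h (q * b)]
      ring
    rw [hkey, norm_mul, norm_pow, mul_comm]
    gcongr
    exact hC _ hx

lemma norm_natCast_cpow_neg {p : ℕ} (hp : 0 < p) (s : ℂ) :
    ‖(p : ℂ) ^ (-s)‖ = (p : ℝ) ^ (-s.re) := by
  rw [Complex.norm_natCast_cpow_of_pos hp, Complex.neg_re]

lemma norm_prime_cpow_neg_le_one {p : ℕ} (hp : p.Prime) {s : ℂ} (hs : 0 ≤ s.re) :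
    ‖(p : ℂ) ^ (-s)‖ ≤ 1 := by
  rw [norm_natCast_cpow_neg hp.pos]
  exact Real.rpow_le_one_of_one_le_of_nonpos (by exact_mod_cast hp.one_lt.le) (by linarith)

lemma norm_prime_cpow_neg_le_two_thirds {p : ℕ} (hp : p.Prime) {s : ℂ} (hs : 3 / 4 ≤ s.re) :
    ‖(p : ℂ) ^ (-s)‖ ≤ 2 / 3 := by
  rw [norm_natCast_cpow_neg hp.pos]
  have hp2 : (2 : ℝ) ≤ p := by exact_mod_cast hp.two_le
  calc (p : ℝ) ^ (-s.re) ≤ (p : ℝ) ^ (-(3 / 4) : ℝ) :=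
        Real.rpow_le_rpow_of_exponent_le (by linarith) (by linarith)
    _ ≤ (2 : ℝ) ^ (-(3 / 4) : ℝ) :=
        Real.rpow_le_rpow_of_nonpos (by norm_num) hp2 (by norm_num)
    _ ≤ 2 / 3 := by
        refine le_of_pow_le_pow_left₀ (n := 4) (by norm_num) (by norm_num) ?_
        rw [← Real.rpow_natCast, ← Real.rpow_mul (by norm_num)]
        norm_num

/-- The local error `ε_p` in the factorisation of the sieve sum, extended by zero. -/
noncomputable def eulerError (k : ℕ) (s s₁ s₂ : ℂ) (n : ℕ) : ℂ :=
  if n.Prime then eulerRatio k ((n : ℂ) ^ (-s)) ((n : ℂ) ^ (-s₁)) ((n : ℂ) ^ (-s₂)) - 1 else 0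

/-- The absolutely convergent Euler product left after the zeta factors are removed. -/
noncomputable def eulerCorrection (k : ℕ) (s s₁ s₂ : ℂ) : ℂ :=
  ∏' n, (1 + eulerError k s s₁ s₂ n)

lemma exists_norm_eulerError_le (k : ℕ) :
    ∃ C : ℝ, 0 ≤ C ∧ ∀ s s₁ s₂ : ℂ, 3 / 4 ≤ s.re → 0 ≤ s₁.re → 0 ≤ s₂.re → ∀ n,
      ‖eulerError k s s₁ s₂ n‖ ≤ C * (n : ℝ) ^ (-(3 / 2) : ℝ) := by
  obtain ⟨C, hC0, hC⟩ := exists_norm_eulerRatio_sub_one_le k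
  refine ⟨C, hC0, fun s s₁ s₂ hs h₁ h₂ n => ?_⟩
  rw [eulerError]
  split_ifs with hn
  · refine (hC _ _ _ (norm_prime_cpow_neg_le_two_thirds hn hs) (norm_prime_cpow_neg_le_one hn h₁)
      (norm_prime_cpow_neg_le_one hn h₂)).trans ?_
    gcongr
    rw [norm_natCast_cpow_neg hn.pos, ← Real.rpow_natCast, ← Real.rpow_mul (by positivity)]
    exact Real.rpow_le_rpow_of_exponent_le (by exact_mod_cast hn.one_lt.le) (by push_cast; linarith)
  · rw [norm_zero]; positivity

lemma summable_rpow_neg_three_halves (C : ℝ) :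
    Summable (fun n : ℕ => C * (n : ℝ) ^ (-(3 / 2) : ℝ)) :=
  (Real.summable_nat_rpow.mpr (by norm_num)).mul_left C

lemma prod_primesBelow_eq_prod_range (N : ℕ) (f : ℕ → ℂ) :
    ∏ p ∈ N.primesBelow, (1 + f p) =
      ∏ n ∈ Finset.range N, (1 + if n.Prime then f n else 0) := by
  rw [Nat.primesBelow, Finset.prod_filter]
  refine Finset.prod_congr rfl fun n _ => ?_
  split_ifs <;> simp

lemma tendsto_prod_eulerError {k : ℕ} {s s₁ s₂ : ℂ} (hs : 3 / 4 ≤ s.re) (h₁ : 0 ≤ s₁.re)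
    (h₂ : 0 ≤ s₂.re) :
    Tendsto (fun N : ℕ => ∏ p ∈ N.primesBelow, (1 + eulerError k s s₁ s₂ p)) atTop
      (𝓝 (eulerCorrection k s s₁ s₂)) := by
  obtain ⟨C, -, hC⟩ := exists_norm_eulerError_le k
  have hsum : Summable (fun n => ‖eulerError k s s₁ s₂ n‖) :=
    (summable_rpow_neg_three_halves C).of_nonneg_of_le (fun _ => norm_nonneg _)
      (hC s s₁ s₂ hs h₁ h₂)
  have := (multipliable_one_add_of_summable hsum).hasProd.tendsto_prod_nat
  refine this.congr fun N => ?_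
  rw [prod_primesBelow_eq_prod_range]
  refine Finset.prod_congr rfl fun n _ => ?_
  unfold eulerError
  split_ifs <;> rfl

lemma norm_prod_one_add_le_exp {ι : Type*} (t : Finset ι) (f : ι → ℂ) :
    ‖∏ i ∈ t, (1 + f i)‖ ≤ Real.exp (∑ i ∈ t, ‖f i‖) := by
  rw [norm_prod, Real.exp_sum]
  refine Finset.prod_le_prod (fun _ _ => norm_nonneg _) fun i _ => ?_
  refine (norm_add_le _ _).trans ?_
  rw [norm_one, add_comm]
  exact Real.add_one_le_exp _

/-- The local errors are `O(p ^ (-3 / 2))`, uniformly in the half planes considered. -/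
lemma exists_norm_eulerCorrection_le (k : ℕ) :
    ∃ C : ℝ, 0 ≤ C ∧ ∀ s s₁ s₂ : ℂ, 3 / 4 ≤ s.re → 0 ≤ s₁.re → 0 ≤ s₂.re →
      ‖eulerCorrection k s s₁ s₂‖ ≤ C := by
  obtain ⟨C, hC0, hC⟩ := exists_norm_eulerError_le k
  refine ⟨Real.exp (∑' n : ℕ, C * (n : ℝ) ^ (-(3 / 2) : ℝ)), (Real.exp_pos _).le,
    fun s s₁ s₂ hs h₁ h₂ => ?_⟩
  refine le_of_tendsto (tendsto_prod_eulerError hs h₁ h₂).norm (Eventually.of_forall fun N => ?_)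
  refine (norm_prod_one_add_le_exp _ _).trans (Real.exp_le_exp.mpr ?_)
  calc ∑ p ∈ N.primesBelow, ‖eulerError k s s₁ s₂ p‖
      ≤ ∑ p ∈ N.primesBelow, C * (p : ℝ) ^ (-(3 / 2) : ℝ) :=
        Finset.sum_le_sum fun p _ => hC s s₁ s₂ hs h₁ h₂ p
    _ ≤ _ := (summable_rpow_neg_three_halves C).sum_le_tsum _ fun n _ => by positivity

/-- At `s = 1`, `s₁ = s₂ = 0` every local error vanishes. -/
lemma tendsto_eulerCorrection {α : Type*} {l : Filter α} {s s₁ s₂ : α → ℂ} (k : ℕ)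
    (hs : Tendsto s l (𝓝 1)) (h₁ : Tendsto s₁ l (𝓝 0)) (h₂ : Tendsto s₂ l (𝓝 0))
    (h₁' : ∀ᶠ x in l, 0 ≤ (s₁ x).re) (h₂' : ∀ᶠ x in l, 0 ≤ (s₂ x).re) :
    Tendsto (fun x => eulerCorrection k (s x) (s₁ x) (s₂ x)) l (𝓝 1) := by
  obtain ⟨C, -, hC⟩ := exists_norm_eulerError_le k
  have hs' : ∀ᶠ x in l, 3 / 4 ≤ (s x).re := by
    have := (Complex.continuous_re.tendsto (1 : ℂ)).comp hs
    exact (this.eventually (lt_mem_nhds (by norm_num : (3 / 4 : ℝ) < (1 : ℂ).re))).mono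
      fun x hx => le_of_lt hx
  have := tendsto_tprod_one_add_of_dominated_convergence (𝓕 := l)
    (f := fun x n => eulerError k (s x) (s₁ x) (s₂ x) n) (g := fun _ => 0)
    (summable_rpow_neg_three_halves C) (fun n => ?_) ?_
  · simpa [eulerCorrection] using this
  · unfold eulerError
    split_ifs with hn
    · have hn0 : (n : ℂ) ≠ 0 := by exact_mod_cast hn.ne_zero
      have hc : ∀ {t : α → ℂ} {t₀ : ℂ}, Tendsto t l (𝓝 t₀) →
          Tendsto (fun x => (n : ℂ) ^ (-t x)) l (𝓝 ((n : ℂ) ^ (-t₀))) :=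
        fun ht => ht.neg.const_cpow (Or.inl hn0)
      have hq := hc hs
      have ha := hc h₁
      have hb := hc h₂
      set q : ℂ := (n : ℂ) ^ (-(1 : ℂ)) with hqdef
      rw [neg_zero, Complex.cpow_zero] at ha hb
      have hq1 : ‖q‖ < 1 := by
        have := norm_prime_cpow_neg_le_two_thirds hn (s := 1) (by norm_num)
        linarith
      have h1q : 1 - q ≠ 0 := by simpa using one_sub_mul_ne_zero (a := 1) hq1 (by simp)
      have hlim : Tendsto (fun x => eulerRatio k ((n : ℂ) ^ (-s x)) ((n : ℂ) ^ (-s₁ x))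
          ((n : ℂ) ^ (-s₂ x)) - 1) l (𝓝 (eulerRatio k q 1 1 - 1)) := by
        refine Tendsto.sub_const ?_ 1
        refine Tendsto.div ?_ ?_ ?_
        · exact (((((hq.const_sub 1).pow k).const_sub 1).mul ((ha.mul hb).sub ha |>.sub hb)).const_add
            1).mul ((((hq.mul ha).mul hb).const_sub 1).pow k)
        · exact (((hq.mul ha).const_sub 1).pow k).mul (((hq.mul hb).const_sub 1).pow k)
        · simp only [mul_one]
          exact mul_ne_zero (pow_ne_zero _ h1q) (pow_ne_zero _ h1q)
      have hval : eulerRatio k q 1 1 - 1 = 0 := by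
        have := pow_ne_zero k h1q
        rw [eulerRatio]
        field_simp
        ring
      rwa [hval] at hlim
    · exact tendsto_const_nhds
  · filter_upwards [hs', h₁', h₂'] with x a b c n using hC _ _ _ a b c n

lemma prime_cpow_neg_add {p : ℕ} (hp : p.Prime) (s t : ℂ) :
    (p : ℂ) ^ (-(s + t)) = (p : ℂ) ^ (-s) * (p : ℂ) ^ (-t) := by
  rw [neg_add, Complex.cpow_add _ _ (by exact_mod_cast hp.ne_zero)]

/-- The product of the local factors of the sieve sum converges. -/
lemma tendsto_prod_local_factor {k : ℕ} {s s₁ s₂ : ℂ} (hs : 3 / 4 ≤ s.re) (h₁ : 0 ≤ s₁.re)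
    (h₂ : 0 ≤ s₂.re) (hs₁ : 1 < (s + s₁).re) (hs₂ : 1 < (s + s₂).re) :
    Tendsto (fun N : ℕ => ∏ p ∈ N.primesBelow, (1 + (1 - (1 - (p : ℂ) ^ (-s)) ^ k) *
      ((p : ℂ) ^ (-s₁) * (p : ℂ) ^ (-s₂) - (p : ℂ) ^ (-s₁) - (p : ℂ) ^ (-s₂)))) atTop
      (𝓝 (riemannZeta (s + s₁ + s₂) ^ k * (riemannZeta (s + s₁))⁻¹ ^ k *
        (riemannZeta (s + s₂))⁻¹ ^ k * eulerCorrection k s s₁ s₂)) := by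
  have hs₁₂ : 1 < (s + s₁ + s₂).re := by rw [Complex.add_re]; linarith
  have hz := (riemannZeta_eulerProduct hs₁₂).pow k
  have hz₁ := ((riemannZeta_eulerProduct hs₁).inv₀
    (riemannZeta_ne_zero_of_one_le_re hs₁.le)).pow k
  have hz₂ := ((riemannZeta_eulerProduct hs₂).inv₀
    (riemannZeta_ne_zero_of_one_le_re hs₂.le)).pow k
  refine (((hz.mul hz₁).mul hz₂).mul (tendsto_prod_eulerError (k := k) hs h₁ h₂)).congr fun N => ?_
  simp_rw [← Finset.prod_inv_distrib, ← Finset.prod_pow, ← Finset.prod_mul_distrib]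
  refine Finset.prod_congr rfl fun p hp => ?_
  have hp' : p.Prime := Nat.prime_of_mem_primesBelow hp
  rw [eulerError, if_pos hp', eulerRatio, prime_cpow_neg_add hp', prime_cpow_neg_add hp',
    prime_cpow_neg_add hp']
  set q := (p : ℂ) ^ (-s)
  have hq : ‖q‖ < 1 := by
    have := norm_prime_cpow_neg_le_two_thirds hp' hs
    linarith
  have ha := norm_prime_cpow_neg_le_one hp' h₁
  have hb := norm_prime_cpow_neg_le_one hp' h₂
  set a := (p : ℂ) ^ (-s₁)
  set b := (p : ℂ) ^ (-s₂)
  have n1 := pow_ne_zero k (one_sub_mul_ne_zero hq ha)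
  have n2 := pow_ne_zero k (one_sub_mul_ne_zero hq hb)
  have n3 : (1 - q * a * b) ^ k ≠ 0 := by
    rw [mul_assoc]
    refine pow_ne_zero k (one_sub_mul_ne_zero hq ?_)
    rw [norm_mul]
    exact mul_le_one₀ ha (norm_nonneg _) hb
  rw [inv_inv, inv_inv, add_sub_cancel, inv_pow]
  field_simp

/-- The binomial theorem for the union of two subsets, prime by prime. -/
lemma sum_powerset_sum_powerset_prod_union {ι R : Type*} [DecidableEq ι] [CommRing R]
    (S : Finset ι) (a b h : ι → R) :
    ∑ A ∈ S.powerset, ∑ B ∈ S.powerset, (∏ p ∈ A, a p) * (∏ p ∈ B, b p) * ∏ p ∈ A ∪ B, h p =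
      ∏ p ∈ S, (1 + h p * (a p * b p + a p + b p)) := by
  induction S using Finset.induction_on with
  | empty => simp
  | insert x S hx ih =>
    rw [Finset.sum_powerset_insert hx, Finset.prod_insert hx, ← ih]
    simp_rw [Finset.sum_powerset_insert hx]
    rw [Finset.sum_add_distrib, Finset.sum_add_distrib, Finset.mul_sum]
    simp_rw [Finset.mul_sum]
    rw [← Finset.sum_add_distrib, ← Finset.sum_add_distrib, ← Finset.sum_add_distrib]
    refine Finset.sum_congr rfl fun A hA => ?_
    rw [← Finset.sum_add_distrib, ← Finset.sum_add_distrib, ← Finset.sum_add_distrib]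
    refine Finset.sum_congr rfl fun B hB => ?_
    have hxA : x ∉ A := fun h => hx (Finset.mem_powerset.mp hA h)
    have hxB : x ∉ B := fun h => hx (Finset.mem_powerset.mp hB h)
    have hxAB : x ∉ A ∪ B := by simp [hxA, hxB]
    have e1 : insert x A ∪ insert x B = insert x (A ∪ B) := by
      ext; simp
    rw [e1, Finset.insert_union, Finset.union_insert, Finset.prod_insert hxA,
      Finset.prod_insert hxB, Finset.prod_insert hxAB]
    ring

end EulerProduct

/-! ### The quadratic form of the sieve -/

section SieveForm

open MeasureTheory

/-- The density `1 - (1 - p ^ (-s)) ^ k` of the multiples of the prime `p` among the terms of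
`ζ(s) ^ k`. -/
noncomputable def sieveDensity (k : ℕ) (s : ℂ) (p : ℕ) : ℂ := 1 - (1 - (p : ℂ) ^ (-s)) ^ k

/-- The sieve weight of `d = ∏ A`, divided by `k!`, for a set `A` of primes; here `L = log √D`. -/
noncomputable def sieveCoeff (k : ℕ) (L : ℝ) (A : Finset ℕ) : ℂ :=
  (-1) ^ A.card * powKernel k (1 - Real.log (∏ p ∈ A, (p : ℝ)) / L)

/-- The quadratic form of the sieve, `∑ λ_{d₁} λ_{d₂} h_s([d₁, d₂]) / (k!)²`. The sum over
squarefree numbers is written as a sum over sets of primes below `N`, so that the least common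
multiple becomes a union. -/
noncomputable def sieveForm (k : ℕ) (L : ℝ) (N : ℕ) (s : ℂ) : ℂ :=
  ∑ A ∈ N.primesBelow.powerset, ∑ B ∈ N.primesBelow.powerset,
    sieveCoeff k L A * sieveCoeff k L B * ∏ p ∈ A ∪ B, sieveDensity k s p

/-- Sets of primes whose product exceeds `√D` do not contribute. -/
lemma sieveCoeff_eq_zero {k : ℕ} {L : ℝ} (hL : 0 < L) {A : Finset ℕ} (hA : ∀ p ∈ A, 0 < p) {N p : ℕ}
    (hN : Real.exp L ≤ N) (hp : p ∈ A) (hpN : N ≤ p) : sieveCoeff k L A = 0 := by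
  have h1 : (p : ℝ) ≤ ∏ q ∈ A, (q : ℝ) := by
    have := Nat.le_of_dvd (Finset.prod_pos hA) (Finset.dvd_prod_of_mem (fun q => q) hp)
    rw [← Nat.cast_prod]
    exact Nat.cast_le.mpr this
  have h2 : L ≤ Real.log (∏ q ∈ A, (q : ℝ)) := by
    rw [Real.le_log_iff_exp_le]
    · exact hN.trans ((by exact_mod_cast hpN : (N : ℝ) ≤ p).trans h1)
    · exact Finset.prod_pos fun q hq => by exact_mod_cast hA q hq
  rw [sieveCoeff, powKernel_of_nonpos, mul_zero]
  rw [sub_nonpos, one_le_div hL]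
  exact h2

lemma sieveForm_eq_of_le {k : ℕ} {L : ℝ} (hL : 0 < L) {N N' : ℕ} (hN : Real.exp L ≤ N)
    (hNN' : N ≤ N') (s : ℂ) : sieveForm k L N s = sieveForm k L N' s := by
  have hsub : N.primesBelow.powerset ⊆ N'.primesBelow.powerset :=
    Finset.powerset_mono.mpr (Finset.filter_subset_filter _ (Finset.range_mono hNN'))
  have hz : ∀ A ∈ N'.primesBelow.powerset, A ∉ N.primesBelow.powerset → sieveCoeff k L A = 0 := by
    intro A hA hA'
    rw [Finset.mem_powerset, Finset.not_subset] at hA'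
    obtain ⟨p, hp, hpN⟩ := hA'
    have hpr : ∀ p ∈ A, p.Prime := fun p hp =>
      Nat.prime_of_mem_primesBelow (Finset.mem_powerset.mp hA hp)
    refine sieveCoeff_eq_zero hL (fun q hq => (hpr q hq).pos) hN hp ?_
    by_contra hlt
    exact hpN (Nat.mem_primesBelow.mpr ⟨not_le.mp hlt, hpr p hp⟩)
  unfold sieveForm
  rw [← Finset.sum_subset hsub]
  · refine Finset.sum_congr rfl fun A _ => ?_
    refine Finset.sum_subset hsub fun B hB hB' => ?_
    rw [hz B hB hB']; ring
  · intro A hA hA'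
    refine Finset.sum_eq_zero fun B _ => ?_
    rw [hz A hA hA']; ring

/-- The value of `μ(d) d ^ (-s)` at `d = ∏ A`, for a set `A` of primes, as a product over `A`. -/
noncomputable def signedPow (A : Finset ℕ) (s : ℂ) : ℂ := ∏ p ∈ A, -(p : ℂ) ^ (-s)

lemma continuous_prime_cpow_lineTwo {p : ℕ} (hp : p.Prime) (L : ℝ) :
    Continuous fun ξ : ℝ => (p : ℂ) ^ (-(lineTwo ξ / L)) :=
  Continuous.const_cpow (by fun_prop) (Or.inl (by exact_mod_cast hp.ne_zero))

/-- The sieve weight of `∏ A` depends on `∏ A` through an exponential, which is multiplicative. -/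
lemma exp_mul_eq_signedPow {L : ℝ} {A : Finset ℕ} (hA : ∀ p ∈ A, p.Prime) (σ : ℂ) :
    Complex.exp (σ * ((1 - Real.log (∏ p ∈ A, (p : ℝ)) / L : ℝ) : ℂ)) * (-1) ^ A.card =
      Complex.exp σ * signedPow A (σ / L) := by
  have h1 : ∏ p ∈ A, (p : ℂ) ^ (-(σ / L)) =
      Complex.exp (-(σ * ((Real.log (∏ p ∈ A, (p : ℝ)) / L : ℝ) : ℂ))) := by
    rw [Real.log_prod (fun p hp => by exact_mod_cast (hA p hp).ne_zero), Complex.ofReal_div,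
      Complex.ofReal_sum, Finset.sum_div, Finset.mul_sum, ← Finset.sum_neg_distrib, Complex.exp_sum]
    refine Finset.prod_congr rfl fun p hp => ?_
    rw [Complex.cpow_def_of_ne_zero (by exact_mod_cast (hA p hp).ne_zero), Complex.natCast_log]
    congr 1
    ring
  rw [signedPow, Finset.prod_neg, h1, mul_comm _ ((-1 : ℂ) ^ A.card), mul_left_comm,
    ← Complex.exp_add]
  congr 2
  push_cast
  ring

/-- Perron's formula for the sieve weights. -/
lemma integral_signedPow {k : ℕ} (hk : k ≠ 0) {L : ℝ} {A : Finset ℕ} (hA : ∀ p ∈ A, p.Prime) :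
    ∫ ξ : ℝ, Complex.exp (lineTwo ξ) * signedPow A (lineTwo ξ / L) * (1 / lineTwo ξ ^ (k + 1)) =
      2 * Real.pi * sieveCoeff k L A := by
  have h := integral_exp_div_pow_eq (c := 2) (by norm_num) hk
    (1 - Real.log (∏ p ∈ A, (p : ℝ)) / L)
  rw [sieveCoeff, mul_left_comm, ← h, ← integral_const_mul]
  refine integral_congr_ae (Eventually.of_forall fun ξ => ?_)
  simp only
  rw [← exp_mul_eq_signedPow hA]
  unfold lineTwo
  ring

lemma norm_signedPow_le_one {A : Finset ℕ} (hA : ∀ p ∈ A, p.Prime) {s : ℂ} (hs : 0 ≤ s.re) :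
    ‖signedPow A s‖ ≤ 1 := by
  rw [signedPow, norm_prod]
  refine Finset.prod_le_one (fun _ _ => norm_nonneg _) fun p hp => ?_
  rw [norm_neg]
  exact norm_prime_cpow_neg_le_one (hA p hp) hs

lemma lineTwo_div_re (ξ L : ℝ) : (lineTwo ξ / L).re = 2 / L := by
  rw [Complex.div_ofReal_re, lineTwo_re]

lemma integrable_signedPow {k : ℕ} (hk : k ≠ 0) {L : ℝ} (hL : 0 < L) {A : Finset ℕ}
    (hA : ∀ p ∈ A, p.Prime) :
    Integrable fun ξ : ℝ =>
      Complex.exp (lineTwo ξ) * signedPow A (lineTwo ξ / L) * (1 / lineTwo ξ ^ (k + 1)) := by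
  refine (integrable_one_div_add_mul_I_pow (c := 2) (by norm_num) hk).bdd_mul (c := Real.exp 2)
    (f := fun ξ : ℝ => Complex.exp (lineTwo ξ) * signedPow A (lineTwo ξ / L)) ?_
    (Eventually.of_forall fun ξ => ?_)
  · refine Continuous.aestronglyMeasurable (Continuous.mul (by fun_prop) ?_)
    unfold signedPow
    exact continuous_finsetProd _ fun p hp => (continuous_prime_cpow_lineTwo (hA p hp) L).neg
  · rw [norm_mul, Complex.norm_exp, lineTwo_re]
    have := norm_signedPow_le_one hA (s := lineTwo ξ / L) (by rw [lineTwo_div_re]; positivity)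
    calc Real.exp 2 * _ ≤ Real.exp 2 * 1 := by gcongr
      _ = _ := mul_one _

/-- The local factor of the Euler product of the sieve form after Laplace inversion. -/
noncomputable def localTerm (k : ℕ) (s s₁ s₂ : ℂ) (p : ℕ) : ℂ :=
  (1 - (1 - (p : ℂ) ^ (-s)) ^ k) *
    ((p : ℂ) ^ (-s₁) * (p : ℂ) ^ (-s₂) - (p : ℂ) ^ (-s₁) - (p : ℂ) ^ (-s₂))

/-- Perron's formula for both sieve weights makes the double sum over sets of primes an Euler
product over the primes below `N`. -/
lemma sieveForm_eq_integral {k : ℕ} (hk : k ≠ 0) {L : ℝ} (hL : 0 < L) (N : ℕ) (s : ℂ) :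
    (2 * Real.pi) ^ 2 * sieveForm k L N s =
      ∫ x : ℝ × ℝ, Complex.exp (lineTwo x.1 + lineTwo x.2) *
        (1 / (lineTwo x.1 * lineTwo x.2) ^ (k + 1)) *
        ∏ p ∈ N.primesBelow, (1 + localTerm k s (lineTwo x.1 / L) (lineTwo x.2 / L) p) := by
  have hpr : ∀ {A : Finset ℕ}, A ∈ N.primesBelow.powerset → ∀ p ∈ A, p.Prime := fun hA p hp =>
    Nat.prime_of_mem_primesBelow (Finset.mem_powerset.mp hA hp)
  set φ : Finset ℕ → ℝ → ℂ := fun A ξ =>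
    Complex.exp (lineTwo ξ) * signedPow A (lineTwo ξ / L) * (1 / lineTwo ξ ^ (k + 1)) with hφ
  have hpt : ∀ x : ℝ × ℝ, Complex.exp (lineTwo x.1 + lineTwo x.2) *
        (1 / (lineTwo x.1 * lineTwo x.2) ^ (k + 1)) *
        ∏ p ∈ N.primesBelow, (1 + localTerm k s (lineTwo x.1 / L) (lineTwo x.2 / L) p) =
      ∑ A ∈ N.primesBelow.powerset, ∑ B ∈ N.primesBelow.powerset,
        (∏ p ∈ A ∪ B, sieveDensity k s p) * (φ A x.1 * φ B x.2) := by
    intro x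
    have h := sum_powerset_sum_powerset_prod_union N.primesBelow
      (fun p => -(p : ℂ) ^ (-(lineTwo x.1 / L))) (fun p => -(p : ℂ) ^ (-(lineTwo x.2 / L)))
      (sieveDensity k s)
    have h2 : ∏ p ∈ N.primesBelow, (1 + localTerm k s (lineTwo x.1 / L) (lineTwo x.2 / L) p) =
        ∑ A ∈ N.primesBelow.powerset, ∑ B ∈ N.primesBelow.powerset,
          signedPow A (lineTwo x.1 / L) * signedPow B (lineTwo x.2 / L) *
            ∏ p ∈ A ∪ B, sieveDensity k s p := by
      unfold signedPow
      rw [h]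
      refine Finset.prod_congr rfl fun p _ => ?_
      rw [localTerm, sieveDensity]
      ring
    rw [h2, Finset.mul_sum]
    refine Finset.sum_congr rfl fun A _ => ?_
    rw [Finset.mul_sum]
    refine Finset.sum_congr rfl fun B _ => ?_
    simp only [hφ]
    rw [Complex.exp_add, mul_pow]
    ring
  simp_rw [hpt]
  have hint : ∀ A ∈ N.primesBelow.powerset, ∀ B ∈ N.primesBelow.powerset,
      Integrable fun x : ℝ × ℝ => (∏ p ∈ A ∪ B, sieveDensity k s p) * (φ A x.1 * φ B x.2) :=
    fun A hA B hB => ((integrable_signedPow hk hL (hpr hA)).mul_prod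
      (integrable_signedPow hk hL (hpr hB))).const_mul _
  rw [integral_finsetSum _ fun A hA => integrable_finsetSum _ fun B hB => hint A hA B hB,
    sieveForm, Finset.mul_sum]
  refine Finset.sum_congr rfl fun A hA => ?_
  rw [integral_finsetSum _ fun B hB => hint A hA B hB, Finset.mul_sum]
  refine Finset.sum_congr rfl fun B hB => ?_
  rw [integral_const_mul, Measure.volume_eq_prod, integral_prod_mul (φ A) (φ B)]
  simp only [hφ]
  rw [integral_signedPow hk (hpr hA), integral_signedPow hk (hpr hB)]
  ring

/-- The density of the multiples of `p` is `O(p ^ (-Re s))`. -/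
lemma norm_one_sub_one_sub_pow_le (k : ℕ) {q : ℂ} (hq : ‖q‖ ≤ 1) :
    ‖1 - (1 - q) ^ k‖ ≤ k * 2 ^ k * ‖q‖ := by
  have h : 1 - (1 - q) ^ k = q * ∑ i ∈ Finset.range k, (1 - q) ^ i := by
    rw [← mul_neg_geom_sum, sub_sub_cancel]
  rw [h, norm_mul, mul_comm]
  gcongr
  refine (norm_sum_le _ _).trans ?_
  calc ∑ i ∈ Finset.range k, ‖(1 - q) ^ i‖ ≤ ∑ _i ∈ Finset.range k, (2 : ℝ) ^ k := by
        refine Finset.sum_le_sum fun i hi => ?_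
        rw [norm_pow]
        have h1 : ‖1 - q‖ ≤ 2 := (norm_sub_le _ _).trans (by rw [norm_one]; linarith)
        calc ‖1 - q‖ ^ i ≤ 2 ^ i := by gcongr
          _ ≤ 2 ^ k := pow_le_pow_right₀ (by norm_num) (Finset.mem_range.mp hi).le
    _ = k * 2 ^ k := by simp

/-- For fixed `L` the Euler product on the lines `Re s₁ = Re s₂ = 2 / L` converges absolutely. -/
lemma norm_localTerm_le {k p : ℕ} (hp : p.Prime) {s s₁ s₂ : ℂ} {δ : ℝ} (hs : 0 ≤ s.re)
    (h₁ : 0 ≤ s₁.re) (h₂ : s₂.re = s₁.re) (hδ : 1 + δ ≤ s.re + s₁.re) :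
    ‖localTerm k s s₁ s₂ p‖ ≤ 3 * (k * 2 ^ k) * (p : ℝ) ^ (-(1 + δ)) := by
  have hq := norm_prime_cpow_neg_le_one hp hs
  have ha := norm_prime_cpow_neg_le_one hp h₁
  have hab : ‖(p : ℂ) ^ (-s₂)‖ = ‖(p : ℂ) ^ (-s₁)‖ := by
    rw [norm_natCast_cpow_neg hp.pos, norm_natCast_cpow_neg hp.pos, h₂]
  have hqa : ‖(p : ℂ) ^ (-s)‖ * ‖(p : ℂ) ^ (-s₁)‖ ≤ (p : ℝ) ^ (-(1 + δ)) := by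
    rw [norm_natCast_cpow_neg hp.pos, norm_natCast_cpow_neg hp.pos,
      ← Real.rpow_add (by exact_mod_cast hp.pos)]
    exact Real.rpow_le_rpow_of_exponent_le (by exact_mod_cast hp.one_lt.le) (by linarith)
  rw [localTerm, norm_mul]
  have h3 : ‖(p : ℂ) ^ (-s₁) * (p : ℂ) ^ (-s₂) - (p : ℂ) ^ (-s₁) - (p : ℂ) ^ (-s₂)‖ ≤
      3 * ‖(p : ℂ) ^ (-s₁)‖ := by
    have h4 := norm_sub_le ((p : ℂ) ^ (-s₁) * (p : ℂ) ^ (-s₂) - (p : ℂ) ^ (-s₁)) ((p : ℂ) ^ (-s₂))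
    have h5 := norm_sub_le ((p : ℂ) ^ (-s₁) * (p : ℂ) ^ (-s₂)) ((p : ℂ) ^ (-s₁))
    rw [norm_mul, hab] at h5
    rw [hab] at h4
    have h6 := mul_le_mul_of_nonneg_left ha (norm_nonneg ((p : ℂ) ^ (-s₁)))
    linarith
  calc _ ≤ (k * 2 ^ k * ‖(p : ℂ) ^ (-s)‖) * (3 * ‖(p : ℂ) ^ (-s₁)‖) := by
        gcongr
        exact norm_one_sub_one_sub_pow_le k hq
    _ = 3 * (k * 2 ^ k) * (‖(p : ℂ) ^ (-s)‖ * ‖(p : ℂ) ^ (-s₁)‖) := by ring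
    _ ≤ _ := by gcongr

/-- The integrand of the Laplace representation of the sieve form at `s = 1 + w / L`, with its
Euler product evaluated. -/
noncomputable def sieveIntegrand (k : ℕ) (L : ℝ) (w : ℂ) (x : ℝ × ℝ) : ℂ :=
  Complex.exp (lineTwo x.1 + lineTwo x.2) * (1 / (lineTwo x.1 * lineTwo x.2) ^ (k + 1)) *
    (riemannZeta (1 + (w + lineTwo x.1 + lineTwo x.2) / L) ^ k *
      (riemannZeta (1 + (lineTwo x.1 + w) / L))⁻¹ ^ k *
      (riemannZeta (1 + (lineTwo x.2 + w) / L))⁻¹ ^ k *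
      eulerCorrection k (1 + w / L) (lineTwo x.1 / L) (lineTwo x.2 / L))

lemma continuous_partial_integrand (k : ℕ) (L : ℝ) (s : ℂ) (N : ℕ) :
    Continuous fun x : ℝ × ℝ => Complex.exp (lineTwo x.1 + lineTwo x.2) *
        (1 / (lineTwo x.1 * lineTwo x.2) ^ (k + 1)) *
        ∏ p ∈ N.primesBelow, (1 + localTerm k s (lineTwo x.1 / L) (lineTwo x.2 / L) p) := by
  refine Continuous.mul (Continuous.mul (by fun_prop) (continuous_const.div (by fun_prop)
    fun x => pow_ne_zero _ (mul_ne_zero (lineTwo_ne_zero _) (lineTwo_ne_zero _)))) ?_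
  refine continuous_finsetProd _ fun p hp => ?_
  have hp' := Nat.prime_of_mem_primesBelow hp
  have h := continuous_prime_cpow_lineTwo hp' L
  have h1 : Continuous fun x : ℝ × ℝ => (p : ℂ) ^ (-(lineTwo x.1 / L)) := h.comp continuous_fst
  have h2 : Continuous fun x : ℝ × ℝ => (p : ℂ) ^ (-(lineTwo x.2 / L)) := h.comp continuous_snd
  unfold localTerm
  fun_prop

lemma abs_re_div_le {w : ℂ} (hw : ‖w‖ ≤ 1) {L : ℝ} (hL : 0 < L) :
    -(1 / L) ≤ (w / L).re ∧ (w / L).re ≤ 1 / L := by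
  have h := abs_le.mp ((Complex.abs_re_le_norm w).trans hw)
  rw [Complex.div_ofReal_re, ← neg_div]
  exact ⟨div_le_div_of_nonneg_right h.1 hL.le, div_le_div_of_nonneg_right h.2 hL.le⟩

lemma tendsto_partial_integrand {k : ℕ} {L : ℝ} (hL : 4 ≤ L) {w : ℂ} (hw : ‖w‖ ≤ 1)
    (x : ℝ × ℝ) :
    Tendsto (fun N : ℕ => Complex.exp (lineTwo x.1 + lineTwo x.2) *
        (1 / (lineTwo x.1 * lineTwo x.2) ^ (k + 1)) *
        ∏ p ∈ N.primesBelow, (1 + localTerm k (1 + w / L) (lineTwo x.1 / L) (lineTwo x.2 / L) p))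
      atTop (𝓝 (sieveIntegrand k L w x)) := by
  have hL0 : 0 < L := by linarith
  have hre := (abs_re_div_le hw hL0).1
  have hL4 : 1 / L ≤ 1 / 4 := one_div_le_one_div_of_le (by norm_num) hL
  have hLp : 0 < 1 / L := by positivity
  have h2 : 2 / L = 2 * (1 / L) := by ring
  have h := tendsto_prod_local_factor (k := k) (s := 1 + w / L) (s₁ := lineTwo x.1 / L)
    (s₂ := lineTwo x.2 / L) (by rw [Complex.add_re, Complex.one_re]; linarith)
    (by rw [lineTwo_div_re]; positivity) (by rw [lineTwo_div_re]; positivity)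
    (by rw [Complex.add_re, lineTwo_div_re, Complex.add_re, Complex.one_re]; linarith)
    (by rw [Complex.add_re, lineTwo_div_re, Complex.add_re, Complex.one_re]; linarith)
  have h3 := h.const_mul (Complex.exp (lineTwo x.1 + lineTwo x.2) *
        (1 / (lineTwo x.1 * lineTwo x.2) ^ (k + 1)))
  rw [sieveIntegrand, show (1 : ℂ) + (w + lineTwo x.1 + lineTwo x.2) / L =
    1 + w / L + lineTwo x.1 / L + lineTwo x.2 / L by ring,
    show (1 : ℂ) + (lineTwo x.1 + w) / L = 1 + w / L + lineTwo x.1 / L by ring,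
    show (1 : ℂ) + (lineTwo x.2 + w) / L = 1 + w / L + lineTwo x.2 / L by ring]
  exact h3

lemma aestronglyMeasurable_sieveIntegrand {k : ℕ} {L : ℝ} (hL : 4 ≤ L) {w : ℂ} (hw : ‖w‖ ≤ 1) :
    AEStronglyMeasurable (sieveIntegrand k L w) volume :=
  aestronglyMeasurable_of_tendsto_ae atTop
    (fun N => (continuous_partial_integrand k L (1 + w / L) N).aestronglyMeasurable)
    (Eventually.of_forall fun x => tendsto_partial_integrand hL hw x)

lemma integrable_one_div_lineTwo_mul_pow {k : ℕ} (hk : k ≠ 0) :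
    Integrable fun x : ℝ × ℝ => 1 / (lineTwo x.1 * lineTwo x.2) ^ (k + 1) := by
  have h := integrable_one_div_add_mul_I_pow (c := 2) (by norm_num) hk
  refine (h.mul_prod h).congr (Eventually.of_forall fun x => ?_)
  simp only [lineTwo]
  rw [mul_pow, one_div_mul_one_div]

/-- Letting the range of primes grow replaces the Euler product by zeta values. -/
lemma sieveForm_eq_integral_sieveIntegrand {k : ℕ} (hk : k ≠ 0) {L : ℝ} (hL : 4 ≤ L) {w : ℂ}
    (hw : ‖w‖ ≤ 1) {N : ℕ} (hN : Real.exp L ≤ N) :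
    (2 * Real.pi) ^ 2 * sieveForm k L N (1 + w / L) = ∫ x, sieveIntegrand k L w x := by
  have hL0 : 0 < L := by linarith
  have hre := (abs_re_div_le hw hL0).1
  have hL4 : 1 / L ≤ 1 / 4 := one_div_le_one_div_of_le (by norm_num) hL
  have h2 : 2 / L = 2 * (1 / L) := by ring
  set T : ℝ := ∑' n : ℕ, 3 * (k * 2 ^ k) * (n : ℝ) ^ (-(1 + 1 / L)) with hT
  have hsum : Summable fun n : ℕ => 3 * (k * 2 ^ k) * (n : ℝ) ^ (-(1 + 1 / L)) := by
    refine (Real.summable_nat_rpow.mpr ?_).mul_left _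
    have : 0 < 1 / L := by positivity
    linarith
  have hlim := tendsto_integral_of_dominated_convergence (μ := (volume : Measure (ℝ × ℝ)))
    (F := fun (M : ℕ) (x : ℝ × ℝ) => Complex.exp (lineTwo x.1 + lineTwo x.2) *
        (1 / (lineTwo x.1 * lineTwo x.2) ^ (k + 1)) *
        ∏ p ∈ M.primesBelow, (1 + localTerm k (1 + w / L) (lineTwo x.1 / L) (lineTwo x.2 / L) p))
    (f := sieveIntegrand k L w)
    (bound := fun x => Real.exp 4 * ‖1 / (lineTwo x.1 * lineTwo x.2) ^ (k + 1)‖ * Real.exp T)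
    (fun M => (continuous_partial_integrand k L (1 + w / L) M).aestronglyMeasurable)
    (((integrable_one_div_lineTwo_mul_pow hk).norm.const_mul _).mul_const _)
    (fun M => Eventually.of_forall fun x => ?_)
    (Eventually.of_forall fun x => tendsto_partial_integrand hL hw x)
  · refine tendsto_nhds_unique ?_ hlim
    refine tendsto_const_nhds.congr' ?_
    filter_upwards [eventually_ge_atTop N] with M hM
    rw [sieveForm_eq_of_le hL0 hN hM, sieveForm_eq_integral hk hL0]
  · rw [norm_mul, norm_mul, Complex.norm_exp, Complex.add_re, lineTwo_re, lineTwo_re,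
      show (2 : ℝ) + 2 = 4 by norm_num]
    gcongr
    refine (norm_prod_one_add_le_exp _ _).trans (Real.exp_le_exp.mpr ?_)
    calc _ ≤ ∑ p ∈ M.primesBelow, 3 * (k * 2 ^ k) * (p : ℝ) ^ (-(1 + 1 / L)) := by
          refine Finset.sum_le_sum fun p hp => norm_localTerm_le
            (Nat.prime_of_mem_primesBelow hp) ?_ ?_ ?_ ?_
          · rw [Complex.add_re, Complex.one_re]; linarith
          · rw [lineTwo_div_re]; positivity
          · rw [lineTwo_div_re, lineTwo_div_re]
          · rw [Complex.add_re, Complex.one_re, lineTwo_div_re]; linarith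
      _ ≤ T := hsum.sum_le_tsum _ fun n _ => by positivity

end SieveForm

/-! ### The scaling limit of the sieve form -/

section ScalingLimit

open MeasureTheory

lemma tendsto_div_ofReal_atTop (v : ℂ) :
    Tendsto (fun L : ℝ => v / (L : ℂ)) atTop (𝓝 0) := by
  have h1 := ((Complex.continuous_ofReal.tendsto 0).comp tendsto_inv_atTop_zero).const_mul v
  rw [Complex.ofReal_zero, mul_zero] at h1
  refine h1.congr fun L => ?_
  simp only [Function.comp]
  rw [Complex.ofReal_inv, div_eq_mul_inv]

/-- Near its pole `ζ(1 + v / L)` behaves like `L / v`. -/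
lemma tendsto_inv_mul_riemannZeta {v : ℂ} (hv : v ≠ 0) :
    Tendsto (fun L : ℝ => (L : ℂ)⁻¹ * riemannZeta (1 + v / L)) atTop (𝓝 v⁻¹) := by
  have h0 : Tendsto (fun L : ℝ => 1 + v / (L : ℂ)) atTop (𝓝 1) := by
    simpa using (tendsto_div_ofReal_atTop v).const_add 1
  have h3 := ((differentiable_poleFreeZeta.continuous.tendsto 1).comp h0).mul_const v⁻¹
  rw [poleFreeZeta_one, one_mul] at h3
  refine h3.congr' ?_
  filter_upwards [eventually_gt_atTop 0] with L hL
  have hL0 : (L : ℂ) ≠ 0 := by exact_mod_cast hL.ne'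
  rw [riemannZeta_eq_poleFreeZeta_div (by simpa using ⟨hv, hL.ne'⟩), add_sub_cancel_left]
  simp only [Function.comp]
  field_simp

lemma lineTwo_add_ne_zero {w : ℂ} (hw : ‖w‖ ≤ 1) (ξ : ℝ) : lineTwo ξ + w ≠ 0 := by
  have := le_norm_lineTwo_add hw ξ
  exact norm_pos_iff.mp (by linarith [abs_nonneg ξ])

/-- Each zeta value is replaced by its pole and the correcting Euler product tends to `1`. -/
lemma tendsto_sieveIntegrand (k : ℕ) {w : ℂ} (hw : ‖w‖ ≤ 1) (x : ℝ × ℝ) :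
    Tendsto (fun L : ℝ => (L : ℂ) ^ k * sieveIntegrand k L w x) atTop
      (𝓝 (modelIntegrand k w x)) := by
  have n0 := add_lineTwo_add_lineTwo_ne_zero hw x.1 x.2
  have n1 := lineTwo_add_ne_zero hw x.1
  have n2 := lineTwo_add_ne_zero hw x.2
  have t0 := (tendsto_inv_mul_riemannZeta n0).pow k
  have t1 := ((tendsto_inv_mul_riemannZeta n1).inv₀ (inv_ne_zero n1)).pow k
  have t2 := ((tendsto_inv_mul_riemannZeta n2).inv₀ (inv_ne_zero n2)).pow k
  have hdiv := tendsto_div_ofReal_atTop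
  have hre : ∀ ξ : ℝ, ∀ᶠ L : ℝ in atTop, 0 ≤ (lineTwo ξ / (L : ℂ)).re := by
    intro ξ
    filter_upwards [eventually_gt_atTop 0] with L hL
    rw [lineTwo_div_re]; positivity
  have hs : Tendsto (fun L : ℝ => 1 + w / (L : ℂ)) atTop (𝓝 1) := by
    simpa using (hdiv w).const_add 1
  have tc := tendsto_eulerCorrection k hs (hdiv (lineTwo x.1)) (hdiv (lineTwo x.2)) (hre x.1)
    (hre x.2)
  have hall := (((t0.mul t1).mul t2).mul tc).const_mul (Complex.exp (lineTwo x.1 + lineTwo x.2) *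
    (1 / (lineTwo x.1 * lineTwo x.2) ^ (k + 1)))
  have hval : Complex.exp (lineTwo x.1 + lineTwo x.2) *
      (1 / (lineTwo x.1 * lineTwo x.2) ^ (k + 1)) *
      ((w + lineTwo x.1 + lineTwo x.2)⁻¹ ^ k * (lineTwo x.1 + w)⁻¹⁻¹ ^ k *
        (lineTwo x.2 + w)⁻¹⁻¹ ^ k * 1) = modelIntegrand k w x := by
    have h1 := lineTwo_ne_zero x.1
    have h2 := lineTwo_ne_zero x.2
    rw [modelIntegrand, inv_inv, inv_inv, mul_pow (lineTwo x.1 + w), inv_pow]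
    field_simp
  rw [hval] at hall
  refine hall.congr' ?_
  filter_upwards [eventually_gt_atTop 0] with L hL
  have hL0 : (L : ℂ) ≠ 0 := by exact_mod_cast hL.ne'
  rw [sieveIntegrand]
  simp only [mul_inv, mul_pow, inv_inv, inv_pow]
  field_simp

/-- The bounds for zeta to the right of the line `Re s = 1` give an integrable majorant,
uniformly in `L`. -/
lemma exists_norm_sieveIntegrand_le {k : ℕ} (hk : 1 ≤ k) :
    ∃ C : ℝ, 0 ≤ C ∧ ∀ L : ℝ, 5 ≤ L → ∀ w : ℂ, ‖w‖ ≤ 1 → ∀ x,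
      ‖(L : ℂ) ^ k * sieveIntegrand k L w x‖ ≤ C * planeMajorant x := by
  have hk0 : (0 : ℝ) < k := by exact_mod_cast hk
  have hk1 : (1 : ℝ) ≤ k := by exact_mod_cast hk
  -- with `ε = 1 / (16 k)` the `k`-th powers of the zeta bounds lose at most a power `1/8` of
  -- `1 + |ξ₁|` and `1 + |ξ₂|`, which leaves the exponents `-7/8` of `planeMajorant`
  obtain ⟨C₀, hC₀, hz⟩ := exists_norm_riemannZeta_one_add_bounds (ε := 1 / (16 * k))
    (by positivity) (by rw [div_le_one (by positivity)]; linarith)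
  obtain ⟨C₁, hC₁, hcorr⟩ := exists_norm_eulerCorrection_le k
  set ε : ℝ := 1 / (16 * k) with hε
  have hε0 : 0 < ε := by positivity
  have hε1 : ε ≤ 1 := by rw [hε, div_le_one (by positivity)]; linarith
  refine ⟨Real.exp 4 * 4 ^ (k + 1) * (C₀ ^ 3 * (18 * 4 * 16)) ^ k * C₁, by positivity,
    fun L hL w hw x => ?_⟩
  have hL0 : 0 < L := by linarith
  have hL1 : 1 ≤ L := by linarith
  have hL5 : 1 / L ≤ 1 / 5 := one_div_le_one_div_of_le (by norm_num) hL
  have hLp : 0 < 1 / L := by positivity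
  have hwre := abs_re_div_le hw hL0
  have e2 : 2 / L = 2 * (1 / L) := by ring
  -- the zeta values at the three points
  have hnd : ∀ v : ℂ, ‖v / (L : ℂ)‖ = ‖v‖ / L := by
    intro v; rw [norm_div, Complex.norm_real, Real.norm_of_nonneg hL0.le]
  have h1re : ∀ ξ : ℝ, 0 < ((lineTwo ξ + w) / (L : ℂ)).re ∧
      ((lineTwo ξ + w) / (L : ℂ)).re ≤ 1 := by
    intro ξ
    rw [add_div, Complex.add_re, lineTwo_div_re]
    constructor <;> linarith [hwre.1, hwre.2]
  have h0re : 0 < ((w + lineTwo x.1 + lineTwo x.2) / (L : ℂ)).re ∧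
      ((w + lineTwo x.1 + lineTwo x.2) / (L : ℂ)).re ≤ 1 := by
    rw [add_div, add_div, Complex.add_re, Complex.add_re, lineTwo_div_re, lineTwo_div_re]
    constructor <;> linarith [hwre.1, hwre.2]
  have b0 := (hz _ h0re.1 h0re.2).2
  have b1 := (hz _ (h1re x.1).1 (h1re x.1).2).1
  have b2 := (hz _ (h1re x.2).1 (h1re x.2).2).1
  rw [hnd] at b0 b1 b2
  have l1 := le_norm_lineTwo x.1
  have l2 := le_norm_lineTwo x.2
  have l0 := le_norm_add_lineTwo_add_lineTwo hw x.1 x.2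
  have u1 := norm_lineTwo_add_le hw x.1
  have u2 := norm_lineTwo_add_le hw x.2
  have hX : ‖w + lineTwo x.1 + lineTwo x.2‖ ≤ ‖lineTwo x.1 + w‖ + ‖lineTwo x.2 + w‖ + 1 := by
    have h := norm_sub_le (lineTwo x.1 + w + (lineTwo x.2 + w)) w
    rw [show lineTwo x.1 + w + (lineTwo x.2 + w) - w = w + lineTwo x.1 + lineTwo x.2 by ring] at h
    linarith [norm_add_le (lineTwo x.1 + w) (lineTwo x.2 + w)]
  have p1 : 0 < ‖lineTwo x.1 + w‖ := norm_pos_iff.mpr (lineTwo_add_ne_zero hw x.1)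
  have p2 : 0 < ‖lineTwo x.2 + w‖ := norm_pos_iff.mpr (lineTwo_add_ne_zero hw x.2)
  have p0 : 0 < ‖w + lineTwo x.1 + lineTwo x.2‖ :=
    norm_pos_iff.mpr (add_lineTwo_add_lineTwo_ne_zero hw x.1 x.2)
  set X := ‖w + lineTwo x.1 + lineTwo x.2‖ with hXdef
  set Y₁ := ‖lineTwo x.1 + w‖ with hY₁
  set Y₂ := ‖lineTwo x.2 + w‖ with hY₂
  set A := 1 + |x.1| with hA
  set B := 1 + |x.2| with hB
  set D := 1 + |x.1 + x.2| with hD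
  have hA1 : 1 ≤ A := by simp [hA]
  have hB1 : 1 ≤ B := by simp [hB]
  have hD1 : 1 ≤ D := by simp [hD]
  have hA0 : 0 < A := by linarith
  have hB0 : 0 < B := by linarith
  have hD0 : 0 < D := by linarith
  set P := (1 + Y₁ / L) * (1 + Y₂ / L) with hP
  have hP1 : 1 ≤ P := one_le_mul_of_one_le_of_one_le (by linarith [div_pos p1 hL0])
    (by linarith [div_pos p2 hL0])
  have hPle : P ≤ 16 * (A * B) := by
    have h1 : 1 + Y₁ / L ≤ 4 * A := by linarith [div_le_self p1.le hL1]
    have h2 : 1 + Y₂ / L ≤ 4 * B := by linarith [div_le_self p2.le hL1]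
    calc P ≤ (4 * A) * (4 * B) := by
          rw [hP]; gcongr
      _ = 16 * (A * B) := by ring
  have hXP : 1 + X / L ≤ 2 * P := by
    have h1 : X / L ≤ Y₁ / L + Y₂ / L + 1 := by
      calc X / L ≤ (Y₁ + Y₂ + 1) / L := by gcongr
        _ = Y₁ / L + Y₂ / L + 1 / L := by ring
        _ ≤ _ := by linarith
    have h2 := mul_pos (div_pos p1 hL0) (div_pos p2 hL0)
    have h3 := div_pos p1 hL0
    have h4 := div_pos p2 hL0
    rw [hP]; nlinarith
  -- the product of the three zeta factors, before taking `k`-th powers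
  have hbr : L * (‖riemannZeta (1 + (w + lineTwo x.1 + lineTwo x.2) / L)‖ *
      ‖riemannZeta (1 + (lineTwo x.1 + w) / L)‖⁻¹ *
      ‖riemannZeta (1 + (lineTwo x.2 + w) / L)‖⁻¹) ≤
      (C₀ ^ 3 * (18 * 4 * 16)) * (A * B / D * (A * B) ^ (2 * ε)) := by
    have hY₁p : 0 < 1 + Y₁ / L := by positivity
    have hY₂p : 0 < 1 + Y₂ / L := by positivity
    have hXp : 0 < 1 + X / L := by positivity
    calc _ ≤ L * ((C₀ * ((X / L)⁻¹ * (1 + X / L) ^ (1 + ε))) *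
          (C₀ * (Y₁ / L * (1 + Y₁ / L) ^ (ε - 1))) * (C₀ * (Y₂ / L * (1 + Y₂ / L) ^ (ε - 1)))) := by
          gcongr
      _ = C₀ ^ 3 * (Y₁ * Y₂ / X) * ((1 + X / L) ^ (1 + ε) * P ^ (ε - 1)) := by
          rw [hP, Real.mul_rpow hY₁p.le hY₂p.le]
          field_simp
      _ ≤ C₀ ^ 3 * ((3 * A) * (3 * B) / (D / 2)) * ((2 * P) ^ (1 + ε) * P ^ (ε - 1)) := by
          gcongr
      _ = C₀ ^ 3 * (18 * (A * B / D)) * (2 ^ (1 + ε) * P ^ (2 * ε)) := by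
          rw [Real.mul_rpow (by norm_num) (by linarith), mul_assoc ((2 : ℝ) ^ (1 + ε)),
            ← Real.rpow_add (by linarith)]
          rw [show 1 + ε + (ε - 1) = 2 * ε by ring]
          field_simp
          ring
      _ ≤ C₀ ^ 3 * (18 * (A * B / D)) * (4 * (16 * (A * B) ^ (2 * ε))) := by
          have h1 : (2 : ℝ) ^ (1 + ε) ≤ 4 := by
            calc (2 : ℝ) ^ (1 + ε) ≤ 2 ^ (2 : ℝ) :=
                  Real.rpow_le_rpow_of_exponent_le (by norm_num) (by linarith)
              _ = 4 := by norm_num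
          have h2 : P ^ (2 * ε) ≤ 16 * (A * B) ^ (2 * ε) := by
            calc P ^ (2 * ε) ≤ (16 * (A * B)) ^ (2 * ε) := by gcongr
              _ = 16 ^ (2 * ε) * (A * B) ^ (2 * ε) := Real.mul_rpow (by norm_num) (by positivity)
              _ ≤ 16 ^ (1 : ℝ) * (A * B) ^ (2 * ε) := by
                  gcongr
                  · norm_num
                  · rw [hε]
                    rw [mul_one_div, div_le_one (by positivity)]
                    linarith
              _ = _ := by rw [Real.rpow_one]
          gcongr
      _ = _ := by ring
  have hcor := hcorr (1 + w / L) (lineTwo x.1 / L) (lineTwo x.2 / L)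
    (by rw [Complex.add_re, Complex.one_re]; linarith [hwre.1])
    (by rw [lineTwo_div_re]; positivity) (by rw [lineTwo_div_re]; positivity)
  have hsplit : ‖(L : ℂ) ^ k * sieveIntegrand k L w x‖ = Real.exp 4 *
      (1 / (‖lineTwo x.1‖ * ‖lineTwo x.2‖) ^ (k + 1)) *
      (L * (‖riemannZeta (1 + (w + lineTwo x.1 + lineTwo x.2) / L)‖ *
      ‖riemannZeta (1 + (lineTwo x.1 + w) / L)‖⁻¹ *
      ‖riemannZeta (1 + (lineTwo x.2 + w) / L)‖⁻¹)) ^ k *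
      ‖eulerCorrection k (1 + w / L) (lineTwo x.1 / L) (lineTwo x.2 / L)‖ := by
    rw [sieveIntegrand]
    simp only [norm_mul, norm_pow, norm_inv, norm_div, norm_one, Complex.norm_real,
      Real.norm_of_nonneg hL0.le, Complex.norm_exp, Complex.add_re, lineTwo_re]
    rw [show (2 : ℝ) + 2 = 4 by norm_num]
    ring
  rw [hsplit]
  have hden : (A * B / 4) ^ (k + 1) ≤ (‖lineTwo x.1‖ * ‖lineTwo x.2‖) ^ (k + 1) := by
    gcongr
    calc A * B / 4 = (A / 2) * (B / 2) := by ring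
      _ ≤ _ := by gcongr
  calc _ ≤ Real.exp 4 * (1 / (A * B / 4) ^ (k + 1)) *
        ((C₀ ^ 3 * (18 * 4 * 16)) * (A * B / D * (A * B) ^ (2 * ε))) ^ k * C₁ := by
        gcongr
    _ = Real.exp 4 * 4 ^ (k + 1) * (C₀ ^ 3 * (18 * 4 * 16)) ^ k * C₁ *
        ((A * B)⁻¹ * ((A * B) ^ (2 * ε)) ^ k * (D ^ k)⁻¹) := by
        rw [mul_pow (C₀ ^ 3 * (18 * 4 * 16)), mul_pow (A * B / D), div_pow, div_pow,
          pow_succ (A * B)]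
        field_simp
    _ ≤ Real.exp 4 * 4 ^ (k + 1) * (C₀ ^ 3 * (18 * 4 * 16)) ^ k * C₁ * planeMajorant x := by
        refine mul_le_mul_of_nonneg_left ?_ (by positivity)
        have h1 : (A * B)⁻¹ * ((A * B) ^ (2 * ε)) ^ k = A ^ (-(7 / 8) : ℝ) * B ^ (-(7 / 8) : ℝ) := by
          rw [← Real.rpow_natCast, ← Real.rpow_mul (by positivity), ← Real.rpow_neg_one,
            ← Real.rpow_add (by positivity), ← Real.mul_rpow hA0.le hB0.le]
          congr 1
          rw [hε]
          field_simp
          norm_num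
        have h2 : (D ^ k)⁻¹ ≤ D⁻¹ := inv_anti₀ hD0 (le_self_pow₀ hD1 (by omega))
        rw [h1, planeMajorant, ← hA, ← hB, ← hD]
        gcongr

/-- The scaling limit of the sieve form on the circle of radius `1 / L` about `s = 1`. -/
lemma tendsto_sieveForm {k : ℕ} (hk : 1 ≤ k) {w : ℂ} (hw : ‖w‖ ≤ 1) {N : ℝ → ℕ}
    (hN : ∀ L : ℝ, Real.exp L ≤ N L) :
    Tendsto (fun L : ℝ => (L : ℂ) ^ k * ((2 * Real.pi) ^ 2 * sieveForm k L (N L) (1 + w / L))) atTop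
      (𝓝 (∫ x, modelIntegrand k w x)) := by
  obtain ⟨C, -, hC⟩ := exists_norm_sieveIntegrand_le hk
  have hlim := tendsto_integral_filter_of_dominated_convergence (μ := (volume : Measure (ℝ × ℝ)))
    (l := (atTop : Filter ℝ)) (F := fun L x => (L : ℂ) ^ k * sieveIntegrand k L w x)
    (f := modelIntegrand k w) (fun x => C * planeMajorant x) ?_ ?_
    (integrable_planeMajorant.const_mul C)
    (Eventually.of_forall fun x => tendsto_sieveIntegrand k hw x)
  · refine hlim.congr' ?_
    filter_upwards [eventually_ge_atTop 5] with L hL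
    rw [integral_const_mul,
      sieveForm_eq_integral_sieveIntegrand (by omega) (by linarith) hw (hN L)]
  · filter_upwards [eventually_ge_atTop 5] with L hL
    exact (aestronglyMeasurable_sieveIntegrand (by linarith) hw).const_mul _
  · filter_upwards [eventually_ge_atTop 5] with L hL
    exact Eventually.of_forall fun x => hC L hL w hw x

/-- The majorant that gives the scaling limit also bounds the sieve form uniformly in `L` and `w`. -/
lemma exists_norm_sieveForm_le {k : ℕ} (hk : 1 ≤ k) :
    ∃ C : ℝ, ∀ L : ℝ, 5 ≤ L → ∀ w : ℂ, ‖w‖ ≤ 1 → ∀ N : ℕ, Real.exp L ≤ N →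
      ‖(L : ℂ) ^ k * ((2 * Real.pi) ^ 2 * sieveForm k L N (1 + w / L))‖ ≤ C := by
  obtain ⟨C, -, hC⟩ := exists_norm_sieveIntegrand_le hk
  refine ⟨∫ x, C * planeMajorant x, fun L hL w hw N hN => ?_⟩
  rw [sieveForm_eq_integral_sieveIntegrand (by omega) (by linarith) hw hN, ← integral_const_mul]
  exact norm_integral_le_of_norm_le (integrable_planeMajorant.const_mul C)
    (Eventually.of_forall fun x => hC L hL w hw x)

end ScalingLimit

/-! ### Dirichlet series of divisor functions over multiples -/

section DirichletSeries

open scoped LSeries.notation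

/-- The `k`-fold divisor function, with Dirichlet series `ζ(s) ^ k`. -/
noncomputable def divisorFun (k : ℕ) : ArithmeticFunction ℕ := ArithmeticFunction.zeta ^ k

lemma divisorFun_succ_apply (k n : ℕ) :
    divisorFun (k + 1) n = ∑ x ∈ n.divisorsAntidiagonal, divisorFun k x.1 := by
  rw [divisorFun, pow_succ, ArithmeticFunction.mul_apply]
  refine Finset.sum_congr rfl fun x hx => ?_
  rw [ArithmeticFunction.zeta_apply_ne (Nat.ne_zero_of_mem_divisorsAntidiagonal hx).2, mul_one]
  rfl

lemma isMultiplicative_divisorFun (k : ℕ) : (divisorFun k).IsMultiplicative :=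
  ArithmeticFunction.isMultiplicative_zeta.pow

lemma divisorFun_prime (k : ℕ) {p : ℕ} (hp : p.Prime) : divisorFun k p = k := by
  induction k with
  | zero => simp [divisorFun, ArithmeticFunction.one_apply_ne hp.ne_one]
  | succ k ih =>
    rw [divisorFun_succ_apply, Nat.sum_divisorsAntidiagonal (fun d _ => divisorFun k d),
      hp.sum_divisors, ih, (isMultiplicative_divisorFun k).map_one]

/-- On squarefree `n` the `k`-fold divisor function is `k ^ ω(n)`. -/
lemma divisorFun_squarefree (k : ℕ) {n : ℕ} (hn : Squarefree n) :
    divisorFun k n = k ^ ArithmeticFunction.cardDistinctFactors n := by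
  have h := (isMultiplicative_divisorFun k).map_prod_of_subset_primeFactors n n.primeFactors
    subset_rfl
  rw [Nat.prod_primeFactors_of_squarefree hn] at h
  rw [h, Finset.prod_congr rfl fun p hp => divisorFun_prime k (Nat.prime_of_mem_primeFactors hp),
    Finset.prod_const, ArithmeticFunction.cardDistinctFactors_apply, ← List.card_toFinset]
  rfl

/-- The Dirichlet series of the `k`-fold divisor function, restricted to integers prime to `N`. -/
lemma lSeriesHasSum_trivChar_mul_divisorFun (k : ℕ) {N : ℕ} (hN : N ≠ 0) {s : ℂ}
    (hs : 1 < s.re) :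
    LSeriesHasSum (fun n : ℕ => (1 : DirichletCharacter ℂ N) n * (divisorFun k n : ℂ)) s
      (((∏ p ∈ N.primeFactors, (1 - (p : ℂ) ^ (-s))) * riemannZeta s) ^ k) := by
  have : NeZero N := ⟨hN⟩
  set χ : DirichletCharacter ℂ N := 1 with hχ
  have hχs : LSeriesHasSum (χ ·) s
      ((∏ p ∈ N.primeFactors, (1 - (p : ℂ) ^ (-s))) * riemannZeta s) := by
    rw [LSeriesHasSum_iff]
    refine ⟨DirichletCharacter.LSeriesSummable_of_one_lt_re χ hs, ?_⟩
    rw [← DirichletCharacter.LFunctionTrivChar_eq_mul_riemannZeta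
      (by rintro rfl; simp at hs), ← DirichletCharacter.LFunction_eq_LSeries χ hs]
  induction k with
  | zero =>
    have h1 : (fun n : ℕ => χ n * (divisorFun 0 n : ℂ)) = LSeries.delta := by
      ext n
      rcases eq_or_ne n 1 with rfl | hn
      · simp [divisorFun, LSeries.delta]
      · simp [divisorFun, LSeries.delta, hn, ArithmeticFunction.one_apply_ne hn]
    rw [h1, pow_zero, LSeriesHasSum]
    have h2 : LSeries.term LSeries.delta s = fun n => if n = 1 then 1 else 0 :=
      funext fun n => LSeries.term_delta s n
    rw [h2]
    exact hasSum_ite_eq 1 1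
  | succ k ih =>
    have h1 : (fun n : ℕ => χ n * (divisorFun (k + 1) n : ℂ)) =
        LSeries.convolution (fun n : ℕ => χ n * (divisorFun k n : ℂ)) (fun n : ℕ => χ n) := by
      have h2 := χ.mul_convolution_distrib (fun n => (divisorFun k n : ℂ)) 1
      rw [mul_one] at h2
      refine Eq.trans ?_ h2.symm
      ext n
      rw [Pi.mul_apply, LSeries.convolution_def, divisorFun_succ_apply]
      push_cast
      simp
    rw [h1, pow_succ]
    exact ih.convolution hχs

lemma trivChar_prod_apply {E : Finset ℕ} (hE : ∀ p ∈ E, p.Prime) (n : ℕ) :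
    (1 : DirichletCharacter ℂ (∏ p ∈ E, p)) n = ∏ p ∈ E, if p ∣ n then (0 : ℂ) else 1 := by
  by_cases h : Nat.Coprime n (∏ p ∈ E, p)
  · rw [MulChar.one_apply ((ZMod.isUnit_iff_coprime _ _).mpr h)]
    symm
    refine Finset.prod_eq_one fun p hp => if_neg fun hdvd => ?_
    have h1 := Nat.Coprime.coprime_dvd_left hdvd h
    exact ((hE p hp).coprime_iff_not_dvd.mp h1) (Finset.dvd_prod_of_mem _ hp)
  · rw [MulChar.map_nonunit _ (mt (ZMod.isUnit_iff_coprime _ _).mp h)]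
    rw [Nat.coprime_prod_right_iff] at h
    push Not at h
    obtain ⟨p, hp, hpn⟩ := h
    have hpn' : ¬ Nat.Coprime p n := fun h => hpn h.symm
    rw [(hE p hp).coprime_iff_not_dvd, not_not] at hpn'
    exact (Finset.prod_eq_zero (f := fun p => if p ∣ n then (0 : ℂ) else 1) hp (if_pos hpn')).symm

lemma lSeriesHasSum_coprime_mul_divisorFun (k : ℕ) {E : Finset ℕ} (hE : ∀ p ∈ E, p.Prime) {s : ℂ}
    (hs : 1 < s.re) :
    LSeriesHasSum (fun n : ℕ => (∏ p ∈ E, if p ∣ n then (0 : ℂ) else 1) * (divisorFun k n : ℂ)) s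
      (((∏ p ∈ E, (1 - (p : ℂ) ^ (-s))) * riemannZeta s) ^ k) := by
  have h := lSeriesHasSum_trivChar_mul_divisorFun k (N := ∏ p ∈ E, p)
    (Finset.prod_ne_zero_iff.mpr fun p hp => (hE p hp).ne_zero) hs
  rw [Nat.primeFactors_prod hE] at h
  refine Eq.mp ?_ h
  congr 1
  ext n
  rw [trivChar_prod_apply hE]

/-- Inclusion–exclusion over the primes in `E` that do not divide `n`. -/
lemma indicator_dvd_eq_sum {E : Finset ℕ} (hE : ∀ p ∈ E, p.Prime) (n : ℕ) :
    (if ∏ p ∈ E, p ∣ n then (1 : ℂ) else 0) = ∑ F ∈ E.powerset, (-1) ^ F.card *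
      ∏ p ∈ F, if p ∣ n then (0 : ℂ) else 1 := by
  have h1 : (if ∏ p ∈ E, p ∣ n then (1 : ℂ) else 0) =
      ∏ p ∈ E, (1 + -(if p ∣ n then (0 : ℂ) else 1)) := by
    by_cases h : ∏ p ∈ E, p ∣ n
    · rw [if_pos h]
      symm
      refine Finset.prod_eq_one fun p hp => ?_
      rw [if_pos ((Finset.dvd_prod_of_mem (fun q => q) hp).trans h)]
      simp
    · rw [if_neg h]
      have : ∃ p ∈ E, ¬ p ∣ n := by
        by_contra hcon
        push Not at hcon
        exact h (Finset.prod_primes_dvd n (fun p hp => (hE p hp).prime) hcon)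
      obtain ⟨p, hp, hpn⟩ := this
      refine (Finset.prod_eq_zero hp ?_).symm
      rw [if_neg hpn]; simp
  rw [h1, Finset.prod_one_add]
  refine Finset.sum_congr rfl fun F hF => ?_
  rw [Finset.prod_neg]

/-- The Dirichlet series of the `k`-fold divisor function over the multiples of a squarefree
number, by inclusion and exclusion from the series over integers prime to its divisors. -/
lemma lSeriesHasSum_divisorFun_multiples (k : ℕ) {E : Finset ℕ} (hE : ∀ p ∈ E, p.Prime) {s : ℂ}
    (hs : 1 < s.re) :
    LSeriesHasSum (fun n => (if ∏ p ∈ E, p ∣ n then (1 : ℂ) else 0) * divisorFun k n) s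
      (riemannZeta s ^ k * ∏ p ∈ E, sieveDensity k s p) := by
  have h := hasSum_sum (s := E.powerset) fun F hF =>
    (lSeriesHasSum_coprime_mul_divisorFun k
      (fun p hp => hE p (Finset.mem_powerset.mp hF hp)) hs).mul_left ((-1 : ℂ) ^ F.card)
  have hval : ∑ F ∈ E.powerset, (-1 : ℂ) ^ F.card *
      ((∏ p ∈ F, (1 - (p : ℂ) ^ (-s))) * riemannZeta s) ^ k =
      riemannZeta s ^ k * ∏ p ∈ E, sieveDensity k s p := by
    have h1 : ∏ p ∈ E, sieveDensity k s p = ∏ p ∈ E, (1 + -((1 - (p : ℂ) ^ (-s)) ^ k)) :=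
      Finset.prod_congr rfl fun p _ => by rw [sieveDensity, sub_eq_add_neg]
    rw [h1, Finset.prod_one_add, Finset.mul_sum]
    refine Finset.sum_congr rfl fun F hF => ?_
    rw [Finset.prod_neg, mul_pow, Finset.prod_pow]
    ring
  rw [hval] at h
  refine h.congr_fun fun n => ?_
  rcases eq_or_ne n 0 with rfl | hn
  · simp
  · simp only [LSeries.term_of_ne_zero hn]
    rw [indicator_dvd_eq_sum hE, Finset.sum_mul, Finset.sum_div]
    refine Finset.sum_congr rfl fun F _ => ?_
    ring

end DirichletSeries

/-! ### The residue theorem in a vertical strip -/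

section ContourShift

open MeasureTheory

/-- Decay like `|Im s|⁻²` in the vertical strip `a ≤ Re s ≤ b`. -/
def QuadraticDecay (a b : ℝ) (u : ℂ → ℂ) : Prop :=
  ∃ C : ℝ, 0 ≤ C ∧ ∀ s : ℂ, a ≤ s.re → s.re ≤ b → ‖u s‖ ≤ C * ((1 + |s.im|) ^ 2)⁻¹

lemma integrable_one_add_abs_sq_inv : Integrable fun ξ : ℝ => ((1 + |ξ|) ^ 2)⁻¹ := by
  refine integrable_inv_one_add_sq.mono' (by fun_prop : Measurable fun ξ : ℝ =>
    ((1 + |ξ|) ^ 2)⁻¹).aestronglyMeasurable (Eventually.of_forall fun ξ => ?_)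
  rw [Real.norm_of_nonneg (by positivity)]
  refine inv_anti₀ (by positivity) ?_
  nlinarith [abs_nonneg ξ, sq_abs ξ]

/-- The vertical line must avoid the pole at the origin. -/
lemma QuadraticDecay.integrable {a b : ℝ} {u : ℂ → ℂ} (h : QuadraticDecay a b u)
    (hu : Differentiable ℂ u) {c : ℝ} (hac : a ≤ c) (hcb : c ≤ b) (hc : c ≠ 0) (m : ℕ) :
    Integrable fun ξ : ℝ => u (c + ξ * Complex.I) / (c + ξ * Complex.I) ^ m := by
  obtain ⟨C, hC0, hC⟩ := h
  have hne : ∀ ξ : ℝ, (c : ℂ) + ξ * Complex.I ≠ 0 := by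
    intro ξ h0
    have := congrArg Complex.re h0
    simp at this
    exact hc this
  have hcont : Continuous fun ξ : ℝ => u (c + ξ * Complex.I) / (c + ξ * Complex.I) ^ m :=
    (hu.continuous.comp (by fun_prop)).div (by fun_prop) fun ξ => pow_ne_zero _ (hne ξ)
  refine (integrable_one_add_abs_sq_inv.const_mul (C * (|c| ^ m)⁻¹)).mono'
    hcont.aestronglyMeasurable (Eventually.of_forall fun ξ => ?_)
  have h1 := hC (c + ξ * Complex.I) (by simpa using hac) (by simpa using hcb)
  have h2 : |c| ≤ ‖(c : ℂ) + ξ * Complex.I‖ := by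
    have := Complex.abs_re_le_norm ((c : ℂ) + ξ * Complex.I)
    simpa using this
  have h3 : 0 < |c| := abs_pos.mpr hc
  simp only [Complex.add_im, Complex.ofReal_im, Complex.mul_im, Complex.ofReal_re, Complex.I_im,
    mul_one, Complex.I_re, mul_zero, add_zero, zero_add] at h1
  rw [norm_div, norm_pow, div_eq_mul_inv]
  calc _ ≤ (C * ((1 + |ξ|) ^ 2)⁻¹) * (|c| ^ m)⁻¹ := by gcongr
    _ = _ := by ring

/-- Cauchy's theorem for an infinite strip. -/
lemma integral_vertical_eq {a b : ℝ} (hab : a ≤ b) (ha : a ≠ 0) (hb : b ≠ 0) {u : ℂ → ℂ}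
    (hu : Differentiable ℂ u) (h : QuadraticDecay a b u) :
    ∫ ξ : ℝ, u (b + ξ * Complex.I) = ∫ ξ : ℝ, u (a + ξ * Complex.I) := by
  have hia : Integrable fun ξ : ℝ => u (a + ξ * Complex.I) := by
    simpa using h.integrable hu le_rfl hab ha 0
  have hib : Integrable fun ξ : ℝ => u (b + ξ * Complex.I) := by
    simpa using h.integrable hu hab le_rfl hb 0
  obtain ⟨C, hC0, hC⟩ := h
  have hhor : ∀ σ : ℝ, |σ| = 1 →
      Tendsto (fun T : ℝ => ∫ x in a..b, u (x + (σ * T : ℝ) * Complex.I)) atTop (𝓝 0) := by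
    intro σ hσ
    have hz : Tendsto (fun T : ℝ => C * (T⁻¹) * |b - a|) atTop (𝓝 0) := by
      simpa using (tendsto_inv_atTop_zero.const_mul C).mul_const |b - a|
    refine squeeze_zero_norm' ?_ hz
    filter_upwards [eventually_ge_atTop 1] with T hT
    refine intervalIntegral.norm_integral_le_of_norm_le_const fun x hx => ?_
    rw [Set.uIoc_of_le hab] at hx
    refine (hC _ (by simpa using hx.1.le) (by simpa using hx.2)).trans ?_
    have him : ((x : ℂ) + (σ * T : ℝ) * Complex.I).im = σ * T := by simp
    rw [him, abs_mul, hσ, one_mul, abs_of_pos (by linarith)]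
    gcongr
    nlinarith
  have hrect : ∀ T : ℝ, (∫ x in a..b, u (x + ((-1) * T : ℝ) * Complex.I)) -
      (∫ x in a..b, u (x + (1 * T : ℝ) * Complex.I)) +
      Complex.I • (∫ y in (-T)..T, u (b + y * Complex.I)) -
      Complex.I • (∫ y in (-T)..T, u (a + y * Complex.I)) = 0 := by
    intro T
    have := Complex.integral_boundary_rect_eq_zero_of_differentiableOn u ⟨a, -T⟩ ⟨b, T⟩
      hu.differentiableOn
    simpa using this
  have hlim := (((hhor (-1) (by simp)).sub (hhor 1 (by simp))).add
    ((intervalIntegral_tendsto_integral hib tendsto_neg_atTop_atBot tendsto_id).const_smul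
      Complex.I)).sub
    ((intervalIntegral_tendsto_integral hia tendsto_neg_atTop_atBot tendsto_id).const_smul
      Complex.I)
  have h0 := tendsto_nhds_unique (hlim.congr fun T => hrect T) tendsto_const_nhds
  rw [sub_self, zero_add, ← smul_sub, smul_eq_zero] at h0
  exact sub_eq_zero.mp (h0.resolve_left Complex.I_ne_zero)

/-- The entire function `(exp s - 1) / s`, with the value `1` at the origin. -/
noncomputable def expSlope : ℂ → ℂ := dslope Complex.exp 0

lemma expSlope_zero : expSlope 0 = 1 := by
  rw [expSlope, dslope_same, Complex.deriv_exp, Complex.exp_zero]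

lemma expSlope_of_ne {s : ℂ} (hs : s ≠ 0) : expSlope s = (Complex.exp s - 1) / s := by
  rw [expSlope, dslope_of_ne _ hs, slope_def_field, Complex.exp_zero, sub_zero]

lemma differentiable_dslope {f : ℂ → ℂ} (hf : Differentiable ℂ f) :
    Differentiable ℂ (dslope f 0) := by
  rw [← differentiableOn_univ, Complex.differentiableOn_dslope univ_mem]
  exact hf.differentiableOn

lemma differentiable_expSlope : Differentiable ℂ expSlope :=
  differentiable_dslope Complex.differentiable_exp

lemma mul_dslope_eq {f : ℂ → ℂ} (hf : f 0 = 0) (s : ℂ) : s * dslope f 0 s = f s := by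
  have := sub_smul_dslope f 0 s
  simpa [hf] using this

/-- Division of an entire function by `s` at a zero improves its decay. -/
lemma quadraticDecay_dslope {a b : ℝ} {f : ℂ → ℂ} (hf : Differentiable ℂ f) (hf0 : f 0 = 0)
    {C : ℝ} (hC : ∀ s : ℂ, a ≤ s.re → s.re ≤ b → 1 ≤ |s.im| → ‖f s‖ ≤ C * (1 + |s.im|)⁻¹) :
    QuadraticDecay a b (dslope f 0) := by
  have hK : IsCompact (Set.Icc a b ×ℂ Set.Icc (-1) 1) := isCompact_Icc.reProdIm isCompact_Icc
  obtain ⟨M, hM⟩ := hK.exists_bound_of_continuousOn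
    (differentiable_dslope hf).continuous.continuousOn
  refine ⟨max (4 * M) (2 * max C 0), le_max_of_le_right (by positivity), fun s hsa hsb => ?_⟩
  rcases le_or_gt |s.im| 1 with him | him
  · have h1 := hM s ⟨⟨hsa, hsb⟩, abs_le.mp him⟩
    have hM0 : 0 ≤ M := (norm_nonneg _).trans h1
    have h2 : 1 / 4 ≤ ((1 + |s.im|) ^ 2)⁻¹ := by
      rw [one_div]
      refine inv_anti₀ (by positivity) ?_
      nlinarith [abs_nonneg s.im]
    calc _ ≤ M := h1
      _ = (4 * M) * (1 / 4) := by ring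
      _ ≤ _ := by gcongr; exact le_max_left _ _
  · have hs0 : s ≠ 0 := by rintro rfl; simp at him; linarith
    have h1 := hC s hsa hsb him.le
    have h2 : (1 + |s.im|) / 2 ≤ ‖s‖ := by linarith [Complex.abs_im_le_norm s]
    have h3 : dslope f 0 s = f s / s := by
      rw [eq_div_iff hs0, mul_comm, mul_dslope_eq hf0]
    rw [h3, norm_div]
    calc ‖f s‖ / ‖s‖ ≤ (max C 0 * (1 + |s.im|)⁻¹) / ((1 + |s.im|) / 2) := by
          have : C * (1 + |s.im|)⁻¹ ≤ max C 0 * (1 + |s.im|)⁻¹ := by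
            gcongr; exact le_max_left _ _
          gcongr
          exact h1.trans this
      _ = (2 * max C 0) * ((1 + |s.im|) ^ 2)⁻¹ := by field_simp
      _ ≤ _ := by gcongr; exact le_max_right _ _

/-- To the right of the pole, the numerator `exp s - 1` is split and each part evaluated by Laplace
inversion, at the points `1` and `0`. -/
lemma integral_expSlope_div_pow_of_pos {c : ℝ} (hc : 0 < c) (m : ℕ) :
    ∫ ξ : ℝ, expSlope (c + ξ * Complex.I) / (c + ξ * Complex.I) ^ (m + 1) =
      2 * Real.pi * (1 / (m + 1).factorial) := by
  have hne : ∀ ξ : ℝ, (c : ℂ) + ξ * Complex.I ≠ 0 := by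
    intro ξ h0
    have := congrArg Complex.re h0
    simp at this
    exact hc.ne' this
  have h1 := integral_exp_div_pow_eq hc m.succ_ne_zero 1
  have h0 := integral_exp_div_pow_eq hc m.succ_ne_zero 0
  rw [powKernel_of_pos _ one_pos] at h1
  rw [powKernel_of_nonpos _ le_rfl, mul_zero] at h0
  have hi : ∀ x : ℝ, Integrable fun ξ : ℝ => Complex.exp ((c + ξ * Complex.I) * x) *
      (1 / (c + ξ * Complex.I) ^ (m.succ + 1)) := by
    intro x
    refine (integrable_one_div_add_mul_I_pow hc m.succ_ne_zero).bdd_mul (c := Real.exp (c * x))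
      (by fun_prop : Continuous fun ξ : ℝ =>
        Complex.exp ((c + ξ * Complex.I) * x)).aestronglyMeasurable
      (Eventually.of_forall fun ξ => ?_)
    rw [Complex.norm_exp]
    simp
  have h2 := integral_sub (hi 1) (hi 0)
  rw [h1, h0, sub_zero] at h2
  rw [← show 2 * (Real.pi : ℂ) * (((1 : ℝ) : ℂ) ^ m.succ / (m.succ.factorial : ℂ)) =
    2 * Real.pi * (1 / (m + 1).factorial) by simp, ← h2]
  refine integral_congr_ae (Eventually.of_forall fun ξ => ?_)
  simp only
  have := hne ξ
  rw [expSlope_of_ne this]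
  simp only [Complex.ofReal_one, mul_one, Complex.ofReal_zero, mul_zero, Complex.exp_zero,
    Nat.succ_eq_add_one]
  field_simp
  ring

/-- To the left of the pole the reflection `s ↦ -s` leads to Laplace inversion at `-1` and `0`, where
the kernel vanishes. -/
lemma integral_expSlope_div_pow_of_neg {c : ℝ} (hc : c < 0) (m : ℕ) :
    ∫ ξ : ℝ, expSlope (c + ξ * Complex.I) / (c + ξ * Complex.I) ^ (m + 1) = 0 := by
  have hc' : 0 < -c := by linarith
  have hne : ∀ ξ : ℝ, ((-c : ℝ) : ℂ) + ξ * Complex.I ≠ 0 := by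
    intro ξ h0
    have := congrArg Complex.re h0
    simp at this
    exact hc.ne this
  have h1 := integral_exp_div_pow_eq hc' m.succ_ne_zero (-1)
  have h0 := integral_exp_div_pow_eq hc' m.succ_ne_zero 0
  rw [powKernel_of_nonpos _ (by norm_num), mul_zero] at h1
  rw [powKernel_of_nonpos _ le_rfl, mul_zero] at h0
  have hi : ∀ x : ℝ, Integrable fun ξ : ℝ => Complex.exp (((-c : ℝ) + ξ * Complex.I) * x) *
      (1 / ((-c : ℝ) + ξ * Complex.I) ^ (m.succ + 1)) := by
    intro x
    refine (integrable_one_div_add_mul_I_pow hc' m.succ_ne_zero).bdd_mul (c := Real.exp (-c * x))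
      (by fun_prop : Continuous fun ξ : ℝ =>
        Complex.exp (((-c : ℝ) + ξ * Complex.I) * x)).aestronglyMeasurable
      (Eventually.of_forall fun ξ => ?_)
    rw [Complex.norm_exp]
    simp
  have h2 := integral_sub (hi (-1)) (hi 0)
  rw [h1, h0, sub_zero] at h2
  rw [← integral_neg_eq_self]
  have h3 : ∀ ξ : ℝ, expSlope (c + ((-ξ : ℝ) : ℂ) * Complex.I) /
      (c + ((-ξ : ℝ) : ℂ) * Complex.I) ^ (m + 1) =
      (-1) ^ (m + 2) * (Complex.exp (((-c : ℝ) + ξ * Complex.I) * (-1 : ℝ)) *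
        (1 / ((-c : ℝ) + ξ * Complex.I) ^ (m.succ + 1)) -
      Complex.exp (((-c : ℝ) + ξ * Complex.I) * (0 : ℝ)) *
        (1 / ((-c : ℝ) + ξ * Complex.I) ^ (m.succ + 1))) := by
    intro ξ
    have h4 : (c : ℂ) + ((-ξ : ℝ) : ℂ) * Complex.I = -(((-c : ℝ) : ℂ) + ξ * Complex.I) := by
      push_cast; ring
    have h5 := hne ξ
    rw [h4, expSlope_of_ne (neg_ne_zero.mpr h5)]
    set z := ((-c : ℝ) : ℂ) + ξ * Complex.I
    simp only [Complex.ofReal_neg, Complex.ofReal_one, mul_neg, mul_one, Complex.ofReal_zero,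
      mul_zero, Complex.exp_zero, Nat.succ_eq_add_one]
    have h6 : (-1 : ℂ) ^ (m + 2) * (-1) ^ (m + 2) = 1 := by
      rw [← mul_pow]; simp
    rw [div_div, ← pow_succ', neg_pow z (m + 1 + 1)]
    have h7 : (-1 : ℂ) ^ (m + 2) ≠ 0 := pow_ne_zero _ (by norm_num)
    rw [div_eq_iff (mul_ne_zero h7 (pow_ne_zero _ h5))]
    field_simp
    linear_combination (-(Complex.exp (-z) - 1)) * h6
  rw [integral_congr_ae (Eventually.of_forall h3), integral_const_mul, h2, mul_zero]

/-- The residue at the origin is the Taylor coefficient of order `m + 1` of the exponential. -/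
lemma circleIntegral_expSlope_div_pow {r : ℝ} (hr : 0 < r) (m : ℕ) :
    (∮ s in C(0, r), expSlope s / s ^ (m + 1)) =
      2 * Real.pi * Complex.I * (1 / (m + 1).factorial) := by
  have hci : ∀ a : ℂ, CircleIntegrable (fun s => (s ^ (m + 1 + 1))⁻¹ * Complex.exp (a * s)) 0 r := by
    intro a
    refine ContinuousOn.circleIntegrable hr.le ?_
    refine ContinuousOn.mul (ContinuousOn.inv₀ (by fun_prop) fun s hs => ?_) (by fun_prop)
    refine pow_ne_zero _ ?_
    rintro rfl
    simp at hs
    exact hr.ne hs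
  have h := circleIntegral.integral_sub (hci 1) (hci 0)
  rw [circleIntegral_inv_pow_mul_exp hr, circleIntegral_inv_pow_mul_exp hr, zero_pow m.succ_ne_zero,
    zero_div, mul_zero, sub_zero, one_pow] at h
  rw [← h]
  refine circleIntegral.integral_congr hr.le fun s hs => ?_
  have hs0 : s ≠ 0 := by rintro rfl; simp at hs; exact hr.ne hs
  simp only [one_mul, zero_mul, Complex.exp_zero]
  rw [expSlope_of_ne hs0]
  field_simp
  ring

/-- The residue theorem for a strip and a single pole of arbitrary order. A multiple of
`(exp s - 1) / s` is subtracted to lower the order of the pole; for the subtracted function all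
integrals are known from Laplace inversion. -/
lemma integral_vertical_sub_eq_circleIntegral {a b : ℝ} (ha : a < 0) (hb : 0 < b) {r : ℝ}
    (hr : 0 < r) (m : ℕ) {u : ℂ → ℂ} (hu : Differentiable ℂ u) (h : QuadraticDecay a b u) :
    (∫ ξ : ℝ, u (b + ξ * Complex.I) / (b + ξ * Complex.I) ^ m) -
      (∫ ξ : ℝ, u (a + ξ * Complex.I) / (a + ξ * Complex.I) ^ m) =
      -Complex.I * ∮ s in C(0, r), u s / s ^ m := by
  induction m generalizing u with
  | zero =>
    simp only [pow_zero, div_one]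
    rw [integral_vertical_eq (ha.trans hb).le ha.ne hb.ne' hu h, sub_self,
      Complex.circleIntegral_eq_zero_of_differentiable_on_off_countable hr.le
      Set.countable_empty hu.continuous.continuousOn fun z _ => hu z, mul_zero]
  | succ m ih =>
    set f : ℂ → ℂ := fun s => u s - u 0 * expSlope s with hf
    have hfd : Differentiable ℂ f := hu.sub (differentiable_expSlope.const_mul _)
    have hf0 : f 0 = 0 := by simp [hf, expSlope_zero]
    set v := dslope f 0 with hv
    have hvd : Differentiable ℂ v := differentiable_dslope hfd
    have hvq : QuadraticDecay a b v := by
      obtain ⟨C, hC0, hC⟩ := h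
      refine quadraticDecay_dslope hfd hf0 (C := C + ‖u 0‖ * ((Real.exp b + 1) * 2))
        fun s hsa hsb him => ?_
      have hs0 : s ≠ 0 := by rintro rfl; simp at him; linarith
      have h1 : ‖u s‖ ≤ C * (1 + |s.im|)⁻¹ := by
        refine (hC s hsa hsb).trans ?_
        gcongr
        exact le_self_pow₀ (by linarith) two_ne_zero
      have h2 : ‖expSlope s‖ ≤ (Real.exp b + 1) * 2 * (1 + |s.im|)⁻¹ := by
        rw [expSlope_of_ne hs0, norm_div]
        have h3 : ‖Complex.exp s - 1‖ ≤ Real.exp b + 1 := by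
          refine (norm_sub_le _ _).trans ?_
          rw [Complex.norm_exp, norm_one]
          gcongr
        have h4 : (1 + |s.im|) / 2 ≤ ‖s‖ := by linarith [Complex.abs_im_le_norm s]
        calc _ ≤ (Real.exp b + 1) / ((1 + |s.im|) / 2) := by gcongr
          _ = _ := by field_simp
      calc ‖f s‖ ≤ ‖u s‖ + ‖u 0‖ * ‖expSlope s‖ := by
            rw [hf]
            refine (norm_sub_le _ _).trans ?_
            rw [norm_mul]
        _ ≤ C * (1 + |s.im|)⁻¹ + ‖u 0‖ * ((Real.exp b + 1) * 2 * (1 + |s.im|)⁻¹) := by gcongr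
        _ = _ := by ring
    have hsplit : ∀ s : ℂ, s ≠ 0 → u s / s ^ (m + 1) =
        u 0 * (expSlope s / s ^ (m + 1)) + v s / s ^ m := by
      intro s hs
      have h1 := mul_dslope_eq hf0 s
      rw [← hv] at h1
      simp only [hf] at h1
      have h2 : u s = u 0 * expSlope s + s * v s := by rw [h1]; ring
      rw [h2, pow_succ]
      field_simp
    have hline : ∀ c : ℝ, a ≤ c → c ≤ b → c ≠ 0 →
        ∫ ξ : ℝ, u (c + ξ * Complex.I) / (c + ξ * Complex.I) ^ (m + 1) =
        u 0 * (∫ ξ : ℝ, expSlope (c + ξ * Complex.I) / (c + ξ * Complex.I) ^ (m + 1)) +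
        ∫ ξ : ℝ, v (c + ξ * Complex.I) / (c + ξ * Complex.I) ^ m := by
      intro c hac hcb hc
      have hne : ∀ ξ : ℝ, (c : ℂ) + ξ * Complex.I ≠ 0 := by
        intro ξ h0
        have := congrArg Complex.re h0
        simp at this
        exact hc this
      have i1 := h.integrable hu hac hcb hc (m + 1)
      have i2 := hvq.integrable hvd hac hcb hc m
      have i3 : Integrable fun ξ : ℝ => u 0 *
          (expSlope (c + ξ * Complex.I) / (c + ξ * Complex.I) ^ (m + 1)) := by
        refine (i1.sub i2).congr (Eventually.of_forall fun ξ => ?_)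
        simp only [Pi.sub_apply]
        rw [hsplit _ (hne ξ)]
        ring
      rw [← integral_const_mul, ← integral_add i3 i2]
      exact integral_congr_ae (Eventually.of_forall fun ξ => hsplit _ (hne ξ))
    have hcirc : (∮ s in C(0, r), u s / s ^ (m + 1)) =
        u 0 * (∮ s in C(0, r), expSlope s / s ^ (m + 1)) + ∮ s in C(0, r), v s / s ^ m := by
      have hne : ∀ s ∈ Metric.sphere (0 : ℂ) r, s ≠ 0 := by
        rintro s hs rfl; simp at hs; exact hr.ne hs
      have hci : ∀ {g : ℂ → ℂ} (_ : Differentiable ℂ g) (j : ℕ),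
          CircleIntegrable (fun s => g s / s ^ j) 0 r := by
        intro g hg j
        refine ContinuousOn.circleIntegrable hr.le ?_
        exact ContinuousOn.div hg.continuous.continuousOn (by fun_prop)
          fun s hs => pow_ne_zero _ (hne s hs)
      have hci' : CircleIntegrable (fun s => u 0 * (expSlope s / s ^ (m + 1))) 0 r :=
        (hci differentiable_expSlope (m + 1)).const_smul (a := u 0)
      rw [← circleIntegral.integral_const_mul, ← circleIntegral.integral_add hci' (hci hvd m)]
      exact circleIntegral.integral_congr hr.le fun s hs => hsplit s (hne s hs)
    rw [hline b (ha.trans hb).le le_rfl hb.ne', hline a le_rfl (ha.trans hb).le ha.ne,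
      integral_expSlope_div_pow_of_pos hb, integral_expSlope_div_pow_of_neg ha, hcirc,
      circleIntegral_expSlope_div_pow hr, mul_add, ← ih hvd hvq]
    linear_combination (u 0 * (2 * Real.pi * (1 / ((m + 1).factorial : ℂ)))) * Complex.I_mul_I

end ContourShift

/-! ### Mellin transforms of smooth functions supported in `[1, 2]` -/

section MellinTransform

open MeasureTheory

lemma eq_zero_of_le_one {f : ℝ → ℂ} (hf : Continuous f) (hs : Function.support f ⊆ Set.Icc 1 2)
    {x : ℝ} (hx : x ≤ 1) : f x = 0 := by
  have h1 : Set.EqOn f (fun _ => 0) (Set.Iio 1) := fun y hy => by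
    by_contra h
    exact absurd (hs h).1 (not_le.mpr hy)
  have := h1.closure hf continuous_const
  rw [closure_Iio] at this
  exact this hx

lemma eq_zero_of_two_le {f : ℝ → ℂ} (hf : Continuous f) (hs : Function.support f ⊆ Set.Icc 1 2)
    {x : ℝ} (hx : 2 ≤ x) : f x = 0 := by
  have h1 : Set.EqOn f (fun _ => 0) (Set.Ioi 2) := fun y hy => by
    by_contra h
    exact absurd (hs h).2 (not_le.mpr hy)
  have := h1.closure hf continuous_const
  rw [closure_Ioi] at this
  exact this hx

lemma mellin_eq_intervalIntegral {f : ℝ → ℂ} (hf : Continuous f)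
    (hs : Function.support f ⊆ Set.Icc 1 2) (s : ℂ) :
    mellin f s = ∫ x in (1 : ℝ)..2, (x : ℂ) ^ (s - 1) * f x := by
  rw [intervalIntegral.integral_of_le one_le_two, mellin]
  refine setIntegral_eq_of_subset_of_forall_sdiff_eq_zero measurableSet_Ioi
    (fun x hx => lt_trans one_pos hx.1) fun x hx => ?_
  rcases le_or_gt x 1 with h | h
  · simp [eq_zero_of_le_one hf hs h]
  · have : 2 < x := by
      by_contra hcon
      exact hx.2 ⟨h, not_lt.mp hcon⟩
    simp [eq_zero_of_two_le hf hs this.le]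

lemma isBigO_zero_of_eventuallyEq {f : ℝ → ℂ} {l : Filter ℝ} (h : f =ᶠ[l] 0) (g : ℝ → ℝ) :
    f =O[l] g := h.trans_isBigO (Asymptotics.isBigO_zero _ _)

lemma differentiable_mellin {f : ℝ → ℂ} (hf : Continuous f)
    (hs : Function.support f ⊆ Set.Icc 1 2) : Differentiable ℂ (mellin f) := by
  intro s
  refine mellin_differentiableAt_of_isBigO_rpow (a := s.re + 1) (b := s.re - 1)
    (hf.locallyIntegrable.locallyIntegrableOn _) (isBigO_zero_of_eventuallyEq ?_ _) (by linarith)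
    (isBigO_zero_of_eventuallyEq ?_ _) (by linarith)
  · filter_upwards [eventually_ge_atTop 2] with x hx using eq_zero_of_two_le hf hs hx
  · filter_upwards [mem_nhdsWithin_of_mem_nhds (Iio_mem_nhds one_pos)] with x hx
      using eq_zero_of_le_one hf hs (le_of_lt hx)

lemma exists_norm_mellin_le {f : ℝ → ℂ} (hf : Continuous f)
    (hs : Function.support f ⊆ Set.Icc 1 2) :
    ∃ C : ℝ, ∀ s : ℂ, s.re ≤ 3 → ‖mellin f s‖ ≤ C := by
  obtain ⟨M, hM⟩ := (isCompact_Icc (a := (1 : ℝ)) (b := 2)).exists_bound_of_continuousOn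
    hf.continuousOn
  refine ⟨4 * M, fun s hsre => ?_⟩
  rw [mellin_eq_intervalIntegral hf hs]
  have := intervalIntegral.norm_integral_le_of_norm_le_const (a := (1 : ℝ)) (b := 2) (C := 4 * M)
    (f := fun x : ℝ => (x : ℂ) ^ (s - 1) * f x) fun x hx => by
      rw [Set.uIoc_of_le one_le_two] at hx
      have hx0 : 0 < x := lt_trans one_pos hx.1
      rw [norm_mul, Complex.norm_cpow_eq_rpow_re_of_pos hx0]
      have h1 : x ^ (s - 1).re ≤ 4 := by
        calc x ^ (s - 1).re ≤ x ^ (2 : ℝ) :=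
              Real.rpow_le_rpow_of_exponent_le hx.1.le (by simp; linarith)
          _ ≤ 2 ^ (2 : ℝ) := Real.rpow_le_rpow hx0.le hx.2 (by norm_num)
          _ = 4 := by norm_num
      have h2 := hM x ⟨hx.1.le, hx.2⟩
      gcongr
  refine this.trans (le_of_eq ?_)
  rw [show (2 : ℝ) - 1 = 1 by norm_num, abs_one, mul_one]

/-- Integration by parts: the operator `-x d/dx` multiplies the Mellin transform by `s`. -/
lemma mellin_neg_mul_deriv {f : ℝ → ℂ} (hf : ContDiff ℝ ∞ f)
    (hs : Function.support f ⊆ Set.Icc 1 2)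
    (hs' : Function.support (fun x : ℝ => -(x : ℂ) * deriv f x) ⊆ Set.Icc 1 2) (s : ℂ) :
    mellin (fun x : ℝ => -(x : ℂ) * deriv f x) s = s * mellin f s := by
  have hd : Continuous (deriv f) := hf.continuous_deriv (by simp)
  have hcont : ∀ c : ℂ, ContinuousOn (fun x : ℝ => (x : ℂ) ^ c) (Set.uIcc 1 2) := by
    intro c x hx
    rw [Set.uIcc_of_le one_le_two] at hx
    have hx0 : 0 < x := lt_of_lt_of_le one_pos hx.1
    exact (Complex.continuousAt_ofReal_cpow_const x c (Or.inr hx0.ne')).continuousWithinAt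
  rcases eq_or_ne s 0 with rfl | hs0
  · rw [zero_mul, mellin_eq_intervalIntegral (by fun_prop) hs']
    have h1 : ∫ x in (1 : ℝ)..2, (x : ℂ) ^ ((0 : ℂ) - 1) * (-(x : ℂ) * deriv f x) =
        ∫ x in (1 : ℝ)..2, -deriv f x := by
      refine intervalIntegral.integral_congr fun x hx => ?_
      rw [Set.uIcc_of_le one_le_two] at hx
      have hx0 : (x : ℂ) ≠ 0 := by exact_mod_cast (lt_of_lt_of_le one_pos hx.1).ne'
      simp only [zero_sub, Complex.cpow_neg_one]
      field_simp
    rw [h1, intervalIntegral.integral_neg, intervalIntegral.integral_deriv_eq_sub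
      (fun x _ => hf.differentiable (by simp) x) (hd.intervalIntegrable _ _),
      eq_zero_of_two_le hf.continuous hs le_rfl, eq_zero_of_le_one hf.continuous hs le_rfl]
    simp
  · rw [mellin_eq_intervalIntegral (by fun_prop) hs', mellin_eq_intervalIntegral hf.continuous hs]
    have hparts := intervalIntegral.integral_mul_deriv_eq_deriv_mul (a := (1 : ℝ)) (b := 2)
      (u := fun x : ℝ => (x : ℂ) ^ s) (v := f) (u' := fun x : ℝ => s * (x : ℂ) ^ (s - 1))
      (v' := deriv f) (fun x hx => ?_) (fun x _ => (hf.differentiable (by simp) x).hasDerivAt)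
      ((continuousOn_const.mul (hcont (s - 1))).intervalIntegrable) (hd.intervalIntegrable _ _)
    · rw [eq_zero_of_two_le hf.continuous hs le_rfl, eq_zero_of_le_one hf.continuous hs le_rfl,
        mul_zero, mul_zero, sub_zero, zero_sub] at hparts
      have h1 : ∫ x in (1 : ℝ)..2, (x : ℂ) ^ (s - 1) * (-(x : ℂ) * deriv f x) =
          -∫ x in (1 : ℝ)..2, (x : ℂ) ^ s * deriv f x := by
        rw [← intervalIntegral.integral_neg]
        refine intervalIntegral.integral_congr fun x hx => ?_
        rw [Set.uIcc_of_le one_le_two] at hx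
        have hx0 : (x : ℂ) ≠ 0 := by exact_mod_cast (lt_of_lt_of_le one_pos hx.1).ne'
        rw [Complex.cpow_sub _ _ hx0, Complex.cpow_one]
        field_simp
      rw [h1, hparts, neg_neg, ← intervalIntegral.integral_const_mul]
      refine intervalIntegral.integral_congr fun x _ => ?_
      ring
    · rw [Set.uIcc_of_le one_le_two] at hx
      have hx0 : x ≠ 0 := (lt_of_lt_of_le one_pos hx.1).ne'
      exact hasDerivAt_ofReal_cpow_const hx0 hs0

lemma support_neg_mul_deriv {f : ℝ → ℂ} (hs : Function.support f ⊆ Set.Icc 1 2) :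
    Function.support (fun x : ℝ => -(x : ℂ) * deriv f x) ⊆ Set.Icc 1 2 := by
  intro x hx
  have h1 : deriv f x ≠ 0 := right_ne_zero_of_mul hx
  have h2 : x ∈ tsupport f := support_deriv_subset h1
  exact closure_minimal hs isClosed_Icc h2

/-- Repeated integration by parts. -/
lemma exists_norm_pow_mul_norm_mellin_le (j : ℕ) {f : ℝ → ℂ} (hf : ContDiff ℝ ∞ f)
    (hs : Function.support f ⊆ Set.Icc 1 2) :
    ∃ C : ℝ, ∀ s : ℂ, s.re ≤ 3 → ‖s‖ ^ j * ‖mellin f s‖ ≤ C := by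
  induction j generalizing f with
  | zero =>
    obtain ⟨C, hC⟩ := exists_norm_mellin_le hf.continuous hs
    exact ⟨C, fun s h => by simpa using hC s h⟩
  | succ j ih =>
    have hs' := support_neg_mul_deriv hs
    have hf' : ContDiff ℝ ∞ (fun x : ℝ => -(x : ℂ) * deriv f x) := by
      have h1 : ContDiff ℝ ∞ (deriv f) := (contDiff_infty_iff_deriv.mp hf).2
      exact (Complex.ofRealCLM.contDiff.neg).mul h1
    obtain ⟨C, hC⟩ := ih hf' hs'
    refine ⟨C, fun s h => ?_⟩
    have := hC s h
    rw [mellin_neg_mul_deriv hf hs hs', norm_mul] at this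
    rw [pow_succ, mul_assoc]
    exact this

lemma exists_norm_mellin_le_inv_pow (j : ℕ) {f : ℝ → ℂ} (hf : ContDiff ℝ ∞ f)
    (hs : Function.support f ⊆ Set.Icc 1 2) :
    ∃ C : ℝ, 0 ≤ C ∧ ∀ s : ℂ, s.re ≤ 3 → ‖mellin f s‖ ≤ C * ((1 + ‖s‖) ^ j)⁻¹ := by
  obtain ⟨C₀, h₀⟩ := exists_norm_pow_mul_norm_mellin_le 0 hf hs
  obtain ⟨C₁, h₁⟩ := exists_norm_pow_mul_norm_mellin_le j hf hs
  have hC₀ : 0 ≤ C₀ := (by positivity : (0 : ℝ) ≤ _).trans (h₀ 0 (by norm_num))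
  have hC₁ : 0 ≤ C₁ := (by positivity : (0 : ℝ) ≤ _).trans (h₁ 0 (by norm_num))
  refine ⟨2 ^ (j - 1) * (C₀ + C₁), by positivity, fun s h => ?_⟩
  rw [← div_eq_mul_inv, le_div_iff₀ (by positivity)]
  have h2 := add_pow_le (zero_le_one) (norm_nonneg s) j
  rw [one_pow] at h2
  have h3 := h₀ s h
  have h4 := h₁ s h
  rw [pow_zero, one_mul] at h3
  calc ‖mellin f s‖ * (1 + ‖s‖) ^ j ≤ ‖mellin f s‖ * (2 ^ (j - 1) * (1 + ‖s‖ ^ j)) := by gcongr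
    _ = 2 ^ (j - 1) * (‖mellin f s‖ + ‖s‖ ^ j * ‖mellin f s‖) := by ring
    _ ≤ _ := by gcongr

lemma integrable_mellin_vertical {f : ℝ → ℂ} (hf : ContDiff ℝ ∞ f)
    (hs : Function.support f ⊆ Set.Icc 1 2) {c : ℝ} (hc : c ≤ 3) :
    Integrable fun y : ℝ => mellin f (c + y * Complex.I) := by
  obtain ⟨C, hC0, hC⟩ := exists_norm_mellin_le_inv_pow 2 hf hs
  refine (integrable_one_add_abs_sq_inv.const_mul C).mono'
    ((differentiable_mellin hf.continuous hs).continuous.comp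
      (by fun_prop)).aestronglyMeasurable (Eventually.of_forall fun y => ?_)
  refine (hC _ (by simpa using hc)).trans ?_
  have h1 := Complex.abs_im_le_norm ((c : ℂ) + y * Complex.I)
  simp at h1
  gcongr

end MellinTransform

/-! ### Smoothed divisor sums over multiples -/

section Multiples

open MeasureTheory

lemma natCast_div_cpow_neg {X : ℝ} (hX : 0 < X) {n : ℕ} (hn : n ≠ 0) (s : ℂ) :
    (((n : ℝ) / X : ℝ) : ℂ) ^ (-s) = (X : ℂ) ^ s * ((n : ℂ) ^ s)⁻¹ := by
  have hn0 : (n : ℂ) ≠ 0 := by exact_mod_cast hn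
  have hX0 : (X : ℂ) ≠ 0 := by exact_mod_cast hX.ne'
  have h : (n : ℂ) = (((n : ℝ) / X : ℝ) : ℂ) * (X : ℂ) := by
    push_cast
    field_simp
  have h1 : (n : ℂ) ^ s = (((n : ℝ) / X : ℝ) : ℂ) ^ s * (X : ℂ) ^ s := by
    conv_lhs => rw [h]
    exact Complex.mul_cpow_ofReal_nonneg (by positivity) hX.le s
  have hXs : (X : ℂ) ^ s ≠ 0 := by simp [Complex.cpow_eq_zero_iff, hX0]
  rw [h1, Complex.cpow_neg, mul_inv, mul_left_comm, mul_inv_cancel₀ hXs, mul_one]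

lemma mellinConvergent_of_support {f : ℝ → ℂ} (hf : Continuous f)
    (hs : Function.support f ⊆ Set.Icc 1 2) (s : ℂ) : MellinConvergent f s := by
  refine mellinConvergent_of_isBigO_rpow (a := s.re + 1) (b := s.re - 1)
    (hf.locallyIntegrable.locallyIntegrableOn _) (isBigO_zero_of_eventuallyEq ?_ _) (by linarith)
    (isBigO_zero_of_eventuallyEq ?_ _) (by linarith)
  · filter_upwards [eventually_ge_atTop 2] with x hx using eq_zero_of_two_le hf hs hx
  · filter_upwards [mem_nhdsWithin_of_mem_nhds (Iio_mem_nhds one_pos)] with x hx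
      using eq_zero_of_le_one hf hs (le_of_lt hx)

/-- Mellin inversion, summed against the coefficients of a Dirichlet series. -/
lemma hasSum_mul_smooth_weight {f : ℝ → ℂ} (hf : ContDiff ℝ ∞ f)
    (hs : Function.support f ⊆ Set.Icc 1 2) {a : ℕ → ℂ} (ha : LSeriesSummable a 2) {X : ℝ}
    (hX : 0 < X) :
    HasSum (fun n : ℕ => a n * f (n / X)) ((2 * Real.pi : ℂ)⁻¹ * ∫ y : ℝ,
      mellin f (2 + y * Complex.I) * (X : ℂ) ^ (2 + y * Complex.I) *
        LSeries a (2 + y * Complex.I)) := by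
  have hint : Integrable fun y : ℝ => mellin f (2 + y * Complex.I) := by
    simpa using integrable_mellin_vertical hf hs (c := 2) (by norm_num)
  have hre : ∀ y : ℝ, ((2 : ℂ) + y * Complex.I).re = 2 := fun y => by simp
  have hX0 : (X : ℂ) ≠ 0 := by exact_mod_cast hX.ne'
  have hXn : ∀ y : ℝ, ‖(X : ℂ) ^ (2 + y * Complex.I)‖ = X ^ (2 : ℝ) := fun y => by
    rw [Complex.norm_cpow_eq_rpow_re_of_pos hX, hre]
  have htn : ∀ (n : ℕ) (y : ℝ), ‖LSeries.term a (2 + y * Complex.I) n‖ = ‖LSeries.term a 2 n‖ := by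
    intro n y
    rw [LSeries.norm_term_eq, LSeries.norm_term_eq, hre]
    simp
  have hcX : Continuous fun y : ℝ => (X : ℂ) ^ (2 + y * Complex.I) :=
    Continuous.const_cpow (by fun_prop) (Or.inl hX0)
  have hct : ∀ n : ℕ, Continuous fun y : ℝ => LSeries.term a (2 + y * Complex.I) n := by
    intro n
    rcases eq_or_ne n 0 with rfl | hn
    · simpa using continuous_const
    · have hn0 : (n : ℂ) ≠ 0 := by exact_mod_cast hn
      simp only [LSeries.term_of_ne_zero hn]
      refine continuous_const.div (Continuous.const_cpow (by fun_prop) (Or.inl hn0)) fun y => ?_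
      simp [Complex.cpow_eq_zero_iff, hn0]
  set F : ℕ → ℝ → ℂ := fun n y => mellin f (2 + y * Complex.I) *
    (X : ℂ) ^ (2 + y * Complex.I) * LSeries.term a (2 + y * Complex.I) n with hF
  have hFint : ∀ n, Integrable (F n) := by
    intro n
    refine (hint.mul_const (X ^ (2 : ℝ) * ‖LSeries.term a 2 n‖ : ℝ)).mono
      ((hint.aestronglyMeasurable.mul hcX.aestronglyMeasurable).mul
        (hct n).aestronglyMeasurable) (Eventually.of_forall fun y => ?_)
    simp only [hF, norm_mul, hXn, htn, Complex.norm_real]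
    rw [Real.norm_of_nonneg (Real.rpow_nonneg hX.le 2), Real.norm_of_nonneg (norm_nonneg _),
      mul_assoc]
  have hFsum : Summable fun n => ∫ y, ‖F n y‖ := by
    have h1 : ∀ n, ∫ y, ‖F n y‖ =
        ‖LSeries.term a 2 n‖ * ((∫ y : ℝ, ‖mellin f (2 + y * Complex.I)‖) * X ^ (2 : ℝ)) := by
      intro n
      rw [mul_comm, ← integral_mul_const, ← integral_mul_const]
      simp only [hF, norm_mul, hXn, htn]
    simp only [h1]
    exact (Summable.norm ha).mul_right _
  have h := (hasSum_integral_of_summable_integral_norm hFint hFsum).mul_left (2 * Real.pi : ℂ)⁻¹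
  have hsum : ∀ y : ℝ, ∑' n, F n y = mellin f (2 + y * Complex.I) *
      (X : ℂ) ^ (2 + y * Complex.I) * LSeries a (2 + y * Complex.I) := fun y => tsum_mul_left
  simp only [hsum] at h
  have hterm : ∀ n : ℕ, a n * f (n / X) = (2 * Real.pi : ℂ)⁻¹ * ∫ y, F n y := by
    intro n
    rcases eq_or_ne n 0 with rfl | hn
    · simp [hF, eq_zero_of_le_one hf.continuous hs zero_le_one]
    · have hn0 : (n : ℂ) ≠ 0 := by exact_mod_cast hn
      have hx : 0 < (n : ℝ) / X := div_pos (by exact_mod_cast Nat.pos_of_ne_zero hn) hX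
      have hinv := mellinInv_mellin_eq 2 f hx (mellinConvergent_of_support hf.continuous hs _)
        (by simpa [Complex.VerticalIntegrable] using hint) hf.continuous.continuousAt
      rw [← hinv, mellinInv, Complex.real_smul, mul_left_comm, ← integral_const_mul]
      congr 1
      · push_cast
        rw [one_div]
      · refine integral_congr_ae (Eventually.of_forall fun y => ?_)
        simp only [hF, smul_eq_mul, LSeries.term_of_ne_zero hn, Complex.ofReal_ofNat]
        rw [natCast_div_cpow_neg hX hn]
        ring
  exact h.congr_fun hterm

/-- On `Re s ≥ 1/4` the products of the local densities are bounded, uniformly in the set of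
primes: all but finitely many of the factors are at most `1`. -/
lemma exists_norm_prod_sieveDensity_le (k : ℕ) :
    ∃ K : ℝ, 0 ≤ K ∧ ∀ E : Finset ℕ, (∀ p ∈ E, p.Prime) → ∀ s : ℂ, 1 / 4 ≤ s.re →
      ‖∏ p ∈ E, sieveDensity k s p‖ ≤ K := by
  have hlim : Tendsto (fun p : ℕ => (k * 2 ^ k : ℝ) * (p : ℝ) ^ (-(1 / 4 : ℝ))) atTop (𝓝 0) := by
    simpa using ((tendsto_rpow_neg_atTop (by norm_num : (0 : ℝ) < 1 / 4)).comp
      tendsto_natCast_atTop_atTop).const_mul (k * 2 ^ k : ℝ)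
  obtain ⟨m, hm⟩ := eventually_atTop.mp (hlim.eventually (Iic_mem_nhds one_pos))
  set M : ℝ := max 1 (k * 2 ^ k) with hM
  refine ⟨M ^ m, by positivity, fun E hE s hs => ?_⟩
  have hfac : ∀ p ∈ E, ‖sieveDensity k s p‖ ≤ if p < m then M else 1 := by
    intro p hp
    have hp0 := (hE p hp).pos
    have hp1 : (1 : ℝ) ≤ p := by exact_mod_cast hp0
    have hq : ‖(p : ℂ) ^ (-s)‖ ≤ (p : ℝ) ^ (-(1 / 4 : ℝ)) := by
      rw [norm_natCast_cpow_neg hp0]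
      exact Real.rpow_le_rpow_of_exponent_le hp1 (by linarith)
    have hq1 : (p : ℝ) ^ (-(1 / 4 : ℝ)) ≤ 1 := Real.rpow_le_one_of_one_le_of_nonpos hp1 (by norm_num)
    have h1 : ‖sieveDensity k s p‖ ≤ k * 2 ^ k * (p : ℝ) ^ (-(1 / 4 : ℝ)) :=
      (norm_one_sub_one_sub_pow_le k (hq.trans hq1)).trans (by gcongr)
    split_ifs with h
    · refine h1.trans ((mul_le_of_le_one_right (by positivity) hq1).trans (le_max_right _ _))
    · exact h1.trans (hm p (not_lt.mp h))
  rw [norm_prod]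
  refine (Finset.prod_le_prod (fun _ _ => norm_nonneg _) hfac).trans ?_
  rw [Finset.prod_ite, Finset.prod_const, Finset.prod_const_one, mul_one]
  refine pow_le_pow_right₀ (le_max_left _ _) ?_
  calc _ ≤ (Finset.range m).card := Finset.card_le_card fun p hp =>
        Finset.mem_range.mpr (Finset.mem_filter.mp hp).2
    _ = m := Finset.card_range m

lemma norm_poleFreeZeta_le {s : ℂ} (hs : 1 / 4 ≤ s.re) :
    ‖poleFreeZeta s‖ ≤ 7 * (1 + ‖s‖) ^ 2 := by
  have h0 := norm_nonneg s
  rcases eq_or_ne s 1 with rfl | h1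
  · rw [poleFreeZeta_one]
    norm_num
  · have hne : 0 < ‖s - 1‖ := norm_pos_iff.mpr (sub_ne_zero.mpr h1)
    have hle : ‖s - 1‖ ≤ ‖s‖ + 1 := by simpa using norm_sub_le s 1
    rw [poleFreeZeta_of_ne h1, norm_mul]
    calc ‖s - 1‖ * ‖riemannZeta s‖ ≤ ‖s - 1‖ * (1 + 1 / ‖s - 1‖ + 5 * ‖s‖) := by
          gcongr
          exact norm_riemannZeta_le_linear hs h1
      _ = ‖s - 1‖ * (1 + 5 * ‖s‖) + 1 := by
          field_simp
          ring
      _ ≤ (‖s‖ + 1) * (1 + 5 * ‖s‖) + 1 := by gcongr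
      _ ≤ 7 * (1 + ‖s‖) ^ 2 := by nlinarith

/-- The integrand of the contour integral for the sum over the multiples of `∏ E`, with the pole
of order `k` at `s = 1` removed and that point moved to the origin. -/
noncomputable def multiplesIntegrand (f : ℝ → ℂ) (k : ℕ) (X : ℝ) (E : Finset ℕ) (σ : ℂ) : ℂ :=
  mellin f (1 + σ) * (X : ℂ) ^ (1 + σ) * poleFreeZeta (1 + σ) ^ k *
    ∏ p ∈ E, sieveDensity k (1 + σ) p

lemma differentiable_multiplesIntegrand {f : ℝ → ℂ} (hf : Continuous f)
    (hs : Function.support f ⊆ Set.Icc 1 2) (k : ℕ) {X : ℝ} (hX : 0 < X) {E : Finset ℕ}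
    (hE : ∀ p ∈ E, p.Prime) : Differentiable ℂ (multiplesIntegrand f k X E) := by
  have hshift : Differentiable ℂ fun σ : ℂ => 1 + σ := by fun_prop
  have hX0 : (X : ℂ) ≠ 0 := by exact_mod_cast hX.ne'
  have h1 := (differentiable_mellin hf hs).comp hshift
  have h2 := (differentiable_poleFreeZeta.comp hshift).pow k
  have h3 : Differentiable ℂ fun σ : ℂ => (X : ℂ) ^ (1 + σ) :=
    hshift.const_cpow (Or.inl hX0)
  have h4 : Differentiable ℂ fun σ : ℂ => ∏ p ∈ E, sieveDensity k (1 + σ) p := by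
    refine Differentiable.fun_finsetProd fun p hp => ?_
    have hp0 : (p : ℂ) ≠ 0 := by exact_mod_cast (hE p hp).ne_zero
    exact ((hshift.neg.const_cpow (Or.inl hp0)).const_sub 1 |>.pow k).const_sub 1
  exact ((h1.mul h3).mul h2).mul h4

/-- The Mellin transform decays fast enough to absorb the quadratic growth of each factor
`(s - 1) ζ(s)` on `Re s ≥ 1/4`. -/
lemma exists_norm_multiplesIntegrand_le {f : ℝ → ℂ} (hf : ContDiff ℝ ∞ f)
    (hs : Function.support f ⊆ Set.Icc 1 2) (k : ℕ) :
    ∃ C : ℝ, 0 ≤ C ∧ ∀ X : ℝ, 0 < X → ∀ E : Finset ℕ, (∀ p ∈ E, p.Prime) → ∀ σ : ℂ,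
      -(3 / 4) ≤ σ.re → σ.re ≤ 1 →
      ‖multiplesIntegrand f k X E σ‖ ≤ C * X ^ (1 + σ.re) * ((1 + |σ.im|) ^ 2)⁻¹ := by
  -- `2 k` orders of decay compensate the growth of `((s - 1) ζ(s)) ^ k`, two remain
  obtain ⟨C₁, hC₁0, hC₁⟩ := exists_norm_mellin_le_inv_pow (2 * k + 2) hf hs
  obtain ⟨K, hK0, hK⟩ := exists_norm_prod_sieveDensity_le k
  refine ⟨C₁ * 7 ^ k * K, by positivity, fun X hX E hE σ h1 h2 => ?_⟩
  have hre : ((1 : ℂ) + σ).re = 1 + σ.re := by simp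
  have him : |σ.im| ≤ ‖1 + σ‖ := by simpa using Complex.abs_im_le_norm (1 + σ)
  set t : ℝ := 1 + ‖1 + σ‖ with ht
  have ht0 : 0 < t := by positivity
  have hti : 1 + |σ.im| ≤ t := by linarith
  have hz := norm_poleFreeZeta_le (s := 1 + σ) (by rw [hre]; linarith)
  have hm := hC₁ (1 + σ) (by rw [hre]; linarith)
  have hp := hK E hE (1 + σ) (by rw [hre]; linarith)
  rw [multiplesIntegrand, norm_mul, norm_mul, norm_mul, norm_pow,
    Complex.norm_cpow_eq_rpow_re_of_pos hX, hre]
  calc ‖mellin f (1 + σ)‖ * X ^ (1 + σ.re) * ‖poleFreeZeta (1 + σ)‖ ^ k *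
        ‖∏ p ∈ E, sieveDensity k (1 + σ) p‖
      ≤ C₁ * (t ^ (2 * k + 2))⁻¹ * X ^ (1 + σ.re) * (7 * t ^ 2) ^ k * K := by gcongr
    _ = C₁ * 7 ^ k * K * X ^ (1 + σ.re) * (t ^ 2)⁻¹ := by
        rw [mul_pow, ← pow_mul, pow_add]
        field_simp
    _ ≤ C₁ * 7 ^ k * K * X ^ (1 + σ.re) * ((1 + |σ.im|) ^ 2)⁻¹ := by gcongr

/-- The smoothed sum of the `k`-fold divisor function over the multiples of the squarefree number
`∏ E`: up to an error that is uniform in `E` it is a residue at `s = 1`, written as an integral over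
a circle of any radius. -/
lemma exists_norm_sum_multiples_sub_circleIntegral_le {f : ℝ → ℂ} (hf : ContDiff ℝ ∞ f)
    (hs : Function.support f ⊆ Set.Icc 1 2) (k : ℕ) :
    ∃ C : ℝ, ∀ X : ℝ, 0 < X → ∀ r : ℝ, 0 < r → ∀ E : Finset ℕ, (∀ p ∈ E, p.Prime) →
      ‖(∑' n : ℕ, (if ∏ p ∈ E, p ∣ n then (1 : ℂ) else 0) * divisorFun k n * f (n / X)) -
        (2 * Real.pi * Complex.I)⁻¹ * ∮ σ in C(0, r), mellin f (1 + σ) * (X : ℂ) ^ (1 + σ) *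
          riemannZeta (1 + σ) ^ k * ∏ p ∈ E, sieveDensity k (1 + σ) p‖ ≤ C * X ^ (1 / 4 : ℝ) := by
  obtain ⟨C, hC0, hC⟩ := exists_norm_multiplesIntegrand_le hf hs k
  refine ⟨(2 * Real.pi)⁻¹ * (C * (4 / 3) ^ k * ∫ ξ : ℝ, ((1 + |ξ|) ^ 2)⁻¹),
    fun X hX r hr E hE => ?_⟩
  set u := multiplesIntegrand f k X E with hu
  have hzeta : ∀ σ : ℂ, σ ≠ 0 → u σ / σ ^ k = mellin f (1 + σ) * (X : ℂ) ^ (1 + σ) *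
      riemannZeta (1 + σ) ^ k * ∏ p ∈ E, sieveDensity k (1 + σ) p := by
    intro σ hσ
    have h1 : (1 : ℂ) + σ ≠ 1 := by simpa using hσ
    rw [hu, multiplesIntegrand, riemannZeta_eq_poleFreeZeta_div h1, add_sub_cancel_left, div_pow]
    ring
  have hdiff : Differentiable ℂ u := differentiable_multiplesIntegrand hf.continuous hs k hX hE
  have hdecay : QuadraticDecay (-(3 / 4)) 1 u := by
    refine ⟨C * (X ^ (1 / 4 : ℝ) + X ^ (2 : ℝ)), by positivity, fun σ h1 h2 => ?_⟩
    refine (hC X hX E hE σ h1 h2).trans ?_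
    gcongr
    rcases le_total X 1 with hX1 | hX1
    · exact (Real.rpow_le_rpow_of_exponent_ge hX hX1 (by linarith)).trans
        (le_add_of_nonneg_right (by positivity))
    · exact (Real.rpow_le_rpow_of_exponent_le hX1 (by linarith)).trans
        (le_add_of_nonneg_left (by positivity))
  have hcontour := integral_vertical_sub_eq_circleIntegral (by norm_num) one_pos hr k hdiff hdecay
  have hL := fun s hs => lSeriesHasSum_divisorFun_multiples k hE (s := s) hs
  have hsum := (hasSum_mul_smooth_weight hf hs
    (hL 2 (by norm_num)).LSeriesSummable hX).tsum_eq
  have hright : (∫ ξ : ℝ, u ((1 : ℝ) + ξ * Complex.I) / ((1 : ℝ) + ξ * Complex.I) ^ k) =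
      ∫ y : ℝ, mellin f (2 + y * Complex.I) * (X : ℂ) ^ (2 + y * Complex.I) *
        LSeries (fun n => (if ∏ p ∈ E, p ∣ n then (1 : ℂ) else 0) * divisorFun k n)
          (2 + y * Complex.I) := by
    refine integral_congr_ae (Eventually.of_forall fun y => ?_)
    have hne : (((1 : ℝ) : ℂ) + y * Complex.I) ≠ 0 := by
      intro h0
      have := congrArg Complex.re h0
      simp at this
    have h2 : (1 : ℂ) + (((1 : ℝ) : ℂ) + y * Complex.I) = 2 + y * Complex.I := by
      push_cast
      ring
    dsimp only
    rw [hzeta _ hne, h2, (hL _ (by simp)).LSeries_eq, mul_assoc _ (riemannZeta _ ^ k)]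
  have hcircle : (∮ σ in C(0, r), mellin f (1 + σ) * (X : ℂ) ^ (1 + σ) *
      riemannZeta (1 + σ) ^ k * ∏ p ∈ E, sieveDensity k (1 + σ) p) =
      ∮ σ in C(0, r), u σ / σ ^ k := by
    refine circleIntegral.integral_congr hr.le fun σ hσ => (hzeta σ ?_).symm
    intro h0
    simp [h0, hr.ne] at hσ
  rw [hcircle, hsum, ← hright]
  have hI : (2 * Real.pi * Complex.I : ℂ)⁻¹ = (2 * Real.pi : ℂ)⁻¹ * -Complex.I := by
    rw [mul_inv, Complex.inv_I]
  rw [hI, mul_assoc, ← mul_sub, ← hcontour, sub_sub_cancel, norm_mul, mul_assoc]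
  have hπ : ‖(2 * Real.pi : ℂ)⁻¹‖ = (2 * Real.pi)⁻¹ := by
    rw [norm_inv]
    simp [abs_of_pos Real.pi_pos]
  rw [hπ]
  refine mul_le_mul_of_nonneg_left ?_ (by positivity)
  -- on the shifted line `X ^ (1 + σ)` has norm `X ^ (1/4)`
  have hX4 : (1 : ℝ) + -(3 / 4) = 1 / 4 := by norm_num
  calc ‖∫ ξ : ℝ, u ((-(3 / 4) : ℝ) + ξ * Complex.I) / ((-(3 / 4) : ℝ) + ξ * Complex.I) ^ k‖
      ≤ ∫ ξ : ℝ, C * (4 / 3) ^ k * X ^ (1 / 4 : ℝ) * ((1 + |ξ|) ^ 2)⁻¹ := by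
        refine norm_integral_le_of_norm_le (integrable_one_add_abs_sq_inv.const_mul _)
          (Eventually.of_forall fun ξ => ?_)
        have h1 := hC X hX E hE ((-(3 / 4) : ℝ) + ξ * Complex.I) (by simp) (by simp; norm_num)
        have hre : (((-(3 / 4) : ℝ) : ℂ) + ξ * Complex.I).re = -(3 / 4) := by simp
        have him : (((-(3 / 4) : ℝ) : ℂ) + ξ * Complex.I).im = ξ := by simp
        rw [hre, him, hX4] at h1
        have h2 : 3 / 4 ≤ ‖((-(3 / 4) : ℝ) : ℂ) + ξ * Complex.I‖ := by
          have := Complex.abs_re_le_norm (((-(3 / 4) : ℝ) : ℂ) + ξ * Complex.I)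
          rw [hre] at this
          norm_num at this ⊢
          exact this
        rw [norm_div, norm_pow, div_eq_mul_inv, ← inv_pow]
        have h3 : ‖((-(3 / 4) : ℝ) : ℂ) + ξ * Complex.I‖⁻¹ ≤ 4 / 3 := by
          rw [show (4 / 3 : ℝ) = (3 / 4)⁻¹ by norm_num]
          exact inv_anti₀ (by norm_num) h2
        calc _ ≤ C * X ^ (1 / 4 : ℝ) * ((1 + |ξ|) ^ 2)⁻¹ * (4 / 3) ^ k := by gcongr
          _ = _ := by ring
    _ = C * (4 / 3) ^ k * (∫ ξ : ℝ, ((1 + |ξ|) ^ 2)⁻¹) * X ^ (1 / 4 : ℝ) := by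
        rw [integral_const_mul]
        ring

end Multiples

/-! ### Reduction to a sieved divisor sum -/

section Reduction

lemma prod_primes_dvd_iff {E : Finset ℕ} (hE : ∀ p ∈ E, p.Prime) (n : ℕ) :
    ∏ p ∈ E, p ∣ n ↔ ∀ p ∈ E, p ∣ n :=
  ⟨fun h _ hp => (Finset.dvd_prod_of_mem (fun p => p) hp).trans h,
    fun h => Finset.prod_primes_dvd n (fun _ hp => (hE _ hp).prime) h⟩

lemma injOn_prod_primes {S : Finset (Finset ℕ)} (hS : ∀ A ∈ S, ∀ p ∈ A, p.Prime) :
    Set.InjOn (fun A : Finset ℕ => ∏ p ∈ A, p) S := by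
  intro A hA B hB h
  rw [← Nat.primeFactors_prod (hS A hA), ← Nat.primeFactors_prod (hS B hB)]
  exact congrArg Nat.primeFactors h

lemma prime_of_mem_powerset_primesBelow {N : ℕ} {A : Finset ℕ} (hA : A ∈ N.primesBelow.powerset) :
    ∀ p ∈ A, p.Prime :=
  fun _ hp => Nat.prime_of_mem_primesBelow (Finset.mem_powerset.mp hA hp)

lemma moebius_prod_primes {A : Finset ℕ} (hA : ∀ p ∈ A, p.Prime) :
    ArithmeticFunction.moebius (∏ p ∈ A, p) = (-1) ^ A.card := by
  rw [ArithmeticFunction.isMultiplicative_moebius.map_prod_of_prime A hA,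
    Finset.prod_congr rfl fun p hp => ArithmeticFunction.moebius_apply_prime (hA p hp),
    Finset.prod_const]

/-- The cut-off `d ≤ √D` is built into `powKernel`; at `d = √D` both sides vanish because `k ≠ 0`. -/
lemma sieveWeight_prod_primes {k : ℕ} (hk : k ≠ 0) {γ X L : ℝ} (hL : 0 < L)
    (hD : sqrtD γ X = Real.exp L) {A : Finset ℕ} (hA : ∀ p ∈ A, p.Prime) :
    (sieveWeight k γ X (∏ p ∈ A, p) : ℂ) = k.factorial * sieveCoeff k L A := by
  have hd : (0 : ℝ) < ∏ p ∈ A, (p : ℝ) := Finset.prod_pos fun p hp => by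
    exact_mod_cast (hA p hp).pos
  set d : ℝ := ∏ p ∈ A, (p : ℝ) with hd_def
  have hle : d ≤ Real.exp L ↔ 0 ≤ 1 - Real.log d / L := by
    rw [sub_nonneg, div_le_one hL, Real.log_le_iff_le_exp hd]
  have hy : Real.log (Real.exp L / d) / Real.log (Real.exp L) = 1 - Real.log d / L := by
    rw [Real.log_div (Real.exp_pos L).ne' hd.ne', Real.log_exp, sub_div, div_self hL.ne']
  rw [sieveWeight, sieveCoeff, hD, moebius_prod_primes hA, Nat.cast_prod, ← hd_def, hy]
  rcases lt_trichotomy (1 - Real.log d / L) 0 with h | h | h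
  · rw [if_neg (fun hc => h.not_ge (hle.mp hc)), powKernel_of_nonpos k h.le]
    simp
  · rw [h, powKernel_of_nonpos k le_rfl, zero_pow hk]
    simp
  · rw [if_pos (hle.mpr h.le), powKernel_of_pos k h]
    have hf : (k.factorial : ℂ) ≠ 0 := by exact_mod_cast k.factorial_ne_zero
    push_cast
    field_simp

/-- The divisor sum of the sieve weights as a sum over sets of primes. -/
lemma sum_divisors_sieveWeight {k : ℕ} (hk : k ≠ 0) {γ X L : ℝ} (hL : 0 < L)
    (hD : sqrtD γ X = Real.exp L) {N : ℕ} (hN : Real.exp L ≤ N) {n : ℕ} (hn : n ≠ 0) :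
    ((∑ d ∈ n.divisors, sieveWeight k γ X d : ℝ) : ℂ) = k.factorial *
      ∑ A ∈ N.primesBelow.powerset, (if ∏ p ∈ A, p ∣ n then (1 : ℂ) else 0) * sieveCoeff k L A := by
  have hprime : ∀ A ∈ N.primesBelow.powerset, ∀ p ∈ A, p.Prime :=
    fun A hA => prime_of_mem_powerset_primesBelow hA
  have h1 : ∑ A ∈ N.primesBelow.powerset with ∏ p ∈ A, p ∣ n, sieveWeight k γ X (∏ p ∈ A, p) =
      ∑ d ∈ n.divisors, sieveWeight k γ X d := by
    refine Finset.sum_bij_ne_zero (fun A _ _ => ∏ p ∈ A, p) ?_ ?_ ?_ ?_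
    · intro A hA _
      exact Nat.mem_divisors.mpr ⟨(Finset.mem_filter.mp hA).2, hn⟩
    · intro A hA _ B hB _ h
      exact injOn_prod_primes hprime (Finset.mem_filter.mp hA).1 (Finset.mem_filter.mp hB).1 h
    · intro d hd hd0
      have hmu : ArithmeticFunction.moebius d ≠ 0 := by
        intro h
        simp [sieveWeight, h] at hd0
      have hsq := ArithmeticFunction.moebius_ne_zero_iff_squarefree.mp hmu
      have hprod := Nat.prod_primeFactors_of_squarefree hsq
      have hpos : (0 : ℝ) < d := by exact_mod_cast Nat.pos_of_mem_divisors hd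
      have hlt : (d : ℝ) < Real.exp L := by
        rw [← hD]
        by_contra hge
        rcases (not_lt.mp hge).eq_or_lt with h | h
        · simp [sieveWeight, h, div_self hpos.ne', hk] at hd0
        · simp [sieveWeight, h.not_ge] at hd0
      refine ⟨d.primeFactors, ?_, ?_, hprod⟩
      · rw [Finset.mem_filter, Finset.mem_powerset, hprod]
        refine ⟨fun p hp => Nat.mem_primesBelow.mpr ⟨?_, Nat.prime_of_mem_primeFactors hp⟩,
          Nat.dvd_of_mem_divisors hd⟩
        have h2 : p ≤ d := Nat.le_of_mem_primeFactors hp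
        have h3 : (d : ℝ) < N := hlt.trans_le hN
        exact h2.trans_lt (by exact_mod_cast h3)
      · rwa [hprod]
    · intro A _ _
      rfl
  rw [← h1, Finset.sum_filter, Complex.ofReal_sum, Finset.mul_sum]
  refine Finset.sum_congr rfl fun A hA => ?_
  split_ifs with h
  · rw [sieveWeight_prod_primes hk hL hD (hprime A hA), one_mul]
  · simp

lemma norm_sieveCoeff_le_one (k : ℕ) {L : ℝ} (hL : 0 < L) {A : Finset ℕ} (hA : ∀ p ∈ A, p.Prime) :
    ‖sieveCoeff k L A‖ ≤ 1 := by
  have h1 : (1 : ℝ) ≤ ∏ p ∈ A, (p : ℝ) := by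
    rw [← Nat.cast_prod, Nat.one_le_cast]
    exact Finset.prod_pos fun p hp => (hA p hp).pos
  have h2 := norm_powKernel_le k (y := 1 - Real.log (∏ p ∈ A, (p : ℝ)) / L) zero_le_one
    (sub_le_self _ (div_nonneg (Real.log_nonneg h1) hL.le))
  rw [sieveCoeff, norm_mul, norm_pow, norm_neg, norm_one, one_pow, one_mul]
  simpa using h2

/-- Each coefficient has norm at most `1`, and `A ↦ ∏ A` is injective on the sets that contribute, with
values below `N`. -/
lemma sum_norm_sieveCoeff_le (k : ℕ) {L : ℝ} (hL : 0 < L) {N : ℕ} (hN : Real.exp L ≤ N) :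
    ∑ A ∈ N.primesBelow.powerset, ‖sieveCoeff k L A‖ ≤ N := by
  have hprime : ∀ A ∈ N.primesBelow.powerset, ∀ p ∈ A, p.Prime :=
    fun A hA => prime_of_mem_powerset_primesBelow hA
  set S := N.primesBelow.powerset.filter fun A => ∏ p ∈ A, p < N with hS
  have h1 : ∑ A ∈ S, ‖sieveCoeff k L A‖ = ∑ A ∈ N.primesBelow.powerset, ‖sieveCoeff k L A‖ := by
    refine Finset.sum_filter_of_ne fun A hA h => ?_
    by_contra hge
    refine h ?_
    have h2 : Real.exp L ≤ ∏ p ∈ A, (p : ℝ) := by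
      rw [← Nat.cast_prod]
      exact hN.trans (Nat.cast_le.mpr (not_lt.mp hge))
    have h3 : 1 ≤ Real.log (∏ p ∈ A, (p : ℝ)) / L := by
      rw [le_div_iff₀ hL, one_mul, Real.le_log_iff_exp_le ((Real.exp_pos L).trans_le h2)]
      exact h2
    rw [sieveCoeff, powKernel_of_nonpos k (sub_nonpos.mpr h3), mul_zero, norm_zero]
  have hcard : S.card ≤ N := by
    have h2 : (S.image fun A : Finset ℕ => ∏ p ∈ A, p).card = S.card :=
      Finset.card_image_of_injOn
        (injOn_prod_primes fun A hA => hprime A (Finset.mem_filter.mp hA).1)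
    rw [← h2, ← Finset.card_range N]
    refine Finset.card_le_card fun m hm => ?_
    obtain ⟨A, hA, rfl⟩ := Finset.mem_image.mp hm
    simpa using (Finset.mem_filter.mp hA).2
  rw [← h1]
  calc ∑ A ∈ S, ‖sieveCoeff k L A‖ ≤ ∑ _A ∈ S, (1 : ℝ) := Finset.sum_le_sum fun A hA =>
        norm_sieveCoeff_le_one k hL (hprime A (Finset.mem_filter.mp hA).1)
    _ = S.card := by simp
    _ ≤ N := by exact_mod_cast hcard

/-- The majorant of `H₂`, normalized by `(k!)²`: the sum of `d_k(n) g(n / X) (∑_{d ∣ n} λ_d)²` over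
all `n`, with the sieve weights indexed by sets of primes. -/
noncomputable def sievedSum (f : ℝ → ℂ) (k : ℕ) (X L : ℝ) (N : ℕ) : ℂ :=
  ∑' n : ℕ, divisorFun k n * (∑ A ∈ N.primesBelow.powerset,
    (if ∏ p ∈ A, p ∣ n then (1 : ℂ) else 0) * sieveCoeff k L A) ^ 2 * f (n / X)

lemma sievedSum_eq {f : ℝ → ℂ} (hf : ContDiff ℝ ∞ f) (hs : Function.support f ⊆ Set.Icc 1 2)
    (k : ℕ) {X : ℝ} (hX : 0 < X) (L : ℝ) (N : ℕ) :
    sievedSum f k X L N = ∑ A ∈ N.primesBelow.powerset, ∑ B ∈ N.primesBelow.powerset,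
      sieveCoeff k L A * sieveCoeff k L B *
        ∑' n : ℕ, (if ∏ p ∈ A ∪ B, p ∣ n then (1 : ℂ) else 0) * divisorFun k n * f (n / X) := by
  have hprime : ∀ A ∈ N.primesBelow.powerset, ∀ p ∈ A, p.Prime :=
    fun A hA => prime_of_mem_powerset_primesBelow hA
  have hunion : ∀ A ∈ N.primesBelow.powerset, ∀ B ∈ N.primesBelow.powerset,
      ∀ p ∈ A ∪ B, p.Prime := fun A hA B hB p hp =>
    (Finset.mem_union.mp hp).elim (hprime A hA p) (hprime B hB p)
  have hsum : ∀ A ∈ N.primesBelow.powerset, ∀ B ∈ N.primesBelow.powerset, Summable fun n : ℕ =>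
      (if ∏ p ∈ A ∪ B, p ∣ n then (1 : ℂ) else 0) * divisorFun k n * f (n / X) := fun A hA B hB =>
    (hasSum_mul_smooth_weight hf hs (lSeriesHasSum_divisorFun_multiples k (hunion A hA B hB)
      (s := 2) (by norm_num)).LSeriesSummable hX).summable
  have hterm : ∀ n : ℕ, divisorFun k n * (∑ A ∈ N.primesBelow.powerset,
      (if ∏ p ∈ A, p ∣ n then (1 : ℂ) else 0) * sieveCoeff k L A) ^ 2 * f (n / X) =
      ∑ A ∈ N.primesBelow.powerset, ∑ B ∈ N.primesBelow.powerset,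
        sieveCoeff k L A * sieveCoeff k L B *
          ((if ∏ p ∈ A ∪ B, p ∣ n then (1 : ℂ) else 0) * divisorFun k n * f (n / X)) := by
    intro n
    rw [sq, Finset.sum_mul_sum, Finset.mul_sum, Finset.sum_mul]
    refine Finset.sum_congr rfl fun A hA => ?_
    rw [Finset.mul_sum, Finset.sum_mul]
    refine Finset.sum_congr rfl fun B hB => ?_
    have h1 : (if ∏ p ∈ A ∪ B, p ∣ n then (1 : ℂ) else 0) =
        (if ∏ p ∈ A, p ∣ n then (1 : ℂ) else 0) * (if ∏ p ∈ B, p ∣ n then (1 : ℂ) else 0) := by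
      have h2 : ∏ p ∈ A ∪ B, p ∣ n ↔ ∏ p ∈ A, p ∣ n ∧ ∏ p ∈ B, p ∣ n := by
        rw [prod_primes_dvd_iff (hunion A hA B hB), prod_primes_dvd_iff (hprime A hA),
          prod_primes_dvd_iff (hprime B hB)]
        exact Finset.forall_mem_union
      simp only [h2, ite_and]
      split_ifs <;> simp
    rw [h1]
    ring
  rw [sievedSum, tsum_congr hterm, Summable.tsum_finsetSum fun A hA =>
    summable_sum fun B hB => (hsum A hA B hB).mul_left _]
  refine Finset.sum_congr rfl fun A hA => ?_
  rw [Summable.tsum_finsetSum fun B hB => (hsum A hA B hB).mul_left _]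
  exact Finset.sum_congr rfl fun B hB => tsum_mul_left

lemma continuousOn_contour_integrand {f : ℝ → ℂ} (hf : Continuous f)
    (hs : Function.support f ⊆ Set.Icc 1 2) (k : ℕ) {X : ℝ} (hX : 0 < X) {E : Finset ℕ}
    (hE : ∀ p ∈ E, p.Prime) :
    ContinuousOn (fun σ : ℂ => mellin f (1 + σ) * (X : ℂ) ^ (1 + σ) * riemannZeta (1 + σ) ^ k *
      ∏ p ∈ E, sieveDensity k (1 + σ) p) {0}ᶜ := by
  intro σ hσ
  have h1 : (1 : ℂ) + σ ≠ 1 := by simpa using hσ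
  have hu := differentiable_multiplesIntegrand hf hs k hX hE
  refine ContinuousAt.continuousWithinAt ?_
  have h2 : ContinuousAt (fun σ : ℂ => multiplesIntegrand f k X E σ / σ ^ k) σ :=
    hu.continuous.continuousAt.div (continuousAt_id.pow k) (pow_ne_zero k hσ)
  refine h2.congr ?_
  filter_upwards [isOpen_ne.mem_nhds hσ] with τ hτ
  rw [multiplesIntegrand, riemannZeta_eq_poleFreeZeta_div (by simpa using hτ),
    add_sub_cancel_left, div_pow]
  ring

/-- The sieved sum is a contour integral around `s = 1`, up to a power saving. -/
lemma exists_norm_sievedSum_sub_circleIntegral_le {f : ℝ → ℂ} (hf : ContDiff ℝ ∞ f)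
    (hs : Function.support f ⊆ Set.Icc 1 2) (k : ℕ) :
    ∃ C : ℝ, 0 ≤ C ∧ ∀ X : ℝ, 0 < X → ∀ r : ℝ, 0 < r → ∀ L : ℝ, 0 < L → ∀ N : ℕ,
      Real.exp L ≤ N →
      ‖sievedSum f k X L N - (2 * Real.pi * Complex.I)⁻¹ * ∮ σ in C(0, r),
        mellin f (1 + σ) * (X : ℂ) ^ (1 + σ) * riemannZeta (1 + σ) ^ k *
          sieveForm k L N (1 + σ)‖ ≤ C * X ^ (1 / 4 : ℝ) * N ^ 2 := by
  obtain ⟨C, hC⟩ := exists_norm_sum_multiples_sub_circleIntegral_le hf hs k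
  refine ⟨max C 0, le_max_right _ _, fun X hX r hr L hL N hN => ?_⟩
  have hprime : ∀ A ∈ N.primesBelow.powerset, ∀ p ∈ A, p.Prime :=
    fun A hA => prime_of_mem_powerset_primesBelow hA
  have hunion : ∀ A ∈ N.primesBelow.powerset, ∀ B ∈ N.primesBelow.powerset,
      ∀ p ∈ A ∪ B, p.Prime := fun A hA B hB p hp =>
    (Finset.mem_union.mp hp).elim (hprime A hA p) (hprime B hB p)
  set G : Finset ℕ → ℂ → ℂ := fun E σ => mellin f (1 + σ) * (X : ℂ) ^ (1 + σ) *
    riemannZeta (1 + σ) ^ k * ∏ p ∈ E, sieveDensity k (1 + σ) p with hG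
  have hci : ∀ A ∈ N.primesBelow.powerset, ∀ B ∈ N.primesBelow.powerset,
      CircleIntegrable (fun σ => sieveCoeff k L A * sieveCoeff k L B * G (A ∪ B) σ) 0 r := by
    intro A hA B hB
    refine ContinuousOn.circleIntegrable hr.le (continuousOn_const.mul
      ((continuousOn_contour_integrand hf.continuous hs k hX (hunion A hA B hB)).mono ?_))
    intro σ hσ h0
    rw [Set.mem_singleton_iff.mp h0] at hσ
    simp [hr.ne] at hσ
  have hcircle : (∮ σ in C(0, r), mellin f (1 + σ) * (X : ℂ) ^ (1 + σ) *
      riemannZeta (1 + σ) ^ k * sieveForm k L N (1 + σ)) =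
      ∑ A ∈ N.primesBelow.powerset, ∑ B ∈ N.primesBelow.powerset,
        sieveCoeff k L A * sieveCoeff k L B * ∮ σ in C(0, r), G (A ∪ B) σ := by
    have h1 : ∀ σ : ℂ, mellin f (1 + σ) * (X : ℂ) ^ (1 + σ) * riemannZeta (1 + σ) ^ k *
        sieveForm k L N (1 + σ) = ∑ A ∈ N.primesBelow.powerset, ∑ B ∈ N.primesBelow.powerset,
          sieveCoeff k L A * sieveCoeff k L B * G (A ∪ B) σ := by
      intro σ
      rw [sieveForm, Finset.mul_sum]
      refine Finset.sum_congr rfl fun A _ => ?_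
      rw [Finset.mul_sum]
      refine Finset.sum_congr rfl fun B _ => ?_
      simp only [hG]
      ring
    simp only [h1]
    rw [circleIntegral.integral_fun_sum fun A hA =>
      CircleIntegrable.fun_sum _ fun B hB => hci A hA B hB]
    refine Finset.sum_congr rfl fun A hA => ?_
    rw [circleIntegral.integral_fun_sum fun B hB => hci A hA B hB]
    exact Finset.sum_congr rfl fun B hB => circleIntegral.integral_const_mul _ _ _ _
  rw [hcircle, sievedSum_eq hf hs k hX L N, Finset.mul_sum, ← Finset.sum_sub_distrib]
  have hX4 : 0 ≤ max C 0 * X ^ (1 / 4 : ℝ) := by positivity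
  calc _ ≤ ∑ A ∈ N.primesBelow.powerset, ∑ B ∈ N.primesBelow.powerset,
        ‖sieveCoeff k L A‖ * ‖sieveCoeff k L B‖ * (max C 0 * X ^ (1 / 4 : ℝ)) := by
        refine norm_sum_le_of_le _ fun A hA => ?_
        rw [Finset.mul_sum, ← Finset.sum_sub_distrib]
        refine norm_sum_le_of_le _ fun B hB => ?_
        rw [mul_left_comm, ← mul_sub, norm_mul, norm_mul]
        gcongr
        refine (hC X hX r hr (A ∪ B) (hunion A hA B hB)).trans ?_
        gcongr
        exact le_max_left _ _
    _ = (∑ A ∈ N.primesBelow.powerset, ‖sieveCoeff k L A‖) ^ 2 * (max C 0 * X ^ (1 / 4 : ℝ)) := by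
        rw [sq, Finset.sum_mul_sum, Finset.sum_mul]
        exact Finset.sum_congr rfl fun A _ => (Finset.sum_mul _ _ _).symm
    _ ≤ (N : ℝ) ^ 2 * (max C 0 * X ^ (1 / 4 : ℝ)) := by
        gcongr
        exact sum_norm_sieveCoeff_le k hL hN
    _ = _ := by ring

lemma summable_of_support_subset_Icc {g : ℝ → ℝ} (hs : Function.support g ⊆ Set.Icc 1 2) {X : ℝ}
    (hX : 0 < X) (a : ℕ → ℝ) : Summable fun n : ℕ => g (n / X) * a n := by
  refine summable_of_hasFiniteSupport ((Set.finite_Iic ⌊2 * X⌋₊).subset fun n hn => ?_)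
  have h1 := (hs (left_ne_zero_of_mul hn)).2
  rw [div_le_iff₀ hX] at h1
  exact Nat.le_floor h1

/-- The Weil bound turns `(k / 2) ^ ω(n)` into `k ^ ω(n)`, and the restriction to squarefree `n` can
be dropped since all the terms are non-negative. -/
lemma H2_le_sievedSum {g : ℝ → ℝ} (hs : Function.support g ⊆ Set.Icc 1 2) (hg0 : ∀ x, 0 ≤ g x)
    {k : ℕ} (hk : k ≠ 0) {γ X L : ℝ} (hX : 0 < X) (hL : 0 < L)
    (hD : sqrtD γ X = Real.exp L) {N : ℕ} (hN : Real.exp L ≤ N) :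
    H2 g k γ X ≤ (k.factorial : ℝ) ^ 2 * (sievedSum (fun x => (g x : ℂ)) k X L N).re := by
  set T : ℕ → ℝ := fun n => g (n / X) *
    (divisorFun k n * (∑ d ∈ n.divisors, sieveWeight k γ X d) ^ 2) with hT
  have hsum : (k.factorial : ℂ) ^ 2 * sievedSum (fun x => (g x : ℂ)) k X L N =
      ((∑' n, T n : ℝ) : ℂ) := by
    rw [sievedSum, ← tsum_mul_left, Complex.ofReal_tsum]
    refine tsum_congr fun n => ?_
    rcases eq_or_ne n 0 with rfl | hn
    · have h0 : g 0 = 0 := by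
        by_contra h
        have := (hs h).1
        norm_num at this
      simp [hT, h0]
    · simp only [hT, Complex.ofReal_mul, Complex.ofReal_pow, Complex.ofReal_natCast]
      rw [sum_divisors_sieveWeight hk hL hD hN hn]
      ring
  have hre : (k.factorial : ℝ) ^ 2 * (sievedSum (fun x => (g x : ℂ)) k X L N).re = ∑' n, T n := by
    have h1 := congrArg Complex.re hsum
    rw [Complex.ofReal_re] at h1
    rw [← h1, ← Complex.ofReal_natCast, ← Complex.ofReal_pow, Complex.re_ofReal_mul]
  rw [hre, H2]
  refine Summable.tsum_le_tsum (fun n => ?_) ?_ (summable_of_support_subset_Icc hs hX _)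
  · simp only [hT, mul_assoc]
    refine mul_le_mul_of_nonneg_left ?_ (hg0 _)
    rw [← mul_assoc, ← mul_assoc]
    refine mul_le_mul_of_nonneg_right ?_ (sq_nonneg _)
    by_cases hn : Squarefree n
    · have hn0 : (0 : ℝ) < Real.sqrt n := Real.sqrt_pos.mpr (by exact_mod_cast hn.ne_zero.bot_lt)
      have hmu : ((ArithmeticFunction.moebius n : ℤ) : ℝ) ^ 2 = 1 := by
        exact_mod_cast ArithmeticFunction.moebius_sq_eq_one_of_squarefree hn
      rw [hmu, mul_one, divisorFun_squarefree k hn]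
      calc ‖kloostermanSum 1 1 n‖ / Real.sqrt n *
            ((k : ℝ) / 2) ^ ArithmeticFunction.cardDistinctFactors n
          ≤ 2 ^ ArithmeticFunction.cardDistinctFactors n *
            ((k : ℝ) / 2) ^ ArithmeticFunction.cardDistinctFactors n := by
            gcongr
            exact (div_le_iff₀ hn0).mpr (norm_kloostermanSum_one_one_le hn)
        _ = _ := by
            rw [← mul_pow]
            push_cast
            congr 1
            ring
    · rw [ArithmeticFunction.moebius_eq_zero_of_not_squarefree hn]
      simp
  · have := summable_of_support_subset_Icc hs hX fun n : ℕ =>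
      (‖kloostermanSum 1 1 n‖ / Real.sqrt (n : ℝ)) * (ArithmeticFunction.moebius n : ℝ) ^ 2 *
        ((k : ℝ) / 2) ^ (ArithmeticFunction.cardDistinctFactors n) *
        (∑ d ∈ n.divisors, sieveWeight k γ X d) ^ 2
    simpa only [mul_assoc] using this

end Reduction

/-! ### The asymptotic formula for the sieved divisor sum -/

section Asymptotics

open MeasureTheory

lemma tendsto_circleIntegral_of_dominated {ι : Type*} {l : Filter ι} [l.IsCountablyGenerated]
    {F : ι → ℂ → ℂ} {f : ℂ → ℂ} {C : ℝ}
    (hF : ∀ᶠ i in l, ContinuousOn (F i) (Metric.sphere 0 1))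
    (hb : ∀ᶠ i in l, ∀ w : ℂ, ‖w‖ = 1 → ‖F i w‖ ≤ C)
    (hlim : ∀ w : ℂ, ‖w‖ = 1 → Tendsto (fun i => F i w) l (𝓝 (f w))) :
    Tendsto (fun i => ∮ w in C(0, 1), F i w) l (𝓝 (∮ w in C(0, 1), f w)) := by
  have hn : ∀ θ : ℝ, ‖circleMap 0 1 θ‖ = 1 := fun θ => by simp
  refine intervalIntegral.tendsto_integral_filter_of_dominated_convergence (fun _ => C) ?_ ?_
    intervalIntegrable_const ?_
  · filter_upwards [hF] with i hi
    have hc : Continuous fun θ : ℝ => F i (circleMap 0 1 θ) :=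
      hi.comp_continuous (continuous_circleMap 0 1) fun θ => by simp
    refine Continuous.aestronglyMeasurable ?_
    simp only [deriv_circleMap, smul_eq_mul]
    exact ((continuous_circleMap 0 1).mul continuous_const).mul hc
  · filter_upwards [hb] with i hi
    refine Eventually.of_forall fun θ _ => ?_
    rw [norm_smul, deriv_circleMap, norm_mul, Complex.norm_I, hn, one_mul, one_mul]
    exact hi _ (hn θ)
  · exact Eventually.of_forall fun θ _ => (hlim _ (hn θ)).const_smul _

/-- The substitution `σ = w / L`. -/
lemma circleIntegral_inv_radius (F : ℂ → ℂ) (L : ℝ) :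
    (∮ σ in C(0, L⁻¹), F σ) = (L : ℂ)⁻¹ * ∮ w in C(0, 1), F (w / L) := by
  rw [circleIntegral, circleIntegral, ← intervalIntegral.integral_const_mul]
  refine intervalIntegral.integral_congr fun θ _ => ?_
  have h : circleMap 0 L⁻¹ θ = circleMap 0 1 θ / L := by
    simp [circleMap, div_eq_inv_mul]
  simp only [deriv_circleMap, smul_eq_mul, h]
  ring

lemma continuous_sieveForm (k : ℕ) (L : ℝ) (N : ℕ) :
    Continuous fun σ : ℂ => sieveForm k L N (1 + σ) := by
  refine continuous_finsetSum _ fun A hA => continuous_finsetSum _ fun B hB =>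
    continuous_const.mul (continuous_finsetProd _ fun p hp => ?_)
  have hp0 : (p : ℂ) ≠ 0 := by
    rcases Finset.mem_union.mp hp with h | h
    · exact_mod_cast (prime_of_mem_powerset_primesBelow hA p h).ne_zero
    · exact_mod_cast (prime_of_mem_powerset_primesBelow hB p h).ne_zero
  have h1 : Continuous fun σ : ℂ => (p : ℂ) ^ (-(1 + σ)) :=
    Continuous.const_cpow (by fun_prop) (Or.inl hp0)
  exact continuous_const.sub ((continuous_const.sub h1).pow k)

/-- The contour integrand on the scale `1 / L` of the pole, normalized to have a limit. -/
noncomputable def scaledIntegrand (f : ℝ → ℂ) (k : ℕ) (t L : ℝ) (N : ℕ) (w : ℂ) : ℂ :=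
  mellin f (1 + w / L) * Complex.exp (w * t) * ((L : ℂ)⁻¹ * riemannZeta (1 + w / L)) ^ k *
    ((L : ℂ) ^ k * ((2 * Real.pi) ^ 2 * sieveForm k L N (1 + w / L)))

lemma scaledIntegrand_eq (f : ℝ → ℂ) (k : ℕ) {X L : ℝ} (hX : 0 < X) (hL : 0 < L) (N : ℕ) (w : ℂ) :
    scaledIntegrand f k (Real.log X / L) L N w = (2 * Real.pi) ^ 2 * (X : ℂ)⁻¹ *
      (mellin f (1 + w / L) * (X : ℂ) ^ (1 + w / L) * riemannZeta (1 + w / L) ^ k *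
        sieveForm k L N (1 + w / L)) := by
  have hX0 : (X : ℂ) ≠ 0 := by exact_mod_cast hX.ne'
  have hL0 : (L : ℂ) ≠ 0 := by exact_mod_cast hL.ne'
  have h1 : (X : ℂ) ^ (1 + w / (L : ℂ)) =
      X * Complex.exp (w * ((Real.log X / L : ℝ) : ℂ)) := by
    rw [Complex.cpow_add _ _ hX0, Complex.cpow_one, Complex.cpow_def_of_ne_zero hX0,
      ← Complex.ofReal_log hX.le]
    congr 2
    push_cast
    ring
  rw [scaledIntegrand, h1, mul_pow, inv_pow]
  field_simp

lemma continuousOn_scaledIntegrand {f : ℝ → ℂ} (hf : Continuous f)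
    (hs : Function.support f ⊆ Set.Icc 1 2) (k : ℕ) {X L : ℝ} (hX : 0 < X) (hL : 0 < L) (N : ℕ) :
    ContinuousOn (scaledIntegrand f k (Real.log X / L) L N) (Metric.sphere 0 1) := by
  have h1 := (continuousOn_contour_integrand hf hs k hX (E := ∅) (by simp)).mul
    (continuous_sieveForm k L N).continuousOn
  have h2 : ContinuousOn (fun w : ℂ => w / (L : ℂ)) (Metric.sphere 0 1) := by fun_prop
  have h3 := (h1.comp h2 fun w hw => ?_).const_mul ((2 * Real.pi) ^ 2 * (X : ℂ)⁻¹)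
  · refine h3.congr fun w _ => ?_
    rw [scaledIntegrand_eq f k hX hL]
    simp
  · have hw1 : ‖w‖ = 1 := by simpa using hw
    have hw0 : w ≠ 0 := fun h => by simp [h] at hw1
    simpa using ⟨hw0, hL.ne'⟩

lemma norm_inv_mul_riemannZeta_le {L : ℝ} (hL : 5 ≤ L) {w : ℂ} (hw : ‖w‖ = 1) :
    ‖(L : ℂ)⁻¹ * riemannZeta (1 + w / L)‖ ≤ 4 := by
  have hL0 : 0 < L := by linarith
  have hn : ‖w / (L : ℂ)‖ = L⁻¹ := by
    rw [norm_div, hw, Complex.norm_real, Real.norm_of_nonneg hL0.le, one_div]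
  have hL5 : L⁻¹ ≤ 1 / 5 := by
    rw [← one_div]
    exact one_div_le_one_div_of_le (by norm_num) hL
  have hre : 1 / 4 ≤ (1 + w / (L : ℂ)).re := by
    have h1 := (abs_le.mp (Complex.abs_re_le_norm (w / (L : ℂ)))).1
    rw [hn] at h1
    rw [Complex.add_re, Complex.one_re]
    linarith
  have hne : 1 + w / (L : ℂ) ≠ 1 := by
    intro h
    rw [add_eq_left] at h
    rw [h, norm_zero] at hn
    exact (inv_pos.mpr hL0).ne hn
  have h1 := norm_riemannZeta_le_linear hre hne
  have h2 : ‖1 + w / (L : ℂ)‖ ≤ 6 / 5 := by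
    refine (norm_add_le _ _).trans ?_
    rw [norm_one, hn]
    linarith
  rw [add_sub_cancel_left, hn, one_div, inv_inv] at h1
  rw [norm_mul, norm_inv, Complex.norm_real, Real.norm_of_nonneg hL0.le, inv_mul_le_iff₀ hL0]
  linarith

/-- Dominated convergence on the unit circle. -/
lemma tendsto_circleIntegral_scaledIntegrand {f : ℝ → ℂ} (hf : Continuous f)
    (hs : Function.support f ⊆ Set.Icc 1 2) {k : ℕ} (hk : 1 ≤ k) {u : ℝ} {L : ℝ → ℝ}
    (hL : Tendsto L atTop atTop) (hLu : Tendsto (fun X => Real.log X / L X) atTop (𝓝 u))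
    {N : ℝ → ℕ} (hN : ∀ L : ℝ, Real.exp L ≤ N L) :
    Tendsto (fun X => ∮ w in C(0, 1), scaledIntegrand f k (Real.log X / L X) (L X) (N (L X)) w)
      atTop (𝓝 (mellin f 1 * ((2 * Real.pi) ^ 2 *
        (2 * Real.pi * Complex.I * modelConstant k u)))) := by
  obtain ⟨C₁, hC₁⟩ := exists_norm_mellin_le hf hs
  obtain ⟨C₂, hC₂⟩ := exists_norm_sieveForm_le hk
  have hlimit : mellin f 1 * ((2 * Real.pi) ^ 2 * (2 * Real.pi * Complex.I * modelConstant k u)) =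
      ∮ w in C(0, 1), mellin f 1 * (Complex.exp (w * u) * (w ^ k)⁻¹ *
        ∫ p, modelIntegrand k w p) := by
    rw [circleIntegral.integral_const_mul, circleIntegral_modelIntegrand hk]
  rw [hlimit]
  refine tendsto_circleIntegral_of_dominated
    (C := C₁ * Real.exp (u + 1) * 4 ^ k * C₂) ?_ ?_ ?_
  · filter_upwards [eventually_gt_atTop 0, hL.eventually_gt_atTop 0] with X hX hLX
    exact continuousOn_scaledIntegrand hf hs k hX hLX _
  · filter_upwards [hL.eventually_ge_atTop 5, hLu.eventually (Iic_mem_nhds (lt_add_one u)),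
      eventually_ge_atTop 1] with X hLX hX hX1
    intro w hw
    have hL0 : 0 < L X := by linarith
    have h1 : ‖mellin f (1 + w / L X)‖ ≤ C₁ := by
      refine hC₁ _ ?_
      have h2 := (abs_re_div_le hw.le hL0).2
      have h3 : 1 / L X ≤ 1 := by
        rw [div_le_one hL0]
        linarith
      rw [Complex.add_re, Complex.one_re]
      linarith
    have h4 : ‖Complex.exp (w * ((Real.log X / L X : ℝ) : ℂ))‖ ≤ Real.exp (u + 1) := by
      rw [Complex.norm_exp, Complex.re_mul_ofReal]
      refine Real.exp_le_exp.mpr (le_trans ?_ hX)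
      exact mul_le_of_le_one_left (div_nonneg (Real.log_nonneg hX1) hL0.le)
        ((Complex.re_le_norm w).trans hw.le)
    have h5 := norm_inv_mul_riemannZeta_le hLX hw
    have h6 := hC₂ (L X) hLX w hw.le (N (L X)) (hN _)
    rw [scaledIntegrand, norm_mul, norm_mul, norm_mul, norm_pow]
    have hC₁0 : 0 ≤ C₁ := (norm_nonneg _).trans h1
    gcongr
  · intro w hw
    have hw0 : w ≠ 0 := fun h => by simp [h] at hw
    have h1 : Tendsto (fun X => mellin f (1 + w / (L X : ℂ))) atTop (𝓝 (mellin f 1)) := by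
      refine ((differentiable_mellin hf hs).continuous.tendsto 1).comp ?_
      simpa using ((tendsto_div_ofReal_atTop w).comp hL).const_add 1
    have h2 : Tendsto (fun X => Complex.exp (w * ((Real.log X / L X : ℝ) : ℂ))) atTop
        (𝓝 (Complex.exp (w * u))) :=
      (Complex.continuous_exp.tendsto _).comp
        (((Complex.continuous_ofReal.tendsto u).comp hLu).const_mul w)
    have h3 := ((tendsto_inv_mul_riemannZeta hw0).comp hL).pow k
    have h4 := (tendsto_sieveForm hk hw.le hN).comp hL
    have h5 := ((h1.mul h2).mul h3).mul h4
    rw [inv_pow, mul_assoc (mellin f 1), mul_assoc (mellin f 1)] at h5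
    exact h5

lemma log_sqrtD {γ X : ℝ} (hX : 0 < X) :
    Real.log (sqrtD γ X) = γ * Real.log X - Real.sqrt (Real.log X) := by
  rw [sqrtD, Real.log_mul (Real.rpow_pos_of_pos hX γ).ne' (Real.exp_pos _).ne', Real.log_rpow hX,
    Real.log_exp, ← sub_eq_add_neg]

lemma sqrtD_pos {γ X : ℝ} (hX : 0 < X) : 0 < sqrtD γ X :=
  mul_pos (Real.rpow_pos_of_pos hX γ) (Real.exp_pos _)

lemma tendsto_log_sqrtD_div_log (γ : ℝ) :
    Tendsto (fun X => Real.log (sqrtD γ X) / Real.log X) atTop (𝓝 γ) := by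
  have h1 : Tendsto (fun X => (Real.sqrt (Real.log X))⁻¹) atTop (𝓝 0) :=
    tendsto_inv_atTop_zero.comp (Real.tendsto_sqrt_atTop.comp Real.tendsto_log_atTop)
  have h2 := h1.const_sub γ
  rw [sub_zero] at h2
  refine h2.congr' ?_
  filter_upwards [eventually_gt_atTop 1] with X hX
  have hl := Real.log_pos hX
  rw [log_sqrtD (by linarith), sub_div, mul_div_cancel_right₀ _ hl.ne', Real.sqrt_div_self]

lemma tendsto_log_sqrtD {γ : ℝ} (hγ : 0 < γ) :
    Tendsto (fun X => Real.log (sqrtD γ X)) atTop atTop := by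
  refine ((tendsto_log_sqrtD_div_log γ).pos_mul_atTop hγ Real.tendsto_log_atTop).congr' ?_
  filter_upwards [eventually_gt_atTop 1] with X hX
  exact div_mul_cancel₀ _ (Real.log_pos hX).ne'

/-- The power saving in `X` beats the number of pairs of sieve weights when `γ ≤ 1/4`. -/
lemma sq_ceil_sqrtD_le {γ X : ℝ} (hγ : γ ≤ 1 / 4) (hX : 1 ≤ X) (hD : 1 ≤ sqrtD γ X) :
    ((⌈sqrtD γ X⌉₊ : ℝ)) ^ 2 ≤ 4 * X ^ (1 / 2 : ℝ) := by
  have hX0 : 0 < X := by linarith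
  have h1 : (⌈sqrtD γ X⌉₊ : ℝ) ≤ 2 * sqrtD γ X := by
    have := (Nat.ceil_lt_add_one (sqrtD_pos (γ := γ) hX0).le).le
    linarith
  have h2 : sqrtD γ X ≤ X ^ (1 / 4 : ℝ) := by
    refine (mul_le_of_le_one_right (Real.rpow_nonneg hX0.le γ) ?_).trans
      (Real.rpow_le_rpow_of_exponent_le hX hγ)
    exact Real.exp_le_one_iff.mpr (neg_nonpos.mpr (Real.sqrt_nonneg _))
  calc (⌈sqrtD γ X⌉₊ : ℝ) ^ 2 ≤ (2 * X ^ (1 / 4 : ℝ)) ^ 2 := by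
        gcongr
        linarith
    _ = 4 * (X ^ (1 / 4 : ℝ)) ^ (2 : ℝ) := by
        rw [Real.rpow_ofNat]
        ring
    _ = 4 * X ^ (1 / 2 : ℝ) := by
        rw [← Real.rpow_mul hX0.le]
        norm_num

/-- The asymptotic formula for the sieved sum: its constant is `g̃(1) R_k(γ)`. -/
theorem tendsto_sievedSum {f : ℝ → ℂ} (hf : ContDiff ℝ ∞ f)
    (hs : Function.support f ⊆ Set.Icc 1 2) {k : ℕ} (hk : 1 ≤ k) {γ : ℝ} (hγ : 0 < γ)
    (hγ' : γ ≤ 1 / 4) :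
    Tendsto (fun X : ℝ => (Real.log X / X : ℝ) *
      sievedSum f k X (Real.log (sqrtD γ X)) ⌈Real.exp (Real.log (sqrtD γ X))⌉₊) atTop
      (𝓝 (mellin f 1 * (R k γ : ℝ))) := by
  obtain ⟨C, hC0, hC⟩ := exists_norm_sievedSum_sub_circleIntegral_le hf hs k
  set L : ℝ → ℝ := fun X => Real.log (sqrtD γ X) with hLdef
  set N : ℝ → ℕ := fun L => ⌈Real.exp L⌉₊ with hNdef
  have hN : ∀ L : ℝ, Real.exp L ≤ N L := fun L => Nat.le_ceil _
  have hL : Tendsto L atTop atTop := tendsto_log_sqrtD hγ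
  have hLu : Tendsto (fun X => Real.log X / L X) atTop (𝓝 γ⁻¹) := by
    refine ((tendsto_log_sqrtD_div_log γ).inv₀ hγ.ne').congr fun X => ?_
    rw [inv_div]
  have hmain := (tendsto_circleIntegral_scaledIntegrand hf.continuous hs hk hL hLu hN).const_mul
    (((2 * Real.pi : ℂ) ^ 2)⁻¹ * (2 * Real.pi * Complex.I)⁻¹)
  set M : ℝ → ℂ := fun X => (((2 * Real.pi : ℂ) ^ 2)⁻¹ * (2 * Real.pi * Complex.I)⁻¹) *
    ∮ w in C(0, 1), scaledIntegrand f k (Real.log X / L X) (L X) (N (L X)) w with hM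
  have hMlim : Tendsto M atTop (𝓝 (mellin f 1 * modelConstant k γ⁻¹)) := by
    have h1 : (((2 * Real.pi : ℂ) ^ 2)⁻¹ * (2 * Real.pi * Complex.I)⁻¹) *
        (mellin f 1 * ((2 * Real.pi) ^ 2 * (2 * Real.pi * Complex.I * modelConstant k γ⁻¹))) =
        mellin f 1 * modelConstant k γ⁻¹ := by
      have hπ : (Real.pi : ℂ) ≠ 0 := by exact_mod_cast Real.pi_ne_zero
      have hI := Complex.I_ne_zero
      field_simp
    rwa [h1] at hmain
  -- after multiplication by `log X / X` the error is `X ^ (1/4)` times the number of pairs of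
  -- weights, which is at most `4 X ^ (1/2)`
  have herr : Tendsto (fun X : ℝ => (L X / X : ℝ) * sievedSum f k X (L X) (N (L X)) - M X) atTop
      (𝓝 0) := by
    have hsmall : Tendsto (fun X : ℝ => 4 * C * (Real.log X / X ^ (1 / 4 : ℝ))) atTop (𝓝 0) := by
      simpa using (isLittleO_log_rpow_atTop (by norm_num : (0 : ℝ) < 1 / 4)).tendsto_div_nhds_zero
        |>.const_mul (4 * C)
    refine squeeze_zero_norm' ?_ hsmall
    filter_upwards [eventually_ge_atTop 1, hL.eventually_gt_atTop 0] with X hX hLX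
    have hX0 : 0 < X := by linarith
    have hD : Real.exp (L X) = sqrtD γ X := Real.exp_log (sqrtD_pos hX0)
    have hD1 : 1 ≤ sqrtD γ X := by
      rw [← hD]
      exact Real.one_le_exp hLX.le
    have hLlog : L X ≤ Real.log X := by
      simp only [hLdef, log_sqrtD hX0]
      nlinarith [Real.sqrt_nonneg (Real.log X), Real.log_nonneg hX]
    have hMX : M X = (L X / X : ℝ) * ((2 * Real.pi * Complex.I)⁻¹ * ∮ σ in C(0, (L X)⁻¹),
        mellin f (1 + σ) * (X : ℂ) ^ (1 + σ) * riemannZeta (1 + σ) ^ k *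
          sieveForm k (L X) (N (L X)) (1 + σ)) := by
      simp only [hM, scaledIntegrand_eq f k hX0 hLX, circleIntegral.integral_const_mul]
      rw [circleIntegral_inv_radius]
      have hπ : (Real.pi : ℂ) ≠ 0 := by exact_mod_cast Real.pi_ne_zero
      have hX0' : (X : ℂ) ≠ 0 := by exact_mod_cast hX0.ne'
      have hL0' : (L X : ℂ) ≠ 0 := by exact_mod_cast hLX.ne'
      push_cast
      field_simp
    have h1 := hC X hX0 (L X)⁻¹ (inv_pos.mpr hLX) (L X) hLX (N (L X)) (hN _)
    have h2 : ((N (L X) : ℕ) : ℝ) ^ 2 ≤ 4 * X ^ (1 / 2 : ℝ) := by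
      simp only [hNdef, hD]
      exact sq_ceil_sqrtD_le hγ' hX hD1
    rw [hMX, ← mul_sub, norm_mul, Complex.norm_real, Real.norm_of_nonneg (by positivity)]
    calc L X / X * _ ≤ Real.log X / X * (C * X ^ (1 / 4 : ℝ) * (4 * X ^ (1 / 2 : ℝ))) := by
          have h3 := h1.trans (mul_le_mul_of_nonneg_left h2 (by positivity))
          have h4 := Real.log_nonneg hX
          gcongr
      _ = 4 * C * (Real.log X * (X ^ (1 / 4 : ℝ) * X ^ (1 / 2 : ℝ) / X)) := by ring
      _ = 4 * C * (Real.log X / X ^ (1 / 4 : ℝ)) := by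
          rw [← Real.rpow_add hX0]
          congr 1
          rw [div_eq_mul_inv (Real.log X), ← Real.rpow_neg hX0.le]
          congr 1
          nth_rewrite 2 [← Real.rpow_one X]
          rw [← Real.rpow_sub hX0]
          norm_num
  have hsum := herr.add hMlim
  simp only [sub_add_cancel, zero_add] at hsum
  have h2 := ((Complex.continuous_ofReal.tendsto _).comp hLu).mul hsum
  have h3 : ((γ⁻¹ : ℝ) : ℂ) * (mellin f 1 * modelConstant k γ⁻¹) = mellin f 1 * (R k γ : ℝ) := by
    rw [R_eq_inv_mul_modelConstant k hγ.ne']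
    push_cast
    ring
  rw [h3] at h2
  refine h2.congr' ?_
  filter_upwards [hL.eventually_gt_atTop 0] with X hLX
  have hL0' : (L X : ℂ) ≠ 0 := by exact_mod_cast hLX.ne'
  simp only [Function.comp]
  rw [← mul_assoc]
  congr 1
  push_cast
  field_simp

/-- The real part of the Mellin transform at `1` is the integral of `g`. -/
lemma mellin_one_re_pos {g : ℝ → ℝ} (hg : Continuous g) (hs : Function.support g ⊆ Set.Icc 1 2)
    (hg0 : ∀ x, 0 ≤ g x) {x : ℝ} (hx : g x ≠ 0) : 0 < (mellin (fun x : ℝ => (g x : ℂ)) 1).re := by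
  have hs' : Function.support (fun x : ℝ => (g x : ℂ)) ⊆ Set.Icc 1 2 := fun y hy =>
    hs fun h => hy (by simp [h])
  rw [mellin_eq_intervalIntegral (by fun_prop) hs']
  simp only [sub_self, Complex.cpow_zero, one_mul]
  rw [intervalIntegral.integral_ofReal, Complex.ofReal_re]
  exact intervalIntegral.integral_pos one_lt_two hg.continuousOn (fun y _ => hg0 y)
    ⟨x, hs hx, (hg0 x).lt_of_ne' hx⟩

end Asymptotics

end KloostermanSieve

theorem proposition2 (k : ℕ) (hk : 1 ≤ k) (γ : ℝ) (hγ_pos : 0 < γ) (hγ_le : γ ≤ 1 / 4)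
    (g : ℝ → ℝ) (hg_smooth : ContDiff ℝ ∞ g) (hg_supp : Function.support g ⊆ Set.Icc 1 2)
    (hg_nonneg : ∀ x, 0 ≤ g x) :
    ∃ ε : ℝ → ℝ, Tendsto ε atTop (𝓝 0) ∧
      ∀ᶠ X : ℝ in atTop,
        KloostermanSieve.H2 g k γ X ≤
          (k.factorial : ℝ) ^ 2 * KloostermanSieve.R k γ *
            (mellin (fun x : ℝ => (g x : ℂ)) 1).re * (X / Real.log X) * (1 + ε X) := by
  by_cases hg : ∃ x, g x ≠ 0
  swap
  · push Not at hg
    have hg0 : g = fun _ => 0 := funext hg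
    refine ⟨fun _ => 0, tendsto_const_nhds, Eventually.of_forall fun X => ?_⟩
    simp [hg0, KloostermanSieve.H2, mellin]
  obtain ⟨x, hx⟩ := hg
  set f : ℝ → ℂ := fun x => (g x : ℂ) with hf_def
  have hf : ContDiff ℝ ∞ f := Complex.ofRealCLM.contDiff.comp hg_smooth
  have hf_supp : Function.support f ⊆ Set.Icc 1 2 := fun y hy =>
    hg_supp fun h => hy (by simp [hf_def, h])
  have hmellin : 0 < (mellin f 1).re :=
    KloostermanSieve.mellin_one_re_pos hg_smooth.continuous hg_supp hg_nonneg hx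
  have hR : 0 < KloostermanSieve.R k γ := by
    rw [KloostermanSieve.R_eq_inv_mul_modelConstant k hγ_pos.ne']
    exact mul_pos (inv_pos.mpr hγ_pos) (KloostermanSieve.modelConstant_pos hk
      ((one_lt_inv₀ hγ_pos).mpr (by linarith)))
  set c : ℝ := (k.factorial : ℝ) ^ 2 * KloostermanSieve.R k γ * (mellin f 1).re with hc
  have hc0 : 0 < c := by positivity
  set W : ℝ → ℂ := fun X => KloostermanSieve.sievedSum f k X
    (Real.log (KloostermanSieve.sqrtD γ X))
    ⌈Real.exp (Real.log (KloostermanSieve.sqrtD γ X))⌉₊ with hW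
  have hlim := (Complex.continuous_re.tendsto _).comp
    (KloostermanSieve.tendsto_sievedSum hf hf_supp hk hγ_pos hγ_le)
  rw [Complex.re_mul_ofReal] at hlim
  -- `ε` is the relative error of the majorant, whose asymptotic formula has the constant `c`.
  refine ⟨fun X => (k.factorial : ℝ) ^ 2 * (Real.log X / X * (W X).re) / c - 1, ?_, ?_⟩
  · have h1 := ((hlim.const_mul ((k.factorial : ℝ) ^ 2)).div_const c).sub_const 1
    have h2 : (k.factorial : ℝ) ^ 2 * ((mellin f 1).re * KloostermanSieve.R k γ) / c - 1 = 0 := by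
      rw [sub_eq_zero, div_eq_one_iff_eq hc0.ne', hc]
      ring
    rw [h2] at h1
    refine h1.congr fun X => ?_
    simp only [Function.comp, Complex.re_ofReal_mul, hW]
  · filter_upwards [eventually_gt_atTop 1,
      (KloostermanSieve.tendsto_log_sqrtD hγ_pos).eventually_gt_atTop 0] with X hX hL
    have hX0 : 0 < X := by linarith
    have hlog := Real.log_pos hX
    refine (KloostermanSieve.H2_le_sievedSum hg_supp hg_nonneg (by omega) hX0 hL
      (Real.exp_log (KloostermanSieve.sqrtD_pos hX0)).symm (Nat.le_ceil _)).trans (le_of_eq ?_)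
    rw [add_sub_cancel]
    change (k.factorial : ℝ) ^ 2 * (W X).re = _
    field_simp
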